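/- **Setting.** Let $G$ be a Lie group with Lie algebra $\mathfrak g$, acting smoothly on the left on two symplectic manifolds $(M,\omega)$ and $(N,\omega^N)$ (Hausdorff, second countable, without boundary). Let $J^M,J^N$ be almost complex structures such that $g^{TM}=\omega(\cdot,J^M\cdot)$ and $g^{TN}=\omega^N(\cdot,J^N\cdot)$ are Riemannian metrics, and let $(L,h^L,\nabla^L)$ on $M$ and $(F,h^F,\nabla^F)$ on $N$ be Hermitian line bundles with Hermitian connections such that $\frac{\sqrt{-1}}{2\pi}(\nabla^L)^2=\omega$ and $\frac{\sqrt{-1}}{2\pi}(\nabla^F)^2=\omega^N$. The actions lift to $L$ and $F$ and preserve the metrics, the almost complex structures and the connections. For $K\in\mathfrak g$ let $K^M_x=\frac{d}{dt}e^{-tK}x|_{t=0}$, let $L_K s=\frac{d}{dt}(e^{tK}\cdot s)|_{t=0}$ on sections, and define the moment maps $\mu,\eta$ of $M,N$ by $2\pi\sqrt{-1}\,\mu(K)=\nabla^L_{K^M}-L_K$ and $2\pi\sqrt{-1}\,\eta(K)=\nabla^F_{K^N}-L_K$. Let $(V_j)$ be a basis of $\mathfrak g$, $\mu_j=\mu(V_j)$,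 $\eta_j=\eta(V_j)$, $\theta_j=\mu_j+\eta_j$, $|\mu|^2=\sum_j\mu_j^2$, $|\theta|^2=\sum_j\theta_j^2$. A repeated index $j$ or $i$ attached to this basis is summed over. Let $\widetilde\alpha,\widetilde\phi\in\mathscr C^\infty(\mathbb R)$ satisfy $\widetilde\alpha(t)=t^2$, $\widetilde\phi(t)=1-t^3$ for $t\le\frac13$; $\widetilde\alpha(t)=1$, $\widetilde\phi(t)=2(1-t)$ for $t\ge\frac23$; and $\widetilde\alpha+\widetilde\phi\ge\frac{29}{27}$, $\widetilde\phi'<0$ on $[\frac13,\frac23]$. For $A>0$ put $\alpha(t)=\widetilde\alpha(\frac tA-1)$, $\phi(t)=\widetilde\phi(\frac tA-1)$ and, on $M\times N$, $$\beta=|\mu|^2+\alpha(|\mu|^2)(|\theta|^2-|\mu|^2),\quad \rho_j=\theta_j-\phi(\beta)\eta_j,\quad \gamma_j=2\bigl(1+\alpha'(|\mu|^2)(|\theta|^2-|\mu|^2)\bigr)\mu_j+2\alpha(|\mu|^2)\eta_j,$$ $$\psi_j=2\rho_j-2\phi'(\beta)\rho_i\eta_i\gamma_j,\qquad X^\rho=\psi_j(V_j^M+V_j^N).$$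 Give $M\times N$ the product metric and almost complex structure. For $W=w+\overline w\in T^{(1,0)}\oplus T^{(0,1)}$ let $c(W)=\sqrt2(\overline w^*\wedge-i_{\overline w})$ be the Clifford action on $\Lambda(T^{*(0,1)}(M\times N))$, where $\overline w^*$ is the metric dual of $w$. Let $D^{L\otimes F}=\sum_a c(e_a)\nabla_{e_a}$ be the spin$^c$ Dirac operator on $\Omega^{0,\bullet}(M\times N,L\otimes F)$, where $\nabla$ is induced by $\nabla^L,\nabla^F$ and the Clifford connection, itself induced by the Levi-Civita connection and the connection on $\det T^{(1,0)}$. Here $\nabla^{T^{(1,0)}}$ is the projection of the Levi-Civita connection to $T^{(1,0)}$. For $T\in\mathbb R$ put $D_T=D^{L\otimes F}+\frac{\sqrt{-1}T}{2}c(X^\rho)$. For a function $\psi$ on $M\times N$ let $(d^M\psi)^*,(d^N\psi)^*$ be its gradients along $M$ and $N$, and set $$I_1=\tfrac14c\bigl((d^M\psi_j)^*\bigr)c(V_j^M+2V_j^N)+\tfrac12c\bigl((d^N\psi_j)^*\bigr)c(V_j^M),$$ $$I_2=\tfrac14\Bigl\langle\Bigl(1+\tfrac{J^M}{\sqrt{-1}}\Bigr)V_j^M,(d^M\psi_j)^*\Bigr\rangle,\qquad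 I_3=\tfrac12c\bigl((d^N\psi_j)^*\bigr)c(V_j^N).$$ **Theorem (Bochner type formula).** For all orthonormal bases $(e_k)$ of $T_xM$ and $(f_i)$ of $T_yN$, the identity $$\begin{aligned}D_T^2={}&(D^{L\otimes F})^2+\frac{\sqrt{-1}T}{4}\sum_{k=1}^{\dim M}c(e_k)c\bigl(\nabla^{TM}_{e_k}(\psi_jV_j^M)\bigr)+\frac{\sqrt{-1}T}{4}\sum_{i=1}^{\dim N}c(f_i)c\bigl(\nabla^{TN}_{f_i}V_j^N\bigr)\psi_j\\&-\frac{\sqrt{-1}T}{2}\operatorname{tr}\bigl[\nabla^{T^{(1,0)}M}(\psi_jV_j^M)|_{T^{(1,0)}M}\bigr]-\frac{\sqrt{-1}T}{2}\psi_j\operatorname{tr}\bigl[\nabla^{T^{(1,0)}N}V_j^N|_{T^{(1,0)}N}\bigr]\\&+2\pi T\psi_j\theta_j-\sqrt{-1}T\psi_jL_{V_j}+\frac{T^2}{4}|X^\rho|^2+\sqrt{-1}T(I_1+I_2+I_3)\end{aligned}$$ holds at every point $(x,y)$ of $M\times N$, when both sides are applied to an $L\otimes F$-valued form of type $(0,\bullet)$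 that is smooth near $(x,y)$. In particular it holds on $\Omega^{0,\bullet}(\mathcal M,L\otimes F)$ for $\mathcal M=\{|\mu|^2\ge A,\ |\theta|^2\le 2A\}\subset M\times N$. -/

import Mathlib

open Bundle Module VectorField
open scoped Manifold ContDiff Topology TensorProduct

namespace BochnerFormula

noncomputable section

/-! ### Pointwise algebra: forms of type `(0,•)` and the Clifford action -/

/-- Families `(η_q)_q` of `W`-valued functions of `q` vectors of `T`. The elements of
`Λ(T^{*(0,1)}) ⊗ W` are those that satisfy `IsAntiholomorphicForm` below. -/
abbrev Cochain (T W : Type*) : Type _ := ∀ q : ℕ, (Fin q → T) → W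

/-- `η ∈ Λ(T^{*(0,1)}) ⊗ W`, where `(T, J)` is a real vector space with a complex structure:
every `η_q` is real multilinear, alternating, and satisfies `η(…, J v, …) = -√-1 η(…, v, …)`.
(A form of type `(0,q)` is determined by its values on real vectors, and
`η(v_1, …, v_q) = η(v_1^{0,1}, …, v_q^{0,1})`; it vanishes for `q > dim T`.) -/
def IsAntiholomorphicForm {T W : Type*} [AddCommGroup T] [Module ℝ T]
    [AddCommGroup W] [Module ℂ W] (J : T → T) (η : Cochain T W) : Prop :=
  ∀ q, (∃ A : AlternatingMap ℝ T W (Fin q), ∀ v, η q v = A v) ∧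
    ∀ (v : Fin q → T) (i : Fin q),
      η q (Function.update v i (J (v i))) = -(Complex.I • η q v)

/-- The metric dual `w̄^* ∈ T^{*(0,1)}` of `w = (W - √-1 J W)/2`, the `(1,0)` part of `W`:
`w̄^*(v) = g(w, v)` with `g` extended complex bilinearly. -/
def dualForm {T : Type*} (g : T → T → ℝ) (J : T → T) (w v : T) : ℂ :=
  ((g w v : ℂ) - Complex.I * (g (J w) v : ℂ)) / 2

/-- Exterior product `a ∧ η` with a complex-valued one-form `a`. -/
def wedgeOne {T W : Type*} [AddCommGroup W] [Module ℂ W] (a : T → ℂ) (η : Cochain T W) :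
    Cochain T W
  | 0, _ => 0
  | q + 1, v => ∑ i : Fin (q + 1), ((-1) ^ (i : ℕ) * a (v i)) • η q (fun k => v (i.succAbove k))

/-- Interior product `i_w η`. -/
def contract {T W : Type*} (w : T) (η : Cochain T W) : Cochain T W :=
  fun q v => η (q + 1) (Fin.cons w v)

/-- The Clifford action `c(W) = √2 (w̄^* ∧ - i_{w̄})` of a real vector `W = w + w̄`. On forms of
type `(0,•)` the operators `i_{w̄}` and `i_W` agree. -/
def cliff {T W : Type*} [AddCommGroup W] [Module ℂ W] (g : T → T → ℝ) (J : T → T) (w : T)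
    (η : Cochain T W) : Cochain T W :=
  ((Real.sqrt 2 : ℝ) : ℂ) • (wedgeOne (dualForm g J w) η - contract w η)

/-- `e` is an orthonormal family for the scalar product `g`. -/
def IsOrthonormal {T ι : Type*} (g : T → T → ℝ) (e : ι → T) : Prop :=
  (∀ i, g (e i) (e i) = 1) ∧ ∀ i j, i ≠ j → g (e i) (e j) = 0

/-! ### Almost Hermitian manifolds: Levi-Civita connection, Clifford connection, Dirac operator -/

section Manifold

variable {E : Type*} [NormedAddCommGroup E] [NormedSpace ℝ E]
  {H : Type*} [TopologicalSpace H] (I : ModelWithCorners ℝ E H)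
  {X : Type*} [TopologicalSpace X] [ChartedSpace H X]

/-- Smoothness of a vector field at a point. -/
def SmoothFieldAt [IsManifold I 1 X] (V : ∀ x : X, TangentSpace I x) (x : X) : Prop :=
  ContMDiffAt I (I.prod 𝓘(ℝ, E)) ∞ (fun y => (⟨y, V y⟩ : TangentBundle I X)) x

variable (g : ∀ x : X, TangentSpace I x → TangentSpace I x → ℝ)
  (J : ∀ x : X, TangentSpace I x → TangentSpace I x)

/-- An orthonormal basis of `T_x X` (one exists as soon as `g x` is a scalar product; a family of
`dim X` orthonormal vectors is a basis). -/
def orthFrame (x : X) : Fin (finrank ℝ E) → TangentSpace I x :=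
  Classical.epsilon fun e : Fin (finrank ℝ E) → TangentSpace I x => IsOrthonormal (g x) e

/-- Koszul's expression for `g(∇_U Y, Z)`, `∇` the Levi-Civita connection of `g`. -/
def koszul (U Y Z : ∀ x : X, TangentSpace I x) (x : X) : ℝ :=
  (mvfderiv I (fun y => g y (Y y) (Z y)) x (U x)
    + mvfderiv I (fun y => g y (U y) (Z y)) x (Y x)
    - mvfderiv I (fun y => g y (U y) (Y y)) x (Z x)
    + g x (mlieBracket I U Y x) (Z x)
    - g x (mlieBracket I U Z x) (Y x)
    - g x (mlieBracket I Y Z x) (U x)) / 2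

/-- The metric dual `(df)^*` of the differential of a function. -/
def grad (f : X → ℝ) (x : X) : TangentSpace I x :=
  ∑ a, mvfderiv I f x (orthFrame I g x a) • orthFrame I g x a

variable [IsManifold I 1 X]

/-- The Levi-Civita derivative `∇_u Y` at `x`, for a tangent vector `u` at `x` and a vector field
`Y`: the vector with `g(∇_u Y, e_a)` given by Koszul's formula (which only depends on the values
at `x` of the fields that extend `u` and `e_a`). -/
def leviCivita (Y : ∀ x : X, TangentSpace I x) (x : X) (u : TangentSpace I x) :
    TangentSpace I x :=
  ∑ a, koszul I g (FiberBundle.extend E u) Y (FiberBundle.extend E (orthFrame I g x a)) x •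
    orthFrame I g x a

/-- The connection on `T^{(1,0)}X` obtained by projecting the Levi-Civita connection, read on
`TX` through `V ↦ V^{1,0} = (V - √-1 J V)/2`: `(∇_u V - J ∇_u (J V))/2`. -/
def holoConn (Y : ∀ x : X, TangentSpace I x) (x : X) (u : TangentSpace I x) :
    TangentSpace I x :=
  (1 / 2 : ℝ) •
    (leviCivita I g Y x u - J x (leviCivita I g (fun y => J y (Y y)) x u))

/-- The complex trace `tr[∇^{T^{(1,0)}X} Y |_{T^{(1,0)}X}]` of the endomorphism
`u ↦ ∇^{T^{(1,0)}X}_u Y^{1,0}` of `T^{(1,0)}X`. For a real endomorphism `A` of `TX`, the complex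
trace of `P^{1,0} A` on `T^{(1,0)}X` is `∑_a (g(A e_a, e_a) - √-1 g(J A e_a, e_a))/2`. -/
def trHolo (Y : ∀ x : X, TangentSpace I x) (x : X) : ℂ :=
  ∑ a, ((g x (holoConn I g J Y x (orthFrame I g x a)) (orthFrame I g x a) : ℂ)
    - Complex.I * (g x (J x (holoConn I g J Y x (orthFrame I g x a))) (orthFrame I g x a) : ℂ)) / 2

/-! In the following, `W` is the family of fibres of a complex vector bundle over `X` and
`nablaW t x u` stands for the covariant derivative `∇^W_u t` at `x` of a section `t`. -/

variable {W : X → Type*} [∀ x, AddCommGroup (W x)] [∀ x, Module ℂ (W x)]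
  (nablaW : (∀ x, W x) → ∀ x, TangentSpace I x → W x)

/-- The connection on `Λ(T^{*(0,1)}X) ⊗ W` induced by the projected connection on `T^{(1,0)}X`
(hence on `T^{(0,1)}X`) and by the connection of `W`, through the Leibniz rule:
`(∇_u s)(v_1, …) = ∇^W_u (s(V_1, …)) - ∑_i s(…, ∇_u V_i, …)`, where `V_i` extends `v_i`. -/
def formConn (s : ∀ x, Cochain (TangentSpace I x) (W x)) (x : X) (u : TangentSpace I x) :
    Cochain (TangentSpace I x) (W x) :=
  fun q v =>
    nablaW (fun y => s y q (fun i => FiberBundle.extend E (v i) y)) x u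
      - ∑ i, s x q (Function.update v i (holoConn I g J (FiberBundle.extend E (v i)) x u))

/-- The Clifford connection on `Λ(T^{*(0,1)}X) ⊗ W` induced by the Levi-Civita connection, the
connection `∇^{det}` on `det T^{(1,0)}X` and the connection of `W`. The Levi-Civita connection is
the sum of the projected connection, which preserves `J`, and of the skew-adjoint part
`B_u v = ∇_u V - (∇_u V - J ∇_u (J V))/2`, which anticommutes with `J`; the latter acts on spinors
by `(1/4) ∑_a c(e_a) c(B_u e_a)` and does not contribute to the determinant. -/
def cliffordConn (s : ∀ x, Cochain (TangentSpace I x) (W x)) (x : X) (u : TangentSpace I x) :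
    Cochain (TangentSpace I x) (W x) :=
  formConn I g J nablaW s x u
    + (1 / 4 : ℂ) • ∑ a,
      cliff (g x) (J x) (orthFrame I g x a)
        (cliff (g x) (J x)
          (leviCivita I g (FiberBundle.extend E (orthFrame I g x a)) x u
            - holoConn I g J (FiberBundle.extend E (orthFrame I g x a)) x u) (s x))

/-- The spin^c Dirac operator `D^W = ∑_a c(e_a) ∇_{e_a}` acting on sections of
`Λ(T^{*(0,1)}X) ⊗ W`. -/
def dirac (s : ∀ x, Cochain (TangentSpace I x) (W x)) (x : X) :
    Cochain (TangentSpace I x) (W x) :=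
  ∑ a, cliff (g x) (J x) (orthFrame I g x a)
    (cliffordConn I g J nablaW s x (orthFrame I g x a))

/-- The deformed Dirac operator `D^W + (√-1 T / 2) c(V)`, for a vector field `V`. -/
def deformedDirac (V : ∀ x : X, TangentSpace I x) (T : ℝ)
    (s : ∀ x, Cochain (TangentSpace I x) (W x)) (x : X) : Cochain (TangentSpace I x) (W x) :=
  dirac I g J nablaW s x + (Complex.I * (T : ℂ) / 2) • cliff (g x) (J x) (V x) (s x)

end Manifold

/-! ### Group actions, equivariant line bundles, moment maps -/

section Action

variable {EG : Type*} [NormedAddCommGroup EG] [NormedSpace ℝ EG]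
  {G : Type*} [TopologicalSpace G] [ChartedSpace EG G] [Group G]

section Fund

variable {E : Type*} [NormedAddCommGroup E] [NormedSpace ℝ E]
  {X : Type*} [TopologicalSpace X] [ChartedSpace E X] [MulAction G X]

/-- The vector field `K^X_x = (d/dt) e^{-tK} x |_{t=0}` generated by `K ∈ 𝔤`, that is, the
derivative at `1` in the direction `K` of `h ↦ h⁻¹ x`. -/
def fundField (K : GroupLieAlgebra 𝓘(ℝ, EG) G) (x : X) : TangentSpace 𝓘(ℝ, E) x :=
  mfderiv 𝓘(ℝ, EG) 𝓘(ℝ, E) (fun h : G => h⁻¹ • x) 1 K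

end Fund

variable {E : Type*} [NormedAddCommGroup E] [NormedSpace ℝ E]
  {X : Type*} [TopologicalSpace X] [ChartedSpace E X] [MulAction G X]
  {L : X → Type*} [∀ x, NormedAddCommGroup (L x)] [∀ x, InnerProductSpace ℂ (L x)]
  [TopologicalSpace (TotalSpace ℂ L)] [FiberBundle ℂ L]

/-- Smoothness of a section of a line bundle at a point. -/
def SmoothSectionAt (s : ∀ x, L x) (x : X) : Prop :=
  ContMDiffAt 𝓘(ℝ, E) (𝓘(ℝ, E).prod 𝓘(ℝ, ℂ)) ∞ (fun y => (⟨y, s y⟩ : TotalSpace ℂ L)) x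

/-- Differentiability of a section of a line bundle at a point. -/
def DiffSectionAt (s : ∀ x, L x) (x : X) : Prop :=
  MDifferentiableAt 𝓘(ℝ, E) (𝓘(ℝ, E).prod 𝓘(ℝ, ℂ)) (fun y => (⟨y, s y⟩ : TotalSpace ℂ L)) x

variable (EG G L) in
/-- A lift of the action of `G` on `X` to a Hermitian line bundle `L`, by unitary maps of the
fibres: `tr h x` is the map `L_{h⁻¹ x} → L_x` given by `h`, so that
`(h · s)(x) = tr h x (s(h⁻¹ x))` for a section `s`. -/
structure LineLift where
  tr : ∀ (h : G) (x : X), L (h⁻¹ • x) ≃ₗᵢ[ℂ] L x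
  one_act : ∀ (s : ∀ x, L x) (x : X), tr 1 x (s ((1 : G)⁻¹ • x)) = s x
  mul_act : ∀ (h k : G) (s : ∀ x, L x) (x : X),
    tr (h * k) x (s ((h * k)⁻¹ • x)) = tr h x (tr k (h⁻¹ • x) (s (k⁻¹ • h⁻¹ • x)))
  smooth_act : ∀ s : ∀ x, L x, (∀ x, SmoothSectionAt (E := E) s x) →
    ContMDiff (𝓘(ℝ, EG).prod 𝓘(ℝ, E)) (𝓘(ℝ, E).prod 𝓘(ℝ, ℂ)) ∞
      (fun p : G × X => (⟨p.2, tr p.1 p.2 (s (p.1⁻¹ • p.2))⟩ : TotalSpace ℂ L))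

/-- The infinitesimal action `L_K s = (d/dt) (e^{tK} · s) |_{t=0}` on sections of a line bundle. -/
def lieSection (ρ : LineLift EG G (E := E) L) (K : GroupLieAlgebra 𝓘(ℝ, EG) G)
    (s : ∀ x, L x) (x : X) : L x :=
  mvfderiv 𝓘(ℝ, EG) (fun h : G => ρ.tr h x (s (h⁻¹ • x))) 1 K

variable (E) in
/-- The local section of `L` that the preferred trivialization at `x₀` identifies with `1`. -/
def localFrame (L : X → Type*) [∀ x, NormedAddCommGroup (L x)] [∀ x, InnerProductSpace ℂ (L x)]
    [TopologicalSpace (TotalSpace ℂ L)] [FiberBundle ℂ L] (x₀ x : X) : L x :=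
  (trivializationAt ℂ L x₀).symm x (1 : ℂ)

variable [IsManifold 𝓘(ℝ, E) ∞ X]
  [VectorBundle ℂ ℂ L] [VectorBundle ℝ ℂ L] [ContMDiffVectorBundle ∞ ℂ L 𝓘(ℝ, E)]

variable (EG G E X L) in
/-- A symplectic manifold `(X, ω)` with a compatible almost complex structure `J`, a Hermitian line
bundle `(L, h^L, ∇^L)` with `(√-1 / 2π) (∇^L)² = ω`, and an action of `G` on `X` that lifts to `L`
and preserves `J`, `g = ω(·, J·)`, `h^L` and `∇^L`. -/
structure PrequantumData where
  omega : ∀ x : X, TangentSpace 𝓘(ℝ, E) x →L[ℝ] TangentSpace 𝓘(ℝ, E) x →L[ℝ] ℝ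
  omega_smooth : ContMDiff 𝓘(ℝ, E) (𝓘(ℝ, E).prod 𝓘(ℝ, E →L[ℝ] E →L[ℝ] ℝ)) ∞
    (fun x => TotalSpace.mk' (E →L[ℝ] E →L[ℝ] ℝ)
      (E := fun y : X => TangentSpace 𝓘(ℝ, E) y →L[ℝ] TangentSpace 𝓘(ℝ, E) y →L[ℝ] ℝ) x (omega x))
  omega_alt : ∀ x u, omega x u u = 0
  omega_closed : ∀ (x : X) (U V Z : ∀ y : X, TangentSpace 𝓘(ℝ, E) y),
    SmoothFieldAt 𝓘(ℝ, E) U x → SmoothFieldAt 𝓘(ℝ, E) V x → SmoothFieldAt 𝓘(ℝ, E) Z x →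
    mvfderiv 𝓘(ℝ, E) (fun y => omega y (V y) (Z y)) x (U x)
      + mvfderiv 𝓘(ℝ, E) (fun y => omega y (Z y) (U y)) x (V x)
      + mvfderiv 𝓘(ℝ, E) (fun y => omega y (U y) (V y)) x (Z x)
      - omega x (mlieBracket 𝓘(ℝ, E) U V x) (Z x)
      - omega x (mlieBracket 𝓘(ℝ, E) V Z x) (U x)
      - omega x (mlieBracket 𝓘(ℝ, E) Z U x) (V x) = 0
  J : ∀ x : X, TangentSpace 𝓘(ℝ, E) x →L[ℝ] TangentSpace 𝓘(ℝ, E) x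
  J_smooth : ContMDiff 𝓘(ℝ, E) (𝓘(ℝ, E).prod 𝓘(ℝ, E →L[ℝ] E)) ∞
    (fun x => TotalSpace.mk' (E →L[ℝ] E)
      (E := fun y : X => TangentSpace 𝓘(ℝ, E) y →L[ℝ] TangentSpace 𝓘(ℝ, E) y) x (J x))
  J_sq : ∀ x u, J x (J x u) = -u
  metric_symm : ∀ x u v, omega x u (J x v) = omega x v (J x u)
  metric_pos : ∀ x u, u ≠ 0 → 0 < omega x u (J x u)
  herm_smooth : ∀ (x : X) (s t : ∀ y, L y), SmoothSectionAt (E := E) s x →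
    SmoothSectionAt (E := E) t x →
    ContMDiffAt 𝓘(ℝ, E) 𝓘(ℝ, ℂ) ∞ (fun y => (inner ℂ (s y) (t y) : ℂ)) x
  conn : CovariantDerivative 𝓘(ℝ, E) ℂ L
  conn_smooth : CovariantDerivative.ContMDiffCovariantDerivative conn ∞
  conn_complex : ∀ (x : X) (s : ∀ y, L y), DiffSectionAt (E := E) s x →
    ∀ u, conn (fun y => Complex.I • s y) x u = Complex.I • conn s x u
  conn_unitary : ∀ (x : X) (s t : ∀ y, L y), DiffSectionAt (E := E) s x →
    DiffSectionAt (E := E) t x → ∀ u,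
    mvfderiv 𝓘(ℝ, E) (fun y => (inner ℂ (s y) (t y) : ℂ)) x u
      = inner ℂ (conn s x u) (t x) + inner ℂ (s x) (conn t x u)
  prequantum : ∀ (x : X) (U V : ∀ y : X, TangentSpace 𝓘(ℝ, E) y) (s : ∀ y, L y),
    SmoothFieldAt 𝓘(ℝ, E) U x → SmoothFieldAt 𝓘(ℝ, E) V x → SmoothSectionAt (E := E) s x →
    (Complex.I / (2 * Real.pi)) •
      (conn (fun y => conn s y (V y)) x (U x) - conn (fun y => conn s y (U y)) x (V x)
        - conn s x (mlieBracket 𝓘(ℝ, E) U V x))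
      = ((omega x (U x) (V x) : ℝ) : ℂ) • s x
  lift : LineLift EG G (E := E) L
  J_inv : ∀ (h : G) (x : X) (u : TangentSpace 𝓘(ℝ, E) x),
    mfderiv 𝓘(ℝ, E) 𝓘(ℝ, E) (fun y : X => h • y) x (J x u)
      = J (h • x) (mfderiv 𝓘(ℝ, E) 𝓘(ℝ, E) (fun y : X => h • y) x u)
  metric_inv : ∀ (h : G) (x : X) (u v : TangentSpace 𝓘(ℝ, E) x),
    omega (h • x) (mfderiv 𝓘(ℝ, E) 𝓘(ℝ, E) (fun y : X => h • y) x u)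
        (J (h • x) (mfderiv 𝓘(ℝ, E) 𝓘(ℝ, E) (fun y : X => h • y) x v))
      = omega x u (J x v)
  conn_inv : ∀ (h : G) (x : X) (s : ∀ y, L y), DiffSectionAt (E := E) s (h⁻¹ • x) →
    ∀ u : TangentSpace 𝓘(ℝ, E) x,
    conn (fun y => lift.tr h y (s (h⁻¹ • y))) x u
      = lift.tr h x (conn s (h⁻¹ • x)
          (mfderiv 𝓘(ℝ, E) 𝓘(ℝ, E) (fun y : X => h⁻¹ • y) x u))

variable (P : PrequantumData EG G E X L)

/-- The Riemannian metric `g(u, v) = ω(u, J v)`. -/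
def PrequantumData.metric (x : X) (u v : TangentSpace 𝓘(ℝ, E) x) : ℝ :=
  P.omega x u (P.J x v)

/-- The almost complex structure, as a plain map on each tangent space. -/
def PrequantumData.cplx (x : X) (u : TangentSpace 𝓘(ℝ, E) x) : TangentSpace 𝓘(ℝ, E) x :=
  P.J x u

/-- The moment map, defined by Kostant's formula `2π√-1 μ(K) = ∇^L_{K^X} - L_K`. The right-hand
side is a function with purely imaginary values, which is evaluated at `x` on a local section with
coordinate `1` in a trivialization. -/
def PrequantumData.moment (K : GroupLieAlgebra 𝓘(ℝ, EG) G) (x : X) : ℝ :=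
  ((trivializationAt ℂ L x).linearMapAt ℂ x
    (P.conn (localFrame L x) x (fundField K x) - lieSection P.lift K (localFrame L x) x)
      / (2 * Real.pi * Complex.I)).re

end Action

/-! ### The product `M × N` and the line bundle `L ⊗ F` -/

section Product

variable {EG : Type*} [NormedAddCommGroup EG] [NormedSpace ℝ EG]
  {G : Type*} [TopologicalSpace G] [ChartedSpace EG G] [Group G]
  {EM : Type*} [NormedAddCommGroup EM] [NormedSpace ℝ EM]
  {M : Type*} [TopologicalSpace M] [ChartedSpace EM M] [IsManifold 𝓘(ℝ, EM) ∞ M] [MulAction G M]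
  {L : M → Type*} [∀ x, NormedAddCommGroup (L x)] [∀ x, InnerProductSpace ℂ (L x)]
  [TopologicalSpace (TotalSpace ℂ L)] [FiberBundle ℂ L] [VectorBundle ℂ ℂ L] [VectorBundle ℝ ℂ L]
  [ContMDiffVectorBundle ∞ ℂ L 𝓘(ℝ, EM)]
  {EN : Type*} [NormedAddCommGroup EN] [NormedSpace ℝ EN]
  {N : Type*} [TopologicalSpace N] [ChartedSpace EN N] [IsManifold 𝓘(ℝ, EN) ∞ N] [MulAction G N]
  {F : N → Type*} [∀ y, NormedAddCommGroup (F y)] [∀ y, InnerProductSpace ℂ (F y)]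
  [TopologicalSpace (TotalSpace ℂ F)] [FiberBundle ℂ F] [VectorBundle ℂ ℂ F] [VectorBundle ℝ ℂ F]
  [ContMDiffVectorBundle ∞ ℂ F 𝓘(ℝ, EN)]

/-- The tangent space `T_{(x,y)}(M × N)`. -/
abbrev TProd (EM EN : Type*) [NormedAddCommGroup EM] [NormedSpace ℝ EM]
    [NormedAddCommGroup EN] [NormedSpace ℝ EN]
    {M N : Type*} [TopologicalSpace M] [ChartedSpace EM M] [TopologicalSpace N]
    [ChartedSpace EN N] (z : M × N) : Type _ :=
  TangentSpace (𝓘(ℝ, EM).prod 𝓘(ℝ, EN)) z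

/-- The vector `(u, v) = u + v` of `T_{(x,y)}(M × N) = T_x M ⊕ T_y N`. -/
def pairVec (z : M × N) (u : TangentSpace 𝓘(ℝ, EM) z.1) (v : TangentSpace 𝓘(ℝ, EN) z.2) :
    TProd EM EN z :=
  ((u, v) : EM × EN)

/-- The component in `T_x M`. -/
def fstVec (z : M × N) (w : TProd EM EN z) : TangentSpace 𝓘(ℝ, EM) z.1 :=
  (show EM × EN from w).1

/-- The component in `T_y N`. -/
def sndVec (z : M × N) (w : TProd EM EN z) : TangentSpace 𝓘(ℝ, EN) z.2 :=
  (show EM × EN from w).2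

variable (P : PrequantumData EG G EM M L) (Q : PrequantumData EG G EN N F)

/-- The product metric. -/
def prodMetric (z : M × N) (u v : TProd EM EN z) : ℝ :=
  P.metric z.1 (fstVec z u) (fstVec z v) + Q.metric z.2 (sndVec z u) (sndVec z v)

/-- The product almost complex structure. -/
def prodCplx (z : M × N) (u : TProd EM EN z) : TProd EM EN z :=
  pairVec z (P.cplx z.1 (fstVec z u)) (Q.cplx z.2 (sndVec z u))

/-- The fibre `L_x ⊗ F_y` of the line bundle `L ⊗ F` over `M × N`. -/
abbrev LineProd (L : M → Type*) [∀ x, NormedAddCommGroup (L x)]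
    [∀ x, InnerProductSpace ℂ (L x)] (F : N → Type*) [∀ y, NormedAddCommGroup (F y)]
    [∀ y, InnerProductSpace ℂ (F y)] (z : M × N) : Type _ :=
  L z.1 ⊗[ℂ] F z.2

/-- The coordinate on the fibre `L_x ⊗ F_y` given by the preferred trivializations of `L` and `F`
at the point `z₀`. -/
def lineCoord (L : M → Type*) [∀ x, NormedAddCommGroup (L x)]
    [∀ x, InnerProductSpace ℂ (L x)] [TopologicalSpace (TotalSpace ℂ L)] [FiberBundle ℂ L]
    [VectorBundle ℂ ℂ L]
    (F : N → Type*) [∀ y, NormedAddCommGroup (F y)]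
    [∀ y, InnerProductSpace ℂ (F y)] [TopologicalSpace (TotalSpace ℂ F)] [FiberBundle ℂ F]
    [VectorBundle ℂ ℂ F] (z₀ z : M × N) : LineProd L F z →ₗ[ℂ] ℂ :=
  LinearMap.mul' ℂ ℂ ∘ₗ
    TensorProduct.map ((trivializationAt ℂ L z₀.1).linearMapAt ℂ z.1)
      ((trivializationAt ℂ F z₀.2).linearMapAt ℂ z.2)

variable (EM EN) in
/-- Smoothness at a point of a section of `L ⊗ F`. -/
def SmoothLineAt (t : ∀ z : M × N, LineProd L F z) (z₀ : M × N) : Prop :=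
  ContMDiffAt (𝓘(ℝ, EM).prod 𝓘(ℝ, EN)) 𝓘(ℝ, ℂ) ∞ (fun z => lineCoord L F z₀ z (t z)) z₀

/-- The connection `∇^{L ⊗ F} = ∇^L ⊗ 1 + 1 ⊗ ∇^F`: if `t = a σ ⊗ τ` near `z₀`, with local
frames `σ` of `L` and `τ` of `F` and a function `a`, then
`∇_{(u,v)} t = da(u,v) σ ⊗ τ + a (∇^L_u σ ⊗ τ + σ ⊗ ∇^F_v τ)`. -/
def prodConn (t : ∀ z : M × N, LineProd L F z) (z₀ : M × N) (w : TProd EM EN z₀) :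
    LineProd L F z₀ :=
  (mvfderiv (𝓘(ℝ, EM).prod 𝓘(ℝ, EN)) (fun z => lineCoord L F z₀ z (t z)) z₀ w) •
      (localFrame L z₀.1 z₀.1 ⊗ₜ[ℂ] localFrame F z₀.2 z₀.2)
    + lineCoord L F z₀ z₀ (t z₀) •
      (P.conn (localFrame L z₀.1) z₀.1 (fstVec z₀ w) ⊗ₜ[ℂ] localFrame F z₀.2 z₀.2
        + localFrame L z₀.1 z₀.1 ⊗ₜ[ℂ] Q.conn (localFrame F z₀.2) z₀.2 (sndVec z₀ w))

/-- The transform of a form with values in `L ⊗ F` by an element of `G`: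
`(h · s)_z (v_1, …, v_q) = h (s_{h⁻¹ z} (dh⁻¹ v_1, …, dh⁻¹ v_q))`. -/
def actForm (h : G) (s : ∀ z : M × N, Cochain (TProd EM EN z) (LineProd L F z)) (z : M × N) :
    Cochain (TProd EM EN z) (LineProd L F z) :=
  fun q v =>
    TensorProduct.map (P.lift.tr h z.1).toLinearEquiv.toLinearMap
      (Q.lift.tr h z.2).toLinearEquiv.toLinearMap
      (s (h⁻¹ • z) q (fun i =>
        mfderiv (𝓘(ℝ, EM).prod 𝓘(ℝ, EN)) (𝓘(ℝ, EM).prod 𝓘(ℝ, EN))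
          (fun z' : M × N => h⁻¹ • z') z (v i)))

/-- The infinitesimal action `L_K s = (d/dt) (e^{tK} · s) |_{t=0}` on forms with values in
`L ⊗ F`. -/
def lieForm (K : GroupLieAlgebra 𝓘(ℝ, EG) G)
    (s : ∀ z : M × N, Cochain (TProd EM EN z) (LineProd L F z)) (z : M × N) :
    Cochain (TProd EM EN z) (LineProd L F z) :=
  fun q v => mvfderiv 𝓘(ℝ, EG) (fun h : G => actForm P Q h s z q v) 1 K

/-- `s` is, near `z₀`, a smooth section of `Λ(T^{*(0,1)}(M × N)) ⊗ L ⊗ F`. -/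
def IsSmoothFormNear (s : ∀ z : M × N, Cochain (TProd EM EN z) (LineProd L F z))
    (z₀ : M × N) : Prop :=
  ∀ᶠ z in 𝓝 z₀, IsAntiholomorphicForm (prodCplx P Q z) (s z) ∧
    ∀ (q : ℕ) (V : Fin q → ∀ z' : M × N, TProd EM EN z'),
      (∀ i, SmoothFieldAt (𝓘(ℝ, EM).prod 𝓘(ℝ, EN)) (V i) z) →
      SmoothLineAt EM EN (fun z' => s z' q (fun i => V i z')) z

end Product

/-! ### The coefficients of the deforming vector field -/

/-- The cut-off functions from which the deformation is built. -/
structure IsCutoffPair (a f : ℝ → ℝ) : Prop where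
  a_smooth : ContDiff ℝ ∞ a
  f_smooth : ContDiff ℝ ∞ f
  a_left : ∀ t, t ≤ 1 / 3 → a t = t ^ 2
  a_right : ∀ t, 2 / 3 ≤ t → a t = 1
  f_left : ∀ t, t ≤ 1 / 3 → f t = 1 - t ^ 3
  f_right : ∀ t, 2 / 3 ≤ t → f t = 2 * (1 - t)
  sum_ge : ∀ t, 1 / 3 ≤ t → t ≤ 2 / 3 → 29 / 27 ≤ a t + f t
  f_deriv_neg : ∀ t, 1 / 3 ≤ t → t ≤ 2 / 3 → deriv f t < 0

section Coefficients

variable {ι : Type*} [Fintype ι] (a f : ℝ → ℝ) (A : ℝ) (μ η : ι → ℝ)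

/-- `α(t) = a(t/A - 1)`, and likewise for `φ`. -/
def rescale (a : ℝ → ℝ) (A t : ℝ) : ℝ := a (t / A - 1)

/-- `|μ|²`. -/
def normSq (μ : ι → ℝ) : ℝ := ∑ j, μ j ^ 2

/-- `β = |μ|² + α(|μ|²) (|θ|² - |μ|²)`, with `θ = μ + η`. -/
def beta : ℝ := normSq μ + rescale a A (normSq μ) * (normSq (μ + η) - normSq μ)

/-- `ρ = θ - φ(β) η`. -/
def rho (j : ι) : ℝ := μ j + η j - rescale f A (beta a A μ η) * η j

/-- `γ_j = 2 (1 + α'(|μ|²) (|θ|² - |μ|²)) μ_j + 2 α(|μ|²) η_j`. -/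
def gammaCoeff (j : ι) : ℝ :=
  2 * (1 + deriv (rescale a A) (normSq μ) * (normSq (μ + η) - normSq μ)) * μ j
    + 2 * rescale a A (normSq μ) * η j

/-- `ψ_j = 2 ρ_j - 2 φ'(β) ⟨ρ, η⟩ γ_j`. -/
def psi (j : ι) : ℝ :=
  2 * rho a f A μ η j
    - 2 * deriv (rescale f A) (beta a A μ η) * (∑ i, rho a f A μ η i * η i)
      * gammaCoeff a A μ η j

end Coefficients

/-! ### The deforming vector field and the correction terms -/

section Deformation

variable {EG : Type*} [NormedAddCommGroup EG] [NormedSpace ℝ EG]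
  {G : Type*} [TopologicalSpace G] [ChartedSpace EG G] [Group G]
  {EM : Type*} [NormedAddCommGroup EM] [NormedSpace ℝ EM]
  {M : Type*} [TopologicalSpace M] [ChartedSpace EM M] [IsManifold 𝓘(ℝ, EM) ∞ M] [MulAction G M]
  {L : M → Type*} [∀ x, NormedAddCommGroup (L x)] [∀ x, InnerProductSpace ℂ (L x)]
  [TopologicalSpace (TotalSpace ℂ L)] [FiberBundle ℂ L] [VectorBundle ℂ ℂ L] [VectorBundle ℝ ℂ L]
  [ContMDiffVectorBundle ∞ ℂ L 𝓘(ℝ, EM)]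
  {EN : Type*} [NormedAddCommGroup EN] [NormedSpace ℝ EN]
  {N : Type*} [TopologicalSpace N] [ChartedSpace EN N] [IsManifold 𝓘(ℝ, EN) ∞ N] [MulAction G N]
  {F : N → Type*} [∀ y, NormedAddCommGroup (F y)] [∀ y, InnerProductSpace ℂ (F y)]
  [TopologicalSpace (TotalSpace ℂ F)] [FiberBundle ℂ F] [VectorBundle ℂ ℂ F] [VectorBundle ℝ ℂ F]
  [ContMDiffVectorBundle ∞ ℂ F 𝓘(ℝ, EN)]
  (P : PrequantumData EG G EM M L) (Q : PrequantumData EG G EN N F)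
  {ι : Type*} [Fintype ι] (V : ι → GroupLieAlgebra 𝓘(ℝ, EG) G)

/-- The functions `ψ_j` on `M × N` attached to the components `μ_j = μ(V_j)`, `η_j = η(V_j)` of
the moment maps of `M` and `N`. -/
def psiFun (a f : ℝ → ℝ) (A : ℝ) (j : ι) (z : M × N) : ℝ :=
  psi a f A (fun i => P.moment (V i) z.1) (fun i => Q.moment (V i) z.2) j

/-- The Dirac operator `D^{L ⊗ F}` of `M × N`. -/
def diracLF (s : ∀ z : M × N, Cochain (TProd EM EN z) (LineProd L F z)) (z : M × N) :
    Cochain (TProd EM EN z) (LineProd L F z) :=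
  dirac (𝓘(ℝ, EM).prod 𝓘(ℝ, EN)) (prodMetric P Q) (prodCplx P Q) (prodConn P Q) s z

/-- The Clifford action at `z` of `u + v`, `u ∈ T_x M`, `v ∈ T_y N`. -/
def cliffLF (z : M × N) (u : TangentSpace 𝓘(ℝ, EM) z.1) (v : TangentSpace 𝓘(ℝ, EN) z.2)
    (η : Cochain (TProd EM EN z) (LineProd L F z)) : Cochain (TProd EM EN z) (LineProd L F z) :=
  cliff (prodMetric P Q z) (prodCplx P Q z) (pairVec z u v) η

variable (ψ : ι → M × N → ℝ)

variable (EM EN) in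
/-- The vector field `∑_j ψ_j (V_j^M + V_j^N)` on `M × N`. -/
def deformField (z : M × N) : TProd EM EN z :=
  pairVec z (∑ j, ψ j z • (fundField (V j) z.1 : TangentSpace 𝓘(ℝ, EM) z.1))
    (∑ j, ψ j z • (fundField (V j) z.2 : TangentSpace 𝓘(ℝ, EN) z.2))

/-- `D^{L ⊗ F} + (√-1 T / 2) c(X)`, with `X = ∑_j ψ_j (V_j^M + V_j^N)`. -/
def deformedDiracLF (T : ℝ) (s : ∀ z : M × N, Cochain (TProd EM EN z) (LineProd L F z))
    (z : M × N) : Cochain (TProd EM EN z) (LineProd L F z) :=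
  deformedDirac (𝓘(ℝ, EM).prod 𝓘(ℝ, EN)) (prodMetric P Q) (prodCplx P Q) (prodConn P Q)
    (deformField EM EN V ψ) T s z

/-- `(d^M h)^*`, the gradient of a function along `M`. -/
def gradM (h : M × N → ℝ) (z : M × N) : TangentSpace 𝓘(ℝ, EM) z.1 :=
  grad 𝓘(ℝ, EM) P.metric (fun x => h (x, z.2)) z.1

/-- `(d^N h)^*`, the gradient of a function along `N`. -/
def gradN (h : M × N → ℝ) (z : M × N) : TangentSpace 𝓘(ℝ, EN) z.2 :=
  grad 𝓘(ℝ, EN) Q.metric (fun y => h (z.1, y)) z.2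

/-- `I_1 = (1/4) c((d^M ψ_j)^*) c(V_j^M + 2 V_j^N) + (1/2) c((d^N ψ_j)^*) c(V_j^M)`, summed
over `j`. -/
def I1 (z : M × N) (η : Cochain (TProd EM EN z) (LineProd L F z)) :
    Cochain (TProd EM EN z) (LineProd L F z) :=
  ∑ j, ((1 / 4 : ℂ) • cliffLF P Q z (gradM P (ψ j) z) 0
          (cliffLF P Q z (fundField (V j) z.1) ((2 : ℝ) • fundField (V j) z.2) η)
        + (1 / 2 : ℂ) • cliffLF P Q z 0 (gradN Q (ψ j) z)
          (cliffLF P Q z (fundField (V j) z.1) 0 η))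

/-- `I_2 = (1/4) ⟨(1 + J^M / √-1) V_j^M, (d^M ψ_j)^*⟩`, summed over `j`, with the metric extended
complex bilinearly. -/
def I2 (z : M × N) : ℂ :=
  (1 / 4 : ℂ) * ∑ j,
    ((P.metric z.1 (fundField (V j) z.1) (gradM P (ψ j) z) : ℂ)
      + (P.metric z.1 (P.cplx z.1 (fundField (V j) z.1)) (gradM P (ψ j) z) : ℂ) / Complex.I)

/-- `I_3 = (1/2) c((d^N ψ_j)^*) c(V_j^N)`, summed over `j`. -/
def I3 (z : M × N) (η : Cochain (TProd EM EN z) (LineProd L F z)) :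
    Cochain (TProd EM EN z) (LineProd L F z) :=
  ∑ j, (1 / 2 : ℂ) • cliffLF P Q z 0 (gradN Q (ψ j) z)
    (cliffLF P Q z 0 (fundField (V j) z.2) η)

end Deformation

end

end BochnerFormula

set_option linter.unusedSectionVars false

namespace BochnerFormula

/-! ### Exterior and interior products on families of functions of vectors -/

section CochainAlgebra

variable {T W : Type*} [AddCommGroup W] [Module ℂ W]

/-! Let K_j be the field on M × N generated by V_j, and X = ψ_j K_j. Since c(X)² = -|X|², squaring
gives D_T² = D² + (√-1 T/2)(D c(X) + c(X) D) + (T²/4)|X|². The Clifford connection satisfies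
∇(c(X)s) = c(∇X)s + c(X)∇s, so anticommuting c(X) past c(e_a) turns the middle bracket into Σ_a
c(e_a)c(∇_{e_a}X) - 2∇_X (`dirac_cliff_add`, `deformedDirac_deformedDirac`). It remains to rewrite
both terms.

The heart is Kostant's formula on spinors, `cliffordConn_prodFund`: for a field K generated by the
group, ∇_K = L_K + 2π√-1 θ(K) + ¼ Σ_a c(e_a)c(∇_{e_a}K) + ½ tr[∇^{T^{(1,0)}}K]. Spinors are realized
as forms of type (0,•), so the Clifford connection along u is the connection induced by
∇^{T^{(1,0)}} plus ¼ Σ_a c(e_a)c(B_u e_a), where B = ∇ - ∇^{T^{(1,0)}} is skew and anticommutes with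
J. Differentiating the transform of a form by h at h = 1 shows that L_K is the induced connection
along K, minus 2π√-1 θ(K), plus the derivation attached to the endomorphism C = ∇K - B_K
(`mvfderiv_actForm`). The action preserves g and J, hence C is skew and commutes with J; for such an
endomorphism the derivation is a Clifford expression plus half a complex trace (`neg_derivForm_eq`).
The two quarter sums combine because C + B_K = ∇K. The complex trace of C is that of ∇^{T^{(1,0)}}K:
here dω = 0 enters, through a cyclic identity for J B (`cyclic_torsionMap`) that kills the trace of
B over its first two arguments (`sum_torsionMap_self`, `sum_moveMap`).

The moment maps appear because ∇_K - L_K is linear over functions on sections of a line bundle;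
unitarity of the lift and of the connection makes its coefficient purely imaginary
(`momentCoeff_eq`, `mvfderiv_actLine`).

On a product the Levi-Civita connection splits (`leviCivita_prodField`), so Σ_a c(e_a)c(∇_{e_a}X) is
c(grad ψ_j)c(K_j) plus ψ_j times the Clifford traces of the two factors, and -2∇_X takes back half
of these traces. The formula keeps the derivative of ψ_j along M inside the Clifford sum and inside
the complex trace of ψ_j V_j^M; I_1, I_2 and I_3 are the gradient terms that restore the balance
(`collect_bochner_terms`). `bochner_formula` carries this out for all differentiable coefficients.

A pointwise choice of orthonormal frames need not be continuous. Every sum over a frame is therefore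
a trace of a bilinear map, which is independent of the frame (`sum_frame_eq`); computing D s in a
smooth frame shows that it is differentiable (`isDiffForm_dirac`), so that D can be applied to it
again. -/

lemma contract_apply (w : T) (η : Cochain T W) (q : ℕ) (v : Fin q → T) :
    contract w η q v = η (q + 1) (Fin.cons w v) := rfl

/-- The inductions on the degree run through this: in positive degree a form is read off from its
contractions, which live one degree lower. -/
lemma cochain_succ (η : Cochain T W) (q : ℕ) (v : Fin (q + 1) → T) :
    η (q + 1) v = contract (v 0) η q (Fin.tail v) := by
  rw [contract_apply, Fin.cons_self_tail]

lemma contract_add_right (w : T) (η ζ : Cochain T W) :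
    contract w (η + ζ) = contract w η + contract w ζ := rfl

lemma contract_sub_right (w : T) (η ζ : Cochain T W) :
    contract w (η - ζ) = contract w η - contract w ζ := rfl

lemma contract_smul_right (c : ℂ) (w : T) (η : Cochain T W) :
    contract w (c • η) = c • contract w η := rfl

lemma contract_neg_right (w : T) (η : Cochain T W) :
    contract w (-η) = -contract w η := rfl

lemma contract_zero_right (w : T) : contract w (0 : Cochain T W) = 0 := rfl

lemma contract_sum_right {ι : Type*} (s : Finset ι) (w : T) (η : ι → Cochain T W) :
    contract w (∑ i ∈ s, η i) = ∑ i ∈ s, contract w (η i) := by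
  classical
  induction s using Finset.induction_on with
  | empty => simp [contract_zero_right]
  | insert a s ha ih => rw [Finset.sum_insert ha, Finset.sum_insert ha, contract_add_right, ih]

lemma wedgeOne_succ (a : T → ℂ) (η : Cochain T W) (q : ℕ) (v : Fin (q + 1) → T) :
    wedgeOne a η (q + 1) v
      = ∑ i : Fin (q + 1), ((-1) ^ (i : ℕ) * a (v i)) • η q (fun k => v (i.succAbove k)) := rfl

lemma wedgeOne_zero_degree (a : T → ℂ) (η : Cochain T W) (v : Fin 0 → T) :
    wedgeOne a η 0 v = 0 := rfl

/-- `i_w (a ∧ η) = a(w) η - a ∧ i_w η`. -/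
lemma contract_wedgeOne (w : T) (a : T → ℂ) (η : Cochain T W) :
    contract w (wedgeOne a η) = a w • η - wedgeOne a (contract w η) := by
  funext q v
  -- The term of index 0 feeds w to a; in the other terms w sits in the first slot of η and the
  -- index shift flips the sign.
  rw [contract_apply, wedgeOne_succ, Fin.sum_univ_succ]
  simp only [Fin.val_zero, pow_zero, one_mul, Fin.cons_zero, Fin.val_succ, Fin.cons_succ,
    Pi.sub_apply, Pi.smul_apply]
  rw [sub_eq_add_neg]
  congr 1
  cases q with
  | zero => simp [wedgeOne_zero_degree]
  | succ q =>
    rw [wedgeOne_succ, ← Finset.sum_neg_distrib]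
    refine Finset.sum_congr rfl fun i _ => ?_
    rw [contract_apply, ← neg_smul]
    congr 1
    · ring
    · congr 1
      funext k
      refine Fin.cases ?_ (fun k => ?_) k
      · simp
      · simp

lemma wedgeOne_add_right (a : T → ℂ) (η ζ : Cochain T W) :
    wedgeOne a (η + ζ) = wedgeOne a η + wedgeOne a ζ := by
  funext q v
  cases q with
  | zero => simp [wedgeOne_zero_degree]
  | succ q => simp [wedgeOne_succ, smul_add, Finset.sum_add_distrib]

lemma wedgeOne_smul_right (a : T → ℂ) (c : ℂ) (η : Cochain T W) :
    wedgeOne a (c • η) = c • wedgeOne a η := by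
  funext q v
  cases q with
  | zero => simp [wedgeOne_zero_degree]
  | succ q => simp [wedgeOne_succ, Finset.smul_sum, smul_comm c]

lemma wedgeOne_neg_right (a : T → ℂ) (η : Cochain T W) :
    wedgeOne a (-η) = -wedgeOne a η := by
  have := wedgeOne_smul_right a (-1) η
  simpa using this

lemma wedgeOne_sub_right (a : T → ℂ) (η ζ : Cochain T W) :
    wedgeOne a (η - ζ) = wedgeOne a η - wedgeOne a ζ := by
  rw [sub_eq_add_neg, wedgeOne_add_right, wedgeOne_neg_right, ← sub_eq_add_neg]

lemma wedgeOne_add_left (a b : T → ℂ) (η : Cochain T W) :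
    wedgeOne (a + b) η = wedgeOne a η + wedgeOne b η := by
  funext q v
  cases q with
  | zero => simp [wedgeOne_zero_degree]
  | succ q => simp [wedgeOne_succ, mul_add, add_smul, Finset.sum_add_distrib]

lemma wedgeOne_smul_left (c : ℂ) (a : T → ℂ) (η : Cochain T W) :
    wedgeOne (c • a) η = c • wedgeOne a η := by
  funext q v
  cases q with
  | zero => simp [wedgeOne_zero_degree]
  | succ q =>
    simp only [wedgeOne_succ, Pi.smul_apply, Finset.smul_sum, smul_eq_mul, smul_smul]
    exact Finset.sum_congr rfl fun i _ => by rw [mul_left_comm]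

/-- Exterior multiplications by one-forms anticommute. -/
lemma wedgeOne_anticomm (a b : T → ℂ) (η : Cochain T W) :
    wedgeOne a (wedgeOne b η) + wedgeOne b (wedgeOne a η) = 0 := by
  suffices H : ∀ (q : ℕ) (η : Cochain T W) (v : Fin q → T),
      (wedgeOne a (wedgeOne b η) + wedgeOne b (wedgeOne a η)) q v = 0 by
    funext q v; exact H q η v
  intro q
  -- Contracting with the first vector, the terms containing a(v_0) or b(v_0) cancel in pairs and
  -- the same expression for the contraction of η is left.
  induction q with
  | zero => intro η v; simp [wedgeOne_zero_degree]
  | succ q ih =>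
    intro η v
    rw [cochain_succ (BochnerFormula.wedgeOne a _ + _), contract_add_right, contract_wedgeOne,
      contract_wedgeOne, contract_wedgeOne,
      contract_wedgeOne, wedgeOne_sub_right, wedgeOne_sub_right, wedgeOne_smul_right,
      wedgeOne_smul_right]
    have := ih (contract (v 0) η) (Fin.tail v)
    simp only [Pi.add_apply, Pi.sub_apply] at this ⊢
    rw [← this]
    abel

/-- The derivation of the algebra of forms that extends `η ↦ η ∘ C` on one-forms. -/
def derivForm (C : T → T) (η : Cochain T W) : Cochain T W :=
  fun q v => ∑ i, η q (Function.update v i (C (v i)))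

/-- C acts either on the slot filled by w or on one of the remaining slots. -/
lemma contract_derivForm (C : T → T) (w : T) (η : Cochain T W) :
    contract w (derivForm C η) = contract (C w) η + derivForm C (contract w η) := by
  funext q v
  simp only [contract_apply, derivForm, Fin.sum_univ_succ, Pi.add_apply, Fin.cons_zero,
    Fin.cons_succ, Fin.update_cons_zero, Fin.cons_update]

end CochainAlgebra

/-! ### Forms of type (0,•): stability under the operations, criteria by contraction -/

section Antiholomorphic

variable {T W : Type*} [AddCommGroup T] [Module ℝ T] [AddCommGroup W] [Module ℂ W]
  {J : T → T}

namespace IsAntiholomorphicForm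

variable {η ζ : Cochain T W}

lemma zero : IsAntiholomorphicForm J (0 : Cochain T W) :=
  fun q => ⟨⟨0, fun _ => rfl⟩, fun _ _ => by simp⟩

lemma add (hη : IsAntiholomorphicForm J η) (hζ : IsAntiholomorphicForm J ζ) :
    IsAntiholomorphicForm J (η + ζ) := fun q => by
  obtain ⟨⟨A, hA⟩, hA'⟩ := hη q
  obtain ⟨⟨B, hB⟩, hB'⟩ := hζ q
  refine ⟨⟨A + B, fun v => by simp [hA, hB]⟩, fun v i => ?_⟩
  simp only [Pi.add_apply, hA', hB', smul_add, neg_add]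

lemma smul (c : ℂ) (hη : IsAntiholomorphicForm J η) : IsAntiholomorphicForm J (c • η) := fun q => by
  obtain ⟨⟨A, hA⟩, hA'⟩ := hη q
  refine ⟨⟨c • A, fun v => by simp [hA]⟩, fun v i => ?_⟩
  simp only [Pi.smul_apply, hA', smul_neg, smul_comm c]

lemma neg (hη : IsAntiholomorphicForm J η) : IsAntiholomorphicForm J (-η) := by
  simpa using hη.smul (-1)

lemma sub (hη : IsAntiholomorphicForm J η) (hζ : IsAntiholomorphicForm J ζ) :
    IsAntiholomorphicForm J (η - ζ) := by
  rw [sub_eq_add_neg]; exact hη.add hζ.neg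

lemma sum {ι : Type*} {s : Finset ι} {η : ι → Cochain T W}
    (h : ∀ i ∈ s, IsAntiholomorphicForm J (η i)) : IsAntiholomorphicForm J (∑ i ∈ s, η i) := by
  classical
  induction s using Finset.induction_on with
  | empty => simpa using zero
  | insert a s ha ih =>
    rw [Finset.sum_insert ha]
    exact (h a (by simp)).add (ih fun i hi => h i (by simp [hi]))

lemma contract (hη : IsAntiholomorphicForm J η) (w : T) :
    IsAntiholomorphicForm J (contract w η) := fun q => by
  obtain ⟨⟨A, hA⟩, hA'⟩ := hη (q + 1)
  refine ⟨⟨A.curryLeft w, fun v => by rw [contract_apply, hA]; rfl⟩, fun v i => ?_⟩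
  rw [contract_apply, contract_apply, Fin.cons_update]
  have := hA' (Fin.cons w v) i.succ
  rwa [Fin.cons_succ] at this

lemma contract_add (hη : IsAntiholomorphicForm J η) (u v : T) :
    BochnerFormula.contract (u + v) η
      = BochnerFormula.contract u η + BochnerFormula.contract v η := by
  funext q x
  obtain ⟨⟨A, hA⟩, -⟩ := hη (q + 1)
  simp only [contract_apply, Pi.add_apply, hA]
  exact A.map_vecCons_add x u v

lemma contract_smul (hη : IsAntiholomorphicForm J η) (r : ℝ) (u : T) :
    BochnerFormula.contract (r • u) η = (r : ℂ) • BochnerFormula.contract u η := by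
  funext q x
  obtain ⟨⟨A, hA⟩, -⟩ := hη (q + 1)
  simp only [contract_apply, Pi.smul_apply, hA]
  rw [Complex.coe_smul]
  exact A.map_vecCons_smul x r u

lemma contract_zero (hη : IsAntiholomorphicForm J η) :
    BochnerFormula.contract 0 η = 0 := by
  simpa using hη.contract_smul 0 0

lemma contract_sum (hη : IsAntiholomorphicForm J η) {ι : Type*} (s : Finset ι) (u : ι → T) :
    BochnerFormula.contract (∑ i ∈ s, u i) η = ∑ i ∈ s, BochnerFormula.contract (u i) η := by
  classical
  induction s using Finset.induction_on with
  | empty => simpa using hη.contract_zero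
  | insert a s ha ih => rw [Finset.sum_insert ha, Finset.sum_insert ha, hη.contract_add, ih]

lemma contract_cplx (hη : IsAntiholomorphicForm J η) (u : T) :
    BochnerFormula.contract (J u) η = -(Complex.I • BochnerFormula.contract u η) := by
  funext q x
  have := (hη (q + 1)).2 (Fin.cons u x) 0
  rwa [Fin.cons_zero, Fin.update_cons_zero] at this

lemma contract_self (hη : IsAntiholomorphicForm J η) (u : T) :
    BochnerFormula.contract u (BochnerFormula.contract u η) = 0 := by
  funext q x
  obtain ⟨⟨A, hA⟩, -⟩ := hη (q + 2)
  rw [contract_apply, contract_apply, hA]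
  exact A.map_eq_zero_of_eq _ (i := 0) (j := 1) rfl (by simp)

/-- Polarization of `contract_self`. -/
lemma contract_anticomm (hη : IsAntiholomorphicForm J η) (u v : T) :
    BochnerFormula.contract u (BochnerFormula.contract v η)
      + BochnerFormula.contract v (BochnerFormula.contract u η) = 0 := by
  have := hη.contract_self (u + v)
  rw [hη.contract_add, contract_add_right, (hη.contract u).contract_add,
    (hη.contract v).contract_add, hη.contract_self, hη.contract_self] at this
  simpa [add_comm] using this

lemma update_add (hη : IsAntiholomorphicForm J η) {q : ℕ} (v : Fin q → T) (i : Fin q) (x y : T) :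
    η q (Function.update v i (x + y))
      = η q (Function.update v i x) + η q (Function.update v i y) := by
  obtain ⟨⟨A, hA⟩, -⟩ := hη q
  simp only [hA, A.map_update_add]

lemma update_smul (hη : IsAntiholomorphicForm J η) {q : ℕ} (v : Fin q → T) (i : Fin q)
    (r : ℝ) (x : T) :
    η q (Function.update v i (r • x)) = (r : ℂ) • η q (Function.update v i x) := by
  obtain ⟨⟨A, hA⟩, -⟩ := hη q
  simp only [hA, A.map_update_smul, Complex.coe_smul]

/-- A form is antiholomorphic if its contractions are, depend linearly on the vector, anticommute
and satisfy `i_{Jw} = -√-1 i_w`. -/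
lemma of_contract (h : ∀ w, IsAntiholomorphicForm J (BochnerFormula.contract w η))
    (hadd : ∀ u v, BochnerFormula.contract (u + v) η
      = BochnerFormula.contract u η + BochnerFormula.contract v η)
    (hsmul : ∀ (r : ℝ) u, BochnerFormula.contract (r • u) η
      = (r : ℂ) • BochnerFormula.contract u η)
    (hself : ∀ u, BochnerFormula.contract u (BochnerFormula.contract u η) = 0)
    (hJ : ∀ u, BochnerFormula.contract (J u) η = -(Complex.I • BochnerFormula.contract u η)) :
    IsAntiholomorphicForm J η := by
  intro q
  cases q with
  | zero =>
    -- In degree 0 there is a single argument, the empty tuple, and nothing to check.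
    refine ⟨⟨AlternatingMap.constOfIsEmpty ℝ T (Fin 0) (η 0 Fin.elim0), fun v => ?_⟩,
      fun v i => i.elim0⟩
    rw [Subsingleton.elim v Fin.elim0]; rfl
  | succ q =>
    have hcons : ∀ v : Fin (q + 1) → T, η (q + 1) v
        = BochnerFormula.contract (v 0) η q (Fin.tail v) := cochain_succ η q
    have hsplit : ∀ (v : Fin (q + 1) → T) (i : Fin q) (x : T),
        η (q + 1) (Function.update v i.succ x)
          = BochnerFormula.contract (v 0) η q (Function.update (Fin.tail v) i x) := by
      intro v i x
      rw [hcons, Fin.tail_update_succ, Function.update_of_ne (Fin.succ_ne_zero i).symm]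
    have hsplit0 : ∀ (v : Fin (q + 1) → T) (x : T),
        η (q + 1) (Function.update v 0 x) = BochnerFormula.contract x η q (Fin.tail v) := by
      intro v x
      rw [hcons, Fin.tail_update_zero, Function.update_self]
    have hzero : ∀ (v : Fin (q + 1) → T) (j : Fin q), v 0 = v j.succ → η (q + 1) v = 0 := by
      intro v j hv
      rw [hcons]
      cases q with
      | zero => exact j.elim0
      | succ q =>
        obtain ⟨⟨A, hA⟩, -⟩ := h (v 0) (q + 1)
        rw [hA]
        -- The swap brings the entry equal to v_0 next to it, where two contractions with the same
        -- vector vanish; undoing the swap costs at most a sign.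
        have key : A (Fin.tail v ∘ Equiv.swap 0 j) = 0 := by
          rw [← hA, cochain_succ (BochnerFormula.contract (v 0) η)]
          have : (Fin.tail v ∘ Equiv.swap 0 j) 0 = v 0 := by
            simp [Fin.tail, hv]
          rw [this, hself]; rfl
        by_cases h0 : (0 : Fin (q + 1)) = j
        · subst h0
          simpa using key
        · rw [A.map_swap _ h0] at key
          simpa using key
    refine ⟨⟨
      { toFun := η (q + 1)
        map_update_add' := ?_
        map_update_smul' := ?_
        map_eq_zero_of_eq' := ?_ }, fun v => rfl⟩, ?_⟩
    · intro inst v i x y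
      -- The field of the structure quantifies over the decidability instance hidden in
      -- `Function.update`; it is identified with the canonical one.
      have : inst = instDecidableEqFin (q + 1) := Subsingleton.elim _ _
      subst this
      refine Fin.cases ?_ (fun i => ?_) i
      · simp only [hsplit0, hadd]; rfl
      · simp only [hsplit, (h _).update_add]
    · intro inst v i r x
      have : inst = instDecidableEqFin (q + 1) := Subsingleton.elim _ _
      subst this
      refine Fin.cases ?_ (fun i => ?_) i
      · simp only [hsplit0, hsmul, Complex.coe_smul]; rfl
      · simp only [hsplit, (h _).update_smul, Complex.coe_smul]
    · intro v i j hv hij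
      change η (q + 1) v = 0
      induction i using Fin.cases with
      | zero =>
        induction j using Fin.cases with
        | zero => exact absurd rfl hij
        | succ j => exact hzero v j hv
      | succ i =>
        induction j using Fin.cases with
        | zero => exact hzero v i hv.symm
        | succ j =>
          rw [hcons]
          obtain ⟨⟨A, hA⟩, -⟩ := h (v 0) q
          rw [hA]
          exact A.map_eq_zero_of_eq _ (i := i) (j := j) hv fun e => hij (by rw [e])
    · intro v i
      refine Fin.cases ?_ (fun i => ?_) i
      · rw [hsplit0, hJ, hcons]; rfl
      · rw [hsplit, hcons v]
        exact (h (v 0) q).2 (Fin.tail v) i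

/-- Exterior product with a one-form of type `(0,1)`. -/
lemma wedgeOne {a : T → ℂ} (ha : ∀ u v, a (u + v) = a u + a v)
    (ha' : ∀ (r : ℝ) u, a (r • u) = r * a u) (haJ : ∀ u, a (J u) = -(Complex.I * a u))
    (hη : IsAntiholomorphicForm J η) : IsAntiholomorphicForm J (wedgeOne a η) := by
  suffices H : ∀ (q : ℕ) (η : Cochain T W), IsAntiholomorphicForm J η →
      ((∃ A : AlternatingMap ℝ T W (Fin q), ∀ v, BochnerFormula.wedgeOne a η q v = A v) ∧
      ∀ (v : Fin q → T) (i : Fin q),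
      BochnerFormula.wedgeOne a η q (Function.update v i (J (v i)))
        = -(Complex.I • BochnerFormula.wedgeOne a η q v)) from fun q => H q η hη
  intro q
  induction q with
  | zero =>
    intro η hη
    exact ⟨⟨0, fun v => rfl⟩, fun v i => i.elim0⟩
  | succ q ih =>
    intro η hη
    constructor
    · obtain ⟨⟨A, hA⟩, -⟩ := hη q
      -- The one-form a ⊗ η with values in alternating maps: its alternatization is a ∧ η, so
      -- multilinearity and alternation come for free.
      let f : T →ₗ[ℝ] AlternatingMap ℝ T W (Fin q) :=
        { toFun := fun w => a w • A
          map_add' := fun u v => by rw [ha, add_smul]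
          map_smul' := fun r u => by
            rw [ha', mul_smul, RingHom.id_apply, Complex.coe_smul] }
      refine ⟨AlternatingMap.alternatizeUncurryFin f, fun v => ?_⟩
      rw [AlternatingMap.alternatizeUncurryFin_apply, wedgeOne_succ]
      refine Finset.sum_congr rfl fun i _ => ?_
      rw [hA, mul_smul]
      have h1 : ((-1 : ℂ) ^ (i : ℕ)) = (((-1 : ℤ) ^ (i : ℕ) : ℤ) : ℂ) := by push_cast; rfl
      rw [h1, Int.cast_smul_eq_zsmul]
      rfl
    -- In slot 0 the factor -√-1 comes from a and from the contraction of η; in a later slot it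
    -- comes from η and from the induction hypothesis for its contraction.
    · intro v i
      refine Fin.cases ?_ (fun i => ?_) i
      · rw [cochain_succ (BochnerFormula.wedgeOne a η), cochain_succ (BochnerFormula.wedgeOne a η) q v, Function.update_self, Fin.tail_update_zero,
          contract_wedgeOne, contract_wedgeOne, haJ, hη.contract_cplx, wedgeOne_neg_right,
          wedgeOne_smul_right]
        simp only [Pi.sub_apply, Pi.smul_apply, Pi.neg_apply, smul_sub, neg_smul, mul_smul]
        abel
      · rw [cochain_succ (BochnerFormula.wedgeOne a η), cochain_succ (BochnerFormula.wedgeOne a η) q v, Fin.tail_update_succ,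
          Function.update_of_ne (Fin.succ_ne_zero i).symm, contract_wedgeOne]
        have h1 := (hη q).2 (Fin.tail v) i
        have h2 := (ih _ (hη.contract (v 0))).2 (Fin.tail v) i
        simp only [Pi.sub_apply, Pi.smul_apply]
        change a (v 0) • η q (Function.update (Fin.tail v) i (J (Fin.tail v i)))
          - BochnerFormula.wedgeOne a (BochnerFormula.contract (v 0) η) q
            (Function.update (Fin.tail v) i (J (Fin.tail v i))) = _
        rw [h1, h2, smul_sub, smul_neg, smul_comm (a (v 0))]
        abel

end IsAntiholomorphicForm

end Antiholomorphic

/-! ### Hermitian linear algebra: orthonormal frames, traces, the Clifford relations -/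

/-- `g` is a scalar product on `T` and `J` an orthogonal complex structure. -/
structure IsHermitianPair {T : Type*} [AddCommGroup T] [Module ℝ T] (g : T → T → ℝ) (J : T → T) :
    Prop where
  add_left : ∀ u v w, g (u + v) w = g u w + g v w
  smul_left : ∀ (r : ℝ) u w, g (r • u) w = r * g u w
  symm : ∀ u v, g u v = g v u
  pos : ∀ u, u ≠ 0 → 0 < g u u
  J_add : ∀ u v, J (u + v) = J u + J v
  J_smul : ∀ (r : ℝ) u, J (r • u) = r • J u
  J_sq : ∀ u, J (J u) = -u
  J_isom : ∀ u v, g (J u) (J v) = g u v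

/-- `e` is an orthonormal family in which every vector can be expanded. -/
def IsOrthoFrame {T ι : Type*} [AddCommGroup T] [Module ℝ T] [Fintype ι] (g : T → T → ℝ)
    (e : ι → T) : Prop :=
  IsOrthonormal g e ∧ ∀ v, v = ∑ a, g v (e a) • e a

section

variable {T W : Type*} [AddCommGroup T] [Module ℝ T] [AddCommGroup W] [Module ℂ W]
  {g : T → T → ℝ} {J : T → T}

lemma IsOrthoFrame.map_eq_sum {V : Type*} [AddCommGroup V] [Module ℝ V]
    {ι : Type*} [Fintype ι] {e : ι → T} (he : IsOrthoFrame g e) (q : T →ₗ[ℝ] V) (v : T) :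
    q v = ∑ a, g v (e a) • q (e a) := by
  conv_lhs => rw [he.2 v]
  simp [map_sum]

lemma cliff_add_right (w : T) (η ζ : Cochain T W) :
    cliff g J w (η + ζ) = cliff g J w η + cliff g J w ζ := by
  simp only [cliff, wedgeOne_add_right, contract_add_right, ← smul_add]
  congr 1; abel

lemma cliff_smul_right (w : T) (c : ℂ) (η : Cochain T W) :
    cliff g J w (c • η) = c • cliff g J w η := by
  simp only [cliff, wedgeOne_smul_right, contract_smul_right, ← smul_sub]
  rw [smul_comm]

lemma cliff_neg_right (w : T) (η : Cochain T W) : cliff g J w (-η) = -cliff g J w η := by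
  simpa using cliff_smul_right (g := g) (J := J) w (-1) η

lemma cliff_sub_right (w : T) (η ζ : Cochain T W) :
    cliff g J w (η - ζ) = cliff g J w η - cliff g J w ζ := by
  rw [sub_eq_add_neg, cliff_add_right, cliff_neg_right, ← sub_eq_add_neg]

lemma cliff_sum_right {ι : Type*} (s : Finset ι) (w : T) (η : ι → Cochain T W) :
    cliff g J w (∑ a ∈ s, η a) = ∑ a ∈ s, cliff g J w (η a) := by
  classical
  induction s using Finset.induction_on with
  | empty => simpa using cliff_smul_right (g := g) (J := J) w 0 (0 : Cochain T W)
  | insert a s ha ih => rw [Finset.sum_insert ha, Finset.sum_insert ha, cliff_add_right, ih]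

namespace IsHermitianPair

variable (h : IsHermitianPair g J)
include h

lemma add_right (u v w : T) : g u (v + w) = g u v + g u w := by
  rw [h.symm, h.add_left, h.symm v, h.symm w]

lemma smul_right (r : ℝ) (u w : T) : g u (r • w) = r * g u w := by
  rw [h.symm, h.smul_left, h.symm w]

lemma neg_left (u w : T) : g (-u) w = -g u w := by simpa using h.smul_left (-1) u w

lemma neg_right (u w : T) : g u (-w) = -g u w := by simpa using h.smul_right (-1) u w

lemma sub_left (u v w : T) : g (u - v) w = g u w - g v w := by
  rw [sub_eq_add_neg, h.add_left, h.neg_left, ← sub_eq_add_neg]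

lemma sub_right (u v w : T) : g u (v - w) = g u v - g u w := by
  rw [sub_eq_add_neg, h.add_right, h.neg_right, ← sub_eq_add_neg]

lemma zero_left (w : T) : g 0 w = 0 := by simpa using h.smul_left 0 0 w

lemma zero_right (w : T) : g w 0 = 0 := by simpa using h.smul_right 0 w 0

lemma sum_left {ι : Type*} (s : Finset ι) (u : ι → T) (w : T) :
    g (∑ i ∈ s, u i) w = ∑ i ∈ s, g (u i) w := by
  classical
  induction s using Finset.induction_on with
  | empty => simpa using h.zero_left w
  | insert a s ha ih => rw [Finset.sum_insert ha, Finset.sum_insert ha, h.add_left, ih]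

lemma sum_right {ι : Type*} (s : Finset ι) (u : ι → T) (w : T) :
    g w (∑ i ∈ s, u i) = ∑ i ∈ s, g w (u i) := by
  rw [h.symm, h.sum_left]; exact Finset.sum_congr rfl fun i _ => h.symm _ _

lemma J_neg (u : T) : J (-u) = -J u := by simpa using h.J_smul (-1) u

lemma J_sub (u v : T) : J (u - v) = J u - J v := by
  rw [sub_eq_add_neg, h.J_add, h.J_neg, ← sub_eq_add_neg]

lemma J_left (u v : T) : g (J u) v = -g u (J v) := by
  rw [← h.J_isom u, h.J_sq, ← h.neg_right, neg_neg]

lemma eq_of_forall {u v : T} (H : ∀ w, g u w = g v w) : u = v := by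
  by_contra hne
  have h1 := h.pos (u - v) (sub_ne_zero.2 hne)
  rw [h.sub_left, H, sub_self] at h1
  exact lt_irrefl _ h1

/-- Pairing a linear relation with e_i gives independence, the cardinality then gives spanning, and
pairing with e_a identifies the coefficients. -/
lemma isOrthoFrame_of_card [FiniteDimensional ℝ T] {ι : Type*} [Fintype ι] {e : ι → T} (he : IsOrthonormal g e)
    (hc : Fintype.card ι = finrank ℝ T) : IsOrthoFrame g e := by
  classical
  refine ⟨he, fun v => ?_⟩
  have hg : ∀ a b, g (e a) (e b) = if a = b then 1 else 0 := by
    intro a b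
    split_ifs with hab
    · rw [hab]; exact he.1 b
    · exact he.2 a b hab
  have hli : LinearIndependent ℝ e := by
    rw [Fintype.linearIndependent_iff]
    intro c hc i
    have := h.sum_left Finset.univ (fun a => c a • e a) (e i)
    rw [hc, h.zero_left] at this
    simp only [h.smul_left, hg, mul_ite, mul_one, mul_zero, Finset.sum_ite_eq',
      Finset.mem_univ, if_true] at this
    exact this.symm
  have hspan : v ∈ Submodule.span ℝ (Set.range e) := by
    rw [hli.span_eq_top_of_card_eq_finrank' hc]; trivial
  obtain ⟨c, hc⟩ := (Submodule.mem_span_range_iff_exists_fun ℝ).1 hspan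
  have : ∀ a, g v (e a) = c a := by
    intro a
    rw [← hc, h.sum_left]
    simp [h.smul_left, hg]
  simp only [this, hc]

/-- `g` is made into an inner product, whose standard orthonormal basis is taken. This is what makes
the `epsilon` choice in `orthFrame` meaningful. -/
lemma exists_orthonormal [FiniteDimensional ℝ T] :
    ∃ e : Fin (finrank ℝ T) → T, IsOrthonormal g e := by
  classical
  let core : InnerProductSpace.Core ℝ T :=
    { inner := fun u v => g u v
      conj_inner_symm := fun u v => by simp [h.symm v u]
      re_inner_nonneg := fun u => by
        by_cases hu : u = 0
        · simp [hu, h.zero_left]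
        · simpa using (h.pos u hu).le
      add_left := h.add_left
      smul_left := fun u v r => by simp [h.smul_left]
      definite := fun u hu => by
        by_contra hne
        exact (h.pos u hne).ne' hu }
  let _ : NormedAddCommGroup T := core.toNormedAddCommGroup
  let _ : InnerProductSpace ℝ T := InnerProductSpace.ofCore core.toCore
  have := (stdOrthonormalBasis ℝ T).orthonormal
  rw [orthonormal_iff_ite] at this
  refine ⟨stdOrthonormalBasis ℝ T, fun i => ?_, fun i j hij => ?_⟩
  · have := this i i
    rw [if_pos rfl] at this
    exact this
  · have := this i j
    rw [if_neg hij] at this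
    exact this

/-- The trace of a bilinear map with respect to the scalar product does not depend on the frame. -/
lemma sum_frame_eq {V : Type*} [AddCommGroup V] [Module ℝ V] {ι κ : Type*} [Fintype ι] [Fintype κ]
    {e : ι → T} {f : κ → T} (he : IsOrthoFrame g e) (hf : IsOrthoFrame g f)
    {Q : T → T → V} (hQ : IsBilinearMap ℝ Q) :
    ∑ a, Q (e a) (e a) = ∑ b, Q (f b) (f b) := by
  let q := hQ.toLinearMap
  change ∑ a, q (e a) (e a) = ∑ b, q (f b) (f b)
  calc ∑ a, q (e a) (e a) = ∑ a, ∑ b, g (e a) (f b) • q (f b) (e a) :=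
        Finset.sum_congr rfl fun a _ => hf.map_eq_sum (q.flip (e a)) (e a)
    _ = ∑ b, ∑ a, g (f b) (e a) • q (f b) (e a) := by
        rw [Finset.sum_comm]
        exact Finset.sum_congr rfl fun b _ => Finset.sum_congr rfl fun a _ => by rw [h.symm]
    _ = ∑ b, q (f b) (f b) :=
        Finset.sum_congr rfl fun b _ => (he.map_eq_sum (q (f b)) (f b)).symm

/-- Moving a skew-adjoint endomorphism from one slot of a trace to the other. -/
lemma sum_frame_skew {V : Type*} [AddCommGroup V] [Module ℝ V] {ι : Type*} [Fintype ι]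
    {e : ι → T} (he : IsOrthoFrame g e) {C : T → T} (hC : ∀ u v, g (C u) v = -g u (C v))
    {Q : T → T → V} (hQ : IsBilinearMap ℝ Q) :
    ∑ a, Q (C (e a)) (e a) = -∑ a, Q (e a) (C (e a)) := by
  let q := hQ.toLinearMap
  change ∑ a, q (C (e a)) (e a) = -∑ a, q (e a) (C (e a))
  calc ∑ a, q (C (e a)) (e a) = ∑ a, ∑ b, g (C (e a)) (e b) • q (e b) (e a) :=
        Finset.sum_congr rfl fun a _ => he.map_eq_sum (q.flip (e a)) (C (e a))
    _ = -∑ b, ∑ a, g (C (e b)) (e a) • q (e b) (e a) := by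
        rw [Finset.sum_comm, ← Finset.sum_neg_distrib]
        refine Finset.sum_congr rfl fun b _ => ?_
        rw [← Finset.sum_neg_distrib]
        refine Finset.sum_congr rfl fun a _ => ?_
        rw [hC, h.symm (e a), neg_smul]
    _ = -∑ a, q (e a) (C (e a)) := by
        congr 1
        exact Finset.sum_congr rfl fun b _ => (he.map_eq_sum (q (e b)) (C (e b))).symm

/-- The complex structure as a linear map. -/
def cplxLinear (h : IsHermitianPair g J) : T →ₗ[ℝ] T where
  toFun := J
  map_add' := h.J_add
  map_smul' := h.J_smul

/-- Apply J to the expansion of J v. Comparing a trace in the frames e and J e is how terms of the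
wrong type are shown to vanish. -/
lemma isOrthoFrame_cplx {ι : Type*} [Fintype ι] {e : ι → T} (he : IsOrthoFrame g e) :
    IsOrthoFrame g (fun a => J (e a)) := by
  refine ⟨⟨fun a => by rw [h.J_isom, he.1.1], fun a b hab => by rw [h.J_isom, he.1.2 a b hab]⟩,
    fun v => ?_⟩
  have h1 : J (J v) = ∑ a, g (J v) (e a) • J (e a) := he.map_eq_sum h.cplxLinear (J v)
  rw [h.J_sq] at h1
  have h2 : ∀ a, g v (J (e a)) • J (e a) = -(g (J v) (e a) • J (e a)) := fun a => by
    rw [h.J_left, neg_smul, neg_neg]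
  simp only [h2, Finset.sum_neg_distrib, ← h1, neg_neg]

/-! ### The Clifford action -/

lemma dualForm_add (w u v : T) : dualForm g J w (u + v) = dualForm g J w u + dualForm g J w v := by
  simp only [dualForm, h.add_right]; push_cast; ring

lemma dualForm_smul (w : T) (r : ℝ) (u : T) :
    dualForm g J w (r • u) = r * dualForm g J w u := by
  simp only [dualForm, h.smul_right]; push_cast; ring

lemma dualForm_cplx (w u : T) : dualForm g J w (J u) = -(Complex.I * dualForm g J w u) := by
  have h1 : g w (J u) = -g (J w) u := by rw [h.J_left, neg_neg]
  simp only [dualForm, h1, h.J_isom]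
  push_cast
  linear_combination (-(g (J w) u : ℂ) / 2) * Complex.I_mul_I

lemma dualForm_add_left (w w' : T) : dualForm g J (w + w') = dualForm g J w + dualForm g J w' := by
  funext u
  simp only [dualForm, h.add_left, h.J_add, Pi.add_apply]; push_cast; ring

lemma dualForm_smul_left (r : ℝ) (w : T) : dualForm g J (r • w) = (r : ℂ) • dualForm g J w := by
  funext u
  simp only [dualForm, h.smul_left, h.J_smul, Pi.smul_apply, smul_eq_mul]; push_cast; ring

lemma dualForm_cplx_left (w : T) : dualForm g J (J w) = Complex.I • dualForm g J w := by
  funext u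
  simp only [dualForm, h.J_sq, h.neg_left, Pi.smul_apply, smul_eq_mul]
  push_cast
  linear_combination ((g (J w) u : ℂ) / 2) * Complex.I_mul_I

/-- The imaginary parts cancel because J is skew. -/
lemma dualForm_symm (u v : T) : dualForm g J u v + dualForm g J v u = g u v := by
  simp only [dualForm, h.symm v u, h.J_left v u, h.symm v (J u)]; push_cast; ring

variable {η ζ : Cochain T W}

lemma wedgeOne_dualForm (hη : IsAntiholomorphicForm J η) (w : T) :
    IsAntiholomorphicForm J (wedgeOne (dualForm g J w) η) :=
  hη.wedgeOne (h.dualForm_add w) (h.dualForm_smul w) (h.dualForm_cplx w)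

lemma isAntiholomorphicForm_cliff (hη : IsAntiholomorphicForm J η) (w : T) :
    IsAntiholomorphicForm J (cliff g J w η) :=
  ((h.wedgeOne_dualForm hη w).sub (hη.contract w)).smul _

lemma cliff_add_left (hη : IsAntiholomorphicForm J η) (u v : T) :
    cliff g J (u + v) η = cliff g J u η + cliff g J v η := by
  simp only [cliff]
  rw [h.dualForm_add_left, wedgeOne_add_left, hη.contract_add, ← smul_add]
  congr 1; abel

lemma cliff_smul_left (hη : IsAntiholomorphicForm J η) (r : ℝ) (u : T) :
    cliff g J (r • u) η = (r : ℂ) • cliff g J u η := by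
  simp only [cliff]
  rw [h.dualForm_smul_left, wedgeOne_smul_left, hη.contract_smul, ← smul_sub, smul_comm]

/-- The Clifford relation. Exterior products anticommute, contractions anticommute, the mixed
operators cancel on symmetrization, and the scalars left by `contract_wedgeOne` add up to g(u, v) by
`dualForm_symm`; the factor 2 is the square of √2. -/
lemma cliff_cliff_add (hη : IsAntiholomorphicForm J η) (u v : T) :
    cliff g J u (cliff g J v η) + cliff g J v (cliff g J u η) = (-2 * (g u v : ℂ)) • η := by
  have h2 : (((Real.sqrt 2 : ℝ) : ℂ)) * ((Real.sqrt 2 : ℝ) : ℂ) = 2 := by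
    rw [← Complex.ofReal_mul, Real.mul_self_sqrt (by norm_num)]; norm_num
  have key : ∀ u v : T, cliff g J u (cliff g J v η)
      = (2 : ℂ) • (wedgeOne (dualForm g J u) (wedgeOne (dualForm g J v) η)
        - wedgeOne (dualForm g J u) (contract v η)
        - (dualForm g J v u • η - wedgeOne (dualForm g J v) (contract u η))
        + contract u (contract v η)) := by
    intro u v
    have : cliff g J v η = ((Real.sqrt 2 : ℝ) : ℂ) • (wedgeOne (dualForm g J v) η - contract v η) :=
      rfl
    rw [this, cliff_smul_right]
    simp only [cliff]
    rw [smul_smul, h2, wedgeOne_sub_right, contract_sub_right, contract_wedgeOne]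
    congr 1; abel
  rw [key, key]
  have h3 := wedgeOne_anticomm (dualForm g J u) (dualForm g J v) η
  have h4 := hη.contract_anticomm u v
  have h5 := h.dualForm_symm u v
  rw [← smul_add, ← h5, show (-2 * (dualForm g J u v + dualForm g J v u))
    = 2 * (-(dualForm g J u v + dualForm g J v u)) by ring, mul_smul]
  congr 1
  rw [neg_smul, add_smul, eq_neg_of_add_eq_zero_left h3, eq_neg_of_add_eq_zero_left h4]
  abel

lemma cliff_cliff_self (hη : IsAntiholomorphicForm J η) (u : T) :
    cliff g J u (cliff g J u η) = (-(g u u : ℂ)) • η := by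
  have := h.cliff_cliff_add hη u u
  rw [← two_smul ℂ, mul_comm, ← neg_mul_comm, mul_comm, mul_smul] at this
  exact smul_right_injective _ (two_ne_zero (α := ℂ)) this

lemma isBilinearMap_cliff_cliff {C D : T → T} (hC : ∀ u v, C (u + v) = C u + C v)
    (hC' : ∀ (r : ℝ) u, C (r • u) = r • C u) (hD : ∀ u v, D (u + v) = D u + D v)
    (hD' : ∀ (r : ℝ) u, D (r • u) = r • D u) (hη : IsAntiholomorphicForm J η) :
    IsBilinearMap ℝ (fun u v => cliff g J (C u) (cliff g J (D v) η)) where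
  add_left u v w := by rw [hC, h.cliff_add_left (h.isAntiholomorphicForm_cliff hη _)]
  smul_left r u w := by
    rw [hC', h.cliff_smul_left (h.isAntiholomorphicForm_cliff hη _), Complex.coe_smul]
  add_right u v w := by rw [hD, h.cliff_add_left hη, cliff_add_right]
  smul_right r u w := by
    rw [hD', h.cliff_smul_left hη, cliff_smul_right, Complex.coe_smul]

/-- The commutator of the spinor action of a skew endomorphism with a Clifford multiplication. -/
lemma spin_commutator {ι : Type*} [Fintype ι] {e : ι → T} (he : IsOrthoFrame g e) {B : T →ₗ[ℝ] T}
    (hB : ∀ u v, g (B u) v = -g u (B v)) (hη : IsAntiholomorphicForm J η) (y : T) :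
    (1 / 4 : ℂ) • ∑ a, cliff g J (e a) (cliff g J (B (e a)) (cliff g J y η))
      = cliff g J y ((1 / 4 : ℂ) • ∑ a, cliff g J (e a) (cliff g J (B (e a)) η))
        + cliff g J (B y) η := by
  have hlin : ∀ (c : ι → ℝ) (x : ι → T), cliff g J (∑ a, c a • x a) η
      = ∑ a, (c a : ℂ) • cliff g J (x a) η := by
    intro c x
    let L : T →+ Cochain T W :=
      AddMonoidHom.mk' (fun u => cliff g J u η) (fun u v => h.cliff_add_left hη u v)
    have := map_sum L (fun a => c a • x a) Finset.univ
    refine this.trans (Finset.sum_congr rfl fun a _ => h.cliff_smul_left hη _ _)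
  have hy : cliff g J (B y) η = ∑ a, (g y (e a) : ℂ) • cliff g J (B (e a)) η := by
    rw [he.map_eq_sum B y, hlin]
  -- A second expansion of c(B y), using that B is skew. Moving c(y) to the left past the two
  -- factors produces both expansions, with weight 2 each, which accounts for the factor 1/4.
  have hy' : cliff g J (B y) η = -∑ a, (g (B (e a)) y : ℂ) • cliff g J (e a) η := by
    have h1 : B y = ∑ a, (-g (B (e a)) y) • e a := by
      conv_lhs => rw [he.2 (B y)]
      refine Finset.sum_congr rfl fun a _ => ?_
      rw [hB, h.symm y]
    rw [h1, hlin, ← Finset.sum_neg_distrib]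
    refine Finset.sum_congr rfl fun a _ => ?_
    push_cast; rw [neg_smul]
  have hterm : ∀ a, cliff g J (e a) (cliff g J (B (e a)) (cliff g J y η))
      = cliff g J y (cliff g J (e a) (cliff g J (B (e a)) η))
        + ((2 : ℂ) • ((g y (e a) : ℂ) • cliff g J (B (e a)) η)
          - (2 : ℂ) • ((g (B (e a)) y : ℂ) • cliff g J (e a) η)) := by
    intro a
    have h1 := eq_sub_of_add_eq (h.cliff_cliff_add hη (B (e a)) y)
    have h2 := eq_sub_of_add_eq
      (h.cliff_cliff_add (h.isAntiholomorphicForm_cliff hη (B (e a))) (e a) y)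
    rw [h1, cliff_sub_right, cliff_smul_right, h2, h.symm (e a) y]
    module
  have hy'' : ∑ a, (g (B (e a)) y : ℂ) • cliff g J (e a) η = -cliff g J (B y) η := by
    rw [hy', neg_neg]
  simp only [hterm, Finset.sum_add_distrib, Finset.sum_sub_distrib, ← Finset.smul_sum]
  rw [← hy, hy'', cliff_smul_right, cliff_sum_right]
  module

/-- The infinitesimal action of a skew-adjoint complex linear endomorphism on forms of type
`(0,•)`, in terms of the Clifford action. -/
lemma neg_derivForm_eq {ι : Type*} [Fintype ι] {e : ι → T} (he : IsOrthoFrame g e) {C : T →ₗ[ℝ] T}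
    (hC : ∀ u v, g (C u) v = -g u (C v)) (hCJ : ∀ u, C (J u) = J (C u))
    (hη : IsAntiholomorphicForm J η) :
    -derivForm C η = (1 / 4 : ℂ) • ∑ a, cliff g J (e a) (cliff g J (C (e a)) η)
      + (1 / 2 * ∑ a, ((g (C (e a)) (e a) : ℂ) - Complex.I * (g (J (C (e a))) (e a) : ℂ)) / 2) •
        η := by
  have hII : ∀ x : Cochain T W, Complex.I • Complex.I • x = -x := fun x => by
    rw [smul_smul, Complex.I_mul_I, neg_one_smul]
  have h2 : (((Real.sqrt 2 : ℝ) : ℂ)) * ((Real.sqrt 2 : ℝ) : ℂ) = 2 := by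
    rw [← Complex.ofReal_mul, Real.mul_self_sqrt (by norm_num)]; norm_num
  have hself : ∀ x : Cochain T W, x = -x → x = 0 := fun x hx => by
    have : (2 : ℂ) • x = 0 := by rw [two_smul]; nth_rewrite 1 [hx]; simp
    simpa using this
  -- the terms of degree `±2` vanish
  have hii : ∑ a, contract (e a) (contract (C (e a)) η) = 0 := by
    refine hself _ ?_
    have hbil : IsBilinearMap ℝ (fun u v => contract u (contract (C v) η)) :=
      { add_left := fun u v w => by rw [(hη.contract _).contract_add]
        smul_left := fun r u w => by rw [(hη.contract _).contract_smul, Complex.coe_smul]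
        add_right := fun u v w => by rw [map_add, hη.contract_add, contract_add_right]
        smul_right := fun r u w => by
          rw [map_smul, hη.contract_smul, contract_smul_right, Complex.coe_smul] }
    -- Passing to the frame J e does not change the trace; since C commutes with J, each of the two
    -- contractions contributes a factor -√-1. The sum is therefore equal to its opposite.
    refine (h.sum_frame_eq he (h.isOrthoFrame_cplx he) hbil).trans ?_
    rw [← Finset.sum_neg_distrib]
    refine Finset.sum_congr rfl fun a _ => ?_
    rw [hCJ, hη.contract_cplx, contract_neg_right, contract_smul_right,
      (hη.contract _).contract_cplx, smul_neg, hII, neg_neg]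
  have haa : ∑ a, wedgeOne (dualForm g J (e a)) (wedgeOne (dualForm g J (C (e a))) η) = 0 := by
    refine hself _ ?_
    have hbil : IsBilinearMap ℝ
        (fun u v => wedgeOne (dualForm g J u) (wedgeOne (dualForm g J (C v)) η)) :=
      { add_left := fun u v w => by rw [h.dualForm_add_left, wedgeOne_add_left]
        smul_left := fun r u w => by
          rw [h.dualForm_smul_left, wedgeOne_smul_left, Complex.coe_smul]
        add_right := fun u v w => by
          rw [map_add, h.dualForm_add_left, wedgeOne_add_left, wedgeOne_add_right]
        smul_right := fun r u w => by
          rw [map_smul, h.dualForm_smul_left, wedgeOne_smul_left, wedgeOne_smul_right,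
            Complex.coe_smul] }
    refine (h.sum_frame_eq he (h.isOrthoFrame_cplx he) hbil).trans ?_
    rw [← Finset.sum_neg_distrib]
    refine Finset.sum_congr rfl fun a _ => ?_
    rw [hCJ, h.dualForm_cplx_left, h.dualForm_cplx_left, wedgeOne_smul_left, wedgeOne_smul_left,
      wedgeOne_smul_right, hII]
  -- Skewness carries C from the dual form to the contraction.
  have hskew : ∑ a, wedgeOne (dualForm g J (C (e a))) (contract (e a) η)
      = -∑ a, wedgeOne (dualForm g J (e a)) (contract (C (e a)) η) := by
    have hbil : IsBilinearMap ℝ (fun u v => wedgeOne (dualForm g J u) (contract v η)) :=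
      { add_left := fun u v w => by rw [h.dualForm_add_left, wedgeOne_add_left]
        smul_left := fun r u w => by
          rw [h.dualForm_smul_left, wedgeOne_smul_left, Complex.coe_smul]
        add_right := fun u v w => by rw [hη.contract_add, wedgeOne_add_right]
        smul_right := fun r u w => by
          rw [hη.contract_smul, wedgeOne_smul_right, Complex.coe_smul] }
    exact h.sum_frame_skew he hC hbil
  -- On one-forms of type (0,1) this is the expansion of a vector in the frame; in higher degree
  -- both sides are compared through their contractions.
  have hderiv : ∑ a, wedgeOne (dualForm g J (e a)) (contract (C (e a)) η) = derivForm C η := by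
    suffices H : ∀ (q : ℕ) (η : Cochain T W) (v : Fin q → T), IsAntiholomorphicForm J η →
        (∑ a, wedgeOne (dualForm g J (e a)) (contract (C (e a)) η)) q v = derivForm C η q v by
      funext q v; exact H q η v hη
    intro q
    induction q with
    | zero =>
      intro η v hη
      simp [wedgeOne_zero_degree, derivForm]
    | succ q ih =>
      intro η v hη
      rw [cochain_succ (∑ a, _), cochain_succ (derivForm C η), contract_derivForm,
        contract_sum_right, Pi.add_apply, Pi.add_apply, ← ih _ _ (hη.contract (v 0))]
      -- The dual form pairs v_0 as half the sum of v_0 and √-1 J v_0. Because C commutes with J and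
      -- η is of type (0,•), the two halves contribute equally.
      have h3 : ∑ a, dualForm g J (e a) (v 0) • contract (C (e a)) η = contract (C (v 0)) η := by
        have e1 : ∀ a, dualForm g J (e a) (v 0)
            = ((g (v 0) (e a) : ℂ) + Complex.I * (g (J (v 0)) (e a) : ℂ)) / 2 := by
          intro a
          rw [dualForm, h.J_left, h.symm (e a), h.symm (e a)]; push_cast; ring
        have e2 : ∀ x, contract (C x) η = ∑ a, (g x (e a) : ℂ) • contract (C (e a)) η := by
          intro x
          rw [he.map_eq_sum C x, hη.contract_sum]
          exact Finset.sum_congr rfl fun a _ => hη.contract_smul _ _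
        have e3 := e2 (v 0)
        have e4 := e2 (J (v 0))
        rw [hCJ, hη.contract_cplx] at e4
        have e5 : contract (C (v 0)) η = (1 / 2 : ℂ) • (contract (C (v 0)) η
            + Complex.I • -(Complex.I • contract (C (v 0)) η)) := by
          rw [smul_neg, hII, neg_neg, ← two_smul ℂ, smul_smul]; norm_num
        rw [e4] at e5
        nth_rewrite 2 [e3] at e5
        rw [e5]
        rw [Finset.smul_sum, ← Finset.sum_add_distrib, Finset.smul_sum]
        refine Finset.sum_congr rfl fun a _ => ?_
        rw [e1]; module
      have h4 : ∑ a, contract (v 0) (wedgeOne (dualForm g J (e a)) (contract (C (e a)) η))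
          = contract (C (v 0)) η
            + ∑ a, wedgeOne (dualForm g J (e a)) (contract (C (e a)) (contract (v 0) η)) := by
        rw [← h3, ← Finset.sum_add_distrib]
        refine Finset.sum_congr rfl fun a _ => ?_
        rw [contract_wedgeOne, eq_neg_of_add_eq_zero_left (hη.contract_anticomm (v 0) (C (e a))),
          wedgeOne_neg_right, sub_neg_eq_add]
      rw [h4]; rfl
  have hcc : ∀ a, cliff g J (e a) (cliff g J (C (e a)) η)
      = (2 : ℂ) • (wedgeOne (dualForm g J (e a)) (wedgeOne (dualForm g J (C (e a))) η)
        - wedgeOne (dualForm g J (e a)) (contract (C (e a)) η)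
        - (dualForm g J (C (e a)) (e a) • η
          - wedgeOne (dualForm g J (C (e a))) (contract (e a) η))
        + contract (e a) (contract (C (e a)) η)) := by
    intro a
    have : cliff g J (C (e a)) η
      = ((Real.sqrt 2 : ℝ) : ℂ) • (wedgeOne (dualForm g J (C (e a))) η - contract (C (e a)) η) := rfl
    rw [this, cliff_smul_right]
    simp only [cliff]
    rw [smul_smul, h2, wedgeOne_sub_right, contract_sub_right, contract_wedgeOne]
    congr 1; abel
  -- Both mixed terms equal minus the derivation, and the scalars add up to the complex trace of C;
  -- multiplying 2 by 1/4 yields the half trace.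
  simp only [hcc, ← Finset.smul_sum, Finset.sum_add_distrib, Finset.sum_sub_distrib, hii, haa,
    hskew, hderiv, ← Finset.sum_smul]
  simp only [dualForm]
  module

end IsHermitianPair

end

/-! ### Differentials of vector-valued functions on manifolds -/

section Calculus

variable {E : Type*} [NormedAddCommGroup E] [NormedSpace ℝ E]
  {H : Type*} [TopologicalSpace H] {I : ModelWithCorners ℝ E H}
  {X : Type*} [TopologicalSpace X] [ChartedSpace H X]
  {F : Type*} [NormedAddCommGroup F] [NormedSpace ℝ F]

lemma mvfderiv_apply (f : X → F) (x : X) (u : TangentSpace I x) :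
    mvfderiv I f x u = mfderiv I 𝓘(ℝ, F) f x u := rfl

lemma mvfderiv_congr {f f' : X → F} {x : X} (h : f =ᶠ[𝓝 x] f') :
    mvfderiv I f x = mvfderiv I f' x := by
  simp only [mvfderiv, h.mfderiv_eq]
  rfl

/-- Chain rule for the differential of a vector-valued function. -/
lemma mvfderiv_comp_vec {E' : Type*} [NormedAddCommGroup E'] [NormedSpace ℝ E']
    {H' : Type*} [TopologicalSpace H'] {I' : ModelWithCorners ℝ E' H'}
    {X' : Type*} [TopologicalSpace X'] [ChartedSpace H' X'] {f : X → F} {φ : X' → X} (x : X')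
    (hf : MDifferentiableAt I 𝓘(ℝ, F) f (φ x)) (hφ : MDifferentiableAt I' I φ x)
    (u : TangentSpace I' x) :
    mvfderiv I' (fun y => f (φ y)) x u = mvfderiv I f (φ x) (mfderiv I' I φ x u) :=
  mfderiv_comp_apply x hf hφ u

lemma mvfderiv_clm_comp {F' : Type*} [NormedAddCommGroup F'] [NormedSpace ℝ F'] (L : F →L[ℝ] F')
    {f : X → F} {x : X} (hf : MDifferentiableAt I 𝓘(ℝ, F) f x) (u : TangentSpace I x) :
    mvfderiv I (fun y => L (f y)) x u = L (mvfderiv I f x u) := by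
  have h := mfderiv_comp_apply (I := I) (I' := 𝓘(ℝ, F)) (I'' := 𝓘(ℝ, F')) x
    (g := L) L.mdifferentiableAt hf u
  rw [L.mfderiv_eq] at h
  exact h

lemma mdifferentiableAt_clm_comp {F' : Type*} [NormedAddCommGroup F'] [NormedSpace ℝ F']
    (L : F →L[ℝ] F') {f : X → F} {x : X} (hf : MDifferentiableAt I 𝓘(ℝ, F) f x) :
    MDifferentiableAt I 𝓘(ℝ, F') (fun y => L (f y)) x :=
  (L.mdifferentiableAt (x := f x)).comp x hf

/-- Leibniz rule for a bilinear product. -/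
lemma mvfderiv_bilin {F₁ F₂ : Type*} [NormedAddCommGroup F₁] [NormedSpace ℝ F₁]
    [NormedAddCommGroup F₂] [NormedSpace ℝ F₂] (B : F₁ →L[ℝ] F₂ →L[ℝ] F) {f : X → F₁} {h : X → F₂}
    {x : X} (hf : MDifferentiableAt I 𝓘(ℝ, F₁) f x) (hh : MDifferentiableAt I 𝓘(ℝ, F₂) h x)
    (u : TangentSpace I x) :
    mvfderiv I (fun y => B (f y) (h y)) x u
      = B (mvfderiv I f x u) (h x) + B (f x) (mvfderiv I h x u) := by
  have hU : UniqueDiffWithinAt ℝ (Set.range I) (extChartAt I x x) :=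
    I.uniqueDiffOn _ (Set.mem_range_self _)
  have hB : IsBoundedBilinearMap ℝ (fun p : F₁ × F₂ => B p.1 p.2) := B.isBoundedBilinearMap
  have hm : MDifferentiableAt I 𝓘(ℝ, F) (fun y => B (f y) (h y)) x :=
    (hB.differentiableAt (f x, h x)).mdifferentiableAt.comp x (hf.prodMk_space hh)
  have h1 := B.fderivWithin_of_bilinear hf.differentiableWithinAt_writtenInExtChartAt
    hh.differentiableWithinAt_writtenInExtChartAt hU
  have e0 := congrArg (fun L => L u) hm.mvfderiv
  have e1 := congrArg (fun L => L u) hf.mvfderiv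
  have e2 := congrArg (fun L => L u) hh.mvfderiv
  refine e0.trans ?_
  rw [e1, e2]
  refine (congrArg (fun L => L u) h1).trans ?_
  have hx : (extChartAt I x).symm (extChartAt I x x) = x := extChartAt_to_inv x
  have hf' : writtenInExtChartAt I 𝓘(ℝ, F₁) x f (extChartAt I x x) = f x := congrArg f hx
  have hh' : writtenInExtChartAt I 𝓘(ℝ, F₂) x h (extChartAt I x x) = h x := congrArg h hx
  rw [hf', hh']
  exact add_comm _ _

end Calculus

/-! ### Vector fields as derivations and the Lie bracket -/

section Bracket

variable {E : Type*} [NormedAddCommGroup E] [NormedSpace ℝ E] [CompleteSpace E]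
  {H : Type*} [TopologicalSpace H] {I : ModelWithCorners ℝ E H} [I.Boundaryless]
  {X : Type*} [TopologicalSpace X] [ChartedSpace H X] [IsManifold I ∞ X]
  {F : Type*} [NormedAddCommGroup F] [NormedSpace ℝ F]

/-- The differential of a vector-valued function, read in a chart. -/
lemma mvfderiv_eq_fderiv_chart {k : X → F} {x y : X} (hy : y ∈ (extChartAt I x).source)
    (hk : MDifferentiableAt I 𝓘(ℝ, F) k y) (w : TangentSpace I y) :
    mvfderiv I k y w = fderiv ℝ (fun p => k ((extChartAt I x).symm p)) (extChartAt I x y)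
      (mfderiv I 𝓘(ℝ, E) (extChartAt I x) y w) := by
  have A : (extChartAt I x).symm (extChartAt I x y) = y := (extChartAt I x).left_inv hy
  have hφy : MDifferentiableAt I 𝓘(ℝ, E) (extChartAt I x) y :=
    mdifferentiableAt_extChartAt (by rwa [← extChartAt_source (I := I)])
  have hs : MDifferentiableAt 𝓘(ℝ, E) I (extChartAt I x).symm (extChartAt I x y) := by
    have := mdifferentiableWithinAt_extChartAt_symm (I := I) ((extChartAt I x).map_source hy)
    rwa [I.range_eq_univ, mdifferentiableWithinAt_univ] at this
  have hk' : MDifferentiableAt 𝓘(ℝ, E) 𝓘(ℝ, F) (fun p => k ((extChartAt I x).symm p))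
      (extChartAt I x y) :=
    MDifferentiableAt.comp (extChartAt I x y) (by rwa [A]) hs
  have h1 : k =ᶠ[𝓝 y] fun z => (fun p => k ((extChartAt I x).symm p)) (extChartAt I x z) := by
    filter_upwards [(isOpen_extChartAt_source x).mem_nhds hy] with z hz
    exact congrArg k ((extChartAt I x).left_inv hz).symm
  rw [mvfderiv_congr h1, mvfderiv_comp_vec y hk' hφy, mvfderiv_apply, mfderiv_eq_fderiv]
  rfl

/-- It turns the image of a field under the differential of a chart into its coordinate as a
section, whose smoothness is the definition of smoothness of the field. -/
lemma mfderiv_extChartAt_eq_trivializationAt {x y : X} (hy : y ∈ (extChartAt I x).source)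
    (w : TangentSpace I y) :
    mfderiv I 𝓘(ℝ, E) (extChartAt I x) y w
      = (trivializationAt E (TangentSpace I) x ⟨y, w⟩).2 := by
  have hy' : y ∈ (chartAt H x).source := by rwa [← extChartAt_source (I := I)]
  have h1 : (trivializationAt E (TangentSpace I) x).continuousLinearMapAt ℝ y w
      = (trivializationAt E (TangentSpace I) x ⟨y, w⟩).2 := by
    rw [Trivialization.continuousLinearMapAt_apply, Trivialization.linearMapAt_apply, if_pos]
    simpa using hy'
  exact (DFunLike.congr_fun
    (TangentBundle.continuousLinearMapAt_trivializationAt (I := I) hy') w).symm.trans h1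

/-- `y ↦ df_y(U_y)` is smooth when `f` and `U` are. -/
lemma contMDiffAt_mvfderiv_apply {f : X → F} {U : ∀ x : X, TangentSpace I x} {x : X}
    (hf : ContMDiffAt I 𝓘(ℝ, F) ∞ f x)
    (hU : ContMDiffAt I (I.prod 𝓘(ℝ, E)) ∞ (fun y => (⟨y, U y⟩ : TangentBundle I X)) x) :
    ContMDiffAt I 𝓘(ℝ, F) ∞ (fun y => mvfderiv I f y (U y)) x := by
  have hfh : ContDiffAt ℝ ∞ (fun p => f ((extChartAt I x).symm p)) (extChartAt I x x) := by
    have h1 := (contMDiffAt_iff.1 hf).2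
    rw [I.range_eq_univ, contDiffWithinAt_univ] at h1
    exact h1
  have hdf : ∀ᶠ y in 𝓝 x, MDifferentiableAt I 𝓘(ℝ, F) f y := by
    filter_upwards [(contMDiffAt_iff_contMDiffAt_nhds (n := 1) (by simp)).1
      (hf.of_le (by simp))] with y hy
    exact hy.mdifferentiableAt (by simp)
  -- In the chart at x the function is a smooth family of linear maps applied to the coordinate of
  -- U.
  have h1 : (fun y => mvfderiv I f y (U y)) =ᶠ[𝓝 x] fun y =>
      fderiv ℝ (fun p => f ((extChartAt I x).symm p)) (extChartAt I x y)
        (trivializationAt E (TangentSpace I) x ⟨y, U y⟩).2 := by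
    filter_upwards [hdf, extChartAt_source_mem_nhds (I := I) x] with y hy hys
    rw [mvfderiv_eq_fderiv_chart hys hy, mfderiv_extChartAt_eq_trivializationAt hys]
  have h2 : ContMDiffAt I 𝓘(ℝ, E →L[ℝ] F) ∞ (fun y =>
      fderiv ℝ (fun p => f ((extChartAt I x).symm p)) (extChartAt I x y)) x :=
    ContMDiffAt.comp x (hfh.fderiv_right (m := ∞) (by simp)).contMDiffAt contMDiffAt_extChartAt
  exact (h2.clm_apply ((contMDiffAt_section _).1 hU)).congr_of_eventuallyEq h1

/-- The Lie bracket is the commutator of derivations. -/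
lemma mvfderiv_mlieBracket {f : X → F} {U V : ∀ x : X, TangentSpace I x} {x : X}
    (hf : ContMDiffAt I 𝓘(ℝ, F) 2 f x)
    (hU : MDifferentiableAt I (I.prod 𝓘(ℝ, E)) (fun y => (⟨y, U y⟩ : TangentBundle I X)) x)
    (hV : MDifferentiableAt I (I.prod 𝓘(ℝ, E)) (fun y => (⟨y, V y⟩ : TangentBundle I X)) x) :
    mvfderiv I f x (mlieBracket I U V x)
      = mvfderiv I (fun y => mvfderiv I f y (V y)) x (U x)
        - mvfderiv I (fun y => mvfderiv I f y (U y)) x (V x) := by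
  have : IsManifold I 2 X := inferInstance
  set φ := extChartAt I x with hφ
  let fh : E → F := fun p => f (φ.symm p)
  -- The representative of a field in the chart at x.
  let hat : (∀ y : X, TangentSpace I y) → E → E := fun W p =>
    mpullbackWithin 𝓘(ℝ, E) I φ.symm W (Set.range I) p
  have hhat : ∀ W : ∀ y : X, TangentSpace I y,
      MDifferentiableAt I (I.prod 𝓘(ℝ, E)) (fun y => (⟨y, W y⟩ : TangentBundle I X)) x →
      DifferentiableAt ℝ (hat W) (φ x) := by
    intro W hW
    have := MDifferentiableWithinAt.differentiableWithinAt_mpullbackWithin_vectorField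
      (s := Set.univ) (mdifferentiableWithinAt_univ.2 hW)
    rw [Set.preimage_univ, Set.univ_inter] at this
    rw [I.range_eq_univ] at this
    have h2 := differentiableWithinAt_univ.1 this
    simpa only [hat, I.range_eq_univ] using h2
  have hmem : ∀ᶠ y in 𝓝 x, y ∈ φ.source := extChartAt_source_mem_nhds x
  -- The pullback is defined by the inverse of the differential of the inverse chart; on the chart
  -- domain this is the differential of the chart itself.
  have hK : ∀ (W : ∀ y : X, TangentSpace I y), ∀ y ∈ φ.source,
      hat W (φ y) = mfderiv I 𝓘(ℝ, E) φ y (W y) := by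
    intro W y hy
    have A : φ.symm (φ y) = y := φ.left_inv hy
    have hinv := isInvertible_mfderivWithin_extChartAt_symm (I := I) (φ.map_source hy)
    obtain ⟨L, hL⟩ := hinv
    have h1 : hat W (φ y) = L.symm (W (φ.symm (φ y))) := by
      change (mfderivWithin 𝓘(ℝ, E) I φ.symm (Set.range I) (φ y)).inverse (W (φ.symm (φ y))) = _
      rw [← hL, ContinuousLinearMap.inverse_equiv]; rfl
    rw [h1]
    apply L.injective
    rw [ContinuousLinearEquiv.apply_symm_apply]
    have h2 := congrArg (fun M => M (W y))
      (mfderivWithin_extChartAt_symm_comp_mfderiv_extChartAt' (I := I) hy)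
    have h3 : (W (φ.symm (φ y)) : E) = (W y : E) := congrArg (fun z => (W z : E)) A
    exact h3.trans (h2.symm.trans (DFunLike.congr_fun hL _).symm)
  have hx : x ∈ φ.source := mem_extChartAt_source x
  have hfh : ContDiffAt ℝ 2 fh (φ x) := by
    have h1 := (contMDiffAt_iff.1 hf).2
    rw [I.range_eq_univ, contDiffWithinAt_univ] at h1
    exact h1
  have hdf : ∀ᶠ y in 𝓝 x, MDifferentiableAt I 𝓘(ℝ, F) f y := by
    filter_upwards [(contMDiffAt_iff_contMDiffAt_nhds (by simp)).1 hf] with y hy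
    exact hy.mdifferentiableAt (by simp)
  have hmain : ∀ U V : ∀ y : X, TangentSpace I y,
      MDifferentiableAt I (I.prod 𝓘(ℝ, E)) (fun y => (⟨y, V y⟩ : TangentBundle I X)) x →
      mvfderiv I (fun y => mvfderiv I f y (V y)) x (U x)
        = fderiv ℝ (fderiv ℝ fh) (φ x) (hat U (φ x)) (hat V (φ x))
          + fderiv ℝ fh (φ x) (fderiv ℝ (hat V) (φ x) (hat U (φ x))) := by
    intro U V hV
    have h1 : (fun y => mvfderiv I f y (V y))
        =ᶠ[𝓝 x] fun y => (fun p => fderiv ℝ fh p (hat V p)) (φ y) := by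
      filter_upwards [hmem, hdf] with y hy hfy
      rw [mvfderiv_eq_fderiv_chart hy hfy, ← hK V y hy]
    have hdd : DifferentiableAt ℝ (fderiv ℝ fh) (φ x) :=
      (hfh.fderiv_right (m := 1) (by norm_num)).differentiableAt (by simp)
    have hG : DifferentiableAt ℝ (fun p => fderiv ℝ fh p (hat V p)) (φ x) :=
      hdd.clm_apply (hhat V hV)
    rw [mvfderiv_congr h1, mvfderiv_comp_vec x hG.mdifferentiableAt
      (mdifferentiableAt_extChartAt (mem_chart_source H x)), mvfderiv_apply, mfderiv_eq_fderiv,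
      ← hK U x hx]
    refine (congrArg (fun L => L (hat U (φ x))) (fderiv_clm_apply hdd (hhat V hV))).trans ?_
    exact add_comm _ _
  have hbr : mfderiv I 𝓘(ℝ, E) φ x (mlieBracket I U V x)
      = lieBracket ℝ (hat U) (hat V) (φ x) := by
    have h1 := mlieBracketWithin_apply (I := I) (V := U) (W := V) (s := Set.univ) (x₀ := x)
    rw [Set.preimage_univ, Set.univ_inter] at h1
    obtain ⟨L, hL⟩ := isInvertible_mfderiv_extChartAt (I := I) hx
    rw [← hL, ContinuousLinearMap.inverse_equiv] at h1
    have hr : lieBracketWithin ℝ (hat U) (hat V) (Set.range I) (φ x)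
        = lieBracket ℝ (hat U) (hat V) (φ x) := by
      rw [I.range_eq_univ, lieBracketWithin_univ]
    rw [← hL, ← mlieBracketWithin_univ, h1]
    exact (L.apply_symm_apply _).trans hr
  rw [mvfderiv_eq_fderiv_chart hx (hf.mdifferentiableAt (by simp)), hbr, hmain U V hV, hmain V U hU, lieBracket,
    map_sub]
  -- Each iterated derivative is a second derivative of f plus a first derivative along the
  -- derivative of a field. The former cancel by symmetry, the latter form the bracket of the
  -- representatives.
  have hsym : IsSymmSndFDerivAt ℝ fh (φ x) := hfh.isSymmSndFDerivAt (by simp)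
  rw [hsym.eq (hat U (φ x)) (hat V (φ x))]
  abel

end Bracket

/-! ### The Levi-Civita connection from Koszul's formula, and its J-linear projection -/

section LeviCivita

variable {E : Type*} [NormedAddCommGroup E] [NormedSpace ℝ E]
  {H : Type*} [TopologicalSpace H] (I : ModelWithCorners ℝ E H)
  {X : Type*} [TopologicalSpace X] [ChartedSpace H X]

/-- Differentiability of a vector field at a point. -/
abbrev DiffFieldAt [IsManifold I 1 X] (V : ∀ x : X, TangentSpace I x) (x : X) : Prop :=
  MDifferentiableAt I (I.prod 𝓘(ℝ, E)) (fun y => (⟨y, V y⟩ : TangentBundle I X)) x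

variable [IsManifold I ∞ X]

/-- An almost Hermitian structure with smooth coefficients. -/
structure IsAlmostHermitian (g : ∀ x : X, TangentSpace I x → TangentSpace I x → ℝ)
    (J : ∀ x : X, TangentSpace I x → TangentSpace I x) : Prop where
  pointwise : ∀ x, IsHermitianPair (g x) (J x)
  metric_diff : ∀ {U V x}, DiffFieldAt I U x → DiffFieldAt I V x →
    MDifferentiableAt I 𝓘(ℝ, ℝ) (fun y => g y (U y) (V y)) x
  metric_smooth : ∀ {U V x}, SmoothFieldAt I U x → SmoothFieldAt I V x →
    ContMDiffAt I 𝓘(ℝ, ℝ) ∞ (fun y => g y (U y) (V y)) x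
  cplx_diff : ∀ {U x}, DiffFieldAt I U x → DiffFieldAt I (fun y => J y (U y)) x
  cplx_smooth : ∀ {U x}, SmoothFieldAt I U x → SmoothFieldAt I (fun y => J y (U y)) x

variable {I}

lemma SmoothFieldAt.diffFieldAt {V : ∀ x : X, TangentSpace I x} {x : X}
    (h : SmoothFieldAt I V x) : DiffFieldAt I V x :=
  ContMDiffAt.mdifferentiableAt h (by simp)

lemma diffFieldAt_extend [FiniteDimensional ℝ E] {x : X} (u : TangentSpace I x) :
    DiffFieldAt I (FiberBundle.extend E u) x :=
  FiberBundle.mdifferentiableAt_extend I E u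

lemma smoothFieldAt_extend [FiniteDimensional ℝ E] {x : X} (u : TangentSpace I x) :
    SmoothFieldAt I (FiberBundle.extend E u) x :=
  FiberBundle.contMDiffAt_extend I E u

namespace DiffFieldAt

variable {U V : ∀ x : X, TangentSpace I x} {x : X}

lemma add (hU : DiffFieldAt I U x) (hV : DiffFieldAt I V x) :
    DiffFieldAt I (fun y => U y + V y) x :=
  mdifferentiableAt_add_section hU hV

lemma smul {f : X → ℝ} (hf : MDifferentiableAt I 𝓘(ℝ, ℝ) f x) (hU : DiffFieldAt I U x) :
    DiffFieldAt I (fun y => f y • U y) x :=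
  MDifferentiableAt.smul_section hf hU

lemma sum {ι : Type*} {s : Finset ι} {U : ι → ∀ x : X, TangentSpace I x}
    (hU : ∀ i ∈ s, DiffFieldAt I (U i) x) : DiffFieldAt I (fun y => ∑ i ∈ s, U i y) x :=
  MDifferentiableAt.sum_section hU

end DiffFieldAt

variable [FiniteDimensional ℝ E] {g : ∀ x : X, TangentSpace I x → TangentSpace I x → ℝ}
    {J : ∀ x : X, TangentSpace I x → TangentSpace I x}

lemma mvfderiv_mul_real {f k : X → ℝ} {x : X} (hf : MDifferentiableAt I 𝓘(ℝ, ℝ) f x)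
    (hk : MDifferentiableAt I 𝓘(ℝ, ℝ) k x) (u : TangentSpace I x) :
    mvfderiv I (fun y => f y * k y) x u = mvfderiv I f x u * k x + f x * mvfderiv I k x u :=
  mvfderiv_bilin (ContinuousLinearMap.mul ℝ ℝ) hf hk u

lemma mvfderiv_add_apply {F : Type*} [NormedAddCommGroup F] [NormedSpace ℝ F] {f k : X → F} {x : X}
    (hf : MDifferentiableAt I 𝓘(ℝ, F) f x)
    (hk : MDifferentiableAt I 𝓘(ℝ, F) k x) (u : TangentSpace I x) :
    mvfderiv I (fun y => f y + k y) x u = mvfderiv I f x u + mvfderiv I k x u := by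
  rw [mvfderiv_fun_add hf hk]; rfl

namespace IsAlmostHermitian

variable (A : IsAlmostHermitian I g J) {U U' Y Y' Z Z' : ∀ x : X, TangentSpace I x} {x : X}
  {f : X → ℝ}
include A

lemma metric_diff_add_left (hU : DiffFieldAt I U x) (hU' : DiffFieldAt I U' x)
    (hZ : DiffFieldAt I Z x) (w : TangentSpace I x) :
    mvfderiv I (fun y => g y ((U + U') y) (Z y)) x w
      = mvfderiv I (fun y => g y (U y) (Z y)) x w + mvfderiv I (fun y => g y (U' y) (Z y)) x w := by
  rw [← mvfderiv_add_apply (A.metric_diff hU hZ) (A.metric_diff hU' hZ)]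
  congr 2
  funext y
  exact (A.pointwise y).add_left _ _ _

lemma metric_diff_smul_left (hf : MDifferentiableAt I 𝓘(ℝ, ℝ) f x) (hU : DiffFieldAt I U x)
    (hZ : DiffFieldAt I Z x) (w : TangentSpace I x) :
    mvfderiv I (fun y => g y ((f • U) y) (Z y)) x w
      = mvfderiv I f x w * g x (U x) (Z x) + f x * mvfderiv I (fun y => g y (U y) (Z y)) x w := by
  rw [← mvfderiv_mul_real hf (A.metric_diff hU hZ)]
  congr 2
  funext y
  exact (A.pointwise y).smul_left _ _ _

lemma metric_comm (U Z : ∀ x : X, TangentSpace I x) :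
    (fun y => g y (U y) (Z y)) = fun y => g y (Z y) (U y) :=
  funext fun y => (A.pointwise y).symm _ _

lemma koszul_add_left (hU : DiffFieldAt I U x) (hU' : DiffFieldAt I U' x)
    (hY : DiffFieldAt I Y x) (hZ : DiffFieldAt I Z x) :
    koszul I g (U + U') Y Z x = koszul I g U Y Z x + koszul I g U' Y Z x := by
  have : CompleteSpace E := FiniteDimensional.complete ℝ E
  have h := A.pointwise x
  simp only [koszul]
  rw [A.metric_diff_add_left hU hU' hZ, A.metric_diff_add_left hU hU' hY,
    mlieBracket_add_left hU hU', mlieBracket_add_left hU hU', h.add_left, h.add_left,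
    Pi.add_apply, h.add_right, map_add]
  ring

/-- The derivatives of f coming from the metric terms cancel those coming from the brackets. -/
lemma koszul_smul_left (hf : MDifferentiableAt I 𝓘(ℝ, ℝ) f x) (hU : DiffFieldAt I U x)
    (hY : DiffFieldAt I Y x) (hZ : DiffFieldAt I Z x) :
    koszul I g (f • U) Y Z x = f x * koszul I g U Y Z x := by
  have : CompleteSpace E := FiniteDimensional.complete ℝ E
  have h := A.pointwise x
  simp only [koszul]
  rw [A.metric_diff_smul_left hf hU hZ, A.metric_diff_smul_left hf hU hY,
    mlieBracket_smul_left hf hU, mlieBracket_smul_left hf hU, h.add_left, h.add_left,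
    Pi.smul_apply', h.smul_right, map_smul]
  simp only [h.smul_left, neg_smul, h.neg_left, smul_eq_mul]
  ring

lemma koszul_add_right (hU : DiffFieldAt I U x) (hY : DiffFieldAt I Y x)
    (hZ : DiffFieldAt I Z x) (hZ' : DiffFieldAt I Z' x) :
    koszul I g U Y (Z + Z') x = koszul I g U Y Z x + koszul I g U Y Z' x := by
  have : CompleteSpace E := FiniteDimensional.complete ℝ E
  have h := A.pointwise x
  simp only [koszul]
  rw [A.metric_comm Y (Z + Z'), A.metric_comm U (Z + Z'), A.metric_diff_add_left hZ hZ' hY,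
    A.metric_diff_add_left hZ hZ' hU,
    mlieBracket_add_right hZ hZ', mlieBracket_add_right hZ hZ', h.add_left, h.add_left,
    Pi.add_apply, h.add_right, map_add, A.metric_comm Y Z, A.metric_comm Y Z', A.metric_comm U Z,
    A.metric_comm U Z']
  ring

lemma koszul_smul_right (hf : MDifferentiableAt I 𝓘(ℝ, ℝ) f x) (hU : DiffFieldAt I U x)
    (hY : DiffFieldAt I Y x) (hZ : DiffFieldAt I Z x) :
    koszul I g U Y (f • Z) x = f x * koszul I g U Y Z x := by
  have : CompleteSpace E := FiniteDimensional.complete ℝ E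
  have h := A.pointwise x
  simp only [koszul]
  rw [A.metric_comm Y (f • Z), A.metric_comm U (f • Z), A.metric_diff_smul_left hf hZ hY,
    A.metric_diff_smul_left hf hZ hU,
    mlieBracket_smul_right hf hZ, mlieBracket_smul_right hf hZ, h.add_left, h.add_left,
    Pi.smul_apply', h.smul_right, map_smul, A.metric_comm Y Z, A.metric_comm U Z,
    h.symm (Z x) (U x), h.symm (Z x) (Y x)]
  simp only [h.smul_left, smul_eq_mul, h.symm (Z x) (U x), h.symm (Z x) (Y x)]
  ring

lemma koszul_add_mid (hU : DiffFieldAt I U x) (hY : DiffFieldAt I Y x)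
    (hY' : DiffFieldAt I Y' x) (hZ : DiffFieldAt I Z x) :
    koszul I g U (Y + Y') Z x = koszul I g U Y Z x + koszul I g U Y' Z x := by
  have : CompleteSpace E := FiniteDimensional.complete ℝ E
  have h := A.pointwise x
  simp only [koszul]
  rw [A.metric_comm U (Y + Y'), A.metric_diff_add_left hY hY' hZ,
    A.metric_diff_add_left hY hY' hU,
    mlieBracket_add_right hY hY', mlieBracket_add_left hY hY', h.add_left, h.add_left,
    Pi.add_apply, h.add_right, map_add, A.metric_comm U Y, A.metric_comm U Y']
  ring

/-- The derivatives of f along Z cancel, while the one along U occurs twice and is halved: this is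
the Leibniz rule of the connection. -/
lemma koszul_smul_mid (hf : MDifferentiableAt I 𝓘(ℝ, ℝ) f x) (hU : DiffFieldAt I U x)
    (hY : DiffFieldAt I Y x) (hZ : DiffFieldAt I Z x) :
    koszul I g U (f • Y) Z x
      = mvfderiv I f x (U x) * g x (Y x) (Z x) + f x * koszul I g U Y Z x := by
  have : CompleteSpace E := FiniteDimensional.complete ℝ E
  have h := A.pointwise x
  simp only [koszul]
  rw [A.metric_comm U (f • Y), A.metric_diff_smul_left hf hY hZ, A.metric_diff_smul_left hf hY hU,
    mlieBracket_smul_right hf hY, mlieBracket_smul_left hf hY, h.add_left, h.add_left,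
    Pi.smul_apply', h.smul_right, map_smul, A.metric_comm U Y]
  simp only [h.smul_left, neg_smul, h.neg_left, smul_eq_mul]
  ring

/-- Linearity over functions makes the value depend only on U at x, so the extensions used in
`leviCivita` may be replaced by any differentiable fields. -/
lemma tensorialAt_koszul_left (hY : DiffFieldAt I Y x) (hZ : DiffFieldAt I Z x) :
    TensorialAt I E (fun U => koszul I g U Y Z x) x where
  smul hf hU := A.koszul_smul_left hf hU hY hZ
  add hU hU' := A.koszul_add_left hU hU' hY hZ

lemma tensorialAt_koszul_right (hU : DiffFieldAt I U x) (hY : DiffFieldAt I Y x) :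
    TensorialAt I E (fun Z => koszul I g U Y Z x) x where
  smul hf hZ := A.koszul_smul_right hf hU hY hZ
  add hZ hZ' := A.koszul_add_right hU hY hZ hZ'

lemma koszul_metric (U Y Z : ∀ x : X, TangentSpace I x) :
    koszul I g U Y Z x + koszul I g U Z Y x = mvfderiv I (fun y => g y (Y y) (Z y)) x (U x) := by
  have h := A.pointwise x
  simp only [koszul]
  rw [A.metric_comm Z Y, mlieBracket_swap_apply (V := Z) (W := Y), h.neg_left]
  ring

lemma koszul_torsion (U Y Z : ∀ x : X, TangentSpace I x) :
    koszul I g U Y Z x - koszul I g Y U Z x = g x (mlieBracket I U Y x) (Z x) := by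
  have h := A.pointwise x
  simp only [koszul]
  rw [A.metric_comm Y U, mlieBracket_swap_apply (V := Y) (W := U), h.neg_left]
  ring

lemma isOrthoFrame {ι : Type*} [Fintype ι] {e : ι → TangentSpace I x}
    (he : IsOrthonormal (g x) e) (hc : Fintype.card ι = finrank ℝ E) : IsOrthoFrame (g x) e := by
  have : FiniteDimensional ℝ (TangentSpace I x) := ‹FiniteDimensional ℝ E›
  exact (A.pointwise x).isOrthoFrame_of_card he hc

lemma isOrthoFrame_orthFrame (x : X) : IsOrthoFrame (g x) (orthFrame I g x) := by
  have : FiniteDimensional ℝ (TangentSpace I x) := ‹FiniteDimensional ℝ E›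
  exact A.isOrthoFrame (Classical.epsilon_spec (A.pointwise x).exists_orthonormal) (by simp)

/-- By tensoriality in U and Z the extensions in the definition are irrelevant, and the sum over the
frame is the expansion of Z at x. All properties of the connection are derived from this. -/
lemma leviCivita_spec (hU : DiffFieldAt I U x) (hY : DiffFieldAt I Y x) (hZ : DiffFieldAt I Z x) :
    g x (leviCivita I g Y x (U x)) (Z x) = koszul I g U Y Z x := by
  have h := A.pointwise x
  have h1 : ∀ a, koszul I g (FiberBundle.extend E (U x)) Y
      (FiberBundle.extend E (orthFrame I g x a)) x
      = (A.tensorialAt_koszul_right hU hY).mkHom _ x (orthFrame I g x a) := fun a =>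
    (A.tensorialAt_koszul_left hY (diffFieldAt_extend _)).pointwise (diffFieldAt_extend _) hU
      (by simp)
  simp only [leviCivita, h1]
  rw [h.sum_left, ← TensorialAt.mkHom_apply (A.tensorialAt_koszul_right hU hY) hZ]
  refine Eq.trans ?_ ((A.isOrthoFrame_orthFrame x).map_eq_sum
    ((A.tensorialAt_koszul_right hU hY).mkHom _ x).toLinearMap (Z x)).symm
  refine Finset.sum_congr rfl fun a _ => ?_
  rw [h.smul_left, h.symm, mul_comm]; rfl

/-- Every tangent vector extends to a smooth field, so nondegeneracy only has to be tested on smooth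
fields. -/
lemma leviCivita_eq_of_forall {v : TangentSpace I x} (hU : DiffFieldAt I U x)
    (hY : DiffFieldAt I Y x)
    (H : ∀ Z, SmoothFieldAt I Z x → koszul I g U Y Z x = g x v (Z x)) :
    leviCivita I g Y x (U x) = v := by
  refine (A.pointwise x).eq_of_forall fun w => ?_
  have h1 := A.leviCivita_spec hU hY (diffFieldAt_extend w)
  have h2 := H _ (smoothFieldAt_extend w)
  rw [h2] at h1
  simpa using h1

lemma leviCivita_add_left (hY : DiffFieldAt I Y x) (u v : TangentSpace I x) :
    leviCivita I g Y x (u + v) = leviCivita I g Y x u + leviCivita I g Y x v := by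
  have hu := diffFieldAt_extend (I := I) u
  have hv := diffFieldAt_extend (I := I) v
  have := A.leviCivita_eq_of_forall (v := leviCivita I g Y x u + leviCivita I g Y x v)
    (hu.add hv) hY fun Z hZ => ?_
  · simpa using this
  · have h1 := A.leviCivita_spec hu hY hZ.diffFieldAt
    have h2 := A.leviCivita_spec hv hY hZ.diffFieldAt
    rw [FiberBundle.extend_apply_self] at h1 h2
    rw [(A.pointwise x).add_left, h1, h2]
    exact A.koszul_add_left hu hv hY hZ.diffFieldAt

lemma leviCivita_smul_left (hY : DiffFieldAt I Y x) (r : ℝ) (u : TangentSpace I x) :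
    leviCivita I g Y x (r • u) = r • leviCivita I g Y x u := by
  have hu := diffFieldAt_extend (I := I) u
  have hr : MDifferentiableAt I 𝓘(ℝ, ℝ) (fun _ : X => r) x := mdifferentiableAt_const
  have := A.leviCivita_eq_of_forall (v := r • leviCivita I g Y x u)
    (hu.smul hr) hY fun Z hZ => ?_
  · simpa using this
  · have h1 := A.leviCivita_spec hu hY hZ.diffFieldAt
    rw [FiberBundle.extend_apply_self] at h1
    rw [(A.pointwise x).smul_left, h1]
    exact A.koszul_smul_left hr hu hY hZ.diffFieldAt

lemma leviCivita_add (hY : DiffFieldAt I Y x) (hY' : DiffFieldAt I Y' x) (u : TangentSpace I x) :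
    leviCivita I g (fun y => Y y + Y' y) x u = leviCivita I g Y x u + leviCivita I g Y' x u := by
  have hu := diffFieldAt_extend (I := I) u
  have := A.leviCivita_eq_of_forall (v := leviCivita I g Y x u + leviCivita I g Y' x u)
    hu (hY.add hY') fun Z hZ => ?_
  · simpa using this
  · have h1 := A.leviCivita_spec hu hY hZ.diffFieldAt
    have h2 := A.leviCivita_spec hu hY' hZ.diffFieldAt
    rw [FiberBundle.extend_apply_self] at h1 h2
    rw [(A.pointwise x).add_left, h1, h2]
    exact A.koszul_add_mid hu hY hY' hZ.diffFieldAt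

lemma leviCivita_smul (hf : MDifferentiableAt I 𝓘(ℝ, ℝ) f x) (hY : DiffFieldAt I Y x)
    (u : TangentSpace I x) :
    leviCivita I g (fun y => f y • Y y) x u
      = mvfderiv I f x u • Y x + f x • leviCivita I g Y x u := by
  have hu := diffFieldAt_extend (I := I) u
  have := A.leviCivita_eq_of_forall (v := mvfderiv I f x u • Y x + f x • leviCivita I g Y x u)
    hu (hY.smul hf) fun Z hZ => ?_
  · simpa using this
  · have h1 := A.leviCivita_spec hu hY hZ.diffFieldAt
    have h2 := A.koszul_smul_mid hf hu hY hZ.diffFieldAt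
    rw [FiberBundle.extend_apply_self] at h1 h2
    rw [(A.pointwise x).add_left, (A.pointwise x).smul_left, (A.pointwise x).smul_left, h1]
    exact h2

lemma leviCivita_sum {ι : Type*} (s : Finset ι) {Y : ι → ∀ x : X, TangentSpace I x}
    (hY : ∀ i, DiffFieldAt I (Y i) x) (u : TangentSpace I x) :
    leviCivita I g (fun y => ∑ i ∈ s, Y i y) x u = ∑ i ∈ s, leviCivita I g (Y i) x u := by
  classical
  induction s using Finset.induction_on with
  | empty =>
    -- The zero field is treated as the function 0 times a differentiable field, so that the Leibniz
    -- rule applies to it.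
    have h0 : DiffFieldAt I (fun y => FiberBundle.extend E (0 : TangentSpace I x) y) x :=
      diffFieldAt_extend _
    have := A.leviCivita_smul (f := fun _ => 0) mdifferentiableAt_const h0 u
    simp only [zero_smul, add_zero, Finset.sum_empty] at this ⊢
    rw [this]
    have h1 : mvfderiv I (fun _ : X => (0 : ℝ)) x u = 0 := by
      rw [mvfderiv_apply, mfderiv_const]; rfl
    rw [h1, zero_smul]
  | insert a s ha ih =>
    simp only [Finset.sum_insert ha]
    rw [A.leviCivita_add (hY a) (DiffFieldAt.sum fun i _ => hY i), ih]

lemma leviCivita_congr (h : ∀ᶠ y in 𝓝 x, Y y = Y' y) :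
    leviCivita I g Y x = leviCivita I g Y' x := by
  have : CompleteSpace E := FiniteDimensional.complete ℝ E
  funext u
  simp only [leviCivita, koszul]
  refine Finset.sum_congr rfl fun a _ => ?_
  have e1 : ∀ Z : ∀ x : X, TangentSpace I x,
      (fun y => g y (Y y) (Z y)) =ᶠ[𝓝 x] fun y => g y (Y' y) (Z y) := fun Z => by
    filter_upwards [h] with y hy; rw [hy]
  have e2 : ∀ Z : ∀ x : X, TangentSpace I x,
      (fun y => g y (Z y) (Y y)) =ᶠ[𝓝 x] fun y => g y (Z y) (Y' y) := fun Z => by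
    filter_upwards [h] with y hy; rw [hy]
  have e3 : ∀ Z : ∀ x : X, TangentSpace I x, mlieBracket I Z Y x = mlieBracket I Z Y' x :=
    fun Z => Filter.EventuallyEq.mlieBracket_vectorField_eq (Filter.EventuallyEq.refl _ _) h
  have e4 : ∀ Z : ∀ x : X, TangentSpace I x, mlieBracket I Y Z x = mlieBracket I Y' Z x :=
    fun Z => Filter.EventuallyEq.mlieBracket_vectorField_eq h (Filter.EventuallyEq.refl _ _)
  rw [mvfderiv_congr (e1 _), mvfderiv_congr (e2 _), h.self_of_nhds, e3, e4]

lemma leviCivita_metric (hY : DiffFieldAt I Y x) (hZ : DiffFieldAt I Z x) (u : TangentSpace I x) :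
    mvfderiv I (fun y => g y (Y y) (Z y)) x u
      = g x (leviCivita I g Y x u) (Z x) + g x (Y x) (leviCivita I g Z x u) := by
  have hu := diffFieldAt_extend (I := I) u
  have h1 := A.leviCivita_spec hu hY hZ
  have h2 := A.leviCivita_spec hu hZ hY
  have h3 := A.koszul_metric (x := x) (FiberBundle.extend E u) Y Z
  rw [FiberBundle.extend_apply_self] at h1 h2 h3
  rw [(A.pointwise x).symm (Y x), h1, h2, h3]

lemma leviCivita_torsion (hU : DiffFieldAt I U x) (hY : DiffFieldAt I Y x) :
    leviCivita I g Y x (U x) - leviCivita I g U x (Y x) = mlieBracket I U Y x := by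
  refine (A.pointwise x).eq_of_forall fun w => ?_
  have hw := diffFieldAt_extend (I := I) w
  have h1 := A.leviCivita_spec hU hY hw
  have h2 := A.leviCivita_spec hY hU hw
  have h3 := A.koszul_torsion (x := x) U Y (FiberBundle.extend E w)
  rw [FiberBundle.extend_apply_self] at h1 h2 h3
  rw [(A.pointwise x).sub_left, h1, h2, h3]

/-! ### The projected connection -/

lemma holoConn_add_left (hY : DiffFieldAt I Y x) (u v : TangentSpace I x) :
    holoConn I g J Y x (u + v) = holoConn I g J Y x u + holoConn I g J Y x v := by
  simp only [holoConn]
  rw [A.leviCivita_add_left hY, A.leviCivita_add_left (A.cplx_diff hY), (A.pointwise x).J_add]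
  module

lemma holoConn_smul_left (hY : DiffFieldAt I Y x) (r : ℝ) (u : TangentSpace I x) :
    holoConn I g J Y x (r • u) = r • holoConn I g J Y x u := by
  simp only [holoConn]
  rw [A.leviCivita_smul_left hY, A.leviCivita_smul_left (A.cplx_diff hY), (A.pointwise x).J_smul]
  module

lemma holoConn_add (hY : DiffFieldAt I Y x) (hY' : DiffFieldAt I Y' x) (u : TangentSpace I x) :
    holoConn I g J (fun y => Y y + Y' y) x u = holoConn I g J Y x u + holoConn I g J Y' x u := by
  simp only [holoConn]
  have h1 : (fun y => J y (Y y + Y' y)) = fun y => J y (Y y) + J y (Y' y) :=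
    funext fun y => (A.pointwise y).J_add _ _
  rw [A.leviCivita_add hY hY', h1, A.leviCivita_add (A.cplx_diff hY) (A.cplx_diff hY'),
    (A.pointwise x).J_add]
  module

/-- Both ∇ and -J∇J contribute one half of the derivative of f times Y, the second because J² = -1.
-/
lemma holoConn_smul (hf : MDifferentiableAt I 𝓘(ℝ, ℝ) f x) (hY : DiffFieldAt I Y x)
    (u : TangentSpace I x) :
    holoConn I g J (fun y => f y • Y y) x u
      = mvfderiv I f x u • Y x + f x • holoConn I g J Y x u := by
  simp only [holoConn]
  have h1 : (fun y => J y (f y • Y y)) = fun y => f y • J y (Y y) :=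
    funext fun y => (A.pointwise y).J_smul _ _
  rw [A.leviCivita_smul hf hY, h1, A.leviCivita_smul hf (A.cplx_diff hY),
    (A.pointwise x).J_add, (A.pointwise x).J_smul, (A.pointwise x).J_smul, (A.pointwise x).J_sq]
  module

lemma holoConn_congr (h : ∀ᶠ y in 𝓝 x, Y y = Y' y) :
    holoConn I g J Y x = holoConn I g J Y' x := by
  funext u
  simp only [holoConn]
  rw [A.leviCivita_congr h, A.leviCivita_congr (Y := fun y => J y (Y y))
    (Y' := fun y => J y (Y' y)) (by filter_upwards [h] with y hy; rw [hy])]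

/-- The projected connection is the average of ∇ and of its conjugate J⁻¹∇J, and conjugation by J
exchanges the two. -/
lemma holoConn_cplx (hY : DiffFieldAt I Y x) (u : TangentSpace I x) :
    holoConn I g J (fun y => J y (Y y)) x u = J x (holoConn I g J Y x u) := by
  simp only [holoConn]
  have h := A.pointwise x
  have h1 : (fun y => J y (J y (Y y))) = fun y => (-1 : ℝ) • Y y :=
    funext fun y => by rw [(A.pointwise y).J_sq, neg_one_smul]
  have h2 : mvfderiv I (fun _ : X => (-1 : ℝ)) x u = 0 := by
    rw [mvfderiv_apply, mfderiv_const]; rfl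
  rw [h1, A.leviCivita_smul mdifferentiableAt_const hY, h2, zero_smul, zero_add, h.J_smul, h.J_smul,
    h.J_sub, h.J_sq]
  module

/-- It averages two metric connections, J being an isometry. -/
lemma holoConn_metric (hY : DiffFieldAt I Y x) (hZ : DiffFieldAt I Z x) (u : TangentSpace I x) :
    mvfderiv I (fun y => g y (Y y) (Z y)) x u
      = g x (holoConn I g J Y x u) (Z x) + g x (Y x) (holoConn I g J Z x u) := by
  have h := A.pointwise x
  have h1 := A.leviCivita_metric hY hZ u
  have h2 := A.leviCivita_metric (A.cplx_diff hY) (A.cplx_diff hZ) u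
  have h3 : (fun y => g y (J y (Y y)) (J y (Z y))) = fun y => g y (Y y) (Z y) :=
    funext fun y => (A.pointwise y).J_isom _ _
  rw [h3] at h2
  have h4 : g x (Y x) (J x (leviCivita I g (fun y => J y (Z y)) x u))
      = -g x (J x (Y x)) (leviCivita I g (fun y => J y (Z y)) x u) := by
    rw [h.J_left, neg_neg]
  simp only [holoConn]
  rw [h.smul_left, h.smul_right, h.sub_left, h.sub_right, h.J_left, h4]
  linarith

end IsAlmostHermitian

end LeviCivita

/-! ### Truncation of forms by degree -/

section Truncation

variable {T W : Type*} [AddCommGroup T] [Module ℝ T] [AddCommGroup W] [Module ℂ W] {J : T → T}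

/-- The components of degree less than `n`. -/
def truncForm (n : ℕ) (η : Cochain T W) : Cochain T W := fun q v => if q < n then η q v else 0

lemma contract_truncForm (n : ℕ) (w : T) (η : Cochain T W) :
    contract w (truncForm (n + 1) η) = truncForm n (contract w η) := by
  funext q v
  simp only [contract_apply, truncForm, Nat.add_lt_add_iff_right]

lemma truncForm_add (n : ℕ) (η ζ : Cochain T W) :
    truncForm n (η + ζ) = truncForm n η + truncForm n ζ := by
  funext q v
  simp only [truncForm, Pi.add_apply]
  split_ifs <;> simp

lemma truncForm_smul (n : ℕ) (c : ℂ) (η : Cochain T W) :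
    truncForm n (c • η) = c • truncForm n η := by
  funext q v
  simp only [truncForm, Pi.smul_apply]
  split_ifs <;> simp

lemma truncForm_zero (n : ℕ) : truncForm n (0 : Cochain T W) = 0 := by
  funext q v
  simp [truncForm]

lemma IsAntiholomorphicForm.truncForm {η : Cochain T W} (hη : IsAntiholomorphicForm J η) (n : ℕ) :
    IsAntiholomorphicForm J (truncForm n η) := by
  intro q
  by_cases hq : q < n
  · have h1 : ∀ v, BochnerFormula.truncForm n η q v = η q v := fun v => if_pos hq
    simp only [h1]
    exact hη q
  · have h1 : ∀ v, BochnerFormula.truncForm n η q v = 0 := fun v => if_neg hq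
    simp only [h1]
    exact IsAntiholomorphicForm.zero (J := J) q

/-- The condition in degree q only involves the component of degree q. A statement about all degrees
at once thus becomes an induction on the order of truncation. -/
lemma isAntiholomorphicForm_of_truncForm {η : Cochain T W}
    (h : ∀ n, IsAntiholomorphicForm J (truncForm n η)) : IsAntiholomorphicForm J η := by
  intro q
  have h1 : ∀ v, truncForm (q + 1) η q v = η q v := fun v => if_pos (Nat.lt_succ_self q)
  have := h (q + 1) q
  simpa only [h1] using this

end Truncation

/-! ### The induced connection on forms of type (0,•) and its Leibniz rules -/

section Connection

variable {E : Type*} [NormedAddCommGroup E] [NormedSpace ℝ E]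
  {H : Type*} [TopologicalSpace H] (I : ModelWithCorners ℝ E H)
  {X : Type*} [TopologicalSpace X] [ChartedSpace H X] [IsManifold I ∞ X]
  {W : X → Type*} [∀ x, AddCommGroup (W x)] [∀ x, Module ℂ (W x)]

/-- A connection on the sections of a family of complex vector spaces, for a class `D` of
sections that are differentiable at a point. -/
structure IsSectionConnection (nablaW : (∀ x, W x) → ∀ x, TangentSpace I x → W x)
    (D : (∀ x, W x) → X → Prop) : Prop where
  diff_congr : ∀ {t t' x}, D t x → (∀ᶠ y in 𝓝 x, t y = t' y) → D t' x
  diff_add : ∀ {t t' x}, D t x → D t' x → D (fun y => t y + t' y) x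
  diff_smul : ∀ {f : X → ℂ} {t x}, MDifferentiableAt I 𝓘(ℝ, ℂ) f x → D t x →
    D (fun y => f y • t y) x
  congr : ∀ {t t' x}, D t x → (∀ᶠ y in 𝓝 x, t y = t' y) → nablaW t x = nablaW t' x
  add : ∀ {t t' x}, D t x → D t' x → ∀ u,
    nablaW (fun y => t y + t' y) x u = nablaW t x u + nablaW t' x u
  smul : ∀ {f : X → ℂ} {t x}, MDifferentiableAt I 𝓘(ℝ, ℂ) f x → D t x → ∀ u,
    nablaW (fun y => f y • t y) x u = mvfderiv I f x u • t x + f x • nablaW t x u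
  add_left : ∀ {t x}, D t x → ∀ u v, nablaW t x (u + v) = nablaW t x u + nablaW t x v
  smul_left : ∀ {t x}, D t x → ∀ (r : ℝ) u, nablaW t x (r • u) = (r : ℂ) • nablaW t x u

/-- Forms of type `(0,•)` near `x` whose values on differentiable fields are differentiable. -/
structure IsDiffForm (J : ∀ x : X, TangentSpace I x → TangentSpace I x)
    (D : (∀ x, W x) → X → Prop) (s : ∀ x, Cochain (TangentSpace I x) (W x)) (x : X) : Prop where
  antihol : ∀ᶠ y in 𝓝 x, IsAntiholomorphicForm (J y) (s y)
  diff : ∀ (q : ℕ) (V : Fin q → ∀ y : X, TangentSpace I y), (∀ i, DiffFieldAt I (V i) x) →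
    D (fun y => s y q (fun i => V i y)) x

variable {I} {nablaW : (∀ x, W x) → ∀ x, TangentSpace I x → W x} {D : (∀ x, W x) → X → Prop}

lemma mdifferentiableAt_ofReal {f : X → ℝ} {x : X} (hf : MDifferentiableAt I 𝓘(ℝ, ℝ) f x) :
    MDifferentiableAt I 𝓘(ℝ, ℂ) (fun y => (f y : ℂ)) x :=
  mdifferentiableAt_clm_comp Complex.ofRealCLM hf

lemma mvfderiv_ofReal {f : X → ℝ} {x : X} (hf : MDifferentiableAt I 𝓘(ℝ, ℝ) f x)
    (u : TangentSpace I x) :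
    mvfderiv I (fun y => (f y : ℂ)) x u = ((mvfderiv I f x u : ℝ) : ℂ) :=
  mvfderiv_clm_comp Complex.ofRealCLM hf u

lemma mvfderiv_const_apply {F : Type*} [NormedAddCommGroup F] [NormedSpace ℝ F] (c : F) (x : X)
    (u : TangentSpace I x) : mvfderiv I (fun _ : X => c) x u = 0 := by
  rw [mvfderiv_apply, mfderiv_const]; rfl

namespace IsSectionConnection

variable (hD : IsSectionConnection I nablaW D) {t t' : ∀ x, W x} {x : X}
include hD

lemma diff_const_smul (ht : D t x) (c : ℂ) : D (fun y => c • t y) x :=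
  hD.diff_smul mdifferentiableAt_const ht

lemma const_smul (ht : D t x) (c : ℂ) (u : TangentSpace I x) :
    nablaW (fun y => c • t y) x u = c • nablaW t x u := by
  rw [hD.smul mdifferentiableAt_const ht, mvfderiv_const_apply, zero_smul, zero_add]

lemma diff_zero (ht : D t x) : D (fun _ => 0) x := by
  simpa using hD.diff_const_smul ht 0

lemma zero (ht : D t x) (u : TangentSpace I x) : nablaW (fun _ => 0) x u = 0 := by
  simpa using hD.const_smul ht 0 u

lemma diff_sum {ι : Type*} {σ : Finset ι} {t : ι → ∀ x, W x} {t₀ : ∀ x, W x} (h₀ : D t₀ x)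
    (ht : ∀ i ∈ σ, D (t i) x) : D (fun y => ∑ i ∈ σ, t i y) x := by
  classical
  induction σ using Finset.induction_on with
  | empty => simpa using hD.diff_zero h₀
  | insert a σ ha ih =>
    simp only [Finset.sum_insert ha]
    exact hD.diff_add (ht a (Finset.mem_insert_self _ _))
      (ih fun i hi => ht i (Finset.mem_insert_of_mem hi))

end IsSectionConnection

variable [FiniteDimensional ℝ E] {g : ∀ x : X, TangentSpace I x → TangentSpace I x → ℝ}
  {J : ∀ x : X, TangentSpace I x → TangentSpace I x}

lemma IsAlmostHermitian.mdifferentiableAt_dualForm (A : IsAlmostHermitian I g J)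
    {Z Y : ∀ x : X, TangentSpace I x} {x : X} (hZ : DiffFieldAt I Z x) (hY : DiffFieldAt I Y x) :
    MDifferentiableAt I 𝓘(ℝ, ℂ) (fun y => dualForm (g y) (J y) (Z y) (Y y)) x := by
  have h1 := mdifferentiableAt_ofReal (A.metric_diff hZ hY)
  have h2 := mdifferentiableAt_ofReal (A.metric_diff (A.cplx_diff hZ) hY)
  have h3 := mdifferentiableAt_clm_comp ((1 / 2 : ℂ) • ContinuousLinearMap.id ℝ ℂ)
    (h1.sub (mdifferentiableAt_clm_comp (Complex.I • ContinuousLinearMap.id ℝ ℂ) h2))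
  refine h3.congr_of_eventuallyEq (Filter.Eventually.of_forall fun y => ?_)
  simp [dualForm]
  ring

/-- The dual form is built from g and J, both parallel for the projected connection. -/
lemma IsAlmostHermitian.mvfderiv_dualForm (A : IsAlmostHermitian I g J)
    {Z Y : ∀ x : X, TangentSpace I x} {x : X} (hZ : DiffFieldAt I Z x) (hY : DiffFieldAt I Y x)
    (u : TangentSpace I x) :
    mvfderiv I (fun y => dualForm (g y) (J y) (Z y) (Y y)) x u
      = dualForm (g x) (J x) (holoConn I g J Z x u) (Y x)
        + dualForm (g x) (J x) (Z x) (holoConn I g J Y x u) := by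
  have h1 := mdifferentiableAt_ofReal (A.metric_diff hZ hY)
  have h2 := mdifferentiableAt_ofReal (A.metric_diff (A.cplx_diff hZ) hY)
  have h2' := mdifferentiableAt_clm_comp (Complex.I • ContinuousLinearMap.id ℝ ℂ) h2
  have h3 : (fun y => dualForm (g y) (J y) (Z y) (Y y)) = fun y =>
      ((1 / 2 : ℂ) • ContinuousLinearMap.id ℝ ℂ) ((g y (Z y) (Y y) : ℂ)
        + (-(Complex.I • ContinuousLinearMap.id ℝ ℂ)) (g y (J y (Z y)) (Y y) : ℂ)) := by
    funext y
    simp [dualForm]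
    ring
  have h4 := mdifferentiableAt_clm_comp (-(Complex.I • ContinuousLinearMap.id ℝ ℂ)) h2
  rw [h3, mvfderiv_clm_comp (f := fun y => (g y (Z y) (Y y) : ℂ)
      + (-(Complex.I • ContinuousLinearMap.id ℝ ℂ)) (g y (J y (Z y)) (Y y) : ℂ)) _ (h1.add h4),
    mvfderiv_add_apply h1 h4, mvfderiv_clm_comp _ h2,
    mvfderiv_ofReal (A.metric_diff hZ hY), mvfderiv_ofReal (A.metric_diff (A.cplx_diff hZ) hY),
    A.holoConn_metric hZ hY, A.holoConn_metric (A.cplx_diff hZ) hY, A.holoConn_cplx hZ]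
  simp [dualForm]
  ring

namespace IsDiffForm

variable {s s' : ∀ x, Cochain (TangentSpace I x) (W x)} {x : X}
  {Y Z : ∀ x : X, TangentSpace I x} {f : X → ℂ}

lemma antihol_self (hs : IsDiffForm I J D s x) : IsAntiholomorphicForm (J x) (s x) :=
  hs.antihol.self_of_nhds

lemma contract (hs : IsDiffForm I J D s x) (hY : DiffFieldAt I Y x) :
    IsDiffForm I J D (fun y => contract (Y y) (s y)) x where
  antihol := hs.antihol.mono fun y hy => hy.contract _
  diff q V hV := by
    have := hs.diff (q + 1) (Fin.cons Y V) (fun i => Fin.cases hY hV i)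
    convert this using 4 with y
    rw [contract_apply]
    congr 1
    funext i
    refine Fin.cases rfl (fun i => rfl) i

lemma add (hD : IsSectionConnection I nablaW D) (hs : IsDiffForm I J D s x)
    (hs' : IsDiffForm I J D s' x) : IsDiffForm I J D (fun y => s y + s' y) x where
  antihol := (hs.antihol.and hs'.antihol).mono fun y hy => hy.1.add hy.2
  diff q V hV := hD.diff_add (hs.diff q V hV) (hs'.diff q V hV)

lemma smul (hD : IsSectionConnection I nablaW D) (hf : MDifferentiableAt I 𝓘(ℝ, ℂ) f x)
    (hs : IsDiffForm I J D s x) : IsDiffForm I J D (fun y => f y • s y) x where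
  antihol := hs.antihol.mono fun y hy => hy.smul _
  diff q V hV := hD.diff_smul hf (hs.diff q V hV)

lemma sub (hD : IsSectionConnection I nablaW D) (hs : IsDiffForm I J D s x)
    (hs' : IsDiffForm I J D s' x) : IsDiffForm I J D (fun y => s y - s' y) x := by
  have := hs.add hD (hs'.smul hD (f := fun _ => -1) mdifferentiableAt_const)
  simpa [sub_eq_add_neg] using this

lemma sum (hD : IsSectionConnection I nablaW D) {ι : Type*} {σ : Finset ι}
    {s : ι → ∀ x, Cochain (TangentSpace I x) (W x)} {s₀ : ∀ x, Cochain (TangentSpace I x) (W x)}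
    (h₀ : IsDiffForm I J D s₀ x) (hs : ∀ i ∈ σ, IsDiffForm I J D (s i) x) :
    IsDiffForm I J D (fun y => ∑ i ∈ σ, s i y) x := by
  classical
  induction σ using Finset.induction_on with
  | empty => simpa using h₀.smul hD (f := fun _ => 0) mdifferentiableAt_const
  | insert a σ ha ih =>
    simp only [Finset.sum_insert ha]
    exact (hs a (Finset.mem_insert_self _ _)).add hD
      (ih fun i hi => hs i (Finset.mem_insert_of_mem hi))

lemma wedgeOne (A : IsAlmostHermitian I g J) (hD : IsSectionConnection I nablaW D)
    (hs : IsDiffForm I J D s x) (hZ : DiffFieldAt I Z x) :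
    IsDiffForm I J D (fun y => wedgeOne (dualForm (g y) (J y) (Z y)) (s y)) x where
  antihol := hs.antihol.mono fun y hy => (A.pointwise y).wedgeOne_dualForm hy _
  diff q V hV := by
    cases q with
    | zero =>
      simp only [wedgeOne_zero_degree]
      exact hD.diff_zero (hs.diff 0 V hV)
    | succ q =>
      simp only [wedgeOne_succ]
      have h1 : ∀ i : Fin (q + 1), D (fun y => s y q (fun k => V (i.succAbove k) y)) x := fun i =>
        hs.diff q (fun k => V (i.succAbove k)) fun k => hV _
      exact hD.diff_sum (h1 0) fun i _ => hD.diff_smul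
        (mdifferentiableAt_clm_comp (((-1 : ℂ) ^ (i : ℕ)) • ContinuousLinearMap.id ℝ ℂ)
          (A.mdifferentiableAt_dualForm hZ (hV i))) (h1 i)

lemma cliff (A : IsAlmostHermitian I g J) (hD : IsSectionConnection I nablaW D)
    (hs : IsDiffForm I J D s x) (hZ : DiffFieldAt I Z x) :
    IsDiffForm I J D (fun y => cliff (g y) (J y) (Z y) (s y)) x :=
  ((hs.wedgeOne A hD hZ).sub hD (hs.contract hZ)).smul hD mdifferentiableAt_const

/-! ### The connection on forms -/

lemma formConn_add (hD : IsSectionConnection I nablaW D)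
    (hs : IsDiffForm I J D s x) (hs' : IsDiffForm I J D s' x) (u : TangentSpace I x) :
    formConn I g J nablaW (fun y => s y + s' y) x u
      = formConn I g J nablaW s x u + formConn I g J nablaW s' x u := by
  funext q v
  have h1 := hD.add (hs.diff q _ fun i => diffFieldAt_extend (v i))
    (hs'.diff q _ fun i => diffFieldAt_extend (v i)) u
  simp only [formConn, Pi.add_apply, Finset.sum_add_distrib] at h1 ⊢
  rw [h1]
  abel

lemma formConn_smul (hD : IsSectionConnection I nablaW D)
    (hf : MDifferentiableAt I 𝓘(ℝ, ℂ) f x) (hs : IsDiffForm I J D s x) (u : TangentSpace I x) :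
    formConn I g J nablaW (fun y => f y • s y) x u
      = mvfderiv I f x u • s x + f x • formConn I g J nablaW s x u := by
  funext q v
  have h1 := hD.smul hf (hs.diff q _ fun i => diffFieldAt_extend (v i)) u
  simp only [formConn, Pi.add_apply, Pi.smul_apply, ← Finset.smul_sum] at h1 ⊢
  rw [h1]
  simp only [FiberBundle.extend_apply_self]
  module

lemma formConn_const_smul (hD : IsSectionConnection I nablaW D) (hs : IsDiffForm I J D s x) (c : ℂ)
    (u : TangentSpace I x) :
    formConn I g J nablaW (fun y => c • s y) x u = c • formConn I g J nablaW s x u := by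
  have := formConn_smul (g := g) hD (f := fun _ => c) mdifferentiableAt_const hs u
  rwa [mvfderiv_const_apply, zero_smul, zero_add] at this

lemma formConn_sub (hD : IsSectionConnection I nablaW D)
    (hs : IsDiffForm I J D s x) (hs' : IsDiffForm I J D s' x) (u : TangentSpace I x) :
    formConn I g J nablaW (fun y => s y - s' y) x u
      = formConn I g J nablaW s x u - formConn I g J nablaW s' x u := by
  have h1 := formConn_add (g := g) hD hs
    (hs'.smul hD (f := fun _ => -1) mdifferentiableAt_const) u
  rw [formConn_const_smul hD hs'] at h1
  simpa [sub_eq_add_neg] using h1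

lemma formConn_congr (hD : IsSectionConnection I nablaW D)
    (hs : IsDiffForm I J D s x) (h : ∀ᶠ y in 𝓝 x, s y = s' y) :
    formConn I g J nablaW s x = formConn I g J nablaW s' x := by
  funext u q v
  simp only [formConn]
  rw [hD.congr (t' := fun y => s' y q (fun i => FiberBundle.extend E (v i) y))
    (hs.diff q _ fun i => diffFieldAt_extend (v i)) (by filter_upwards [h] with y hy; rw [hy]),
    h.self_of_nhds]

/-- For the extension chosen in the definition this is the definition itself. The difference
∇^W(s(Y, …)) - s(∇Y, …) is linear over functions in Y, so every differentiable field with the same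
value at x may be used instead. Later inductions on the degree rest on this freedom. -/
lemma contract_formConn (A : IsAlmostHermitian I g J) (hD : IsSectionConnection I nablaW D)
    (hs : IsDiffForm I J D s x) (hY : DiffFieldAt I Y x) (u : TangentSpace I x) :
    BochnerFormula.contract (Y x) (formConn I g J nablaW s x u)
      = formConn I g J nablaW (fun y => BochnerFormula.contract (Y y) (s y)) x u
        - BochnerFormula.contract (holoConn I g J Y x u) (s x) := by
  funext q v
  have hT : TensorialAt I E (fun Y : ∀ y : X, TangentSpace I y =>
      nablaW (fun y => s y (q + 1) (Fin.cons (Y y) fun i => FiberBundle.extend E (v i) y)) x u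
        - s x (q + 1) (Fin.cons (holoConn I g J Y x u) v)) x := by
    have hd : ∀ Y : ∀ y : X, TangentSpace I y, DiffFieldAt I Y x →
        D (fun y => s y (q + 1) (Fin.cons (Y y) fun i => FiberBundle.extend E (v i) y)) x :=
      fun Y hY => (hs.contract hY).diff q _ fun i => diffFieldAt_extend (v i)
    constructor
    · intro f Y hf hY
      have h1 : ∀ᶠ y in 𝓝 x, (f y : ℂ) •
          s y (q + 1) (Fin.cons (Y y) fun i => FiberBundle.extend E (v i) y)
          = s y (q + 1) (Fin.cons ((f • Y) y) fun i => FiberBundle.extend E (v i) y) := by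
        filter_upwards [hs.antihol] with y hy
        exact (congrFun (congrFun (hy.contract_smul (f y) (Y y)) q) _).symm
      have h2 := hD.congr (hD.diff_smul (mdifferentiableAt_ofReal hf) (hd Y hY)) h1
      have h3 := hs.antihol_self.contract_add (mvfderiv I f x u • Y x) (f x • holoConn I g J Y x u)
      rw [hs.antihol_self.contract_smul, hs.antihol_self.contract_smul] at h3
      have h4 := congrFun (congrFun h3 q) v
      have h5 : holoConn I g J (f • Y) x u = mvfderiv I f x u • Y x + f x • holoConn I g J Y x u :=
        A.holoConn_smul hf hY u
      rw [← h2, hD.smul (mdifferentiableAt_ofReal hf) (hd Y hY), mvfderiv_ofReal hf, h5]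
      simp only [contract_apply, Pi.add_apply, Pi.smul_apply,
        FiberBundle.extend_apply_self] at h4 ⊢
      rw [h4, ← Complex.coe_smul]
      module
    · intro Y Y' hY hY'
      have h1 : ∀ᶠ y in 𝓝 x,
          s y (q + 1) (Fin.cons (Y y) fun i => FiberBundle.extend E (v i) y)
            + s y (q + 1) (Fin.cons (Y' y) fun i => FiberBundle.extend E (v i) y)
          = s y (q + 1) (Fin.cons ((Y + Y') y) fun i => FiberBundle.extend E (v i) y) := by
        filter_upwards [hs.antihol] with y hy
        exact (congrFun (congrFun (hy.contract_add (Y y) (Y' y)) q) _).symm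
      have h2 := hD.congr (hD.diff_add (hd Y hY) (hd Y' hY')) h1
      have h3 := hs.antihol_self.contract_add (holoConn I g J Y x u) (holoConn I g J Y' x u)
      have h4 := congrFun (congrFun h3 q) v
      have h5 : holoConn I g J (Y + Y') x u = holoConn I g J Y x u + holoConn I g J Y' x u :=
        A.holoConn_add hY hY' u
      rw [← h2, hD.add (hd Y hY) (hd Y' hY'), h5]
      simp only [contract_apply, Pi.add_apply] at h4 ⊢
      rw [h4]
      abel
  have h1 := hT.pointwise (σ := FiberBundle.extend E (Y x)) (σ' := Y)
    (diffFieldAt_extend _) hY (by simp)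
  have h2 : (fun y => s y (q + 1) (fun i => FiberBundle.extend E
      ((Fin.cons (Y x) v : Fin (q + 1) → TangentSpace I x) i) y))
      = fun y => s y (q + 1) (Fin.cons (FiberBundle.extend E (Y x) y)
        fun i => FiberBundle.extend E (v i) y) := by
    funext y
    congr 1
    funext i
    refine Fin.cases rfl (fun i => rfl) i
  simp only [contract_apply, formConn, Pi.sub_apply, Fin.sum_univ_succ, Fin.cons_zero,
    Fin.cons_succ, Fin.update_cons_zero, Fin.cons_update, h2] at h1 ⊢
  rw [← sub_sub, h1]
  abel

/-- Since contraction commutes with the connection up to i_{∇Y}, each hypothesis of `of_contract`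
follows by differentiating the corresponding identity for s, valid near x. The remaining hypothesis
concerns the derivative of the contractions of s, one degree lower, whence an induction on
truncations. -/
lemma isAntiholomorphicForm_formConn (A : IsAlmostHermitian I g J)
    (hD : IsSectionConnection I nablaW D) (hs : IsDiffForm I J D s x) (u : TangentSpace I x) :
    IsAntiholomorphicForm (J x) (formConn I g J nablaW s x u) := by
  have hadd : ∀ (s) (_ : IsDiffForm I J D s x) (v w : TangentSpace I x),
      BochnerFormula.contract (v + w) (formConn I g J nablaW s x u)
        = BochnerFormula.contract v (formConn I g J nablaW s x u)
          + BochnerFormula.contract w (formConn I g J nablaW s x u) := by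
    intro s hs v w
    have hv := diffFieldAt_extend (I := I) v
    have hw := diffFieldAt_extend (I := I) w
    have h0 := contract_formConn A hD hs (hv.add hw) u
    have h1 := contract_formConn A hD hs hv u
    have h2 := contract_formConn A hD hs hw u
    have h3 : formConn I g J nablaW (fun y => BochnerFormula.contract
        (FiberBundle.extend E v y + FiberBundle.extend E w y) (s y)) x
      = formConn I g J nablaW (fun y => BochnerFormula.contract (FiberBundle.extend E v y) (s y)
        + BochnerFormula.contract (FiberBundle.extend E w y) (s y)) x :=
      formConn_congr hD (hs.contract (hv.add hw)) (by
        filter_upwards [hs.antihol] with y hy; exact hy.contract_add _ _)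
    rw [h3, formConn_add hD (hs.contract hv) (hs.contract hw), A.holoConn_add hv hw,
      hs.antihol_self.contract_add] at h0
    simp only [FiberBundle.extend_apply_self] at h0 h1 h2
    rw [h0, h1, h2]
    abel
  have hsmul : ∀ (s) (_ : IsDiffForm I J D s x) (r : ℝ) (v : TangentSpace I x),
      BochnerFormula.contract (r • v) (formConn I g J nablaW s x u)
        = (r : ℂ) • BochnerFormula.contract v (formConn I g J nablaW s x u) := by
    intro s hs r v
    have hv := diffFieldAt_extend (I := I) v
    have hr : MDifferentiableAt I 𝓘(ℝ, ℝ) (fun _ : X => r) x := mdifferentiableAt_const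
    have h0 := contract_formConn A hD hs (hv.smul hr) u
    have h1 := contract_formConn A hD hs hv u
    have h3 : formConn I g J nablaW (fun y => BochnerFormula.contract
        (r • FiberBundle.extend E v y) (s y)) x
      = formConn I g J nablaW (fun y => (r : ℂ) •
        BochnerFormula.contract (FiberBundle.extend E v y) (s y)) x :=
      formConn_congr hD (hs.contract (hv.smul hr)) (by
        filter_upwards [hs.antihol] with y hy; exact hy.contract_smul _ _)
    rw [h3, formConn_const_smul hD (hs.contract hv), A.holoConn_smul hr hv, mvfderiv_const_apply,
      zero_smul, zero_add, hs.antihol_self.contract_smul] at h0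
    simp only [FiberBundle.extend_apply_self] at h0 h1
    rw [h0, h1, smul_sub]
  have hself : ∀ (s) (_ : IsDiffForm I J D s x) (v : TangentSpace I x),
      BochnerFormula.contract v (BochnerFormula.contract v (formConn I g J nablaW s x u)) = 0 := by
    intro s hs v
    have hv := diffFieldAt_extend (I := I) v
    -- Differentiating i_v i_v s = 0 leaves i_{∇v} i_v s + i_v i_{∇v} s, which vanishes by
    -- anticommutation.
    have h1 := contract_formConn A hD hs hv u
    have h2 := contract_formConn A hD (hs.contract hv) hv u
    have h3 : formConn I g J nablaW (fun y => BochnerFormula.contract (FiberBundle.extend E v y)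
        (BochnerFormula.contract (FiberBundle.extend E v y) (s y))) x
        = formConn I g J nablaW (fun y => (0 : ℂ) • s y) x :=
      formConn_congr hD ((hs.contract hv).contract hv) (by
        filter_upwards [hs.antihol] with y hy; rw [hy.contract_self, zero_smul])
    rw [h3, formConn_const_smul hD hs, zero_smul, zero_sub] at h2
    simp only [FiberBundle.extend_apply_self] at h1 h2
    rw [h1, contract_sub_right, h2, sub_eq_add_neg, ← neg_add, add_comm,
      hs.antihol_self.contract_anticomm, neg_zero]
  have hcplx : ∀ (s) (_ : IsDiffForm I J D s x) (v : TangentSpace I x),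
      BochnerFormula.contract (J x v) (formConn I g J nablaW s x u)
        = -(Complex.I • BochnerFormula.contract v (formConn I g J nablaW s x u)) := by
    intro s hs v
    have hv := diffFieldAt_extend (I := I) v
    have h0 := contract_formConn A hD hs (A.cplx_diff hv) u
    have h1 := contract_formConn A hD hs hv u
    have h3 : formConn I g J nablaW (fun y => BochnerFormula.contract
        (J y (FiberBundle.extend E v y)) (s y)) x
      = formConn I g J nablaW (fun y => (-Complex.I) •
        BochnerFormula.contract (FiberBundle.extend E v y) (s y)) x :=
      formConn_congr hD (hs.contract (A.cplx_diff hv)) (by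
        filter_upwards [hs.antihol] with y hy; rw [hy.contract_cplx, neg_smul])
    -- This is the point where the projected connection is needed: it commutes with J, which ∇ in
    -- general does not.
    rw [h3, formConn_const_smul hD (hs.contract hv), A.holoConn_cplx hv,
      hs.antihol_self.contract_cplx] at h0
    simp only [FiberBundle.extend_apply_self] at h0 h1
    rw [h0, h1]
    module
  refine isAntiholomorphicForm_of_truncForm fun n => ?_
  induction n generalizing s with
  | zero =>
    have : truncForm 0 (formConn I g J nablaW s x u) = 0 := by
      funext q v; simp [truncForm]
    rw [this]
    exact IsAntiholomorphicForm.zero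
  | succ n ih =>
    refine IsAntiholomorphicForm.of_contract (fun w => ?_) (fun v w => ?_) (fun r v => ?_)
      (fun v => ?_) (fun v => ?_)
    · have hw := diffFieldAt_extend (I := I) w
      have h1 := contract_formConn A hD hs hw u
      rw [FiberBundle.extend_apply_self] at h1
      rw [contract_truncForm, h1, sub_eq_add_neg, truncForm_add]
      exact (ih (hs.contract hw)).add ((hs.antihol_self.contract _).neg.truncForm n)
    · simp only [contract_truncForm, ← truncForm_add, hadd s hs]
    · simp only [contract_truncForm, ← truncForm_smul, hsmul s hs]
    · cases n with
      | zero =>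
        funext q w
        simp [contract_apply, truncForm]
      | succ n => rw [contract_truncForm, contract_truncForm, hself s hs, truncForm_zero]
    · rw [contract_truncForm, contract_truncForm, hcplx s hs, ← neg_smul, truncForm_smul, neg_smul]

/-- Contract both sides with a field through the first vector: `contract_wedgeOne` produces scalars,
differentiated by `mvfderiv_dualForm`, and the same identity for the contraction of s. -/
lemma formConn_wedgeOne (A : IsAlmostHermitian I g J) (hD : IsSectionConnection I nablaW D)
    (hs : IsDiffForm I J D s x) (hZ : DiffFieldAt I Z x) (u : TangentSpace I x) :
    formConn I g J nablaW (fun y => BochnerFormula.wedgeOne (dualForm (g y) (J y) (Z y)) (s y)) x u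
      = BochnerFormula.wedgeOne (dualForm (g x) (J x) (Z x)) (formConn I g J nablaW s x u)
        + BochnerFormula.wedgeOne (dualForm (g x) (J x) (holoConn I g J Z x u)) (s x) := by
  funext q v
  induction q generalizing s with
  | zero =>
    simp only [formConn, wedgeOne_zero_degree, Pi.add_apply, Finset.univ_eq_empty,
      Finset.sum_empty, sub_zero, add_zero]
    exact hD.zero (hs.diff 0 (fun i => i.elim0) fun i => i.elim0) u
  | succ q ih =>
    obtain ⟨Y, hY, hYx⟩ : ∃ Y : ∀ y : X, TangentSpace I y, DiffFieldAt I Y x ∧ Y x = v 0 :=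
      ⟨_, diffFieldAt_extend (v 0), FiberBundle.extend_apply_self _ _⟩
    have hf := A.mdifferentiableAt_dualForm hZ hY
    have h1 : formConn I g J nablaW (fun y => BochnerFormula.contract (Y y)
          (BochnerFormula.wedgeOne (dualForm (g y) (J y) (Z y)) (s y))) x u
        = (dualForm (g x) (J x) (holoConn I g J Z x u) (Y x)
            + dualForm (g x) (J x) (Z x) (holoConn I g J Y x u)) • s x
          + dualForm (g x) (J x) (Z x) (Y x) • formConn I g J nablaW s x u
          - formConn I g J nablaW (fun y => BochnerFormula.wedgeOne (dualForm (g y) (J y) (Z y))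
            (BochnerFormula.contract (Y y) (s y))) x u := by
      rw [← A.mvfderiv_dualForm hZ hY, ← formConn_smul hD hf hs,
        ← formConn_sub hD (hs.smul hD hf) ((hs.contract hY).wedgeOne A hD hZ)]
      congr 1
      funext y
      rw [contract_wedgeOne]
    have h2 := contract_formConn A hD (hs.wedgeOne A hD hZ) hY u
    have h3 := contract_formConn A hD hs hY u
    have h4 := ih (hs.contract hY) (Fin.tail v)
    rw [cochain_succ (formConn I g J nablaW _ x u), ← hYx, h2, cochain_succ (_ + _), ← hYx,
      contract_add_right, contract_wedgeOne, contract_wedgeOne, h1, contract_wedgeOne, h3,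
      wedgeOne_sub_right]
    simp only [Pi.sub_apply, Pi.add_apply, Pi.smul_apply] at h4 ⊢
    rw [h4]
    module

/-- Only the projected derivative of Z appears here; the spinor term of the Clifford connection will
turn it into the Levi-Civita derivative. -/
lemma formConn_cliff (A : IsAlmostHermitian I g J) (hD : IsSectionConnection I nablaW D)
    (hs : IsDiffForm I J D s x) (hZ : DiffFieldAt I Z x) (u : TangentSpace I x) :
    formConn I g J nablaW (fun y => BochnerFormula.cliff (g y) (J y) (Z y) (s y)) x u
      = BochnerFormula.cliff (g x) (J x) (Z x) (formConn I g J nablaW s x u)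
        + BochnerFormula.cliff (g x) (J x) (holoConn I g J Z x u) (s x) := by
  have hW := hs.wedgeOne A hD hZ
  have hC := hs.contract hZ
  have h1 := contract_formConn A hD hs hZ u
  simp only [BochnerFormula.cliff]
  rw [formConn_const_smul hD (hW.sub hD hC), formConn_sub hD hW hC, formConn_wedgeOne A hD hs hZ,
    h1]
  module

end IsDiffForm

end Connection

/-! ### The Clifford connection, and the square of a deformed Dirac operator -/

section Dirac

variable {E : Type*} [NormedAddCommGroup E] [NormedSpace ℝ E] [FiniteDimensional ℝ E]
  {H : Type*} [TopologicalSpace H] {I : ModelWithCorners ℝ E H}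
  {X : Type*} [TopologicalSpace X] [ChartedSpace H X] [IsManifold I ∞ X]
  {g : ∀ x : X, TangentSpace I x → TangentSpace I x → ℝ}
  {J : ∀ x : X, TangentSpace I x → TangentSpace I x}

namespace IsAlmostHermitian

variable {x : X} {Y Z : ∀ x : X, TangentSpace I x}

/-- Both connections obey the same Leibniz rule, so the derivatives of f cancel in the difference.
-/
lemma tensorialAt_leviCivita_sub_holoConn (A : IsAlmostHermitian I g J) (x : X)
    (u : TangentSpace I x) :
    TensorialAt I E (fun Y => leviCivita I g Y x u - holoConn I g J Y x u) x where
  smul {f Y} hf hY := by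
    have h1 : leviCivita I g (f • Y) x u = _ := A.leviCivita_smul hf hY u
    have h2 : holoConn I g J (f • Y) x u = _ := A.holoConn_smul hf hY u
    rw [h1, h2]
    module
  add {Y Y'} hY hY' := by
    have h1 : leviCivita I g (Y + Y') x u = _ := A.leviCivita_add hY hY' u
    have h2 : holoConn I g J (Y + Y') x u = _ := A.holoConn_add hY hY' u
    rw [h1, h2]
    module

/-- The difference `B_u` of the Levi-Civita and the projected connection. -/
noncomputable def torsionMap (A : IsAlmostHermitian I g J) (x : X) (u : TangentSpace I x) :
    TangentSpace I x →ₗ[ℝ] TangentSpace I x :=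
  ((A.tensorialAt_leviCivita_sub_holoConn x u).mkHom _ x).toLinearMap

variable (A : IsAlmostHermitian I g J)
include A

lemma torsionMap_apply (hY : DiffFieldAt I Y x) (u : TangentSpace I x) :
    A.torsionMap x u (Y x) = leviCivita I g Y x u - holoConn I g J Y x u :=
  TensorialAt.mkHom_apply (A.tensorialAt_leviCivita_sub_holoConn x u) hY

lemma torsionMap_extend (u v : TangentSpace I x) :
    A.torsionMap x u v = leviCivita I g (FiberBundle.extend E v) x u
      - holoConn I g J (FiberBundle.extend E v) x u := rfl

lemma torsionMap_add_left (u v w : TangentSpace I x) :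
    A.torsionMap x (u + v) w = A.torsionMap x u w + A.torsionMap x v w := by
  simp only [torsionMap_extend]
  rw [A.leviCivita_add_left (diffFieldAt_extend w), A.holoConn_add_left (diffFieldAt_extend w)]
  module

lemma torsionMap_smul_left (r : ℝ) (u w : TangentSpace I x) :
    A.torsionMap x (r • u) w = r • A.torsionMap x u w := by
  simp only [torsionMap_extend]
  rw [A.leviCivita_smul_left (diffFieldAt_extend w), A.holoConn_smul_left (diffFieldAt_extend w)]
  module

/-- A difference of two metric connections. -/
lemma torsionMap_skew (u v w : TangentSpace I x) :
    g x (A.torsionMap x u v) w = -g x v (A.torsionMap x u w) := by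
  have h := A.pointwise x
  have hv := diffFieldAt_extend (I := I) v
  have hw := diffFieldAt_extend (I := I) w
  have h1 := A.leviCivita_metric hv hw u
  have h2 := A.holoConn_metric hv hw u
  simp only [FiberBundle.extend_apply_self] at h1 h2
  rw [torsionMap_extend, torsionMap_extend, h.sub_left, h.sub_right]
  linarith

/-- The projection retains the part of ∇ that commutes with J, so the remainder anticommutes with
it. -/
lemma torsionMap_cplx (u v : TangentSpace I x) :
    A.torsionMap x u (J x v) = -J x (A.torsionMap x u v) := by
  have h := A.pointwise x
  have hv := diffFieldAt_extend (I := I) v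
  have h1 := A.torsionMap_apply (A.cplx_diff hv) u
  simp only [FiberBundle.extend_apply_self] at h1
  rw [h1, A.holoConn_cplx hv, torsionMap_extend, h.J_sub]
  simp only [holoConn, h.J_smul, h.J_sub, h.J_sq]
  module

end IsAlmostHermitian

variable {W : X → Type*} [∀ x, AddCommGroup (W x)] [∀ x, Module ℂ (W x)]
  {nablaW : (∀ x, W x) → ∀ x, TangentSpace I x → W x} {D : (∀ x, W x) → X → Prop}

lemma formConn_add_left (A : IsAlmostHermitian I g J) (hD : IsSectionConnection I nablaW D)
    {s : ∀ x, Cochain (TangentSpace I x) (W x)} {x : X}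
    (hs : IsDiffForm I J D s x) (u v : TangentSpace I x) :
    formConn I g J nablaW s x (u + v)
      = formConn I g J nablaW s x u + formConn I g J nablaW s x v := by
  funext q w
  simp only [formConn, Pi.add_apply]
  rw [hD.add_left (hs.diff q _ fun i => diffFieldAt_extend (w i))]
  simp only [A.holoConn_add_left (diffFieldAt_extend (w _)), hs.antihol_self.update_add,
    Finset.sum_add_distrib]
  abel

lemma formConn_smul_left (A : IsAlmostHermitian I g J) (hD : IsSectionConnection I nablaW D)
    {s : ∀ x, Cochain (TangentSpace I x) (W x)} {x : X}
    (hs : IsDiffForm I J D s x) (r : ℝ) (u : TangentSpace I x) :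
    formConn I g J nablaW s x (r • u) = (r : ℂ) • formConn I g J nablaW s x u := by
  funext q w
  simp only [formConn, Pi.smul_apply]
  rw [hD.smul_left (hs.diff q _ fun i => diffFieldAt_extend (w i))]
  simp only [A.holoConn_smul_left (diffFieldAt_extend (w _)), hs.antihol_self.update_smul,
    ← Finset.smul_sum, smul_sub]

namespace IsDiffForm

variable {s s' : ∀ x, Cochain (TangentSpace I x) (W x)} {x : X}
  {Y Z : ∀ x : X, TangentSpace I x} {f : X → ℂ}

lemma cliffordConn_eq_orthFrame (A : IsAlmostHermitian I g J) (u : TangentSpace I x) :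
    cliffordConn I g J nablaW s x u = formConn I g J nablaW s x u
      + (1 / 4 : ℂ) • ∑ a, BochnerFormula.cliff (g x) (J x) (orthFrame I g x a)
        (BochnerFormula.cliff (g x) (J x) (A.torsionMap x u (orthFrame I g x a)) (s x)) := rfl

lemma cliffordConn_eq (A : IsAlmostHermitian I g J) (hs : IsDiffForm I J D s x) {κ : Type*}
    [Fintype κ] {e : κ → TangentSpace I x} (he : IsOrthoFrame (g x) e) (u : TangentSpace I x) :
    cliffordConn I g J nablaW s x u = formConn I g J nablaW s x u
      + (1 / 4 : ℂ) • ∑ a, BochnerFormula.cliff (g x) (J x) (e a)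
        (BochnerFormula.cliff (g x) (J x) (A.torsionMap x u (e a)) (s x)) := by
  rw [cliffordConn_eq_orthFrame A]
  congr 2
  exact (A.pointwise x).sum_frame_eq (A.isOrthoFrame_orthFrame x) he
    ((A.pointwise x).isBilinearMap_cliff_cliff (C := fun u => u) (D := A.torsionMap x u)
      (fun _ _ => rfl) (fun _ _ => rfl) (map_add _) (map_smul _) hs.antihol_self)

lemma cliffordConn_add (hD : IsSectionConnection I nablaW D)
    (hs : IsDiffForm I J D s x) (hs' : IsDiffForm I J D s' x) (u : TangentSpace I x) :
    cliffordConn I g J nablaW (fun y => s y + s' y) x u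
      = cliffordConn I g J nablaW s x u + cliffordConn I g J nablaW s' x u := by
  simp only [cliffordConn]
  rw [formConn_add hD hs hs']
  simp only [cliff_add_right, Finset.sum_add_distrib, smul_add]
  abel

lemma cliffordConn_const_smul (hD : IsSectionConnection I nablaW D)
    (hs : IsDiffForm I J D s x) (c : ℂ) (u : TangentSpace I x) :
    cliffordConn I g J nablaW (fun y => c • s y) x u = c • cliffordConn I g J nablaW s x u := by
  simp only [cliffordConn]
  rw [formConn_const_smul hD hs]
  simp only [cliff_smul_right, ← Finset.smul_sum, smul_add]
  module

lemma cliffordConn_add_left (A : IsAlmostHermitian I g J) (hD : IsSectionConnection I nablaW D)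
    (hs : IsDiffForm I J D s x) (u v : TangentSpace I x) :
    cliffordConn I g J nablaW s x (u + v)
      = cliffordConn I g J nablaW s x u + cliffordConn I g J nablaW s x v := by
  have h := A.pointwise x
  simp only [cliffordConn_eq_orthFrame A, A.torsionMap_add_left, h.cliff_add_left hs.antihol_self,
    cliff_add_right, Finset.sum_add_distrib, formConn_add_left A hD hs]
  module

lemma cliffordConn_smul_left (A : IsAlmostHermitian I g J) (hD : IsSectionConnection I nablaW D)
    (hs : IsDiffForm I J D s x) (r : ℝ) (u : TangentSpace I x) :
    cliffordConn I g J nablaW s x (r • u) = (r : ℂ) • cliffordConn I g J nablaW s x u := by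
  have h := A.pointwise x
  simp only [cliffordConn_eq_orthFrame A, A.torsionMap_smul_left,
    h.cliff_smul_left hs.antihol_self, cliff_smul_right, ← Finset.smul_sum,
    formConn_smul_left A hD hs]
  module

lemma isAntiholomorphicForm_cliffordConn (A : IsAlmostHermitian I g J)
    (hD : IsSectionConnection I nablaW D) (hs : IsDiffForm I J D s x) (u : TangentSpace I x) :
    IsAntiholomorphicForm (J x) (cliffordConn I g J nablaW s x u) :=
  (isAntiholomorphicForm_formConn A hD hs u).add ((IsAntiholomorphicForm.sum fun a _ =>
    (A.pointwise x).isAntiholomorphicForm_cliff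
      ((A.pointwise x).isAntiholomorphicForm_cliff hs.antihol_self _) _).smul _)

/-- The Clifford connection is compatible with the Levi-Civita connection. -/
lemma cliffordConn_cliff (A : IsAlmostHermitian I g J) (hD : IsSectionConnection I nablaW D)
    (hs : IsDiffForm I J D s x) (hZ : DiffFieldAt I Z x) (u : TangentSpace I x) :
    cliffordConn I g J nablaW (fun y => BochnerFormula.cliff (g y) (J y) (Z y) (s y)) x u
      = BochnerFormula.cliff (g x) (J x) (Z x) (cliffordConn I g J nablaW s x u)
        + BochnerFormula.cliff (g x) (J x) (leviCivita I g Z x u) (s x) := by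
  have h := A.pointwise x
  have hB : leviCivita I g Z x u = holoConn I g J Z x u + A.torsionMap x u (Z x) := by
    rw [A.torsionMap_apply hZ]; abel
  rw [cliffordConn_eq_orthFrame A, cliffordConn_eq_orthFrame A, formConn_cliff A hD hs hZ,
    h.spin_commutator (A.isOrthoFrame_orthFrame x) (A.torsionMap_skew u) hs.antihol_self, hB,
    h.cliff_add_left hs.antihol_self, cliff_add_right]
  abel

/-! ### The Dirac operator -/

/-- `orthFrame` is chosen independently at each point; being a trace, the Dirac operator can be
computed in any frame, in particular in a smooth one or in one adapted to a product. -/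
lemma dirac_eq (A : IsAlmostHermitian I g J) (hD : IsSectionConnection I nablaW D)
    (hs : IsDiffForm I J D s x) {κ : Type*} [Fintype κ] {e : κ → TangentSpace I x}
    (he : IsOrthoFrame (g x) e) :
    dirac I g J nablaW s x
      = ∑ a, BochnerFormula.cliff (g x) (J x) (e a) (cliffordConn I g J nablaW s x (e a)) := by
  have h := A.pointwise x
  have hbil : IsBilinearMap ℝ (fun u v => BochnerFormula.cliff (g x) (J x) u
      (cliffordConn I g J nablaW s x v)) :=
    { add_left := fun u v w =>
        h.cliff_add_left (isAntiholomorphicForm_cliffordConn A hD hs w) u v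
      smul_left := fun r u w => by
        rw [h.cliff_smul_left (isAntiholomorphicForm_cliffordConn A hD hs w), Complex.coe_smul]
      add_right := fun u v w => by rw [cliffordConn_add_left A hD hs, cliff_add_right]
      smul_right := fun r u w => by
        rw [cliffordConn_smul_left A hD hs, cliff_smul_right, Complex.coe_smul] }
  exact h.sum_frame_eq (A.isOrthoFrame_orthFrame x) he hbil

lemma dirac_add_smul (hD : IsSectionConnection I nablaW D)
    (hs : IsDiffForm I J D s x) (hs' : IsDiffForm I J D s' x) (c : ℂ) :
    dirac I g J nablaW (fun y => s y + c • s' y) x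
      = dirac I g J nablaW s x + c • dirac I g J nablaW s' x := by
  simp only [dirac]
  simp only [cliffordConn_add hD hs (hs'.smul hD (f := fun _ => c) mdifferentiableAt_const),
    cliffordConn_const_smul hD hs', cliff_add_right, cliff_smul_right, Finset.sum_add_distrib,
    ← Finset.smul_sum]

/-- In D c(Z) s the derivative falls on Z or on s. In the second case moving c(Z) to the left of
c(e_a) costs -2 g(Z, e_a), and these coefficients reassemble the derivative along Z. -/
lemma dirac_cliff_add (A : IsAlmostHermitian I g J) (hD : IsSectionConnection I nablaW D)
    (hs : IsDiffForm I J D s x) (hZ : DiffFieldAt I Z x) {κ : Type*} [Fintype κ]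
    {e : κ → TangentSpace I x} (he : IsOrthoFrame (g x) e) :
    dirac I g J nablaW (fun y => BochnerFormula.cliff (g y) (J y) (Z y) (s y)) x
        + BochnerFormula.cliff (g x) (J x) (Z x) (dirac I g J nablaW s x)
      = ∑ a, BochnerFormula.cliff (g x) (J x) (e a)
          (BochnerFormula.cliff (g x) (J x) (leviCivita I g Z x (e a)) (s x))
        - (2 : ℂ) • cliffordConn I g J nablaW s x (Z x) := by
  have h := A.pointwise x
  have hZs : cliffordConn I g J nablaW s x (Z x)
      = ∑ a, (g x (Z x) (e a) : ℂ) • cliffordConn I g J nablaW s x (e a) := by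
    let L : TangentSpace I x →ₗ[ℝ] Cochain (TangentSpace I x) (W x) :=
      { toFun := fun u => cliffordConn I g J nablaW s x u
        map_add' := cliffordConn_add_left A hD hs
        map_smul' := fun r u => by
          rw [cliffordConn_smul_left A hD hs, Complex.coe_smul, RingHom.id_apply] }
    refine (he.map_eq_sum L (Z x)).trans (Finset.sum_congr rfl fun a _ => ?_)
    rw [Complex.coe_smul]; rfl
  rw [dirac_eq A hD (hs.cliff A hD hZ) he, dirac_eq A hD hs he, cliff_sum_right, hZs,
    Finset.smul_sum, ← Finset.sum_add_distrib, ← Finset.sum_sub_distrib]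
  refine Finset.sum_congr rfl fun a _ => ?_
  have h1 := h.cliff_cliff_add (isAntiholomorphicForm_cliffordConn A hD hs (e a)) (e a) (Z x)
  rw [cliffordConn_cliff A hD hs hZ, cliff_add_right, eq_sub_of_add_eq h1, h.symm (e a)]
  module

/-- The cross terms are the anticommutator just computed, and (√-1 T/2)² c(Z)² = (T²/4)|Z|².
Differentiability of D s is needed for D to be additive on D s + (√-1 T/2) c(Z) s. -/
lemma deformedDirac_deformedDirac (A : IsAlmostHermitian I g J)
    (hD : IsSectionConnection I nablaW D) (hs : IsDiffForm I J D s x)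
    (hDs : IsDiffForm I J D (fun y => dirac I g J nablaW s y) x)
    (hZ : DiffFieldAt I Z x) {κ : Type*} [Fintype κ]
    {e : κ → TangentSpace I x} (he : IsOrthoFrame (g x) e) (T : ℝ) :
    deformedDirac I g J nablaW Z T (deformedDirac I g J nablaW Z T s) x
      = dirac I g J nablaW (dirac I g J nablaW s) x
        + (Complex.I * (T : ℂ) / 2) • (∑ a, BochnerFormula.cliff (g x) (J x) (e a)
          (BochnerFormula.cliff (g x) (J x) (leviCivita I g Z x (e a)) (s x))
          - (2 : ℂ) • cliffordConn I g J nablaW s x (Z x))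
        + ((T : ℂ) ^ 2 / 4 * (g x (Z x) (Z x) : ℂ)) • s x := by
  have h := A.pointwise x
  rw [← dirac_cliff_add A hD hs hZ he]
  simp only [deformedDirac]
  have h1 := dirac_add_smul (g := g) hD hDs (hs.cliff A hD hZ) (Complex.I * (T : ℂ) / 2)
  refine (congrArg₂ (· + ·) h1 rfl).trans ?_
  rw [cliff_add_right, cliff_smul_right, h.cliff_cliff_self hs.antihol_self]
  have h2 : (Complex.I * (T : ℂ) / 2) * (Complex.I * (T : ℂ) / 2) = -((T : ℂ) ^ 2 / 4) := by
    linear_combination ((T : ℂ) ^ 2 / 4) * Complex.I_mul_I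
  simp only [smul_add, smul_smul]
  rw [show Complex.I * (T : ℂ) / 2 * (Complex.I * (T : ℂ) / 2 * -(g x (Z x) (Z x) : ℂ))
    = (Complex.I * (T : ℂ) / 2) * (Complex.I * (T : ℂ) / 2) * -(g x (Z x) (Z x) : ℂ) by ring, h2,
    neg_mul_neg]
  abel

end IsDiffForm

end Dirac

/-! ### Smooth orthonormal frames and differentiability of D s -/

section Smoothness

variable {E : Type*} [NormedAddCommGroup E] [NormedSpace ℝ E]
  {H : Type*} [TopologicalSpace H] {I : ModelWithCorners ℝ E H}
  {X : Type*} [TopologicalSpace X] [ChartedSpace H X] [IsManifold I ∞ X]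

namespace SmoothFieldAt

variable {U V : ∀ x : X, TangentSpace I x} {x : X}

lemma sub (hU : SmoothFieldAt I U x) (hV : SmoothFieldAt I V x) :
    SmoothFieldAt I (fun y => U y - V y) x :=
  ContMDiffAt.sub_section hU hV

lemma smul {f : X → ℝ} (hf : ContMDiffAt I 𝓘(ℝ, ℝ) ∞ f x) (hU : SmoothFieldAt I U x) :
    SmoothFieldAt I (fun y => f y • U y) x :=
  ContMDiffAt.smul_section hf hU

lemma sum {ι : Type*} {s : Finset ι} {U : ι → ∀ x : X, TangentSpace I x}
    (hU : ∀ i ∈ s, SmoothFieldAt I (U i) x) : SmoothFieldAt I (fun y => ∑ i ∈ s, U i y) x :=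
  ContMDiffAt.sum_section hU

lemma congr (hU : SmoothFieldAt I U x) (h : ∀ᶠ y in 𝓝 x, U y = V y) : SmoothFieldAt I V x := by
  refine ContMDiffAt.congr_of_eventuallyEq hU ?_
  filter_upwards [h] with y hy
  rw [hy]

lemma eventually_diffFieldAt (hU : SmoothFieldAt I U x) : ∀ᶠ y in 𝓝 x, DiffFieldAt I U y := by
  have h1 : ContMDiffAt I (I.prod 𝓘(ℝ, E)) 1 (fun y => (⟨y, U y⟩ : TangentBundle I X)) x :=
    ContMDiffAt.of_le hU (by simp)
  have : IsManifold (I.prod 𝓘(ℝ, E)) 1 (TangentBundle I X) := inferInstance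
  filter_upwards [(contMDiffAt_iff_contMDiffAt_nhds (by simp)).1 h1] with y hy
  exact hy.mdifferentiableAt (by simp)

end SmoothFieldAt

variable [FiniteDimensional ℝ E] {g : ∀ x : X, TangentSpace I x → TangentSpace I x → ℝ}
  {J : ∀ x : X, TangentSpace I x → TangentSpace I x}

namespace IsAlmostHermitian

variable {x : X} {U Y Z : ∀ x : X, TangentSpace I x}

/-- An orthonormal family at a point extends to a smooth orthonormal family near it. -/
lemma exists_smooth_orthonormal (A : IsAlmostHermitian I g J) (x : X) {k : ℕ}
    (v : Fin k → TangentSpace I x) (hv : IsOrthonormal (g x) v) :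
    ∃ e : Fin k → ∀ y : X, TangentSpace I y, (∀ i, SmoothFieldAt I (e i) x) ∧
      (∀ i, e i x = v i) ∧ ∀ᶠ y in 𝓝 x, IsOrthonormal (g y) (fun i => e i y) := by
  induction k with
  | zero =>
    exact ⟨fun i => i.elim0, fun i => i.elim0, fun i => i.elim0,
      Filter.Eventually.of_forall fun y => ⟨fun i => i.elim0, fun i => i.elim0⟩⟩
  | succ k ih =>
    obtain ⟨e, he, hex, heo⟩ := ih (fun i => v i.succ)
      ⟨fun i => hv.1 _, fun i j hij => hv.2 _ _ fun h => hij (Fin.succ_injective _ h)⟩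
    obtain ⟨V, hV, hVx⟩ : ∃ V : ∀ y : X, TangentSpace I y, SmoothFieldAt I V x ∧ V x = v 0 :=
      ⟨_, smoothFieldAt_extend (v 0), FiberBundle.extend_apply_self _ _⟩
    -- One Gram-Schmidt step: subtract from an extension of v_0 its projection on the frame already
    -- found. At x nothing is subtracted, so w keeps the value v_0.
    set w : ∀ y : X, TangentSpace I y := fun y => V y - ∑ i, g y (V y) (e i y) • e i y with hw
    have hwS : SmoothFieldAt I w x :=
      hV.sub (SmoothFieldAt.sum fun i _ => (he i).smul (A.metric_smooth hV (he i)))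
    have hwx : w x = v 0 := by
      have : ∀ i, g x (V x) (e i x) = 0 := fun i => by
        rw [hVx, hex]; exact hv.2 _ _ (Fin.succ_ne_zero i).symm
      simp only [hw]
      simp only [this, zero_smul, Finset.sum_const_zero, sub_zero]
      exact hVx
    have hN := A.metric_smooth hwS hwS
    have hNx : g x (w x) (w x) = 1 := by rw [hwx]; exact hv.1 0
    -- Since |w| = 1 at x, the normalizing factor is smooth near this value.
    have hr : ContDiffAt ℝ ∞ (fun r : ℝ => (Real.sqrt r)⁻¹) (g x (w x) (w x)) := by
      rw [hNx]
      exact (Real.contDiffAt_sqrt one_ne_zero).inv (by simp)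
    have hc : ContMDiffAt I 𝓘(ℝ, ℝ) ∞ (fun y => (Real.sqrt (g y (w y) (w y)))⁻¹) x :=
      ContMDiffAt.comp x (g := fun r : ℝ => (Real.sqrt r)⁻¹) hr.contMDiffAt hN
    have hpos : ∀ᶠ y in 𝓝 x, 0 < g y (w y) (w y) :=
      hN.continuousAt.eventually (lt_mem_nhds (hNx.symm ▸ one_pos : 0 < g x (w x) (w x)))
    have h0 : (Real.sqrt (g x (w x) (w x)))⁻¹ • w x = v 0 := by
      rw [hNx, hwx, Real.sqrt_one, inv_one, one_smul]
    refine ⟨Fin.cons (fun y => (Real.sqrt (g y (w y) (w y)))⁻¹ • w y) e,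
      fun i => Fin.cases (hwS.smul hc) he i, fun i => Fin.cases h0 hex i, ?_⟩
    · filter_upwards [heo, hpos] with y hy hp
      have h := A.pointwise y
      have horth : ∀ j, g y (w y) (e j y) = 0 := by
        intro j
        simp only [hw]
        rw [h.sub_left, h.sum_left, Finset.sum_eq_single j]
        · rw [h.smul_left, hy.1 j, mul_one, sub_self]
        · intro i _ hij
          rw [h.smul_left, hy.2 i j hij, mul_zero]
        · intro hj; exact absurd (Finset.mem_univ j) hj
      constructor
      · intro i
        induction i using Fin.cases with
        | zero =>
          simp only [Fin.cons_zero]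
          rw [h.smul_left, h.smul_right]
          have := Real.mul_self_sqrt hp.le
          have h3 : Real.sqrt (g y (w y) (w y)) ≠ 0 := (Real.sqrt_pos.2 hp).ne'
          field_simp
          nlinarith
        | succ i => exact hy.1 i
      · intro i j
        induction i using Fin.cases with
        | zero =>
          induction j using Fin.cases with
          | zero => exact fun h => absurd rfl h
          | succ j =>
            intro _
            simp only [Fin.cons_zero, Fin.cons_succ]
            rw [h.smul_left, horth, mul_zero]
        | succ i =>
          induction j using Fin.cases with
          | zero =>
            intro _
            simp only [Fin.cons_zero, Fin.cons_succ]
            rw [h.symm, h.smul_left, horth, mul_zero]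
          | succ j => exact fun hij => hy.2 i j fun h => hij (by rw [h])

lemma exists_smooth_frame (A : IsAlmostHermitian I g J) (x : X) :
    ∃ e : Fin (finrank ℝ E) → ∀ y : X, TangentSpace I y, (∀ i, SmoothFieldAt I (e i) x) ∧
      ∀ᶠ y in 𝓝 x, IsOrthoFrame (g y) (fun i => e i y) := by
  obtain ⟨e, h1, -, h3⟩ := A.exists_smooth_orthonormal x _ (A.isOrthoFrame_orthFrame x).1
  exact ⟨e, h1, h3.mono fun y hy => A.isOrthoFrame hy (by simp)⟩

variable [I.Boundaryless]

lemma contMDiffAt_koszul (A : IsAlmostHermitian I g J) (hU : SmoothFieldAt I U x)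
    (hY : SmoothFieldAt I Y x) (hZ : SmoothFieldAt I Z x) :
    ContMDiffAt I 𝓘(ℝ, ℝ) ∞ (koszul I g U Y Z) x := by
  have : CompleteSpace E := FiniteDimensional.complete ℝ E
  have hb : ∀ {U V : ∀ x : X, TangentSpace I x}, SmoothFieldAt I U x → SmoothFieldAt I V x →
      SmoothFieldAt I (mlieBracket I U V) x := fun hU hV => by
    have : IsManifold I (minSmoothness ℝ 2) X := by
      rw [minSmoothness_of_isRCLikeNormedField]; infer_instance
    have : IsManifold I ((⊤ : ℕ∞) + 1) X := ‹IsManifold I ∞ X›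
    exact ContMDiffAt.mlieBracket_vectorField (n := ⊤) (m := ⊤) hU hV
      (by rw [minSmoothness_of_isRCLikeNormedField]; exact le_rfl)
  have h1 := contMDiffAt_mvfderiv_apply (A.metric_smooth hY hZ) hU
  have h2 := contMDiffAt_mvfderiv_apply (A.metric_smooth hU hZ) hY
  have h3 := contMDiffAt_mvfderiv_apply (A.metric_smooth hU hY) hZ
  have h4 := A.metric_smooth (hb hU hY) hZ
  have h5 := A.metric_smooth (hb hU hZ) hY
  have h6 := A.metric_smooth (hb hY hZ) hU
  have h7 := ((((h1.add h2).sub h3).add h4).sub h5).sub h6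
  have h8 : ContMDiffAt I 𝓘(ℝ, ℝ) ∞ (fun _ : X => (1 / 2 : ℝ)) x := contMDiffAt_const
  refine (h7.mul h8).congr_of_eventuallyEq (Filter.Eventually.of_forall fun y => ?_)
  simp only [koszul, Pi.add_apply, Pi.sub_apply, Pi.mul_apply]
  ring

/-- In a smooth orthonormal frame the coefficients are Koszul's expressions, which are smooth
functions; the frame of the definition would not show this. -/
lemma smoothFieldAt_leviCivita (A : IsAlmostHermitian I g J) (hU : SmoothFieldAt I U x)
    (hY : SmoothFieldAt I Y x) : SmoothFieldAt I (fun y => leviCivita I g Y y (U y)) x := by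
  obtain ⟨e, he, heo⟩ := A.exists_smooth_frame x
  have h1 : SmoothFieldAt I (fun y => ∑ a, koszul I g U Y (e a) y • e a y) x :=
    SmoothFieldAt.sum fun a _ => (he a).smul (A.contMDiffAt_koszul hU hY (he a))
  refine h1.congr ?_
  filter_upwards [heo, hU.eventually_diffFieldAt, hY.eventually_diffFieldAt,
    Filter.eventually_all.2 fun a => (he a).eventually_diffFieldAt] with y h1 h2 h3 h4
  rw [h1.2 (leviCivita I g Y y (U y))]
  exact Finset.sum_congr rfl fun a _ => by rw [A.leviCivita_spec h2 h3 (h4 a)]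

lemma smoothFieldAt_holoConn (A : IsAlmostHermitian I g J) (hU : SmoothFieldAt I U x)
    (hY : SmoothFieldAt I Y x) : SmoothFieldAt I (fun y => holoConn I g J Y y (U y)) x :=
  ((A.smoothFieldAt_leviCivita hU hY).sub
    (A.cplx_smooth (A.smoothFieldAt_leviCivita hU (A.cplx_smooth hY)))).smul contMDiffAt_const

end IsAlmostHermitian

variable {W : X → Type*} [∀ x, AddCommGroup (W x)] [∀ x, Module ℂ (W x)]
  {nablaW : (∀ x, W x) → ∀ x, TangentSpace I x → W x} {D S : (∀ x, W x) → X → Prop}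
  {s s' : ∀ x, Cochain (TangentSpace I x) (W x)} {x : X}

lemma IsDiffForm.congr (hD : IsSectionConnection I nablaW D) (hs : IsDiffForm I J D s x)
    (h : ∀ᶠ y in 𝓝 x, s y = s' y) : IsDiffForm I J D s' x where
  antihol := by filter_upwards [hs.antihol, h] with y h1 h2; rwa [← h2]
  diff q V hV := hD.diff_congr (hs.diff q V hV) (by filter_upwards [h] with y hy; rw [hy])

/-- It suffices to test the differentiability of a form on a frame. -/
lemma IsDiffForm.of_frame (A : IsAlmostHermitian I g J) (hD : IsSectionConnection I nablaW D)
    {ι : Type*} [Fintype ι] {e : ι → ∀ y : X, TangentSpace I y} (he : ∀ i, SmoothFieldAt I (e i) x)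
    (heo : ∀ᶠ y in 𝓝 x, IsOrthoFrame (g y) (fun i => e i y))
    (hs : ∀ᶠ y in 𝓝 x, IsAntiholomorphicForm (J y) (s y))
    (H : ∀ (q : ℕ) (κ : Fin q → ι), D (fun y => s y q (fun i => e (κ i) y)) x) :
    IsDiffForm I J D s x := by
  refine ⟨hs, fun q => ?_⟩
  induction q generalizing s with
  | zero =>
    intro V _
    have := H 0 (fun i => i.elim0)
    convert this using 3
  | succ q ih =>
    intro V hV
    have h0 : ∀ a, D (fun y => BochnerFormula.contract (e a y) (s y) q (fun i => V i.succ y)) x := fun a => by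
      refine ih (s := fun y => BochnerFormula.contract (e a y) (s y)) (hs.mono fun y hy => hy.contract _)
        (fun q κ => ?_) (fun i => V i.succ) (fun i => hV _)
      have := H (q + 1) (Fin.cons a κ)
      convert this using 4 with y
      rw [contract_apply]
      congr 1
      funext i
      refine Fin.cases rfl (fun i => rfl) i
    -- The first field is expanded in the frame; the induction hypothesis takes care of the other
    -- slots of each contraction.
    have h1 : D (fun y => ∑ a, (g y (V 0 y) (e a y) : ℂ) •
        BochnerFormula.contract (e a y) (s y) q (fun i => V i.succ y)) x := by
      rcases isEmpty_or_nonempty ι with hι | ⟨⟨a⟩⟩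
      · simpa using hD.diff_zero (H 0 fun i => i.elim0)
      · exact hD.diff_sum (h0 a) fun a _ => hD.diff_smul (mdifferentiableAt_ofReal
          (A.metric_diff (hV 0) (he a).diffFieldAt)) (h0 a)
    refine hD.diff_congr h1 ?_
    filter_upwards [heo, hs] with y h2 h3
    have h4 : BochnerFormula.contract (V 0 y) (s y)
        = ∑ a, (g y (V 0 y) (e a y) : ℂ) • BochnerFormula.contract (e a y) (s y) := by
      conv_lhs => rw [h2.2 (V 0 y)]
      rw [h3.contract_sum]
      exact Finset.sum_congr rfl fun a _ => h3.contract_smul _ _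
    rw [cochain_succ (s y)]
    have h5 := congrFun (congrFun h4 q) (fun i => V i.succ y)
    simp only [Finset.sum_apply, Pi.smul_apply] at h5
    exact h5.symm

/-- The covariant derivatives of the sections of the class `S` along smooth fields are
differentiable. -/
structure IsSmoothClass (I : ModelWithCorners ℝ E H) [IsManifold I ∞ X]
    (nablaW : (∀ x, W x) → ∀ x, TangentSpace I x → W x)
    (D S : (∀ x, W x) → X → Prop) : Prop where
  diff : ∀ {t x}, S t x → D t x
  diff_conn : ∀ {t x} {U : ∀ y : X, TangentSpace I y}, S t x → SmoothFieldAt I U x →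
    D (fun y => nablaW t y (U y)) x

/-- Smooth forms of type `(0,•)` near `x`. -/
def IsSmoothForm (I : ModelWithCorners ℝ E H) [IsManifold I ∞ X]
    (J : ∀ x : X, TangentSpace I x → TangentSpace I x)
    (S : (∀ x, W x) → X → Prop) (s : ∀ x, Cochain (TangentSpace I x) (W x)) (x : X) : Prop :=
  ∀ᶠ y in 𝓝 x, IsAntiholomorphicForm (J y) (s y) ∧
    ∀ (q : ℕ) (V : Fin q → ∀ z : X, TangentSpace I z), (∀ i, SmoothFieldAt I (V i) y) →
      S (fun z => s z q (fun i => V i z)) y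

namespace IsSmoothForm

lemma isDiffForm (A : IsAlmostHermitian I g J) (hD : IsSectionConnection I nablaW D)
    (hS : IsSmoothClass I nablaW D S) (hs : IsSmoothForm I J S s x) : IsDiffForm I J D s x := by
  obtain ⟨e, he, heo⟩ := A.exists_smooth_frame x
  exact IsDiffForm.of_frame A hD he heo (hs.mono fun y hy => hy.1)
    fun q κ => hS.diff (hs.self_of_nhds.2 q _ fun i => he _)

lemma eventually (hs : IsSmoothForm I J S s x) : ∀ᶠ y in 𝓝 x, IsSmoothForm I J S s y :=
  eventually_eventually_nhds.2 hs

end IsSmoothForm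

/-- The definition uses one chosen extension of each vector; arbitrary fields are allowed by peeling
off the slots one at a time with `contract_formConn`. -/
lemma IsDiffForm.formConn_apply (A : IsAlmostHermitian I g J)
    (hD : IsSectionConnection I nablaW D) (hs : IsDiffForm I J D s x) (u : TangentSpace I x)
    (q : ℕ) (V : Fin q → ∀ y : X, TangentSpace I y) (hV : ∀ i, DiffFieldAt I (V i) x) :
    formConn I g J nablaW s x u q (fun i => V i x)
      = nablaW (fun y => s y q (fun i => V i y)) x u
        - ∑ i, s x q (Function.update (fun i => V i x) i (holoConn I g J (V i) x u)) := by
  induction q generalizing s with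
  | zero =>
    simp only [formConn, Finset.univ_eq_empty, Finset.sum_empty, sub_zero]
    congr 2
    funext y
    congr 1
    exact Subsingleton.elim _ _
  | succ q ih =>
    have h1 := congrFun (congrFun (contract_formConn A hD hs (hV 0) u) q) (fun i => V i.succ x)
    have h2 := ih (hs.contract (hV 0)) (fun i => V i.succ) (fun i => hV _)
    have hcons : ∀ y, (fun i => V i y) = (Fin.cons (V 0 y) fun i => V i.succ y :
        Fin (q + 1) → TangentSpace I y) := fun y => by
      funext i
      refine Fin.cases rfl (fun i => rfl) i
    simp only [hcons, Fin.sum_univ_succ, Fin.update_cons_zero]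
    simp only [contract_apply, Pi.sub_apply, Fin.cons_update] at h1 h2
    rw [h1, h2]
    abel

variable [I.Boundaryless]

/-- On the fields of a smooth frame the value is a covariant derivative of a smooth section, plus
values of s on fields that are again smooth. -/
lemma IsSmoothForm.isDiffForm_formConn (A : IsAlmostHermitian I g J)
    (hD : IsSectionConnection I nablaW D) (hS : IsSmoothClass I nablaW D S)
    (hs : IsSmoothForm I J S s x) {U : ∀ y : X, TangentSpace I y} (hU : SmoothFieldAt I U x) :
    IsDiffForm I J D (fun y => formConn I g J nablaW s y (U y)) x := by
  obtain ⟨e, he, heo⟩ := A.exists_smooth_frame x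
  have hev := hs.eventually.mono fun y hy => hy.isDiffForm A hD hS
  refine IsDiffForm.of_frame A hD he heo
    (hev.mono fun y hy => hy.isAntiholomorphicForm_formConn A hD _) fun q κ => ?_
  have h1 : ∀ᶠ y in 𝓝 x, nablaW (fun z => s z q (fun i => e (κ i) z)) y (U y)
      + (-1 : ℂ) • ∑ i, s y q (fun j => (Function.update (fun i => e (κ i)) i
        (fun z => holoConn I g J (e (κ i)) z (U z))) j y)
      = formConn I g J nablaW s y (U y) q (fun i => e (κ i) y) := by
    filter_upwards [hev, Filter.eventually_all.2 fun a => (he a).eventually_diffFieldAt]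
      with y h2 h3
    rw [h2.formConn_apply A hD (U y) q (fun i => e (κ i)) (fun i => h3 _), neg_one_smul,
      ← sub_eq_add_neg]
    congr 1
    refine Finset.sum_congr rfl fun i _ => ?_
    congr 1
    funext j
    by_cases hij : j = i
    · subst hij; simp
    · simp [hij]
  have h4 : D (fun z => s z q (fun i => e (κ i) z)) x :=
    hS.diff (hs.self_of_nhds.2 q _ fun i => he _)
  refine hD.diff_congr (hD.diff_add (hS.diff_conn (hs.self_of_nhds.2 q _ fun i => he _) hU)
    (hD.diff_const_smul (hD.diff_sum h4 fun i _ => hev.self_of_nhds.diff q _ fun j => ?_) _)) h1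
  by_cases hij : j = i
  · subst hij
    simpa using (A.smoothFieldAt_holoConn hU (he (κ j))).diffFieldAt
  · simpa [hij] using (he (κ j)).diffFieldAt

/-- Near x the operator is rewritten in a smooth frame, where each summand is built from
differentiable pieces. This makes the second application of D legitimate. -/
lemma IsSmoothForm.isDiffForm_dirac (A : IsAlmostHermitian I g J)
    (hD : IsSectionConnection I nablaW D) (hS : IsSmoothClass I nablaW D S)
    (hs : IsSmoothForm I J S s x) : IsDiffForm I J D (fun y => dirac I g J nablaW s y) x := by
  obtain ⟨e, he, heo⟩ := A.exists_smooth_frame x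
  have hev := hs.eventually.mono fun y hy => hy.isDiffForm A hD hS
  have hsx := hev.self_of_nhds
  have hc : ∀ a, IsDiffForm I J D (fun y => cliffordConn I g J nablaW s y (e a y)) x := by
    intro a
    have h1 : ∀ b, IsDiffForm I J D (fun y => cliff (g y) (J y) (e b y) (cliff (g y) (J y)
        (leviCivita I g (e b) y (e a y) - holoConn I g J (e b) y (e a y)) (s y))) x := fun b =>
      (hsx.cliff A hD ((A.smoothFieldAt_leviCivita (he a) (he b)).sub
        (A.smoothFieldAt_holoConn (he a) (he b))).diffFieldAt).cliff A hD (he b).diffFieldAt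
    have h5 : IsDiffForm I J D (fun y => formConn I g J nablaW s y (e a y)
        + (1 / 4 : ℂ) • ∑ b, cliff (g y) (J y) (e b y) (cliff (g y) (J y)
          (leviCivita I g (e b) y (e a y) - holoConn I g J (e b) y (e a y)) (s y))) x :=
      (hs.isDiffForm_formConn A hD hS (he a)).add hD
        (IsDiffForm.smul hD (f := fun _ => (1 / 4 : ℂ)) mdifferentiableAt_const
          (hsx.sum hD fun b _ => h1 b))
    refine h5.congr hD ?_
    filter_upwards [hev, heo, Filter.eventually_all.2 fun a => (he a).eventually_diffFieldAt]
      with y h2 h3 h4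
    rw [h2.cliffordConn_eq A h3]
    simp only [A.torsionMap_apply (h4 _)]
  have h5 : IsDiffForm I J D (fun y => ∑ a, cliff (g y) (J y) (e a y)
      (cliffordConn I g J nablaW s y (e a y))) x :=
    hsx.sum hD fun a _ => (hc a).cliff A hD (he a).diffFieldAt
  refine h5.congr hD ?_
  filter_upwards [hev, heo] with y h2 h3
  rw [h2.dirac_eq A hD h3]

end Smoothness

/-! ### Vector fields, differentials and brackets on a product -/

section ProductFields

variable {EM : Type*} [NormedAddCommGroup EM] [NormedSpace ℝ EM]
  {M : Type*} [TopologicalSpace M] [ChartedSpace EM M] [IsManifold 𝓘(ℝ, EM) ∞ M]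
  {EN : Type*} [NormedAddCommGroup EN] [NormedSpace ℝ EN]
  {N : Type*} [TopologicalSpace N] [ChartedSpace EN N] [IsManifold 𝓘(ℝ, EN) ∞ N]

/-- The field `(U, V)` on a product. -/
def prodField (U : ∀ x : M, TangentSpace 𝓘(ℝ, EM) x) (V : ∀ y : N, TangentSpace 𝓘(ℝ, EN) y)
    (z : M × N) : TProd EM EN z :=
  pairVec z (U z.1) (V z.2)

section Algebra

variable (z : M × N)

@[simp] lemma fstVec_pairVec (u : TangentSpace 𝓘(ℝ, EM) z.1) (v : TangentSpace 𝓘(ℝ, EN) z.2) :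
    fstVec z (pairVec z u v) = u := rfl

@[simp] lemma sndVec_pairVec (u : TangentSpace 𝓘(ℝ, EM) z.1) (v : TangentSpace 𝓘(ℝ, EN) z.2) :
    sndVec z (pairVec z u v) = v := rfl

lemma pairVec_fstVec_sndVec (w : TProd EM EN z) : pairVec z (fstVec z w) (sndVec z w) = w := rfl

lemma fstVec_add (u v : TProd EM EN z) : fstVec z (u + v) = fstVec z u + fstVec z v := rfl

lemma sndVec_add (u v : TProd EM EN z) : sndVec z (u + v) = sndVec z u + sndVec z v := rfl

lemma fstVec_smul (r : ℝ) (u : TProd EM EN z) : fstVec z (r • u) = r • fstVec z u := rfl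

lemma sndVec_smul (r : ℝ) (u : TProd EM EN z) : sndVec z (r • u) = r • sndVec z u := rfl

lemma pairVec_add (u u' : TangentSpace 𝓘(ℝ, EM) z.1) (v v' : TangentSpace 𝓘(ℝ, EN) z.2) :
    pairVec z (u + u') (v + v') = pairVec z u v + pairVec z u' v' := rfl

lemma pairVec_smul (r : ℝ) (u : TangentSpace 𝓘(ℝ, EM) z.1) (v : TangentSpace 𝓘(ℝ, EN) z.2) :
    pairVec z (r • u) (r • v) = r • pairVec z u v := rfl

lemma pairVec_eq_add (u : TangentSpace 𝓘(ℝ, EM) z.1) (v : TangentSpace 𝓘(ℝ, EN) z.2) :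
    pairVec z u v = pairVec z u 0 + pairVec z 0 v := by
  rw [← pairVec_add, add_zero, zero_add]

lemma TProd.ext {u v : TProd EM EN z} (h1 : fstVec z u = fstVec z v)
    (h2 : sndVec z u = sndVec z v) : u = v :=
  Prod.ext h1 h2

lemma mfderiv_fst_apply (w : TProd EM EN z) :
    mfderiv (𝓘(ℝ, EM).prod 𝓘(ℝ, EN)) 𝓘(ℝ, EM) (Prod.fst : M × N → M) z w = fstVec z w := by
  rw [mfderiv_fst]; rfl

lemma mfderiv_snd_apply (w : TProd EM EN z) :
    mfderiv (𝓘(ℝ, EM).prod 𝓘(ℝ, EN)) 𝓘(ℝ, EN) (Prod.snd : M × N → N) z w = sndVec z w := by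
  rw [mfderiv_snd]; rfl

end Algebra

variable {z : M × N} {W : ∀ z : M × N, TProd EM EN z}

/-- The component is the image under the tangent map of the projection. It is a field along the
projection rather than a field on M. -/
lemma contMDiffAt_fstVec (h : SmoothFieldAt (𝓘(ℝ, EM).prod 𝓘(ℝ, EN)) W z) :
    ContMDiffAt (𝓘(ℝ, EM).prod 𝓘(ℝ, EN)) 𝓘(ℝ, EM).tangent ∞
      (fun z => (⟨z.1, fstVec z (W z)⟩ : TangentBundle 𝓘(ℝ, EM) M)) z := by
  have h1 : ContMDiff (𝓘(ℝ, EM).prod 𝓘(ℝ, EN)).tangent 𝓘(ℝ, EM).tangent ∞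
      (tangentMap (𝓘(ℝ, EM).prod 𝓘(ℝ, EN)) 𝓘(ℝ, EM) (Prod.fst : M × N → M)) :=
    (contMDiff_fst (n := ∞)).contMDiff_tangentMap (by simp)
  refine (h1.contMDiffAt.comp z h).congr_of_eventuallyEq (Filter.Eventually.of_forall fun z => ?_)
  simp only [Function.comp, tangentMap, mfderiv_fst_apply]

lemma contMDiffAt_sndVec (h : SmoothFieldAt (𝓘(ℝ, EM).prod 𝓘(ℝ, EN)) W z) :
    ContMDiffAt (𝓘(ℝ, EM).prod 𝓘(ℝ, EN)) 𝓘(ℝ, EN).tangent ∞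
      (fun z => (⟨z.2, sndVec z (W z)⟩ : TangentBundle 𝓘(ℝ, EN) N)) z := by
  have h1 : ContMDiff (𝓘(ℝ, EM).prod 𝓘(ℝ, EN)).tangent 𝓘(ℝ, EN).tangent ∞
      (tangentMap (𝓘(ℝ, EM).prod 𝓘(ℝ, EN)) 𝓘(ℝ, EN) (Prod.snd : M × N → N)) :=
    (contMDiff_snd (n := ∞)).contMDiff_tangentMap (by simp)
  refine (h1.contMDiffAt.comp z h).congr_of_eventuallyEq (Filter.Eventually.of_forall fun z => ?_)
  simp only [Function.comp, tangentMap, mfderiv_snd_apply]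

lemma mdifferentiableAt_fstVec (h : DiffFieldAt (𝓘(ℝ, EM).prod 𝓘(ℝ, EN)) W z) :
    MDifferentiableAt (𝓘(ℝ, EM).prod 𝓘(ℝ, EN)) 𝓘(ℝ, EM).tangent
      (fun z => (⟨z.1, fstVec z (W z)⟩ : TangentBundle 𝓘(ℝ, EM) M)) z := by
  have h1 : ContMDiff (𝓘(ℝ, EM).prod 𝓘(ℝ, EN)).tangent 𝓘(ℝ, EM).tangent ∞
      (tangentMap (𝓘(ℝ, EM).prod 𝓘(ℝ, EN)) 𝓘(ℝ, EM) (Prod.fst : M × N → M)) :=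
    (contMDiff_fst (n := ∞)).contMDiff_tangentMap (by simp)
  refine ((h1.mdifferentiable (by simp) _).comp z h).congr_of_eventuallyEq
    (Filter.Eventually.of_forall fun z => ?_)
  simp only [Function.comp, tangentMap, mfderiv_fst_apply]

lemma mdifferentiableAt_sndVec (h : DiffFieldAt (𝓘(ℝ, EM).prod 𝓘(ℝ, EN)) W z) :
    MDifferentiableAt (𝓘(ℝ, EM).prod 𝓘(ℝ, EN)) 𝓘(ℝ, EN).tangent
      (fun z => (⟨z.2, sndVec z (W z)⟩ : TangentBundle 𝓘(ℝ, EN) N)) z := by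
  have h1 : ContMDiff (𝓘(ℝ, EM).prod 𝓘(ℝ, EN)).tangent 𝓘(ℝ, EN).tangent ∞
      (tangentMap (𝓘(ℝ, EM).prod 𝓘(ℝ, EN)) 𝓘(ℝ, EN) (Prod.snd : M × N → N)) :=
    (contMDiff_snd (n := ∞)).contMDiff_tangentMap (by simp)
  refine ((h1.mdifferentiable (by simp) _).comp z h).congr_of_eventuallyEq
    (Filter.Eventually.of_forall fun z => ?_)
  simp only [Function.comp, tangentMap, mfderiv_snd_apply]

lemma smoothFieldAt_pairVec {U : ∀ z : M × N, TangentSpace 𝓘(ℝ, EM) z.1}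
    {V : ∀ z : M × N, TangentSpace 𝓘(ℝ, EN) z.2}
    (hU : ContMDiffAt (𝓘(ℝ, EM).prod 𝓘(ℝ, EN)) 𝓘(ℝ, EM).tangent ∞
      (fun z => (⟨z.1, U z⟩ : TangentBundle 𝓘(ℝ, EM) M)) z)
    (hV : ContMDiffAt (𝓘(ℝ, EM).prod 𝓘(ℝ, EN)) 𝓘(ℝ, EN).tangent ∞
      (fun z => (⟨z.2, V z⟩ : TangentBundle 𝓘(ℝ, EN) N)) z) :
    SmoothFieldAt (𝓘(ℝ, EM).prod 𝓘(ℝ, EN)) (fun z => pairVec z (U z) (V z)) z :=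
  ContMDiffAt.comp (g := (equivTangentBundleProd 𝓘(ℝ, EM) M 𝓘(ℝ, EN) N).symm) z
    (contMDiff_equivTangentBundleProd_symm (n := ∞)).contMDiffAt (hU.prodMk hV)

lemma diffFieldAt_pairVec {U : ∀ z : M × N, TangentSpace 𝓘(ℝ, EM) z.1}
    {V : ∀ z : M × N, TangentSpace 𝓘(ℝ, EN) z.2}
    (hU : MDifferentiableAt (𝓘(ℝ, EM).prod 𝓘(ℝ, EN)) 𝓘(ℝ, EM).tangent
      (fun z => (⟨z.1, U z⟩ : TangentBundle 𝓘(ℝ, EM) M)) z)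
    (hV : MDifferentiableAt (𝓘(ℝ, EM).prod 𝓘(ℝ, EN)) 𝓘(ℝ, EN).tangent
      (fun z => (⟨z.2, V z⟩ : TangentBundle 𝓘(ℝ, EN) N)) z) :
    DiffFieldAt (𝓘(ℝ, EM).prod 𝓘(ℝ, EN)) (fun z => pairVec z (U z) (V z)) z :=
  ((contMDiff_equivTangentBundleProd_symm (n := ∞) (I := 𝓘(ℝ, EM)) (M := M) (I' := 𝓘(ℝ, EN))
    (M' := N)).mdifferentiable (by simp) (⟨z.1, U z⟩, ⟨z.2, V z⟩)).comp z (hU.prodMk hV)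

variable {U U' : ∀ x : M, TangentSpace 𝓘(ℝ, EM) x} {V V' : ∀ y : N, TangentSpace 𝓘(ℝ, EN) y}

lemma smoothFieldAt_prodField (hU : SmoothFieldAt 𝓘(ℝ, EM) U z.1)
    (hV : SmoothFieldAt 𝓘(ℝ, EN) V z.2) :
    SmoothFieldAt (𝓘(ℝ, EM).prod 𝓘(ℝ, EN)) (prodField U V) z :=
  smoothFieldAt_pairVec (ContMDiffAt.comp z (f := Prod.fst) hU contMDiffAt_fst)
    (ContMDiffAt.comp z (f := Prod.snd) hV contMDiffAt_snd)

section Calculus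

variable {F : Type*} [NormedAddCommGroup F] [NormedSpace ℝ F]

lemma mvfderiv_comp_fst {f : M → F} (hf : MDifferentiableAt 𝓘(ℝ, EM) 𝓘(ℝ, F) f z.1)
    (w : TProd EM EN z) :
    mvfderiv (𝓘(ℝ, EM).prod 𝓘(ℝ, EN)) (fun z : M × N => f z.1) z w
      = mvfderiv 𝓘(ℝ, EM) f z.1 (fstVec z w) := by
  rw [mvfderiv_comp_vec (φ := Prod.fst) z hf mdifferentiableAt_fst, mfderiv_fst_apply]

lemma mvfderiv_comp_snd {f : N → F} (hf : MDifferentiableAt 𝓘(ℝ, EN) 𝓘(ℝ, F) f z.2)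
    (w : TProd EM EN z) :
    mvfderiv (𝓘(ℝ, EM).prod 𝓘(ℝ, EN)) (fun z : M × N => f z.2) z w
      = mvfderiv 𝓘(ℝ, EN) f z.2 (sndVec z w) := by
  rw [mvfderiv_comp_vec (φ := Prod.snd) z hf mdifferentiableAt_snd, mfderiv_snd_apply]

lemma mvfderiv_slice_fst {f : M × N → F}
    (hf : MDifferentiableAt (𝓘(ℝ, EM).prod 𝓘(ℝ, EN)) 𝓘(ℝ, F) f z) (u : TangentSpace 𝓘(ℝ, EM) z.1) :
    mvfderiv 𝓘(ℝ, EM) (fun x => f (x, z.2)) z.1 u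
      = mvfderiv (𝓘(ℝ, EM).prod 𝓘(ℝ, EN)) f z (pairVec z u 0) := by
  rw [mvfderiv_comp_vec (φ := fun x => (x, z.2)) z.1 hf
    (mdifferentiableAt_id.prodMk mdifferentiableAt_const), mfderiv_prod_left]
  rfl

lemma mvfderiv_slice_snd {f : M × N → F}
    (hf : MDifferentiableAt (𝓘(ℝ, EM).prod 𝓘(ℝ, EN)) 𝓘(ℝ, F) f z) (v : TangentSpace 𝓘(ℝ, EN) z.2) :
    mvfderiv 𝓘(ℝ, EN) (fun y => f (z.1, y)) z.2 v
      = mvfderiv (𝓘(ℝ, EM).prod 𝓘(ℝ, EN)) f z (pairVec z 0 v) := by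
  rw [mvfderiv_comp_vec (φ := fun y => (z.1, y)) z.2 hf
    (mdifferentiableAt_const.prodMk mdifferentiableAt_id), mfderiv_prod_right]
  rfl

end Calculus

section Bracket

lemma two_le_infty : (2 : WithTop ℕ∞) ≤ ∞ := ENat.LEInfty.out

variable [CompleteSpace EM] [CompleteSpace EN]

/-- The differential of a chart is invertible, so a vector is detected by its action on one
vector-valued function. -/
lemma eq_of_mvfderiv_extChartAt {x : M} {u v : TangentSpace 𝓘(ℝ, EM) x}
    (h : mvfderiv 𝓘(ℝ, EM) (extChartAt 𝓘(ℝ, EM) x) x u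
      = mvfderiv 𝓘(ℝ, EM) (extChartAt 𝓘(ℝ, EM) x) x v) : u = v := by
  obtain ⟨L, hL⟩ := isInvertible_mfderiv_extChartAt (I := 𝓘(ℝ, EM)) (mem_extChartAt_source x)
  apply L.injective
  have h1 := fun w => DFunLike.congr_fun hL w
  exact (h1 u).trans (Eq.trans h (h1 v).symm)

lemma eventually_mdifferentiableAt_extChartAt (x : M) :
    ∀ᶠ y in 𝓝 x, MDifferentiableAt 𝓘(ℝ, EM) 𝓘(ℝ, EM) (extChartAt 𝓘(ℝ, EM) x) y := by
  filter_upwards [extChartAt_source_mem_nhds (I := 𝓘(ℝ, EM)) x] with y hy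
  exact mdifferentiableAt_extChartAt (by rwa [← extChartAt_source (I := 𝓘(ℝ, EM))])

/-- Each component is tested on the chart of its factor. There the bracket is a commutator of
derivations, and a product field differentiates a function of one factor through the corresponding
component only. -/
lemma mlieBracket_prodField (hU : SmoothFieldAt 𝓘(ℝ, EM) U z.1)
    (hU' : SmoothFieldAt 𝓘(ℝ, EM) U' z.1) (hV : SmoothFieldAt 𝓘(ℝ, EN) V z.2)
    (hV' : SmoothFieldAt 𝓘(ℝ, EN) V' z.2) :
    mlieBracket (𝓘(ℝ, EM).prod 𝓘(ℝ, EN)) (prodField U V) (prodField U' V') z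
      = pairVec z (mlieBracket 𝓘(ℝ, EM) U U' z.1) (mlieBracket 𝓘(ℝ, EN) V V' z.2) := by
  have hW := (smoothFieldAt_prodField hU hV).diffFieldAt
  have hW' := (smoothFieldAt_prodField hU' hV').diffFieldAt
  refine TProd.ext z (eq_of_mvfderiv_extChartAt ?_) (eq_of_mvfderiv_extChartAt ?_)
  · set φ := extChartAt 𝓘(ℝ, EM) z.1
    have hφ : ContMDiffAt 𝓘(ℝ, EM) 𝓘(ℝ, EM) ∞ φ z.1 := contMDiffAt_extChartAt
    have hf : ContMDiffAt (𝓘(ℝ, EM).prod 𝓘(ℝ, EN)) 𝓘(ℝ, EM) 2 (fun z : M × N => φ z.1) z :=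
      (hφ.of_le two_le_infty).comp z contMDiffAt_fst
    have key : ∀ {U : ∀ x : M, TangentSpace 𝓘(ℝ, EM) x} {V : ∀ y : N, TangentSpace 𝓘(ℝ, EN) y},
        SmoothFieldAt 𝓘(ℝ, EM) U z.1 → ∀ w : TProd EM EN z,
        mvfderiv (𝓘(ℝ, EM).prod 𝓘(ℝ, EN)) (fun y : M × N =>
          mvfderiv (𝓘(ℝ, EM).prod 𝓘(ℝ, EN)) (fun z : M × N => φ z.1) y (prodField U V y)) z w
          = mvfderiv 𝓘(ℝ, EM) (fun x => mvfderiv 𝓘(ℝ, EM) φ x (U x)) z.1 (fstVec z w) := by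
      intro U V hU w
      rw [← mvfderiv_comp_fst ((contMDiffAt_mvfderiv_apply hφ hU).mdifferentiableAt (by simp))]
      congr 1
      refine mvfderiv_congr ?_
      filter_upwards [(continuous_fst.tendsto z).eventually
          (eventually_mdifferentiableAt_extChartAt (EM := EM) z.1)]
        with y hy
      exact mvfderiv_comp_fst hy _
    have h1 := mvfderiv_mlieBracket hf hW hW'
    rw [key hU', key hU] at h1
    rw [fstVec_pairVec, ← mvfderiv_comp_fst (hφ.mdifferentiableAt (by simp)), h1,
      mvfderiv_mlieBracket (hφ.of_le two_le_infty) hU.diffFieldAt hU'.diffFieldAt]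
    rfl
  · set φ := extChartAt 𝓘(ℝ, EN) z.2
    have hφ : ContMDiffAt 𝓘(ℝ, EN) 𝓘(ℝ, EN) ∞ φ z.2 := contMDiffAt_extChartAt
    have hf : ContMDiffAt (𝓘(ℝ, EM).prod 𝓘(ℝ, EN)) 𝓘(ℝ, EN) 2 (fun z : M × N => φ z.2) z :=
      (hφ.of_le two_le_infty).comp z contMDiffAt_snd
    have key : ∀ {U : ∀ x : M, TangentSpace 𝓘(ℝ, EM) x} {V : ∀ y : N, TangentSpace 𝓘(ℝ, EN) y},
        SmoothFieldAt 𝓘(ℝ, EN) V z.2 → ∀ w : TProd EM EN z,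
        mvfderiv (𝓘(ℝ, EM).prod 𝓘(ℝ, EN)) (fun y : M × N =>
          mvfderiv (𝓘(ℝ, EM).prod 𝓘(ℝ, EN)) (fun z : M × N => φ z.2) y (prodField U V y)) z w
          = mvfderiv 𝓘(ℝ, EN) (fun x => mvfderiv 𝓘(ℝ, EN) φ x (V x)) z.2 (sndVec z w) := by
      intro U V hV w
      rw [← mvfderiv_comp_snd ((contMDiffAt_mvfderiv_apply hφ hV).mdifferentiableAt (by simp))]
      congr 1
      refine mvfderiv_congr ?_
      filter_upwards [(continuous_snd.tendsto z).eventually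
          (eventually_mdifferentiableAt_extChartAt (EM := EN) z.2)]
        with y hy
      exact mvfderiv_comp_snd hy _
    have h1 := mvfderiv_mlieBracket hf hW hW'
    rw [key hV', key hV] at h1
    rw [sndVec_pairVec, ← mvfderiv_comp_snd (hφ.mdifferentiableAt (by simp)), h1,
      mvfderiv_mlieBracket (hφ.of_le two_le_infty) hV.diffFieldAt hV'.diffFieldAt]
    rfl

end Bracket

end ProductFields

/-! ### The almost Hermitian structure of a prequantized manifold -/

section PrequantumGeometry

variable {EG : Type*} [NormedAddCommGroup EG] [NormedSpace ℝ EG]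
  {G : Type*} [TopologicalSpace G] [ChartedSpace EG G] [Group G]
  {E : Type*} [NormedAddCommGroup E] [NormedSpace ℝ E]
  {X : Type*} [TopologicalSpace X] [ChartedSpace E X] [MulAction G X]
  {L : X → Type*} [∀ x, NormedAddCommGroup (L x)] [∀ x, InnerProductSpace ℂ (L x)]
  [TopologicalSpace (TotalSpace ℂ L)] [FiberBundle ℂ L] [IsManifold 𝓘(ℝ, E) ∞ X]
  [VectorBundle ℂ ℂ L] [VectorBundle ℝ ℂ L] [ContMDiffVectorBundle ∞ ℂ L 𝓘(ℝ, E)]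
  {E' : Type*} [NormedAddCommGroup E'] [NormedSpace ℝ E']
  {H' : Type*} [TopologicalSpace H'] {I' : ModelWithCorners ℝ E' H'}
  {X' : Type*} [TopologicalSpace X'] [ChartedSpace H' X']

namespace PrequantumData

variable (P : PrequantumData EG G E X L)

lemma omega_neg (x : X) (u v : TangentSpace 𝓘(ℝ, E) x) : P.omega x u v = -P.omega x v u := by
  have h := P.omega_alt x (u + v)
  simp only [map_add, ContinuousLinearMap.add_apply, P.omega_alt] at h
  linarith

lemma isHermitianPair (x : X) : IsHermitianPair (P.metric x) (P.cplx x) where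
  add_left u v w := by simp [metric]
  smul_left r u w := by simp [metric]
  symm u v := P.metric_symm x u v
  pos u hu := P.metric_pos x u hu
  J_add u v := by simp [cplx]
  J_smul r u := by simp [cplx]
  J_sq u := P.J_sq x u
  J_isom u v := by
    simp only [metric, cplx]
    rw [P.J_sq, map_neg, ← P.omega_neg, P.metric_symm]

section Smooth

variable {b : X' → X} {u v : ∀ m, TangentSpace 𝓘(ℝ, E) (b m)} {m : X'}

/-- Stated for fields along a map b, to be applied with b the identity and with b a projection of
the product. -/
lemma contMDiffAt_cplx (hb : ContMDiffAt I' 𝓘(ℝ, E) ∞ b m)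
    (hu : ContMDiffAt I' 𝓘(ℝ, E).tangent ∞
      (fun m => (⟨b m, u m⟩ : TangentBundle 𝓘(ℝ, E) X)) m) :
    ContMDiffAt I' 𝓘(ℝ, E).tangent ∞
      (fun m => (⟨b m, P.cplx (b m) (u m)⟩ : TangentBundle 𝓘(ℝ, E) X)) m :=
  ContMDiffAt.clm_bundle_apply (ϕ := fun m => P.J (b m)) ((P.J_smooth (b m)).comp m hb) hu

lemma mdifferentiableAt_cplx (hb : MDifferentiableAt I' 𝓘(ℝ, E) b m)
    (hu : MDifferentiableAt I' 𝓘(ℝ, E).tangent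
      (fun m => (⟨b m, u m⟩ : TangentBundle 𝓘(ℝ, E) X)) m) :
    MDifferentiableAt I' 𝓘(ℝ, E).tangent
      (fun m => (⟨b m, P.cplx (b m) (u m)⟩ : TangentBundle 𝓘(ℝ, E) X)) m :=
  MDifferentiableAt.clm_bundle_apply (ϕ := fun m => P.J (b m))
    (((P.J_smooth (b m)).mdifferentiableAt (by simp)).comp m hb) hu

lemma contMDiffAt_metric (hb : ContMDiffAt I' 𝓘(ℝ, E) ∞ b m)
    (hu : ContMDiffAt I' 𝓘(ℝ, E).tangent ∞
      (fun m => (⟨b m, u m⟩ : TangentBundle 𝓘(ℝ, E) X)) m)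
    (hv : ContMDiffAt I' 𝓘(ℝ, E).tangent ∞
      (fun m => (⟨b m, v m⟩ : TangentBundle 𝓘(ℝ, E) X)) m) :
    ContMDiffAt I' 𝓘(ℝ, ℝ) ∞ (fun m => P.metric (b m) (u m) (v m)) m := by
  have h := ContMDiffAt.clm_bundle_apply₂ (E₃ := Bundle.Trivial X ℝ) (F₃ := ℝ)
    (ψ := fun m => P.omega (b m)) ((P.omega_smooth (b m)).comp m hb) hu
    (P.contMDiffAt_cplx hb hv)
  exact (contMDiffAt_totalSpace.1 h).2

lemma mdifferentiableAt_metric (hb : MDifferentiableAt I' 𝓘(ℝ, E) b m)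
    (hu : MDifferentiableAt I' 𝓘(ℝ, E).tangent
      (fun m => (⟨b m, u m⟩ : TangentBundle 𝓘(ℝ, E) X)) m)
    (hv : MDifferentiableAt I' 𝓘(ℝ, E).tangent
      (fun m => (⟨b m, v m⟩ : TangentBundle 𝓘(ℝ, E) X)) m) :
    MDifferentiableAt I' 𝓘(ℝ, ℝ) (fun m => P.metric (b m) (u m) (v m)) m := by
  have h := MDifferentiableAt.clm_bundle_apply₂ (E₃ := Bundle.Trivial X ℝ) (F₃ := ℝ)
    (ψ := fun m => P.omega (b m)) (((P.omega_smooth (b m)).mdifferentiableAt (by simp)).comp m hb)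
    hu (P.mdifferentiableAt_cplx hb hv)
  exact ((mdifferentiableAt_totalSpace _ _).1 h).2

end Smooth

lemma isAlmostHermitian : IsAlmostHermitian 𝓘(ℝ, E) P.metric P.cplx where
  pointwise := P.isHermitianPair
  metric_diff hU hV := P.mdifferentiableAt_metric mdifferentiableAt_id hU hV
  metric_smooth hU hV := P.contMDiffAt_metric contMDiffAt_id hU hV
  cplx_diff hU := P.mdifferentiableAt_cplx mdifferentiableAt_id hU
  cplx_smooth hU := P.contMDiffAt_cplx contMDiffAt_id hU

end PrequantumData

end PrequantumGeometry

/-! ### The almost Hermitian structure of the product -/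

section ProductGeometry

variable {EG : Type*} [NormedAddCommGroup EG] [NormedSpace ℝ EG]
  {G : Type*} [TopologicalSpace G] [ChartedSpace EG G] [Group G]
  {EM : Type*} [NormedAddCommGroup EM] [NormedSpace ℝ EM]
  {M : Type*} [TopologicalSpace M] [ChartedSpace EM M] [IsManifold 𝓘(ℝ, EM) ∞ M] [MulAction G M]
  {L : M → Type*} [∀ x, NormedAddCommGroup (L x)] [∀ x, InnerProductSpace ℂ (L x)]
  [TopologicalSpace (TotalSpace ℂ L)] [FiberBundle ℂ L] [VectorBundle ℂ ℂ L] [VectorBundle ℝ ℂ L]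
  [ContMDiffVectorBundle ∞ ℂ L 𝓘(ℝ, EM)]
  {EN : Type*} [NormedAddCommGroup EN] [NormedSpace ℝ EN]
  {N : Type*} [TopologicalSpace N] [ChartedSpace EN N] [IsManifold 𝓘(ℝ, EN) ∞ N] [MulAction G N]
  {F : N → Type*} [∀ y, NormedAddCommGroup (F y)] [∀ y, InnerProductSpace ℂ (F y)]
  [TopologicalSpace (TotalSpace ℂ F)] [FiberBundle ℂ F] [VectorBundle ℂ ℂ F] [VectorBundle ℝ ℂ F]
  [ContMDiffVectorBundle ∞ ℂ F 𝓘(ℝ, EN)]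
  (P : PrequantumData EG G EM M L) (Q : PrequantumData EG G EN N F)

lemma isHermitianPair_prod (z : M × N) : IsHermitianPair (prodMetric P Q z) (prodCplx P Q z) where
  add_left u v w := by
    simp only [prodMetric, fstVec_add, sndVec_add, (P.isHermitianPair _).add_left,
      (Q.isHermitianPair _).add_left]
    ring
  smul_left r u w := by
    simp only [prodMetric, fstVec_smul, sndVec_smul, (P.isHermitianPair _).smul_left,
      (Q.isHermitianPair _).smul_left]
    ring
  symm u v := by
    simp only [prodMetric, (P.isHermitianPair _).symm (fstVec z u),
      (Q.isHermitianPair _).symm (sndVec z u)]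
  pos u hu := by
    have hP := P.isHermitianPair z.1
    have hQ := Q.isHermitianPair z.2
    have h1 : 0 ≤ P.metric z.1 (fstVec z u) (fstVec z u) := by
      by_cases h : fstVec z u = 0
      · rw [h, hP.zero_left]
      · exact (hP.pos _ h).le
    have h2 : 0 ≤ Q.metric z.2 (sndVec z u) (sndVec z u) := by
      by_cases h : sndVec z u = 0
      · rw [h, hQ.zero_left]
      · exact (hQ.pos _ h).le
    by_cases h : fstVec z u = 0
    · have h3 : sndVec z u ≠ 0 := fun h3 => hu (TProd.ext z h h3)
      exact add_pos_of_nonneg_of_pos h1 (hQ.pos _ h3)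
    · exact add_pos_of_pos_of_nonneg (hP.pos _ h) h2
  J_add u v := by
    simp only [prodCplx, fstVec_add, sndVec_add, (P.isHermitianPair _).J_add,
      (Q.isHermitianPair _).J_add, pairVec_add]
  J_smul r u := by
    simp only [prodCplx, fstVec_smul, sndVec_smul, (P.isHermitianPair _).J_smul,
      (Q.isHermitianPair _).J_smul, pairVec_smul]
  J_sq u := by
    simp only [prodCplx, fstVec_pairVec, sndVec_pairVec, (P.isHermitianPair _).J_sq,
      (Q.isHermitianPair _).J_sq]
    rfl
  J_isom u v := by
    simp only [prodMetric, prodCplx, fstVec_pairVec, sndVec_pairVec, (P.isHermitianPair _).J_isom,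
      (Q.isHermitianPair _).J_isom]

lemma isAlmostHermitian_prod :
    IsAlmostHermitian (𝓘(ℝ, EM).prod 𝓘(ℝ, EN)) (prodMetric P Q) (prodCplx P Q) where
  pointwise := isHermitianPair_prod P Q
  metric_diff hU hV :=
    (P.mdifferentiableAt_metric mdifferentiableAt_fst (mdifferentiableAt_fstVec hU)
      (mdifferentiableAt_fstVec hV)).add (Q.mdifferentiableAt_metric mdifferentiableAt_snd
      (mdifferentiableAt_sndVec hU) (mdifferentiableAt_sndVec hV))
  metric_smooth hU hV :=
    (P.contMDiffAt_metric contMDiffAt_fst (contMDiffAt_fstVec hU)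
      (contMDiffAt_fstVec hV)).add (Q.contMDiffAt_metric contMDiffAt_snd
      (contMDiffAt_sndVec hU) (contMDiffAt_sndVec hV))
  cplx_diff hU := diffFieldAt_pairVec
    (P.mdifferentiableAt_cplx mdifferentiableAt_fst (mdifferentiableAt_fstVec hU))
    (Q.mdifferentiableAt_cplx mdifferentiableAt_snd (mdifferentiableAt_sndVec hU))
  cplx_smooth hU := smoothFieldAt_pairVec
    (P.contMDiffAt_cplx contMDiffAt_fst (contMDiffAt_fstVec hU))
    (Q.contMDiffAt_cplx contMDiffAt_snd (contMDiffAt_sndVec hU))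

variable [FiniteDimensional ℝ EM] [FiniteDimensional ℝ EN] {z : M × N}
  {U Y Z : ∀ x : M, TangentSpace 𝓘(ℝ, EM) x} {U' Y' Z' : ∀ y : N, TangentSpace 𝓘(ℝ, EN) y}

lemma mvfderiv_prodMetric (hY : DiffFieldAt 𝓘(ℝ, EM) Y z.1) (hZ : DiffFieldAt 𝓘(ℝ, EM) Z z.1)
    (hY' : DiffFieldAt 𝓘(ℝ, EN) Y' z.2) (hZ' : DiffFieldAt 𝓘(ℝ, EN) Z' z.2) (w : TProd EM EN z) :
    mvfderiv (𝓘(ℝ, EM).prod 𝓘(ℝ, EN))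
        (fun z => prodMetric P Q z (prodField Y Y' z) (prodField Z Z' z)) z w
      = mvfderiv 𝓘(ℝ, EM) (fun x => P.metric x (Y x) (Z x)) z.1 (fstVec z w)
        + mvfderiv 𝓘(ℝ, EN) (fun y => Q.metric y (Y' y) (Z' y)) z.2 (sndVec z w) := by
  have h1 := P.isAlmostHermitian.metric_diff hY hZ
  have h2 := Q.isAlmostHermitian.metric_diff hY' hZ'
  rw [← mvfderiv_comp_fst h1, ← mvfderiv_comp_snd h2]
  exact mvfderiv_add_apply (f := fun z : M × N => P.metric z.1 (Y z.1) (Z z.1))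
    (k := fun z : M × N => Q.metric z.2 (Y' z.2) (Z' z.2))
    (MDifferentiableAt.comp z (f := Prod.fst) h1 mdifferentiableAt_fst)
    (MDifferentiableAt.comp z (f := Prod.snd) h2 mdifferentiableAt_snd) w

lemma koszul_prodField (hU : SmoothFieldAt 𝓘(ℝ, EM) U z.1) (hU' : SmoothFieldAt 𝓘(ℝ, EN) U' z.2)
    (hY : SmoothFieldAt 𝓘(ℝ, EM) Y z.1) (hY' : SmoothFieldAt 𝓘(ℝ, EN) Y' z.2)
    (hZ : SmoothFieldAt 𝓘(ℝ, EM) Z z.1) (hZ' : SmoothFieldAt 𝓘(ℝ, EN) Z' z.2) :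
    koszul (𝓘(ℝ, EM).prod 𝓘(ℝ, EN)) (prodMetric P Q) (prodField U U') (prodField Y Y')
        (prodField Z Z') z
      = koszul 𝓘(ℝ, EM) P.metric U Y Z z.1 + koszul 𝓘(ℝ, EN) Q.metric U' Y' Z' z.2 := by
  have : CompleteSpace EM := FiniteDimensional.complete ℝ EM
  have : CompleteSpace EN := FiniteDimensional.complete ℝ EN
  simp only [koszul]
  rw [mvfderiv_prodMetric P Q hY.diffFieldAt hZ.diffFieldAt hY'.diffFieldAt hZ'.diffFieldAt,
    mvfderiv_prodMetric P Q hU.diffFieldAt hZ.diffFieldAt hU'.diffFieldAt hZ'.diffFieldAt,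
    mvfderiv_prodMetric P Q hU.diffFieldAt hY.diffFieldAt hU'.diffFieldAt hY'.diffFieldAt,
    mlieBracket_prodField hU hY hU' hY', mlieBracket_prodField hU hZ hU' hZ',
    mlieBracket_prodField hY hZ hY' hZ']
  simp only [prodMetric, prodField, fstVec_pairVec, sndVec_pairVec]
  ring

/-- Koszul's expression splits because the metric and the bracket of product fields do, and product
fields attain every tangent vector. -/
lemma leviCivita_prodField (hY : SmoothFieldAt 𝓘(ℝ, EM) Y z.1)
    (hY' : SmoothFieldAt 𝓘(ℝ, EN) Y' z.2) (w : TProd EM EN z) :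
    leviCivita (𝓘(ℝ, EM).prod 𝓘(ℝ, EN)) (prodMetric P Q) (prodField Y Y') z w
      = pairVec z (leviCivita 𝓘(ℝ, EM) P.metric Y z.1 (fstVec z w))
        (leviCivita 𝓘(ℝ, EN) Q.metric Y' z.2 (sndVec z w)) := by
  have hA := isAlmostHermitian_prod P Q
  refine (hA.pointwise z).eq_of_forall fun v => ?_
  obtain ⟨U, hU, hUx⟩ : ∃ U : ∀ x : M, TangentSpace 𝓘(ℝ, EM) x, SmoothFieldAt 𝓘(ℝ, EM) U z.1 ∧
    U z.1 = fstVec z w := ⟨_, smoothFieldAt_extend _, FiberBundle.extend_apply_self _ _⟩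
  obtain ⟨U', hU', hUx'⟩ : ∃ U : ∀ x : N, TangentSpace 𝓘(ℝ, EN) x, SmoothFieldAt 𝓘(ℝ, EN) U z.2 ∧
    U z.2 = sndVec z w := ⟨_, smoothFieldAt_extend _, FiberBundle.extend_apply_self _ _⟩
  obtain ⟨Z, hZ, hZx⟩ : ∃ U : ∀ x : M, TangentSpace 𝓘(ℝ, EM) x, SmoothFieldAt 𝓘(ℝ, EM) U z.1 ∧
    U z.1 = fstVec z v := ⟨_, smoothFieldAt_extend _, FiberBundle.extend_apply_self _ _⟩
  obtain ⟨Z', hZ', hZx'⟩ : ∃ U : ∀ x : N, TangentSpace 𝓘(ℝ, EN) x, SmoothFieldAt 𝓘(ℝ, EN) U z.2 ∧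
    U z.2 = sndVec z v := ⟨_, smoothFieldAt_extend _, FiberBundle.extend_apply_self _ _⟩
  have hw : w = prodField U U' z := TProd.ext z hUx.symm hUx'.symm
  have hv : v = prodField Z Z' z := TProd.ext z hZx.symm hZx'.symm
  rw [hv, hw, hA.leviCivita_spec (smoothFieldAt_prodField hU hU').diffFieldAt
    (smoothFieldAt_prodField hY hY').diffFieldAt (smoothFieldAt_prodField hZ hZ').diffFieldAt,
    koszul_prodField P Q hU hU' hY hY' hZ hZ']
  simp only [prodMetric, prodField, fstVec_pairVec, sndVec_pairVec]
  rw [P.isAlmostHermitian.leviCivita_spec hU.diffFieldAt hY.diffFieldAt hZ.diffFieldAt,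
    Q.isAlmostHermitian.leviCivita_spec hU'.diffFieldAt hY'.diffFieldAt hZ'.diffFieldAt]

lemma holoConn_prodField (hY : SmoothFieldAt 𝓘(ℝ, EM) Y z.1)
    (hY' : SmoothFieldAt 𝓘(ℝ, EN) Y' z.2) (w : TProd EM EN z) :
    holoConn (𝓘(ℝ, EM).prod 𝓘(ℝ, EN)) (prodMetric P Q) (prodCplx P Q) (prodField Y Y') z w
      = pairVec z (holoConn 𝓘(ℝ, EM) P.metric P.cplx Y z.1 (fstVec z w))
        (holoConn 𝓘(ℝ, EN) Q.metric Q.cplx Y' z.2 (sndVec z w)) := by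
  have h1 := leviCivita_prodField P Q hY hY' w
  have h2 := leviCivita_prodField P Q (P.isAlmostHermitian.cplx_smooth hY)
    (Q.isAlmostHermitian.cplx_smooth hY') w
  have h3 : (fun y => prodCplx P Q y (prodField Y Y' y))
      = prodField (fun x => P.cplx x (Y x)) (fun y => Q.cplx y (Y' y)) := rfl
  simp only [holoConn]
  rw [h3, h1, h2]
  rfl

/-- A pair of orthonormal frames of the factors is an orthonormal frame of the product. -/
lemma isOrthoFrame_prod {ι κ : Type*} [Fintype ι] [Fintype κ] {e : ι → TangentSpace 𝓘(ℝ, EM) z.1}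
    {ε : κ → TangentSpace 𝓘(ℝ, EN) z.2} (he : IsOrthoFrame (P.metric z.1) e)
    (hε : IsOrthoFrame (Q.metric z.2) ε) :
    IsOrthoFrame (prodMetric P Q z)
      (Sum.elim (fun k => pairVec z (e k) 0) (fun i => pairVec z 0 (ε i))) := by
  have hP := P.isHermitianPair z.1
  have hQ := Q.isHermitianPair z.2
  refine ⟨⟨?_, ?_⟩, fun v => ?_⟩
  · rintro (k | i) <;> simp [prodMetric, hP.zero_left, hQ.zero_left, he.1.1, hε.1.1]
  · rintro (k | i) (l | j) hij
    · simp [prodMetric, hQ.zero_left, he.1.2 k l fun h => hij (by rw [h])]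
    · simp [prodMetric, hP.zero_right, hQ.zero_left]
    · simp [prodMetric, hP.zero_left, hQ.zero_right]
    · simp [prodMetric, hP.zero_left, hε.1.2 i j fun h => hij (by rw [h])]
  · simp only [Fintype.sum_sum_type, Sum.elim_inl, Sum.elim_inr, prodMetric, fstVec_pairVec,
      sndVec_pairVec, hP.zero_right, hQ.zero_right, add_zero, zero_add]
    have h1 : ∀ u : TangentSpace 𝓘(ℝ, EM) z.1,
        pairVec z u (0 : TangentSpace 𝓘(ℝ, EN) z.2) = ∑ k, P.metric z.1 u (e k) •
          pairVec z (e k) (0 : TangentSpace 𝓘(ℝ, EN) z.2) := fun u =>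
      he.map_eq_sum ({ toFun := fun u => pairVec z u (0 : TangentSpace 𝓘(ℝ, EN) z.2)
                       map_add' := fun u v => by rw [← pairVec_add, add_zero]
                       map_smul' := fun r u => by
                        rw [RingHom.id_apply, ← pairVec_smul, smul_zero] } :
        TangentSpace 𝓘(ℝ, EM) z.1 →ₗ[ℝ] TProd EM EN z) u
    have h2 : ∀ u : TangentSpace 𝓘(ℝ, EN) z.2,
        pairVec z (0 : TangentSpace 𝓘(ℝ, EM) z.1) u = ∑ k, Q.metric z.2 u (ε k) •
          pairVec z (0 : TangentSpace 𝓘(ℝ, EM) z.1) (ε k) := fun u =>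
      hε.map_eq_sum ({ toFun := fun u => pairVec z (0 : TangentSpace 𝓘(ℝ, EM) z.1) u
                       map_add' := fun u v => by rw [← pairVec_add, add_zero]
                       map_smul' := fun r u => by
                        rw [RingHom.id_apply, ← pairVec_smul, smul_zero] } :
        TangentSpace 𝓘(ℝ, EN) z.2 →ₗ[ℝ] TProd EM EN z) u
    rw [← h1, ← h2, ← pairVec_eq_add, pairVec_fstVec_sndVec]

end ProductGeometry

/-! ### Line bundles in local frames -/

section LineBundle

variable {E : Type*} [NormedAddCommGroup E] [NormedSpace ℝ E]
  {X : Type*} [TopologicalSpace X] [ChartedSpace E X]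
  {L : X → Type*} [∀ x, NormedAddCommGroup (L x)] [∀ x, InnerProductSpace ℂ (L x)]
  [TopologicalSpace (TotalSpace ℂ L)] [FiberBundle ℂ L]
  [VectorBundle ℂ ℂ L]

variable (L) in
/-- The coordinate on `L x` given by the preferred trivialization at `x₀`. -/
noncomputable abbrev fibreCoord (x₀ x : X) : L x →ₗ[ℂ] ℂ := (trivializationAt ℂ L x₀).linearMapAt ℂ x

variable {x₀ x : X}

lemma fibreCoord_eq (hx : x ∈ (trivializationAt ℂ L x₀).baseSet) (v : L x) :
    fibreCoord L x₀ x v = (trivializationAt ℂ L x₀ ⟨x, v⟩).2 := by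
  rw [fibreCoord, Trivialization.coe_linearMapAt_of_mem _ hx]

lemma fibreCoord_localFrame (hx : x ∈ (trivializationAt ℂ L x₀).baseSet) :
    fibreCoord L x₀ x (localFrame L x₀ x) = 1 := by
  rw [fibreCoord_eq hx, localFrame, Trivialization.apply_mk_symm _ hx]

lemma fibreCoord_injective (hx : x ∈ (trivializationAt ℂ L x₀).baseSet) {v w : L x}
    (h : fibreCoord L x₀ x v = fibreCoord L x₀ x w) : v = w := by
  have := congrArg ((trivializationAt ℂ L x₀).symm x) h
  rwa [Trivialization.symm_linearMapAt _ hx, Trivialization.symm_linearMapAt _ hx] at this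

lemma fibreCoord_smul_localFrame (hx : x ∈ (trivializationAt ℂ L x₀).baseSet) (v : L x) :
    fibreCoord L x₀ x v • localFrame L x₀ x = v :=
  fibreCoord_injective hx (by rw [map_smul, fibreCoord_localFrame hx, smul_eq_mul, mul_one])

lemma localFrame_ne_zero (hx : x ∈ (trivializationAt ℂ L x₀).baseSet) :
    localFrame L x₀ x ≠ 0 := by
  intro h
  have := fibreCoord_localFrame hx
  rw [h, map_zero] at this
  exact zero_ne_one this

lemma mem_baseSet_self (x : X) : x ∈ (trivializationAt ℂ L x).baseSet :=
  FiberBundle.mem_baseSet_trivializationAt' x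

lemma eventually_mem_baseSet (hx : x ∈ (trivializationAt ℂ L x₀).baseSet) :
    ∀ᶠ y in 𝓝 x, y ∈ (trivializationAt ℂ L x₀).baseSet :=
  (trivializationAt ℂ L x₀).open_baseSet.mem_nhds hx

variable [VectorBundle ℝ ℂ L] [ContMDiffVectorBundle ∞ ℂ L 𝓘(ℝ, E)]

lemma smoothSectionAt_iff (hx : x ∈ (trivializationAt ℂ L x₀).baseSet) (s : ∀ y, L y) :
    SmoothSectionAt (E := E) s x
      ↔ ContMDiffAt 𝓘(ℝ, E) 𝓘(ℝ, ℂ) ∞ (fun y => fibreCoord L x₀ y (s y)) x := by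
  have h := Trivialization.contMDiffAt_section_iff (IB := 𝓘(ℝ, E)) (n := ∞)
    (trivializationAt ℂ L x₀) (s := s) hx
  refine h.trans (Filter.EventuallyEq.contMDiffAt_iff ?_)
  filter_upwards [eventually_mem_baseSet hx] with y hy
  exact (fibreCoord_eq hy _).symm

variable [IsManifold 𝓘(ℝ, E) ∞ X]

lemma diffSectionAt_iff (hx : x ∈ (trivializationAt ℂ L x₀).baseSet) (s : ∀ y, L y) :
    DiffSectionAt (E := E) s x
      ↔ MDifferentiableAt 𝓘(ℝ, E) 𝓘(ℝ, ℂ) (fun y => fibreCoord L x₀ y (s y)) x := by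
  have : ContMDiffVectorBundle 1 ℂ L 𝓘(ℝ, E) := ContMDiffVectorBundle.of_le (n := ∞) (by simp)
  have h := Trivialization.mdifferentiableAt_section_iff 𝓘(ℝ, E)
    (trivializationAt ℂ L x₀) s hx
  refine h.trans (Filter.EventuallyEq.mdifferentiableAt_iff ?_)
  filter_upwards [eventually_mem_baseSet hx] with y hy
  exact (fibreCoord_eq hy _).symm

lemma SmoothSectionAt.diffSectionAt {s : ∀ y, L y} (hs : SmoothSectionAt (E := E) s x) :
    DiffSectionAt (E := E) s x :=
  ContMDiffAt.mdifferentiableAt hs (by simp)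

lemma smoothSectionAt_localFrame (hx : x ∈ (trivializationAt ℂ L x₀).baseSet) :
    SmoothSectionAt (E := E) (localFrame L x₀) x := by
  refine (smoothSectionAt_iff hx _).2
    (contMDiffAt_const (c := (1 : ℂ)) |>.congr_of_eventuallyEq ?_)
  filter_upwards [eventually_mem_baseSet hx] with y hy
  exact fibreCoord_localFrame hy

lemma DiffSectionAt.congr {s t : ∀ y, L y} (hs : DiffSectionAt (E := E) s x)
    (h : ∀ᶠ y in 𝓝 x, s y = t y) : DiffSectionAt (E := E) t x := by
  refine MDifferentiableAt.congr_of_eventuallyEq hs ?_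
  filter_upwards [h] with y hy
  rw [hy]

lemma DiffSectionAt.smul {f : X → ℂ} {s : ∀ y, L y}
    (hf : MDifferentiableAt 𝓘(ℝ, E) 𝓘(ℝ, ℂ) f x) (hs : DiffSectionAt (E := E) s x) :
    DiffSectionAt (E := E) (fun y => f y • s y) x := by
  rw [diffSectionAt_iff (mem_baseSet_self x)] at hs ⊢
  simp only [map_smul, smul_eq_mul]
  exact hf.mul hs

/-- A local frame of a line bundle agrees near any point with a smooth global section. -/
lemma exists_smooth_section [FiniteDimensional ℝ E] [T2Space X]
    (hx : x ∈ (trivializationAt ℂ L x₀).baseSet) :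
    ∃ s : ∀ y, L y, (∀ y, SmoothSectionAt (E := E) s y) ∧
      ∀ᶠ y in 𝓝 x, localFrame L x₀ y = s y := by
  have hU := eventually_mem_baseSet hx
  -- A bump function with support inside the trivializing set and equal to 1 near x extends the
  -- frame by zero.
  obtain ⟨χ, hχ⟩ := ((SmoothBumpFunction.nhds_basis_tsupport (I := 𝓘(ℝ, E)) x).mem_iff.1 hU)
  obtain ⟨-, hχ⟩ := hχ
  refine ⟨(χ : X → ℝ) • localFrame L x₀, ?_, ?_⟩
  · refine ContMDiffOn.smul_section_of_tsupport (F := ℂ) (I := 𝓘(ℝ, E)) (n := ∞)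
      (u := (trivializationAt ℂ L x₀).baseSet) χ.contMDiff.contMDiffOn
      (trivializationAt ℂ L x₀).open_baseSet hχ ?_
    exact fun y hy => (smoothSectionAt_localFrame hy).contMDiffWithinAt
  · filter_upwards [χ.eventuallyEq_one] with y hy
    rw [Pi.smul_apply', hy]
    simp

end LineBundle

/-! ### Complex Leibniz rule and smoothness for the connection of a line bundle -/

section LineConnection

variable {EG : Type*} [NormedAddCommGroup EG] [NormedSpace ℝ EG]
  {G : Type*} [TopologicalSpace G] [ChartedSpace EG G] [Group G]
  {E : Type*} [NormedAddCommGroup E] [NormedSpace ℝ E]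
  {X : Type*} [TopologicalSpace X] [ChartedSpace E X] [MulAction G X]
  {L : X → Type*} [∀ x, NormedAddCommGroup (L x)] [∀ x, InnerProductSpace ℂ (L x)]
  [TopologicalSpace (TotalSpace ℂ L)] [FiberBundle ℂ L] [IsManifold 𝓘(ℝ, E) ∞ X]
  [VectorBundle ℂ ℂ L] [VectorBundle ℝ ℂ L] [ContMDiffVectorBundle ∞ ℂ L 𝓘(ℝ, E)]

namespace PrequantumData

variable (P : PrequantumData EG G E X L) {x : X}

lemma conn_congr {s t : ∀ y, L y} (hs : DiffSectionAt (E := E) s x)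
    (h : ∀ᶠ y in 𝓝 x, s y = t y) : P.conn s x = P.conn t x :=
  P.conn.isCovariantDerivativeOnUniv.congr_of_eventuallyEq hs (hs.congr h) Filter.univ_mem h

lemma conn_add {s t : ∀ y, L y} (hs : DiffSectionAt (E := E) s x)
    (ht : DiffSectionAt (E := E) t x) (u : TangentSpace 𝓘(ℝ, E) x) :
    P.conn (fun y => s y + t y) x u = P.conn s x u + P.conn t x u :=
  DFunLike.congr_fun (P.conn.isCovariantDerivativeOnUniv.add hs ht) u

lemma conn_real_smul {f : X → ℝ} {s : ∀ y, L y} (hf : MDifferentiableAt 𝓘(ℝ, E) 𝓘(ℝ, ℝ) f x)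
    (hs : DiffSectionAt (E := E) s x) (u : TangentSpace 𝓘(ℝ, E) x) :
    P.conn (fun y => (f y : ℂ) • s y) x u
      = (mvfderiv 𝓘(ℝ, E) f x u : ℂ) • s x + (f x : ℂ) • P.conn s x u := by
  have h := DFunLike.congr_fun (P.conn.isCovariantDerivativeOnUniv.leibniz hs hf) u
  have h2 : (f • s : ∀ y, L y) = fun y => (f y : ℂ) • s y := by
    funext y
    rw [Pi.smul_apply', Complex.coe_smul]
  rw [h2] at h
  refine h.trans ?_
  rw [Complex.coe_smul, Complex.coe_smul, add_comm]
  rfl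

/-- Leibniz rule for complex-valued functions. -/
lemma conn_smul {f : X → ℂ} {s : ∀ y, L y} (hf : MDifferentiableAt 𝓘(ℝ, E) 𝓘(ℝ, ℂ) f x)
    (hs : DiffSectionAt (E := E) s x) (u : TangentSpace 𝓘(ℝ, E) x) :
    P.conn (fun y => f y • s y) x u = mvfderiv 𝓘(ℝ, E) f x u • s x + f x • P.conn s x u := by
  have hre := mdifferentiableAt_clm_comp Complex.reCLM hf
  have him := mdifferentiableAt_clm_comp Complex.imCLM hf
  have dre := mvfderiv_clm_comp Complex.reCLM hf u
  have dim := mvfderiv_clm_comp Complex.imCLM hf u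
  simp only [Complex.reCLM_apply, Complex.imCLM_apply] at hre him dre dim
  have h1 : DiffSectionAt (E := E) (fun y => (((f y).re : ℝ) : ℂ) • s y) x :=
    hs.smul (mdifferentiableAt_ofReal hre)
  have h2 : DiffSectionAt (E := E) (fun y => (((f y).im : ℝ) : ℂ) • s y) x :=
    hs.smul (mdifferentiableAt_ofReal him)
  have h3 : DiffSectionAt (E := E) (fun y => Complex.I • (((f y).im : ℝ) : ℂ) • s y) x :=
    h2.smul (f := fun _ => Complex.I) mdifferentiableAt_const
  -- The real Leibniz rule is applied to the real and imaginary parts of f, and `conn_complex`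
  -- extracts the constant √-1.
  have e : (fun y => f y • s y)
      = fun y => (((f y).re : ℝ) : ℂ) • s y + Complex.I • (((f y).im : ℝ) : ℂ) • s y := by
    funext y
    rw [smul_smul, ← add_smul, mul_comm Complex.I, Complex.re_add_im]
  rw [e, P.conn_add h1 h3, P.conn_complex x _ h2, P.conn_real_smul hre hs,
    P.conn_real_smul him hs, dre, dim]
  conv_rhs => rw [← Complex.re_add_im (f x), ← Complex.re_add_im (mvfderiv 𝓘(ℝ, E) f x u)]
  module

lemma conn_smul_left (s : ∀ y, L y) (r : ℝ) (u : TangentSpace 𝓘(ℝ, E) x) :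
    P.conn s x (r • u) = (r : ℂ) • P.conn s x u := by
  rw [map_smul, Complex.coe_smul]

/-- The covariant derivative of a local frame is smooth. -/
lemma smoothSectionAt_conn_localFrame [FiniteDimensional ℝ E] [T2Space X] {x₀ : X}
    (hx : x ∈ (trivializationAt ℂ L x₀).baseSet) {X' : Type*} {E' H' : Type*}
    [NormedAddCommGroup E'] [NormedSpace ℝ E'] [TopologicalSpace H']
    {I' : ModelWithCorners ℝ E' H'} [TopologicalSpace X'] [ChartedSpace H' X'] {b : X' → X}
    {m : X'} (hm : b m = x) {u : ∀ m, TangentSpace 𝓘(ℝ, E) (b m)}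
    (hb : ContMDiffAt I' 𝓘(ℝ, E) ∞ b m)
    (hu : ContMDiffAt I' 𝓘(ℝ, E).tangent ∞
      (fun m => (⟨b m, u m⟩ : TangentBundle 𝓘(ℝ, E) X)) m) :
    ContMDiffAt I' 𝓘(ℝ, ℂ) ∞
      (fun m => fibreCoord L x₀ (b m) (P.conn (localFrame L x₀) (b m) (u m))) m := by
  subst hm
  -- The smoothness of the connection is used on global sections, so the local frame is replaced by
  -- a global section with the same germ.
  obtain ⟨s, hs, hs'⟩ := exists_smooth_section (E := E) hx
  have h1 := P.conn_smooth.contMDiff.contMDiff (σ := s) (fun y _ => (hs y).contMDiffWithinAt)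
  have h2 := ((contMDiffOn_univ.1 h1) (b m)).comp m hb
  have h3 := ContMDiffAt.clm_bundle_apply (ϕ := fun m => P.conn s (b m)) h2 hu
  have h4 := (Trivialization.contMDiffAt_iff (IB := 𝓘(ℝ, E)) (e := trivializationAt ℂ L x₀)
    ((trivializationAt ℂ L x₀).mem_source.2 hx)).1 h3
  refine h4.2.congr_of_eventuallyEq ?_
  have h5 := hb.continuousAt.eventually (hs'.eventually_nhds)
  have h6 := hb.continuousAt.eventually (eventually_mem_baseSet hx)
  filter_upwards [h5, h6] with y hy hy'
  rw [fibreCoord_eq hy', P.conn_congr (smoothSectionAt_localFrame hy').diffSectionAt hy]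

end PrequantumData

end LineConnection

/-! ### The connection of L ⊗ F -/

section TensorLine

variable {EG : Type*} [NormedAddCommGroup EG] [NormedSpace ℝ EG]
  {G : Type*} [TopologicalSpace G] [ChartedSpace EG G] [Group G]
  {EM : Type*} [NormedAddCommGroup EM] [NormedSpace ℝ EM]
  {M : Type*} [TopologicalSpace M] [ChartedSpace EM M] [IsManifold 𝓘(ℝ, EM) ∞ M] [MulAction G M]
  {L : M → Type*} [∀ x, NormedAddCommGroup (L x)] [∀ x, InnerProductSpace ℂ (L x)]
  [TopologicalSpace (TotalSpace ℂ L)] [FiberBundle ℂ L] [VectorBundle ℂ ℂ L] [VectorBundle ℝ ℂ L]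
  [ContMDiffVectorBundle ∞ ℂ L 𝓘(ℝ, EM)]
  {EN : Type*} [NormedAddCommGroup EN] [NormedSpace ℝ EN]
  {N : Type*} [TopologicalSpace N] [ChartedSpace EN N] [IsManifold 𝓘(ℝ, EN) ∞ N] [MulAction G N]
  {F : N → Type*} [∀ y, NormedAddCommGroup (F y)] [∀ y, InnerProductSpace ℂ (F y)]
  [TopologicalSpace (TotalSpace ℂ F)] [FiberBundle ℂ F] [VectorBundle ℂ ℂ F] [VectorBundle ℝ ℂ F]
  [ContMDiffVectorBundle ∞ ℂ F 𝓘(ℝ, EN)]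

variable (EM EN) in
/-- Differentiability at a point of a section of `L ⊗ F`. -/
def DiffLineAt (t : ∀ z : M × N, LineProd L F z) (z₀ : M × N) : Prop :=
  MDifferentiableAt (𝓘(ℝ, EM).prod 𝓘(ℝ, EN)) 𝓘(ℝ, ℂ) (fun z => lineCoord L F z₀ z (t z)) z₀

lemma lineCoord_tmul (z₀ z : M × N) (v : L z.1) (w : F z.2) :
    lineCoord L F z₀ z (v ⊗ₜ[ℂ] w) = fibreCoord L z₀.1 z.1 v * fibreCoord F z₀.2 z.2 w := rfl

variable {z z₀ : M × N}

lemma lineCoord_smul_localFrame (h1 : z.1 ∈ (trivializationAt ℂ L z₀.1).baseSet)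
    (h2 : z.2 ∈ (trivializationAt ℂ F z₀.2).baseSet) (v : LineProd L F z) :
    lineCoord L F z₀ z v • (localFrame L z₀.1 z.1 ⊗ₜ[ℂ] localFrame F z₀.2 z.2) = v := by
  induction v using TensorProduct.induction_on with
  | zero => simp
  | tmul v w =>
    rw [lineCoord_tmul, TensorProduct.smul_tmul', mul_comm, mul_smul,
      fibreCoord_smul_localFrame h1, TensorProduct.smul_tmul, fibreCoord_smul_localFrame h2]
  | add v w hv hw => rw [map_add, add_smul, hv, hw]

lemma eventually_mem_baseSet_prod :
    ∀ᶠ y in 𝓝 z, y.1 ∈ (trivializationAt ℂ L z.1).baseSet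
      ∧ y.2 ∈ (trivializationAt ℂ F z.2).baseSet :=
  ((continuous_fst.tendsto z).eventually (eventually_mem_baseSet (mem_baseSet_self z.1))).and
    ((continuous_snd.tendsto z).eventually (eventually_mem_baseSet (mem_baseSet_self z.2)))

lemma DiffSectionAt.comp_fst {x₀ : M} {σ : ∀ x, L x} (hσ : DiffSectionAt (E := EM) σ z.1)
    (hx : z.1 ∈ (trivializationAt ℂ L x₀).baseSet) :
    MDifferentiableAt (𝓘(ℝ, EM).prod 𝓘(ℝ, EN)) 𝓘(ℝ, ℂ)
      (fun y : M × N => fibreCoord L x₀ y.1 (σ y.1)) z :=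
  MDifferentiableAt.comp (I' := 𝓘(ℝ, EM)) (g := fun x => fibreCoord L x₀ x (σ x)) z
    ((diffSectionAt_iff hx σ).1 hσ) mdifferentiableAt_fst

lemma DiffSectionAt.comp_snd {y₀ : N} {τ : ∀ y, F y} (hτ : DiffSectionAt (E := EN) τ z.2)
    (hy : z.2 ∈ (trivializationAt ℂ F y₀).baseSet) :
    MDifferentiableAt (𝓘(ℝ, EM).prod 𝓘(ℝ, EN)) 𝓘(ℝ, ℂ)
      (fun y : M × N => fibreCoord F y₀ y.2 (τ y.2)) z :=
  MDifferentiableAt.comp (I' := 𝓘(ℝ, EN)) (g := fun x => fibreCoord F y₀ x (τ x)) z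
    ((diffSectionAt_iff hy τ).1 hτ) mdifferentiableAt_snd

variable (P : PrequantumData EG G EM M L) (Q : PrequantumData EG G EN N F)

/-- The connection of `L ⊗ F` in arbitrary local sections of `L` and `F`. -/
lemma prodConn_tmul {t : ∀ z : M × N, LineProd L F z} {a : M × N → ℂ} {σ : ∀ x, L x}
    {τ : ∀ y, F y} (ha : MDifferentiableAt (𝓘(ℝ, EM).prod 𝓘(ℝ, EN)) 𝓘(ℝ, ℂ) a z)
    (hσ : DiffSectionAt (E := EM) σ z.1) (hτ : DiffSectionAt (E := EN) τ z.2)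
    (ht : ∀ᶠ y in 𝓝 z, t y = a y • (σ y.1 ⊗ₜ[ℂ] τ y.2)) (w : TProd EM EN z) :
    prodConn P Q t z w = mvfderiv (𝓘(ℝ, EM).prod 𝓘(ℝ, EN)) a z w • (σ z.1 ⊗ₜ[ℂ] τ z.2)
      + a z • (P.conn σ z.1 (fstVec z w) ⊗ₜ[ℂ] τ z.2
        + σ z.1 ⊗ₜ[ℂ] Q.conn τ z.2 (sndVec z w)) := by
  have b1 := mem_baseSet_self (L := L) z.1
  have b2 := mem_baseSet_self (L := F) z.2
  -- Coefficients of σ and τ in the frames that define `prodConn`; their derivatives are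
  -- redistributed by the Leibniz rules of the two connections.
  set φ : M → ℂ := fun x => fibreCoord L z.1 x (σ x) with hφ
  set χ : N → ℂ := fun y => fibreCoord F z.2 y (τ y) with hχ
  have hφd : MDifferentiableAt 𝓘(ℝ, EM) 𝓘(ℝ, ℂ) φ z.1 := (diffSectionAt_iff b1 σ).1 hσ
  have hχd : MDifferentiableAt 𝓘(ℝ, EN) 𝓘(ℝ, ℂ) χ z.2 := (diffSectionAt_iff b2 τ).1 hτ
  have hφ' := hσ.comp_fst (EN := EN) (z := z) b1
  have hχ' := hτ.comp_snd (EM := EM) (z := z) b2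
  have f1 : DiffSectionAt (E := EM) (localFrame L z.1) z.1 :=
    (smoothSectionAt_localFrame b1).diffSectionAt
  have f2 : DiffSectionAt (E := EN) (localFrame F z.2) z.2 :=
    (smoothSectionAt_localFrame b2).diffSectionAt
  have c1 : P.conn σ z.1 (fstVec z w) = mvfderiv 𝓘(ℝ, EM) φ z.1 (fstVec z w) • localFrame L z.1 z.1
      + φ z.1 • P.conn (localFrame L z.1) z.1 (fstVec z w) := by
    rw [← P.conn_smul hφd f1]
    refine DFunLike.congr_fun (P.conn_congr hσ ?_) _
    filter_upwards [eventually_mem_baseSet b1] with y hy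
    exact (fibreCoord_smul_localFrame hy _).symm
  have c2 : Q.conn τ z.2 (sndVec z w) = mvfderiv 𝓘(ℝ, EN) χ z.2 (sndVec z w) • localFrame F z.2 z.2
      + χ z.2 • Q.conn (localFrame F z.2) z.2 (sndVec z w) := by
    rw [← Q.conn_smul hχd f2]
    refine DFunLike.congr_fun (Q.conn_congr hτ ?_) _
    filter_upwards [eventually_mem_baseSet b2] with y hy
    exact (fibreCoord_smul_localFrame hy _).symm
  have e : (fun y => lineCoord L F z y (t y)) =ᶠ[𝓝 z] fun y => a y * (φ y.1 * χ y.2) := by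
    filter_upwards [ht] with y hy
    rw [hy, map_smul, lineCoord_tmul]
    rfl
  have d1 := mvfderiv_bilin (ContinuousLinearMap.mul ℝ ℂ) ha (hφ'.mul hχ') w
  have d2 := mvfderiv_bilin (ContinuousLinearMap.mul ℝ ℂ) hφ' hχ' w
  simp only [ContinuousLinearMap.mul_apply'] at d1 d2
  have d3 := mvfderiv_comp_fst (z := z) hφd w
  have d4 := mvfderiv_comp_snd (z := z) hχd w
  have hσz : σ z.1 = φ z.1 • localFrame L z.1 z.1 := (fibreCoord_smul_localFrame b1 _).symm
  have hτz : τ z.2 = χ z.2 • localFrame F z.2 z.2 := (fibreCoord_smul_localFrame b2 _).symm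
  have d5 : mvfderiv (𝓘(ℝ, EM).prod 𝓘(ℝ, EN)) (fun y => lineCoord L F z y (t y)) z w
      = mvfderiv (𝓘(ℝ, EM).prod 𝓘(ℝ, EN)) a z w * (φ z.1 * χ z.2)
        + a z * (mvfderiv 𝓘(ℝ, EM) φ z.1 (fstVec z w) * χ z.2
          + φ z.1 * mvfderiv 𝓘(ℝ, EN) χ z.2 (sndVec z w)) := by
    rw [mvfderiv_congr e, ← d3, ← d4, ← d2]
    exact d1
  rw [prodConn, d5, c1, c2, hσz, hτz, e.eq_of_nhds]
  simp only [TensorProduct.add_tmul, TensorProduct.tmul_add, ← TensorProduct.smul_tmul',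
    TensorProduct.tmul_smul, smul_add, smul_smul]
  module

lemma prodConn_add_left (t : ∀ z : M × N, LineProd L F z) (u v : TProd EM EN z) :
    prodConn P Q t z (u + v) = prodConn P Q t z u + prodConn P Q t z v := by
  simp only [prodConn, fstVec_add, sndVec_add, map_add, TensorProduct.add_tmul,
    TensorProduct.tmul_add]
  module

lemma prodConn_smul_left (t : ∀ z : M × N, LineProd L F z) (r : ℝ) (u : TProd EM EN z) :
    prodConn P Q t z (r • u) = (r : ℂ) • prodConn P Q t z u := by
  simp only [prodConn, fstVec_smul, sndVec_smul, P.conn_smul_left, Q.conn_smul_left, map_smul,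
    ← TensorProduct.smul_tmul', TensorProduct.tmul_smul, Complex.real_smul]
  module

/-- A section of `L ⊗ F` in the local frames at `z`. -/
lemma eventually_eq_lineCoord_smul (t : ∀ z : M × N, LineProd L F z) (z : M × N) :
    ∀ᶠ y in 𝓝 z, t y
      = lineCoord L F z y (t y) • (localFrame L z.1 y.1 ⊗ₜ[ℂ] localFrame F z.2 y.2) := by
  filter_upwards [eventually_mem_baseSet_prod (L := L) (F := F)] with y hy
  exact (lineCoord_smul_localFrame hy.1 hy.2 _).symm

/-- This makes the general theory of forms with values in W available for W = L ⊗ F. -/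
lemma isSectionConnection_prodConn [FiniteDimensional ℝ EM] [FiniteDimensional ℝ EN] :
    IsSectionConnection (𝓘(ℝ, EM).prod 𝓘(ℝ, EN)) (prodConn P Q) (DiffLineAt EM EN) where
  diff_congr {t t' z} h he := by
    refine MDifferentiableAt.congr_of_eventuallyEq h ?_
    filter_upwards [he] with y hy
    rw [hy]
  diff_add {t t' z} h h' := by
    simp only [DiffLineAt, map_add]
    exact MDifferentiableAt.add h h'
  diff_smul {f t z} hf h := by
    simp only [DiffLineAt, map_smul, smul_eq_mul]
    exact hf.mul h
  congr {t t' z} h he := by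
    funext w
    simp only [prodConn]
    rw [he.self_of_nhds, mvfderiv_congr (f' := fun y => lineCoord L F z y (t' y))]
    filter_upwards [he] with y hy
    rw [hy]
  add {t t' z} h h' w := by
    have := mvfderiv_add_apply h h' w
    simp only [prodConn, map_add]
    rw [this]
    module
  smul {f t z} hf h w := by
    have d := mvfderiv_bilin (ContinuousLinearMap.mul ℝ ℂ) hf h w
    simp only [ContinuousLinearMap.mul_apply'] at d
    have ht := (eventually_eq_lineCoord_smul t z).self_of_nhds
    simp only [prodConn, map_smul, smul_eq_mul]
    rw [d]
    conv_rhs => rw [ht]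
    simp only [map_smul, lineCoord_tmul, fibreCoord_localFrame (mem_baseSet_self z.1),
      fibreCoord_localFrame (mem_baseSet_self z.2), smul_eq_mul, mul_one]
    module
  add_left _ u v := prodConn_add_left P Q _ u v
  smul_left _ r u := prodConn_smul_left P Q _ r u

/-- The covariant derivative of a section of `L ⊗ F` in the local frames at `z`. -/
lemma eventually_prodConn_eq {t : ∀ z : M × N, LineProd L F z} (ht : SmoothLineAt EM EN t z) :
    ∀ᶠ y in 𝓝 z, ∀ w : TProd EM EN y, lineCoord L F z y (prodConn P Q t y w)
      = mvfderiv (𝓘(ℝ, EM).prod 𝓘(ℝ, EN)) (fun y => lineCoord L F z y (t y)) y w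
        + lineCoord L F z y (t y) *
          (fibreCoord L z.1 y.1 (P.conn (localFrame L z.1) y.1 (fstVec y w))
            + fibreCoord F z.2 y.2 (Q.conn (localFrame F z.2) y.2 (sndVec y w))) := by
  have hd : ∀ᶠ y in 𝓝 z, MDifferentiableAt (𝓘(ℝ, EM).prod 𝓘(ℝ, EN)) 𝓘(ℝ, ℂ)
      (fun y => lineCoord L F z y (t y)) y := by
    filter_upwards [(contMDiffAt_iff_contMDiffAt_nhds (n := 1) (by simp)).1
      (ContMDiffAt.of_le ht (by simp))] with y hy
    exact hy.mdifferentiableAt (by simp)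
  have hb := (eventually_mem_baseSet_prod (L := L) (F := F) (z := z)).eventually_nhds
  filter_upwards [hd, hb] with y hy hby w
  obtain ⟨b1, b2⟩ := hby.self_of_nhds
  have h := prodConn_tmul P Q (t := t) hy
    (smoothSectionAt_localFrame (E := EM) b1).diffSectionAt
    (smoothSectionAt_localFrame (E := EN) b2).diffSectionAt
    (hby.mono fun y hy => (lineCoord_smul_localFrame hy.1 hy.2 _).symm) w
  rw [h]
  simp only [map_add, map_smul, lineCoord_tmul, fibreCoord_localFrame b1, fibreCoord_localFrame b2,
    smul_eq_mul, mul_one, one_mul]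

/-- In the frames at z, the covariant derivative along U is the derivative of the coefficient plus
the coefficient times the connection forms of the two frames, all differentiable. -/
lemma isSmoothClass_prodConn [FiniteDimensional ℝ EM] [T2Space M] [FiniteDimensional ℝ EN]
    [T2Space N] : IsSmoothClass (𝓘(ℝ, EM).prod 𝓘(ℝ, EN)) (prodConn P Q) (DiffLineAt EM EN)
      (SmoothLineAt EM EN) where
  diff h := ContMDiffAt.mdifferentiableAt h (by simp)
  diff_conn {t z U} ht hU := by
    have h1 := contMDiffAt_mvfderiv_apply ht hU
    have h2 := P.smoothSectionAt_conn_localFrame (mem_baseSet_self z.1)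
      (b := fun y : M × N => y.1) (m := z) rfl contMDiffAt_fst (contMDiffAt_fstVec hU)
    have h3 := Q.smoothSectionAt_conn_localFrame (mem_baseSet_self z.2)
      (b := fun y : M × N => y.2) (m := z) rfl contMDiffAt_snd (contMDiffAt_sndVec hU)
    refine MDifferentiableAt.congr_of_eventuallyEq
      ((h1.mdifferentiableAt (by simp)).add ((ContMDiffAt.mdifferentiableAt ht (by simp)).mul
        ((h2.mdifferentiableAt (by simp)).add (h3.mdifferentiableAt (by simp))))) ?_
    filter_upwards [eventually_prodConn_eq P Q ht] with y hy
    exact hy _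

lemma isSmoothFormNear_iff {s : ∀ z : M × N, Cochain (TProd EM EN z) (LineProd L F z)} :
    IsSmoothFormNear P Q s z ↔
      IsSmoothForm (𝓘(ℝ, EM).prod 𝓘(ℝ, EN)) (prodCplx P Q) (SmoothLineAt EM EN) s z := Iff.rfl

end TensorLine

/-! ### Coordinate functions with their dual fields -/

section CoordinateFrame

variable {E : Type*} [NormedAddCommGroup E] [NormedSpace ℝ E] [FiniteDimensional ℝ E]
  {X : Type*} [TopologicalSpace X] [ChartedSpace E X] [IsManifold 𝓘(ℝ, E) ∞ X]

/-- Coordinate functions `f_i` and coordinate fields `B_i` near a point. -/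
lemma exists_coordinate_frame (x : X) :
    ∃ (f : Fin (finrank ℝ E) → X → ℝ) (B : Fin (finrank ℝ E) → ∀ y : X, TangentSpace 𝓘(ℝ, E) y),
      (∀ i, ContMDiffAt 𝓘(ℝ, E) 𝓘(ℝ, ℝ) ∞ (f i) x) ∧ (∀ i, SmoothFieldAt 𝓘(ℝ, E) (B i) x) ∧
      ∀ᶠ y in 𝓝 x, ∀ w : TangentSpace 𝓘(ℝ, E) y,
        w = ∑ i, mvfderiv 𝓘(ℝ, E) (f i) y w • B i y := by
  have : CompleteSpace E := FiniteDimensional.complete ℝ E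
  let b := finBasis ℝ E
  let c : Fin (finrank ℝ E) → E →L[ℝ] ℝ := fun i => LinearMap.toContinuousLinearMap (b.coord i)
  let e := trivializationAt E (TangentSpace 𝓘(ℝ, E)) x
  have hb : ∀ᶠ y in 𝓝 x, y ∈ e.baseSet :=
    e.open_baseSet.mem_nhds (FiberBundle.mem_baseSet_trivializationAt' x)
  refine ⟨fun i y => c i (extChartAt 𝓘(ℝ, E) x y), fun i y => e.symm y (b i), fun i => ?_,
    fun i => ?_, ?_⟩
  · exact (c i).contMDiff.contMDiffAt.comp x contMDiffAt_extChartAt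
  · have h := Trivialization.contMDiffAt_section_iff (IB := 𝓘(ℝ, E)) (n := ∞)
      e (s := fun y => e.symm y (b i)) (x₀ := x) (FiberBundle.mem_baseSet_trivializationAt' x)
    refine h.2 (contMDiffAt_const (c := b i) |>.congr_of_eventuallyEq ?_)
    filter_upwards [hb] with y hy
    rw [Trivialization.apply_mk_symm _ hy]
  · filter_upwards [hb, eventually_mdifferentiableAt_extChartAt (EM := E) x,
      extChartAt_source_mem_nhds (I := 𝓘(ℝ, E)) x] with y hy hd hys w
    -- The trivialization of the tangent bundle is the differential of the chart, so the coordinate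
    -- differentials read off the coefficients of w in the fields B_i.
    have h1 : ∀ i, mvfderiv 𝓘(ℝ, E) (fun y => c i (extChartAt 𝓘(ℝ, E) x y)) y w
        = b.repr ((e ⟨y, w⟩).2) i := fun i => by
      rw [mvfderiv_clm_comp (c i) hd w, mvfderiv_apply, mfderiv_extChartAt_eq_trivializationAt hys]
      rfl
    have h2 : ∀ r : E, e.symm y r = e.symmₗ ℝ y r := fun r => congrFun (e.coe_symmₗ hy).symm r
    calc w = e.symm y ((e ⟨y, w⟩).2) := (e.symm_apply_apply_mk hy w).symm
      _ = e.symm y (∑ i, b.repr ((e ⟨y, w⟩).2) i • b i) := by rw [b.sum_repr]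
      _ = ∑ i, b.repr ((e ⟨y, w⟩).2) i • e.symm y (b i) := by
        simp only [h2, map_sum, map_smul]
      _ = _ := Finset.sum_congr rfl fun i _ => by rw [h1]

end CoordinateFrame

/-! ### Smooth actions: generated fields and transport of vectors -/

section SmoothAction

variable {EG : Type*} [NormedAddCommGroup EG] [NormedSpace ℝ EG] [FiniteDimensional ℝ EG]
  {G : Type*} [TopologicalSpace G] [ChartedSpace EG G] [Group G] [LieGroup 𝓘(ℝ, EG) ∞ G]
  {E : Type*} [NormedAddCommGroup E] [NormedSpace ℝ E] [FiniteDimensional ℝ E]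
  {X : Type*} [TopologicalSpace X] [ChartedSpace E X] [IsManifold 𝓘(ℝ, E) ∞ X]
  [MulAction G X] [ContMDiffSMul 𝓘(ℝ, EG) 𝓘(ℝ, E) ∞ G X]

lemma contMDiff_inv_smul :
    ContMDiff (𝓘(ℝ, EG).prod 𝓘(ℝ, E)) 𝓘(ℝ, E) ∞ (fun p : G × X => p.1⁻¹ • p.2) :=
  ContMDiff.smul (I := 𝓘(ℝ, EG)) (I' := 𝓘(ℝ, E))
    (ContMDiff.inv (contMDiff_fst (M := G) (N := X))) contMDiff_snd

lemma contMDiff_inv_smul_left (x : X) :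
    ContMDiff 𝓘(ℝ, EG) 𝓘(ℝ, E) ∞ (fun h : G => h⁻¹ • x) :=
  (contMDiff_inv_smul (EG := EG) (E := E)).comp (contMDiff_id.prodMk contMDiff_const)

variable (EG E) in
include EG E in
lemma contMDiff_inv_smul_right (h : G) :
    ContMDiff 𝓘(ℝ, E) 𝓘(ℝ, E) ∞ (fun x : X => h⁻¹ • x) :=
  (contMDiff_inv_smul (EG := EG) (E := E)).comp (contMDiff_const.prodMk contMDiff_id)

variable (EG E) in
include EG E in
lemma continuousAt_inv_smul (x : X) : Filter.Tendsto (fun h : G => h⁻¹ • x) (𝓝 1) (𝓝 x) := by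
  have h := (contMDiff_inv_smul_left (EG := EG) (E := E) (G := G) x).continuous.tendsto 1
  simpa using h

/-- The differential `dh⁻¹ : T_x X → T_{h⁻¹ x} X` of the action of `h⁻¹`. -/
noncomputable def pullVec (h : G) (x : X) (v : TangentSpace 𝓘(ℝ, E) x) :
    TangentSpace 𝓘(ℝ, E) (h⁻¹ • x) :=
  mfderiv 𝓘(ℝ, E) 𝓘(ℝ, E) (fun y : X => h⁻¹ • y) x v

/-- The generated field is a partial derivative of (h, x) ↦ h⁻¹x on G × X; this gives its smoothness
and lets differentiation in h and in x be interchanged. -/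
lemma fundField_eq (K : GroupLieAlgebra 𝓘(ℝ, EG) G) (x : X) :
    (fundField K x : E) = mfderiv (𝓘(ℝ, EG).prod 𝓘(ℝ, E)) 𝓘(ℝ, E)
      (fun p : G × X => p.1⁻¹ • p.2) (1, x) (pairVec (M := G) (1, x) K 0) := by
  have h := mfderiv_comp_apply (I' := 𝓘(ℝ, EG).prod 𝓘(ℝ, E)) (1 : G)
    (g := fun p : G × X => p.1⁻¹ • p.2) (f := fun h : G => (h, x))
    ((contMDiff_inv_smul (EG := EG) (E := E)).mdifferentiable (by simp) (1, x))
    (mdifferentiableAt_id.prodMk mdifferentiableAt_const) K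
  rw [mfderiv_prod_left] at h
  exact h

lemma smoothFieldAt_fundField (K : GroupLieAlgebra 𝓘(ℝ, EG) G) (x : X) :
    SmoothFieldAt 𝓘(ℝ, E) (fundField K : ∀ x : X, TangentSpace 𝓘(ℝ, E) x) x := by
  have h1 : ContMDiff (𝓘(ℝ, EG).prod 𝓘(ℝ, E)).tangent 𝓘(ℝ, E).tangent ∞
      (tangentMap (𝓘(ℝ, EG).prod 𝓘(ℝ, E)) 𝓘(ℝ, E) (fun p : G × X => p.1⁻¹ • p.2)) :=
    contMDiff_inv_smul.contMDiff_tangentMap (by simp)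
  have h2 : SmoothFieldAt (𝓘(ℝ, EG).prod 𝓘(ℝ, E))
      (prodField (FiberBundle.extend EG K : ∀ g : G, TangentSpace 𝓘(ℝ, EG) g)
        (fun y : X => (0 : TangentSpace 𝓘(ℝ, E) y))) (1, x) :=
    smoothFieldAt_prodField (smoothFieldAt_extend (I := 𝓘(ℝ, EG)) (x := (1 : G)) K)
      (contMDiff_zeroSection ℝ (TangentSpace 𝓘(ℝ, E))).contMDiffAt
  have h3 : ContMDiffAt 𝓘(ℝ, E) (𝓘(ℝ, EG).prod 𝓘(ℝ, E)) ∞ (fun y : X => ((1 : G), y)) x :=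
    contMDiffAt_const.prodMk contMDiffAt_id
  refine ((h1.contMDiffAt.comp _ h2).comp x h3).congr_of_eventuallyEq
    (Filter.Eventually.of_forall fun y => ?_)
  -- The points 1⁻¹y and y are equal but not by definition; tangent vectors at them are compared as
  -- elements of the model space.
  have h4 : ∀ (a b : X) (u v : E), a = b → u = v →
      (⟨a, u⟩ : TangentBundle 𝓘(ℝ, E) X) = ⟨b, v⟩ := by
    rintro a b u v rfl rfl; rfl
  refine h4 _ _ _ _ (by simp) ((fundField_eq K y).trans ?_)
  simp only [prodField, FiberBundle.extend_apply_self]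
  rfl

/-- `df` along the field of `K`, as a derivative on the product `G × X`. -/
lemma mvfderiv_inv_smul_fst {F : Type*} [NormedAddCommGroup F] [NormedSpace ℝ F] {f : X → F} {x : X}
    (hf : MDifferentiableAt 𝓘(ℝ, E) 𝓘(ℝ, F) f x) (K : GroupLieAlgebra 𝓘(ℝ, EG) G) :
    mvfderiv (𝓘(ℝ, EG).prod 𝓘(ℝ, E)) (fun p : G × X => f (p.1⁻¹ • p.2)) (1, x)
      (pairVec (M := G) (1, x) K 0) = mvfderiv 𝓘(ℝ, E) f x (fundField K x) := by
  have h1 : ∀ (a b : X) (u v : E), a = b → u = v →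
      mvfderiv 𝓘(ℝ, E) f a u = mvfderiv 𝓘(ℝ, E) f b v := by
    rintro a b u v rfl rfl; rfl
  have h2 : (fun p : G × X => p.1⁻¹ • p.2) (1, x) = x := by simp
  rw [mvfderiv_comp_vec (I := 𝓘(ℝ, E)) (φ := fun p : G × X => p.1⁻¹ • p.2) _ (by simpa using hf)
    (contMDiff_inv_smul.mdifferentiable (by simp) _)]
  exact h1 _ _ _ _ h2 (fundField_eq K x).symm

lemma mdifferentiableAt_comp_inv_smul {F : Type*} [NormedAddCommGroup F] [NormedSpace ℝ F]
    {f : X → F} {x : X} (hf : MDifferentiableAt 𝓘(ℝ, E) 𝓘(ℝ, F) f x) :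
    MDifferentiableAt 𝓘(ℝ, EG) 𝓘(ℝ, F) (fun h : G => f (h⁻¹ • x)) 1 :=
  MDifferentiableAt.comp (I' := 𝓘(ℝ, E)) (g := f) (f := fun h : G => h⁻¹ • x) (1 : G)
    (by simpa using hf) ((contMDiff_inv_smul_left x).mdifferentiable (by simp) 1)

lemma mvfderiv_comp_inv_smul {F : Type*} [NormedAddCommGroup F] [NormedSpace ℝ F]
    {f : X → F} {x : X} (hf : MDifferentiableAt 𝓘(ℝ, E) 𝓘(ℝ, F) f x)
    (K : GroupLieAlgebra 𝓘(ℝ, EG) G) :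
    mvfderiv 𝓘(ℝ, EG) (fun h : G => f (h⁻¹ • x)) 1 K
      = mvfderiv 𝓘(ℝ, E) f x (fundField K x) := by
  have h2 : (fun h : G => h⁻¹ • x) 1 = x := by simp
  have h1 : ∀ (a b : X) (u : E), a = b → mvfderiv 𝓘(ℝ, E) f a u = mvfderiv 𝓘(ℝ, E) f b u := by
    rintro a b u rfl; rfl
  rw [mvfderiv_comp_vec (I := 𝓘(ℝ, E)) (φ := fun h : G => h⁻¹ • x) _ (by simpa using hf)
    ((contMDiff_inv_smul_left x).mdifferentiable (by simp) 1)]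
  exact h1 _ _ _ h2

section Core

variable {F : Type*} [NormedAddCommGroup F] [NormedSpace ℝ F] {f : X → F} {x : X}
  {V : ∀ y : X, TangentSpace 𝓘(ℝ, E) y}

lemma contMDiffAt_comp_inv_smul (hf : ContMDiffAt 𝓘(ℝ, E) 𝓘(ℝ, F) ∞ f x) :
    ContMDiffAt (𝓘(ℝ, EG).prod 𝓘(ℝ, E)) 𝓘(ℝ, F) ∞ (fun p : G × X => f (p.1⁻¹ • p.2)) (1, x) :=
  ContMDiffAt.comp (g := f) (f := fun p : G × X => p.1⁻¹ • p.2) (1, x) (by simpa using hf)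
    contMDiff_inv_smul.contMDiffAt

lemma smoothFieldAt_prodField_zero (hV : SmoothFieldAt 𝓘(ℝ, E) V x) :
    SmoothFieldAt (𝓘(ℝ, EG).prod 𝓘(ℝ, E))
      (prodField (fun g : G => (0 : TangentSpace 𝓘(ℝ, EG) g)) V) (1, x) :=
  smoothFieldAt_prodField (contMDiff_zeroSection ℝ (TangentSpace 𝓘(ℝ, EG))).contMDiffAt hV

/-- The chain rule for y ↦ h⁻¹y: transport of a vector becomes a derivative of f(h⁻¹y) in the
direction of X. -/
lemma eventually_mvfderiv_pullVec (hf : ContMDiffAt 𝓘(ℝ, E) 𝓘(ℝ, F) ∞ f x) :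
    ∀ᶠ h : G in 𝓝 1, mvfderiv 𝓘(ℝ, E) f (h⁻¹ • x) (pullVec h x (V x))
      = mvfderiv (𝓘(ℝ, EG).prod 𝓘(ℝ, E)) (fun p : G × X => f (p.1⁻¹ • p.2)) (h, x)
        (prodField (fun g : G => (0 : TangentSpace 𝓘(ℝ, EG) g)) V (h, x)) := by
  have hd : ∀ᶠ y in 𝓝 x, MDifferentiableAt 𝓘(ℝ, E) 𝓘(ℝ, F) f y := by
    filter_upwards [(contMDiffAt_iff_contMDiffAt_nhds (n := 1) (by simp)).1
      (hf.of_le (by simp))] with y hy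
    exact hy.mdifferentiableAt (by simp)
  filter_upwards [(continuousAt_inv_smul EG E (G := G) x).eventually hd] with h hh
  have h1 : MDifferentiableAt (𝓘(ℝ, EG).prod 𝓘(ℝ, E)) 𝓘(ℝ, F)
      (fun p : G × X => f (p.1⁻¹ • p.2)) (h, x) :=
    MDifferentiableAt.comp (I' := 𝓘(ℝ, E)) (g := f) (f := fun p : G × X => p.1⁻¹ • p.2) (h, x) hh
      (contMDiff_inv_smul.mdifferentiable (by simp) _)
  exact (mvfderiv_comp_vec (φ := fun y : X => h⁻¹ • y) x hh
    ((contMDiff_inv_smul_right EG E h).mdifferentiable (by simp) x) (V x)).symm.trans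
    (mvfderiv_slice_snd h1 (V x))

lemma mdifferentiableAt_mvfderiv_pullVec (hf : ContMDiffAt 𝓘(ℝ, E) 𝓘(ℝ, F) ∞ f x)
    (hV : SmoothFieldAt 𝓘(ℝ, E) V x) :
    MDifferentiableAt 𝓘(ℝ, EG) 𝓘(ℝ, F)
      (fun h : G => mvfderiv 𝓘(ℝ, E) f (h⁻¹ • x) (pullVec h x (V x))) 1 := by
  have h1 := contMDiffAt_mvfderiv_apply (contMDiffAt_comp_inv_smul (EG := EG) (G := G) hf)
    (smoothFieldAt_prodField_zero hV)
  refine MDifferentiableAt.congr_of_eventuallyEq ?_ (eventually_mvfderiv_pullVec (EG := EG) hf)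
  exact MDifferentiableAt.comp (f := fun h : G => (h, x)) (1 : G)
    (h1.mdifferentiableAt (by simp)) (mdifferentiableAt_id.prodMk mdifferentiableAt_const)

/-- The derivative at `1` of `h ↦ df(dh⁻¹ v)` is `V(K f)`, if `V` extends `v`. -/
lemma mvfderiv_mvfderiv_pullVec (hf : ContMDiffAt 𝓘(ℝ, E) 𝓘(ℝ, F) ∞ f x)
    (hV : SmoothFieldAt 𝓘(ℝ, E) V x) (K : GroupLieAlgebra 𝓘(ℝ, EG) G) :
    mvfderiv 𝓘(ℝ, EG) (fun h : G => mvfderiv 𝓘(ℝ, E) f (h⁻¹ • x) (pullVec h x (V x))) 1 K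
      = mvfderiv 𝓘(ℝ, E) (fun y => mvfderiv 𝓘(ℝ, E) f y (fundField K y)) x (V x) := by
  have : CompleteSpace E := FiniteDimensional.complete ℝ E
  have : CompleteSpace EG := FiniteDimensional.complete ℝ EG
  set Φ : G × X → F := fun p => f (p.1⁻¹ • p.2) with hΦ
  have hΦs := contMDiffAt_comp_inv_smul (EG := EG) (G := G) hf
  have hK := smoothFieldAt_extend (I := 𝓘(ℝ, EG)) (x := (1 : G)) K
  have h0 : SmoothFieldAt 𝓘(ℝ, E) (fun y : X => (0 : TangentSpace 𝓘(ℝ, E) y)) x :=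
    (contMDiff_zeroSection ℝ (TangentSpace 𝓘(ℝ, E))).contMDiffAt
  have h0' : SmoothFieldAt 𝓘(ℝ, EG) (fun y : G => (0 : TangentSpace 𝓘(ℝ, EG) y)) 1 :=
    (contMDiff_zeroSection ℝ (TangentSpace 𝓘(ℝ, EG))).contMDiffAt
  have hU : SmoothFieldAt (𝓘(ℝ, EG).prod 𝓘(ℝ, E))
      (prodField (FiberBundle.extend EG K : ∀ g : G, TangentSpace 𝓘(ℝ, EG) g)
        (fun y : X => (0 : TangentSpace 𝓘(ℝ, E) y))) (1, x) := smoothFieldAt_prodField hK h0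
  have hW := smoothFieldAt_prodField_zero (EG := EG) (G := G) hV
  have hb := mvfderiv_mlieBracket (hΦs.of_le two_le_infty) hU.diffFieldAt hW.diffFieldAt
  -- The fields (K, 0) and (0, V) on G × X commute, so the derivatives in the two directions may be
  -- taken in either order.
  have hz : mlieBracket (𝓘(ℝ, EG).prod 𝓘(ℝ, E))
      (prodField (FiberBundle.extend EG K : ∀ g : G, TangentSpace 𝓘(ℝ, EG) g)
        (fun y : X => (0 : TangentSpace 𝓘(ℝ, E) y)))
      (prodField (fun g : G => (0 : TangentSpace 𝓘(ℝ, EG) g)) V) (1, x) = 0 := by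
    rw [mlieBracket_prodField (z := ((1 : G), x)) hK h0' h0 hV]
    have e1 : (fun g : G => (0 : TangentSpace 𝓘(ℝ, EG) g)) = 0 := rfl
    have e2 : (fun g : X => (0 : TangentSpace 𝓘(ℝ, E) g)) = 0 := rfl
    rw [e1, e2, mlieBracket_zero_right, mlieBracket_zero_left]
    rfl
  rw [hz, map_zero] at hb
  have hb' := sub_eq_zero.1 hb.symm
  have d1 := contMDiffAt_mvfderiv_apply hΦs hW
  have d2 := contMDiffAt_mvfderiv_apply hΦs hU
  rw [mvfderiv_congr (eventually_mvfderiv_pullVec (EG := EG) hf)]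
  have s1 := mvfderiv_slice_fst (z := ((1 : G), x)) (d1.mdifferentiableAt (by simp)) K
  have s2 := mvfderiv_slice_snd (z := ((1 : G), x)) (d2.mdifferentiableAt (by simp)) (V x)
  refine s1.trans (Eq.trans ?_ (hb'.trans (s2.symm.trans ?_)))
  · congr 1
    simp only [prodField, FiberBundle.extend_apply_self]
  · refine DFunLike.congr_fun (mvfderiv_congr ?_) _
    have hd : ∀ᶠ y in 𝓝 x, MDifferentiableAt 𝓘(ℝ, E) 𝓘(ℝ, F) f y := by
      filter_upwards [(contMDiffAt_iff_contMDiffAt_nhds (n := 1) (by simp)).1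
        (hf.of_le (by simp))] with y hy
      exact hy.mdifferentiableAt (by simp)
    filter_upwards [hd] with y hy
    rw [← mvfderiv_inv_smul_fst hy K]
    simp only [prodField, FiberBundle.extend_apply_self]

end Core

end SmoothAction

/-! ### Leibniz rule for finite sums -/

section SumSmul

variable {E : Type*} [NormedAddCommGroup E] [NormedSpace ℝ E]
  {H : Type*} [TopologicalSpace H] {I : ModelWithCorners ℝ E H}
  {X : Type*} [TopologicalSpace X] [ChartedSpace H X]
  {F : Type*} [NormedAddCommGroup F] [NormedSpace ℝ F] {x : X}

lemma mvfderiv_real_smul {c : X → ℝ} {a : X → F} (hc : MDifferentiableAt I 𝓘(ℝ, ℝ) c x)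
    (ha : MDifferentiableAt I 𝓘(ℝ, F) a x) (u : TangentSpace I x) :
    mvfderiv I (fun y => c y • a y) x u = mvfderiv I c x u • a x + c x • mvfderiv I a x u := by
  have h := DFunLike.congr_fun (mvfderiv_smul hc ha) u
  refine Eq.trans h ?_
  rw [add_comm]
  rfl

lemma mdifferentiableAt_sum_smul {κ : Type*} (σ : Finset κ) {c : κ → X → ℝ} {a : κ → X → F}
    (hc : ∀ i, MDifferentiableAt I 𝓘(ℝ, ℝ) (c i) x)
    (ha : ∀ i, MDifferentiableAt I 𝓘(ℝ, F) (a i) x) :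
    MDifferentiableAt I 𝓘(ℝ, F) (fun y => ∑ i ∈ σ, c i y • a i y) x := by
  classical
  induction σ using Finset.induction_on with
  | empty => simpa using mdifferentiableAt_const
  | insert i σ hi ih =>
    simp only [Finset.sum_insert hi]
    exact MDifferentiableAt.add (MDifferentiableAt.smul (hc i) (ha i)) ih

lemma mvfderiv_sum_smul {κ : Type*} (σ : Finset κ) {c : κ → X → ℝ} {a : κ → X → F}
    (hc : ∀ i, MDifferentiableAt I 𝓘(ℝ, ℝ) (c i) x)
    (ha : ∀ i, MDifferentiableAt I 𝓘(ℝ, F) (a i) x) (u : TangentSpace I x) :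
    mvfderiv I (fun y => ∑ i ∈ σ, c i y • a i y) x u
      = ∑ i ∈ σ, (mvfderiv I (c i) x u • a i x + c i x • mvfderiv I (a i) x u) := by
  classical
  induction σ using Finset.induction_on with
  | empty => simp [mvfderiv_const]
  | insert i σ hi ih =>
    simp only [Finset.sum_insert hi]
    rw [← ih, ← mvfderiv_real_smul (hc i) (ha i) u]
    exact DFunLike.congr_fun
      (mvfderiv_fun_add ((hc i).smul (ha i)) (mdifferentiableAt_sum_smul σ hc ha)) u

end SumSmul

/-! ### Derivative of a transported one-form -/

section OneForm

variable {EG : Type*} [NormedAddCommGroup EG] [NormedSpace ℝ EG] [FiniteDimensional ℝ EG]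
  {G : Type*} [TopologicalSpace G] [ChartedSpace EG G] [Group G] [LieGroup 𝓘(ℝ, EG) ∞ G]
  {E : Type*} [NormedAddCommGroup E] [NormedSpace ℝ E] [FiniteDimensional ℝ E]
  {X : Type*} [TopologicalSpace X] [ChartedSpace E X] [IsManifold 𝓘(ℝ, E) ∞ X]
  [MulAction G X] [ContMDiffSMul 𝓘(ℝ, EG) 𝓘(ℝ, E) ∞ G X]

lemma pullVec_one (x : X) (v : TangentSpace 𝓘(ℝ, E) x) : (pullVec (1 : G) x v : E) = v := by
  have h : ∀ f : X → X, f = id → (mfderiv 𝓘(ℝ, E) 𝓘(ℝ, E) f x v : E) = v := by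
    rintro f rfl
    rw [mfderiv_id]
    rfl
  exact h _ (funext fun y => by simp)

lemma mvfderiv_pullVec_one {F : Type*} [NormedAddCommGroup F] [NormedSpace ℝ F] (f : X → F) {x : X}
    (v : TangentSpace 𝓘(ℝ, E) x) :
    mvfderiv 𝓘(ℝ, E) f ((1 : G)⁻¹ • x) (pullVec (1 : G) x v) = mvfderiv 𝓘(ℝ, E) f x v := by
  have h : ∀ (a : X) (u : E), a = x → u = v →
      mvfderiv 𝓘(ℝ, E) f a u = mvfderiv 𝓘(ℝ, E) f x v := by
    rintro a u rfl rfl; rfl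
  exact h _ _ (by simp) (pullVec_one x v)

/-- A family of linear forms on the tangent spaces that is differentiable at `x` on fields smooth
at `x`. -/
structure IsDiffOneForm (q : ∀ y : X, TangentSpace 𝓘(ℝ, E) y → ℝ) (x : X) : Prop where
  add : ∀ y u v, q y (u + v) = q y u + q y v
  smul : ∀ y (r : ℝ) u, q y (r • u) = r * q y u
  diff : ∀ {B : ∀ y : X, TangentSpace 𝓘(ℝ, E) y}, SmoothFieldAt 𝓘(ℝ, E) B x →
    MDifferentiableAt 𝓘(ℝ, E) 𝓘(ℝ, ℝ) (fun y => q y (B y)) x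

namespace IsDiffOneForm

variable {q : ∀ y : X, TangentSpace 𝓘(ℝ, E) y → ℝ} {x : X}
  {V : ∀ y : X, TangentSpace 𝓘(ℝ, E) y}

lemma map_sum (hq : IsDiffOneForm q x) {κ : Type*} (σ : Finset κ) (y : X)
    (u : κ → TangentSpace 𝓘(ℝ, E) y) : q y (∑ i ∈ σ, u i) = ∑ i ∈ σ, q y (u i) := by
  classical
  induction σ using Finset.induction_on with
  | empty =>
    have := hq.smul y 0 0
    simpa using this
  | insert i σ hi ih => rw [Finset.sum_insert hi, Finset.sum_insert hi, hq.add, ih]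

/-- Transport of a one-form by the action. -/
lemma pullVec_aux (hq : IsDiffOneForm q x) (hV : SmoothFieldAt 𝓘(ℝ, E) V x)
    (K : GroupLieAlgebra 𝓘(ℝ, EG) G) :
    MDifferentiableAt 𝓘(ℝ, EG) 𝓘(ℝ, ℝ) (fun h : G => q (h⁻¹ • x) (pullVec h x (V x))) 1 ∧
    mvfderiv 𝓘(ℝ, EG) (fun h : G => q (h⁻¹ • x) (pullVec h x (V x))) 1 K
      = mvfderiv 𝓘(ℝ, E) (fun y => q y (V y)) x (fundField K x)
        - q x (mlieBracket 𝓘(ℝ, E) (fundField K) V x) := by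
  have : CompleteSpace E := FiniteDimensional.complete ℝ E
  obtain ⟨f, B, hf, hB, hfB⟩ := exists_coordinate_frame (E := E) x
  have hqB := fun i => hq.diff (hB i)
  have hK := smoothFieldAt_fundField (E := E) K x
  -- The transported vector is expanded in the coordinate fields at h⁻¹x: each term is then a
  -- derivative of f_i along the transported vector times a function composed with the action, both
  -- differentiable in h.
  have e1 : (fun h : G => q (h⁻¹ • x) (pullVec h x (V x))) =ᶠ[𝓝 1] fun h =>
      ∑ i, mvfderiv 𝓘(ℝ, E) (f i) (h⁻¹ • x) (pullVec h x (V x))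
        • q (h⁻¹ • x) (B i (h⁻¹ • x)) := by
    filter_upwards [(continuousAt_inv_smul EG E x).eventually hfB] with h hh
    conv_lhs => rw [hh (pullVec h x (V x))]
    rw [hq.map_sum]
    exact Finset.sum_congr rfl fun i _ => hq.smul _ _ _
  have e2 : (fun y => q y (V y)) =ᶠ[𝓝 x] fun y =>
      ∑ i, mvfderiv 𝓘(ℝ, E) (f i) y (V y) • q y (B i y) := by
    filter_upwards [hfB] with y hy
    conv_lhs => rw [hy (V y)]
    rw [hq.map_sum]
    exact Finset.sum_congr rfl fun i _ => hq.smul _ _ _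
  have c1 := fun i => mdifferentiableAt_mvfderiv_pullVec (EG := EG) (G := G) (hf i) hV
  have c2 := fun i => mdifferentiableAt_comp_inv_smul (EG := EG) (G := G) (hqB i)
  have c3 := fun i => (contMDiffAt_mvfderiv_apply (hf i) hV).mdifferentiableAt (by simp)
  refine ⟨(mdifferentiableAt_sum_smul _ c1 c2).congr_of_eventuallyEq e1, ?_⟩
  -- The coefficients of the bracket are K(V f_i) - V(K f_i). Differentiation in h produces V(K
  -- f_i), while q(V) differentiated along K produces K(V f_i); the bracket accounts for the
  -- difference.
  have hb : q x (mlieBracket 𝓘(ℝ, E) (fundField K) V x)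
      = ∑ i, (mvfderiv 𝓘(ℝ, E) (fun y => mvfderiv 𝓘(ℝ, E) (f i) y (V y)) x (fundField K x)
        - mvfderiv 𝓘(ℝ, E) (fun y => mvfderiv 𝓘(ℝ, E) (f i) y (fundField K y)) x (V x))
          * q x (B i x) := by
    conv_lhs => rw [hfB.self_of_nhds (mlieBracket 𝓘(ℝ, E) (fundField K) V x)]
    rw [hq.map_sum]
    refine Finset.sum_congr rfl fun i _ => ?_
    rw [hq.smul, mvfderiv_mlieBracket ((hf i).of_le two_le_infty) hK.diffFieldAt hV.diffFieldAt]
  have hp : ∀ i, mvfderiv 𝓘(ℝ, E) (f i) ((1 : G)⁻¹ • x) (pullVec (1 : G) x (V x))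
      = mvfderiv 𝓘(ℝ, E) (f i) x (V x) := fun i => mvfderiv_pullVec_one (f i) (V x)
  have hp' : ∀ i, q ((1 : G)⁻¹ • x) (B i ((1 : G)⁻¹ • x)) = q x (B i x) := fun i => by
    have : ∀ a : X, a = x → q a (B i a) = q x (B i x) := by rintro a rfl; rfl
    exact this _ (by simp)
  rw [mvfderiv_congr e1, mvfderiv_congr e2, mvfderiv_sum_smul _ c1 c2, mvfderiv_sum_smul _ c3 hqB,
    hb, ← Finset.sum_sub_distrib]
  refine Finset.sum_congr rfl fun i _ => ?_
  rw [mvfderiv_mvfderiv_pullVec (hf i) hV, mvfderiv_comp_inv_smul (hqB i), hp, hp']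
  simp only [smul_eq_mul]
  ring

end IsDiffOneForm

end OneForm

/-! ### The endomorphism that compares L_K with the projected connection -/

section MoveMap

variable {E : Type*} [NormedAddCommGroup E] [NormedSpace ℝ E] [FiniteDimensional ℝ E]
  {H : Type*} [TopologicalSpace H] {I : ModelWithCorners ℝ E H}
  {X : Type*} [TopologicalSpace X] [ChartedSpace H X] [IsManifold I ∞ X]
  {g : ∀ x : X, TangentSpace I x → TangentSpace I x → ℝ}
  {J : ∀ x : X, TangentSpace I x → TangentSpace I x}

/-- The endomorphism `v ↦ ∇_v K - B_K v` of the tangent space, `B` being the part of the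
Levi-Civita connection that anticommutes with `J`. On a field `V` that extends `v` it is the
difference of the projected derivative of `V` along `K` and of `[K, V]`. -/
noncomputable def moveMap (A : IsAlmostHermitian I g J) (K : ∀ x : X, TangentSpace I x) {x : X}
    (hK : DiffFieldAt I K x) : TangentSpace I x →ₗ[ℝ] TangentSpace I x where
  toFun v := leviCivita I g K x v - A.torsionMap x (K x) v
  map_add' u v := by rw [A.leviCivita_add_left hK, map_add]; module
  map_smul' r u := by rw [A.leviCivita_smul_left hK, map_smul, RingHom.id_apply]; module

variable (A : IsAlmostHermitian I g J) {K : ∀ x : X, TangentSpace I x} {x : X}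
  (hK : DiffFieldAt I K x)

lemma moveMap_apply (v : TangentSpace I x) :
    moveMap A K hK v = leviCivita I g K x v - A.torsionMap x (K x) v := rfl

/-- By absence of torsion ∇_V K = ∇_K V - [K, V]; subtracting B_K V leaves the projected derivative
of V. -/
lemma moveMap_field {V : ∀ x : X, TangentSpace I x} (hV : DiffFieldAt I V x) :
    moveMap A K hK (V x) = holoConn I g J V x (K x) - mlieBracket I K V x := by
  rw [moveMap_apply, A.torsionMap_apply hV, ← A.leviCivita_torsion hK hV]
  module

/-- The complex trace of an endomorphism that anticommutes with `J` vanishes. -/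
lemma sum_torsionMap_cplx {κ : Type*} [Fintype κ] {e : κ → TangentSpace I x}
    (he : IsOrthoFrame (g x) e) (u : TangentSpace I x) :
    ∑ a, g x (J x (A.torsionMap x u (e a))) (e a) = 0 := by
  have h := A.pointwise x
  have h1 := h.sum_frame_eq he (h.isOrthoFrame_cplx he)
    (Q := fun v w => g x (J x (A.torsionMap x u v)) w)
    { add_left := fun v w y => by simp only [map_add, h.J_add, h.add_left]
      add_right := fun v w y => by simp only [h.add_right]
      smul_left := fun r v w => by simp only [map_smul, h.J_smul, h.smul_left, smul_eq_mul]
      smul_right := fun r v w => by simp only [h.smul_right, smul_eq_mul] }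
  have h2 : ∀ a, g x (J x (A.torsionMap x u (J x (e a)))) (J x (e a))
      = -g x (J x (A.torsionMap x u (e a))) (e a) := fun a => by
    rw [A.torsionMap_cplx, h.J_isom, h.neg_left]
  simp only [h2, Finset.sum_neg_distrib] at h1
  linarith

lemma torsionMap_self_orth (u v : TangentSpace I x) : g x (A.torsionMap x u v) v = 0 := by
  have h := A.torsionMap_skew (x := x) u v v
  rw [(A.pointwise x).symm v] at h
  linarith

end MoveMap

/-! ### Infinitesimal invariance of g and J -/

section Invariance

variable {EG : Type*} [NormedAddCommGroup EG] [NormedSpace ℝ EG] [FiniteDimensional ℝ EG]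
  {G : Type*} [TopologicalSpace G] [ChartedSpace EG G] [Group G] [LieGroup 𝓘(ℝ, EG) ∞ G]
  {E : Type*} [NormedAddCommGroup E] [NormedSpace ℝ E] [FiniteDimensional ℝ E]
  {X : Type*} [TopologicalSpace X] [ChartedSpace E X] [IsManifold 𝓘(ℝ, E) ∞ X]
  [MulAction G X] [ContMDiffSMul 𝓘(ℝ, EG) 𝓘(ℝ, E) ∞ G X]
  {L : X → Type*} [∀ x, NormedAddCommGroup (L x)] [∀ x, InnerProductSpace ℂ (L x)]
  [TopologicalSpace (TotalSpace ℂ L)] [FiberBundle ℂ L]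
  [VectorBundle ℂ ℂ L] [VectorBundle ℝ ℂ L] [ContMDiffVectorBundle ∞ ℂ L 𝓘(ℝ, E)]

namespace PrequantumData

variable (P : PrequantumData EG G E X L) {x : X} {V W b : ∀ y : X, TangentSpace 𝓘(ℝ, E) y}

lemma metric_pullVec (h : G) (u v : TangentSpace 𝓘(ℝ, E) x) :
    P.metric (h⁻¹ • x) (pullVec h x u) (pullVec h x v) = P.metric x u v :=
  P.metric_inv h⁻¹ x u v

lemma cplx_pullVec (h : G) (u : TangentSpace 𝓘(ℝ, E) x) :
    P.cplx (h⁻¹ • x) (pullVec h x u) = pullVec h x (P.cplx x u) :=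
  (P.J_inv h⁻¹ x u).symm

lemma isDiffOneForm_metric (hb : SmoothFieldAt 𝓘(ℝ, E) b x) :
    IsDiffOneForm (fun y u => P.metric y u (b y)) x where
  add y u v := (P.isHermitianPair y).add_left _ _ _
  smul y r u := (P.isHermitianPair y).smul_left _ _ _
  diff hB := (P.isAlmostHermitian.metric_smooth hB hb).mdifferentiableAt (by simp)

lemma isDiffOneForm_metric_cplx (hb : SmoothFieldAt 𝓘(ℝ, E) b x) :
    IsDiffOneForm (fun y u => P.metric y (P.cplx y u) (b y)) x where
  add y u v := by rw [(P.isHermitianPair y).J_add, (P.isHermitianPair y).add_left]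
  smul y r u := by rw [(P.isHermitianPair y).J_smul, (P.isHermitianPair y).smul_left]
  diff hB := (P.isAlmostHermitian.metric_smooth (P.isAlmostHermitian.cplx_smooth hB)
    hb).mdifferentiableAt (by simp)

/-- The fundamental fields preserve the almost complex structure. -/
lemma mlieBracket_fundField_cplx (K : GroupLieAlgebra 𝓘(ℝ, EG) G)
    (hV : SmoothFieldAt 𝓘(ℝ, E) V x) :
    mlieBracket 𝓘(ℝ, E) (fundField K) (fun y => P.cplx y (V y)) x
      = P.cplx x (mlieBracket 𝓘(ℝ, E) (fundField K) V x) := by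
  refine (P.isHermitianPair x).eq_of_forall fun w => ?_
  obtain ⟨b, hb, hbx⟩ : ∃ b : ∀ y : X, TangentSpace 𝓘(ℝ, E) y,
      SmoothFieldAt 𝓘(ℝ, E) b x ∧ b x = w :=
    ⟨_, smoothFieldAt_extend w, FiberBundle.extend_apply_self _ _⟩
  -- By invariance of J, the one-form g(·, b) on J V and the one-form g(J·, b) on V transport to the
  -- same function of h. Their derivatives at 1 agree, and so do the terms without bracket.
  have h1 := ((P.isDiffOneForm_metric hb).pullVec_aux
    (P.isAlmostHermitian.cplx_smooth hV) K).2
  have h2 := ((P.isDiffOneForm_metric_cplx hb).pullVec_aux hV K).2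
  simp only [P.cplx_pullVec] at h2
  rw [h1] at h2
  rw [← hbx]
  linarith

/-- The fundamental fields are Killing fields. -/
lemma mvfderiv_metric_fundField (K : GroupLieAlgebra 𝓘(ℝ, EG) G)
    (hV : SmoothFieldAt 𝓘(ℝ, E) V x) (hW : SmoothFieldAt 𝓘(ℝ, E) W x) :
    mvfderiv 𝓘(ℝ, E) (fun y => P.metric y (V y) (W y)) x (fundField K x)
      = P.metric x (mlieBracket 𝓘(ℝ, E) (fundField K) V x) (W x)
        + P.metric x (V x) (mlieBracket 𝓘(ℝ, E) (fundField K) W x) := by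
  have : CompleteSpace E := FiniteDimensional.complete ℝ E
  obtain ⟨f, B, hf, hB, hfB⟩ := exists_coordinate_frame (E := E) x
  have hK := smoothFieldAt_fundField (E := E) K x
  have expand : ∀ (y : X) (u : TangentSpace 𝓘(ℝ, E) y) (c : Fin (finrank ℝ E) → ℝ),
      P.metric y u (∑ i, c i • B i y) = ∑ i, c i • P.metric y u (B i y) := by
    intro y u c
    rw [(P.isHermitianPair y).sum_right]
    exact Finset.sum_congr rfl fun i _ => (P.isHermitianPair y).smul_right _ _ _
  -- By invariance the transported product is constant in h. Only W is expanded in coordinate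
  -- fields, so that the rule for one-forms applies to V.
  have e1 : (fun _ : G => P.metric x (V x) (W x)) =ᶠ[𝓝 1] fun h =>
      ∑ i, mvfderiv 𝓘(ℝ, E) (f i) (h⁻¹ • x) (pullVec h x (W x))
        • P.metric (h⁻¹ • x) (pullVec h x (V x)) (B i (h⁻¹ • x)) := by
    filter_upwards [(continuousAt_inv_smul EG E x).eventually hfB] with h hh
    rw [← expand, ← hh (pullVec h x (W x)), P.metric_pullVec]
  have e2 : (fun y => P.metric y (V y) (W y)) =ᶠ[𝓝 x] fun y =>
      ∑ i, mvfderiv 𝓘(ℝ, E) (f i) y (W y) • P.metric y (V y) (B i y) := by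
    filter_upwards [hfB] with y hy
    rw [← expand, ← hy (W y)]
  have c0 := fun i => (P.isDiffOneForm_metric (hB i)).pullVec_aux hV K
  have c1 := fun i => mdifferentiableAt_mvfderiv_pullVec (EG := EG) (G := G) (hf i) hW
  have c3 := fun i => (contMDiffAt_mvfderiv_apply (hf i) hW).mdifferentiableAt (by simp)
  have c4 := fun i => (P.isDiffOneForm_metric (hB i)).diff hV
  have hp : ∀ i, P.metric ((1 : G)⁻¹ • x) (pullVec (1 : G) x (V x)) (B i ((1 : G)⁻¹ • x))
      = P.metric x (V x) (B i x) := fun i => by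
    have : ∀ (a : X) (u : E), a = x → u = V x →
        P.metric a u (B i a) = P.metric x (V x) (B i x) := by rintro a u rfl rfl; rfl
    exact this _ _ (by simp) (pullVec_one x (V x))
  have h1 := mvfderiv_sum_smul Finset.univ c1 (fun i => (c0 i).1) K
  rw [← mvfderiv_congr e1, mvfderiv_const] at h1
  have hbr : ∀ u : TangentSpace 𝓘(ℝ, E) x,
      P.metric x u (mlieBracket 𝓘(ℝ, E) (fundField K) W x)
      = ∑ i, (mvfderiv 𝓘(ℝ, E) (fun y => mvfderiv 𝓘(ℝ, E) (f i) y (W y)) x (fundField K x)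
        - mvfderiv 𝓘(ℝ, E) (fun y => mvfderiv 𝓘(ℝ, E) (f i) y (fundField K y)) x (W x))
          • P.metric x u (B i x) := by
    intro u
    conv_lhs => rw [hfB.self_of_nhds (mlieBracket 𝓘(ℝ, E) (fundField K) W x), expand]
    refine Finset.sum_congr rfl fun i _ => ?_
    rw [mvfderiv_mlieBracket ((hf i).of_le two_le_infty) hK.diffFieldAt hW.diffFieldAt]
  have hW' : P.metric x (mlieBracket 𝓘(ℝ, E) (fundField K) V x) (W x)
      = ∑ i, mvfderiv 𝓘(ℝ, E) (f i) x (W x)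
        • P.metric x (mlieBracket 𝓘(ℝ, E) (fundField K) V x) (B i x) := by
    rw [← expand, ← hfB.self_of_nhds (W x)]
  rw [mvfderiv_congr e2, mvfderiv_sum_smul _ c3 c4, hbr, hW', ← Finset.sum_add_distrib]
  have h2 : (0 : ℝ) = ∑ i, (mvfderiv 𝓘(ℝ, E)
      (fun y => mvfderiv 𝓘(ℝ, E) (f i) y (fundField K y)) x (W x) • P.metric x (V x) (B i x)
      + mvfderiv 𝓘(ℝ, E) (f i) x (W x) •
        (mvfderiv 𝓘(ℝ, E) (fun y => P.metric y (V y) (B i y)) x (fundField K x)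
          - P.metric x (mlieBracket 𝓘(ℝ, E) (fundField K) V x) (B i x))) := by
    refine Eq.trans h1 (Finset.sum_congr rfl fun i _ => ?_)
    rw [(c0 i).2, mvfderiv_mvfderiv_pullVec (hf i) hW, hp, mvfderiv_pullVec_one]
  rw [← sub_eq_zero, ← Finset.sum_sub_distrib]
  refine Eq.trans (Finset.sum_congr rfl fun i _ => ?_) h2.symm
  simp only [smul_eq_mul]
  ring

variable (x) in
lemma diffFieldAt_fundField (K : GroupLieAlgebra 𝓘(ℝ, EG) G) :
    DiffFieldAt 𝓘(ℝ, E) (fundField K : ∀ y : X, TangentSpace 𝓘(ℝ, E) y) x :=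
  (smoothFieldAt_fundField K x).diffFieldAt

/-- The projected derivative along K and the bracket with K both obey the product rule for g, the
second because K is a Killing field. Their difference is therefore skew. -/
lemma moveMap_skew (K : GroupLieAlgebra 𝓘(ℝ, EG) G) (u v : TangentSpace 𝓘(ℝ, E) x) :
    P.metric x (moveMap P.isAlmostHermitian (fundField K) (diffFieldAt_fundField x K) u) v
      = -P.metric x u
        (moveMap P.isAlmostHermitian (fundField K) (diffFieldAt_fundField x K) v) := by
  have A := P.isAlmostHermitian
  have h := P.isHermitianPair x
  have hK := diffFieldAt_fundField (E := E) x K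
  obtain ⟨U, hU, rfl⟩ : ∃ b : ∀ y : X, TangentSpace 𝓘(ℝ, E) y,
      SmoothFieldAt 𝓘(ℝ, E) b x ∧ b x = u :=
    ⟨_, smoothFieldAt_extend u, FiberBundle.extend_apply_self _ _⟩
  obtain ⟨V, hV, rfl⟩ : ∃ b : ∀ y : X, TangentSpace 𝓘(ℝ, E) y,
      SmoothFieldAt 𝓘(ℝ, E) b x ∧ b x = v :=
    ⟨_, smoothFieldAt_extend v, FiberBundle.extend_apply_self _ _⟩
  have h1 := P.mvfderiv_metric_fundField K hU hV
  rw [A.holoConn_metric hU.diffFieldAt hV.diffFieldAt] at h1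
  rw [moveMap_field _ _ hU.diffFieldAt, moveMap_field _ _ hV.diffFieldAt, h.sub_left, h.sub_right]
  linarith

/-- Both the projected derivative along K and the bracket with K commute with J. -/
lemma moveMap_cplx (K : GroupLieAlgebra 𝓘(ℝ, EG) G) (u : TangentSpace 𝓘(ℝ, E) x) :
    moveMap P.isAlmostHermitian (fundField K) (diffFieldAt_fundField x K) (P.cplx x u)
      = P.cplx x
        (moveMap P.isAlmostHermitian (fundField K) (diffFieldAt_fundField x K) u) := by
  have A := P.isAlmostHermitian
  have h := P.isHermitianPair x
  obtain ⟨U, hU, rfl⟩ : ∃ b : ∀ y : X, TangentSpace 𝓘(ℝ, E) y,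
      SmoothFieldAt 𝓘(ℝ, E) b x ∧ b x = u :=
    ⟨_, smoothFieldAt_extend u, FiberBundle.extend_apply_self _ _⟩
  have e1 := moveMap_field A (diffFieldAt_fundField (E := E) x K) hU.diffFieldAt
  have e2 := moveMap_field A (diffFieldAt_fundField (E := E) x K) (A.cplx_diff hU.diffFieldAt)
  have e3 := P.mlieBracket_fundField_cplx K hU
  have e4 := A.holoConn_cplx hU.diffFieldAt (fundField K x)
  rw [e3, e4, ← h.J_sub] at e2
  exact e2.trans (congrArg (P.cplx x) e1.symm)

/-! ### Consequences of the closedness of `ω` -/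

lemma omega_eq (y : X) (u v : TangentSpace 𝓘(ℝ, E) y) :
    P.omega y u v = P.metric y (P.cplx y u) v := by
  have h := P.isHermitianPair y
  rw [h.J_left]
  simp only [metric, cplx]
  rw [P.J_sq, map_neg, neg_neg]

end PrequantumData

end Invariance

/-! ### Trace identities from dω = 0 -/

section Invariance

variable {EG : Type*} [NormedAddCommGroup EG] [NormedSpace ℝ EG] [FiniteDimensional ℝ EG]
  {G : Type*} [TopologicalSpace G] [ChartedSpace EG G] [Group G] [LieGroup 𝓘(ℝ, EG) ∞ G]
  {E : Type*} [NormedAddCommGroup E] [NormedSpace ℝ E] [FiniteDimensional ℝ E]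
  {X : Type*} [TopologicalSpace X] [ChartedSpace E X] [IsManifold 𝓘(ℝ, E) ∞ X]
  [MulAction G X] [ContMDiffSMul 𝓘(ℝ, EG) 𝓘(ℝ, E) ∞ G X]
  {L : X → Type*} [∀ x, NormedAddCommGroup (L x)] [∀ x, InnerProductSpace ℂ (L x)]
  [TopologicalSpace (TotalSpace ℂ L)] [FiberBundle ℂ L]
  [VectorBundle ℂ ℂ L] [VectorBundle ℝ ℂ L] [ContMDiffVectorBundle ∞ ℂ L 𝓘(ℝ, E)]

namespace PrequantumData

variable (P : PrequantumData EG G E X L) {x : X} {V W b : ∀ y : X, TangentSpace 𝓘(ℝ, E) y}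

/-- The cyclic sum of `g(J B_u v, w)` vanishes. -/
lemma cyclic_torsionMap (u v w : TangentSpace 𝓘(ℝ, E) x) :
    P.metric x (P.cplx x (P.isAlmostHermitian.torsionMap x u v)) w
      + P.metric x (P.cplx x (P.isAlmostHermitian.torsionMap x v w)) u
      + P.metric x (P.cplx x (P.isAlmostHermitian.torsionMap x w u)) v = 0 := by
  have A := P.isAlmostHermitian
  have h := P.isHermitianPair x
  obtain ⟨U, hU, rfl⟩ : ∃ b : ∀ y : X, TangentSpace 𝓘(ℝ, E) y,
      SmoothFieldAt 𝓘(ℝ, E) b x ∧ b x = u :=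
    ⟨_, smoothFieldAt_extend u, FiberBundle.extend_apply_self _ _⟩
  obtain ⟨V, hV, rfl⟩ : ∃ b : ∀ y : X, TangentSpace 𝓘(ℝ, E) y,
      SmoothFieldAt 𝓘(ℝ, E) b x ∧ b x = v :=
    ⟨_, smoothFieldAt_extend v, FiberBundle.extend_apply_self _ _⟩
  obtain ⟨W, hW, rfl⟩ : ∃ b : ∀ y : X, TangentSpace 𝓘(ℝ, E) y,
      SmoothFieldAt 𝓘(ℝ, E) b x ∧ b x = w :=
    ⟨_, smoothFieldAt_extend w, FiberBundle.extend_apply_self _ _⟩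
  have hc := P.omega_closed x U V W hU hV hW
  simp only [P.omega_eq] at hc
  -- As B anticommutes with J, ∇_u(J Y) = J∇_u Y - 2 J B_u Y. This expresses the derivative of ω(Y,
  -- Z) by ∇ and B.
  have hd : ∀ {Y Z : ∀ y : X, TangentSpace 𝓘(ℝ, E) y}, SmoothFieldAt 𝓘(ℝ, E) Y x →
      SmoothFieldAt 𝓘(ℝ, E) Z x → ∀ u,
      mvfderiv 𝓘(ℝ, E) (fun y => P.metric y (P.cplx y (Y y)) (Z y)) x u
        = P.metric x (P.cplx x (leviCivita 𝓘(ℝ, E) P.metric Y x u)) (Z x)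
          - 2 * P.metric x (P.cplx x (A.torsionMap x u (Y x))) (Z x)
          - P.metric x (Y x) (P.cplx x (leviCivita 𝓘(ℝ, E) P.metric Z x u)) := by
    intro Y Z hY hZ u
    have hJY := A.cplx_diff hY.diffFieldAt
    have e1 := A.torsionMap_apply hJY u
    have e2 := A.torsionMap_apply hY.diffFieldAt u
    have e3 : leviCivita 𝓘(ℝ, E) P.metric (fun y => P.cplx y (Y y)) x u
        = P.cplx x (leviCivita 𝓘(ℝ, E) P.metric Y x u)
          - (2 : ℝ) • P.cplx x (A.torsionMap x u (Y x)) := by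
      have e4 : leviCivita 𝓘(ℝ, E) P.metric (fun y => P.cplx y (Y y)) x u
          = A.torsionMap x u (P.cplx x (Y x))
            + holoConn 𝓘(ℝ, E) P.metric P.cplx (fun y => P.cplx y (Y y)) x u := by
        rw [e1]; abel
      rw [e4, A.torsionMap_cplx, A.holoConn_cplx hY.diffFieldAt, e2, h.J_sub]
      module
    rw [A.leviCivita_metric hJY hZ.diffFieldAt, e3, h.sub_left, h.smul_left,
      h.J_left (Y x)]
    ring
  -- With the brackets written as differences of covariant derivatives, every ∇ term in dω = 0
  -- cancels and the cyclic sum of the B terms remains.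
  rw [hd hV hW, hd hW hU, hd hU hV, ← A.leviCivita_torsion hU.diffFieldAt hV.diffFieldAt,
    ← A.leviCivita_torsion hV.diffFieldAt hW.diffFieldAt,
    ← A.leviCivita_torsion hW.diffFieldAt hU.diffFieldAt] at hc
  generalize leviCivita 𝓘(ℝ, E) P.metric V x (U x) = a1 at hc
  generalize leviCivita 𝓘(ℝ, E) P.metric W x (U x) = a2 at hc
  generalize leviCivita 𝓘(ℝ, E) P.metric W x (V x) = a3 at hc
  generalize leviCivita 𝓘(ℝ, E) P.metric U x (V x) = a4 at hc
  generalize leviCivita 𝓘(ℝ, E) P.metric U x (W x) = a5 at hc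
  generalize leviCivita 𝓘(ℝ, E) P.metric V x (W x) = a6 at hc
  generalize A.torsionMap x (U x) (V x) = b1 at hc ⊢
  generalize A.torsionMap x (V x) (W x) = b2 at hc ⊢
  generalize A.torsionMap x (W x) (U x) = b3 at hc ⊢
  generalize U x = u at hc ⊢
  generalize V x = v at hc ⊢
  generalize W x = w at hc ⊢
  rw [h.symm v, h.symm w, h.symm u (P.cplx x _)] at hc
  simp only [h.J_sub, h.sub_left] at hc
  linarith

/-- The trace of `B` over its first two arguments vanishes. -/
lemma sum_torsionMap_self {κ : Type*} [Fintype κ] {e : κ → TangentSpace 𝓘(ℝ, E) x}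
    (he : IsOrthoFrame (P.metric x) e) :
    ∑ a, P.isAlmostHermitian.torsionMap x (e a) (e a) = 0 := by
  have A := P.isAlmostHermitian
  have h := P.isHermitianPair x
  have hb : IsBilinearMap ℝ (fun u v => A.torsionMap x u v) :=
    { add_left := fun v w y => A.torsionMap_add_left _ _ _
      add_right := fun v w y => map_add _ _ _
      smul_left := fun r v w => A.torsionMap_smul_left _ _ _
      smul_right := fun r v w => map_smul _ _ _ }
  have h1 := h.sum_frame_eq he (h.isOrthoFrame_cplx he) hb
  -- The cyclic identity at u, J u and J(J v) gives this relation. Summed over a frame, and compared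
  -- with the frame J e, it makes the trace equal to its opposite.
  have key : ∀ u : TangentSpace 𝓘(ℝ, E) x,
      A.torsionMap x u u = -A.torsionMap x (P.cplx x u) (P.cplx x u) := by
    intro u
    refine h.eq_of_forall fun v => ?_
    have hc := P.cyclic_torsionMap u (P.cplx x u) (P.cplx x (P.cplx x v))
    have e1 : P.metric x (A.torsionMap x u (P.cplx x u)) (P.cplx x v)
        = -P.metric x (A.torsionMap x u u) v := by
      rw [A.torsionMap_cplx, h.neg_left, h.J_isom]
    have e2 : P.metric x (P.cplx x (A.torsionMap x (P.cplx x u) (P.cplx x (P.cplx x v)))) u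
        = -P.metric x (P.cplx x v) (A.torsionMap x (P.cplx x u) u) := by
      rw [A.torsionMap_cplx, h.J_neg, h.J_sq, neg_neg, A.torsionMap_skew]
    have e3 : P.metric x (-A.torsionMap x (P.cplx x u) (P.cplx x u)) v
        = -P.metric x (P.cplx x v) (A.torsionMap x (P.cplx x u) u) := by
      rw [A.torsionMap_cplx, neg_neg, h.J_left, h.symm]
    rw [h.J_isom, h.J_isom, torsionMap_self_orth A, e1, e2] at hc
    rw [e3]
    linarith
  have h2 : ∑ a, A.torsionMap x (P.cplx x (e a)) (P.cplx x (e a))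
      = -∑ a, A.torsionMap x (e a) (e a) := by
    rw [← Finset.sum_neg_distrib]
    exact Finset.sum_congr rfl fun a _ => by rw [key (e a), neg_neg]
  have h3 := h1.trans h2
  have h4 : (2 : ℝ) • ∑ a, A.torsionMap x (e a) (e a) = 0 := by
    rw [two_smul]
    nth_rewrite 1 [h3]
    exact neg_add_cancel _
  exact (smul_eq_zero.1 h4).resolve_left two_ne_zero

lemma sum_torsionMap_left {κ : Type*} [Fintype κ] {e : κ → TangentSpace 𝓘(ℝ, E) x}
    (he : IsOrthoFrame (P.metric x) e) (v : TangentSpace 𝓘(ℝ, E) x) :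
    ∑ a, P.metric x (P.isAlmostHermitian.torsionMap x (e a) v) (e a) = 0 := by
  have h := P.isHermitianPair x
  have h1 := congrArg (fun w => -P.metric x v w) (P.sum_torsionMap_self he)
  simp only [h.sum_right, h.zero_right, neg_zero] at h1
  rw [← h1, ← Finset.sum_neg_distrib]
  exact Finset.sum_congr rfl fun a _ => P.isAlmostHermitian.torsionMap_skew _ _ _

lemma sum_torsionMap_left_cplx {κ : Type*} [Fintype κ] {e : κ → TangentSpace 𝓘(ℝ, E) x}
    (he : IsOrthoFrame (P.metric x) e) (v : TangentSpace 𝓘(ℝ, E) x) :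
    ∑ a, P.metric x (P.cplx x (P.isAlmostHermitian.torsionMap x (e a) v)) (e a) = 0 := by
  have h := P.isHermitianPair x
  rw [← P.sum_torsionMap_left he (-P.cplx x v)]
  refine Finset.sum_congr rfl fun a _ => ?_
  rw [map_neg, P.isAlmostHermitian.torsionMap_cplx, neg_neg]

/-- The complex trace of `∇^{T^{(1,0)}} K` is that of the endomorphism `moveMap` of `K`. -/
lemma sum_moveMap (K : GroupLieAlgebra 𝓘(ℝ, EG) G) (x : X) :
    ∑ a, ((P.metric x (moveMap P.isAlmostHermitian (fundField K) (diffFieldAt_fundField x K)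
          (orthFrame 𝓘(ℝ, E) P.metric x a)) (orthFrame 𝓘(ℝ, E) P.metric x a) : ℂ)
        - Complex.I * (P.metric x (P.cplx x (moveMap P.isAlmostHermitian (fundField K)
          (diffFieldAt_fundField x K) (orthFrame 𝓘(ℝ, E) P.metric x a)))
            (orthFrame 𝓘(ℝ, E) P.metric x a) : ℂ)) / 2
      = trHolo 𝓘(ℝ, E) P.metric P.cplx (fundField K) x := by
  have A := P.isAlmostHermitian
  have h := P.isHermitianPair x
  have hK := diffFieldAt_fundField (E := E) x K
  have he := A.isOrthoFrame_orthFrame x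
  set o := orthFrame 𝓘(ℝ, E) P.metric x
  have hh : ∀ a, holoConn 𝓘(ℝ, E) P.metric P.cplx (fundField K) x (o a)
      = leviCivita 𝓘(ℝ, E) P.metric (fundField K) x (o a)
        - A.torsionMap x (o a) (fundField K x) := fun a => by
    rw [A.torsionMap_apply hK]
    abel
  -- The two endomorphisms differ by B_{e_a}K and B_K e_a: the first has vanishing trace by dω = 0,
  -- and the second is orthogonal to e_a.
  have s1 : ∑ a, P.metric x (moveMap A (fundField K) hK (o a)) (o a)
      = ∑ a, P.metric x (holoConn 𝓘(ℝ, E) P.metric P.cplx (fundField K) x (o a)) (o a) := by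
    rw [← sub_eq_zero, ← Finset.sum_sub_distrib, ← P.sum_torsionMap_left he (fundField K x)]
    refine Finset.sum_congr rfl fun a _ => ?_
    rw [hh, moveMap_apply, h.sub_left, h.sub_left, torsionMap_self_orth A]
    ring
  -- After composition with J the trace of B_K vanishes because B_K anticommutes with J; the other
  -- one reduces to the previous trace with K replaced by -J K.
  have s2 : ∑ a, P.metric x (P.cplx x (moveMap A (fundField K) hK (o a))) (o a)
      = ∑ a, P.metric x
        (P.cplx x (holoConn 𝓘(ℝ, E) P.metric P.cplx (fundField K) x (o a))) (o a) := by
    have h0 := sum_torsionMap_cplx A he (fundField K x)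
    have h1 := P.sum_torsionMap_left_cplx he (fundField K x)
    rw [← sub_eq_zero, ← Finset.sum_sub_distrib]
    have : ∀ a, P.metric x (P.cplx x (moveMap A (fundField K) hK (o a))) (o a) - P.metric x
        (P.cplx x (holoConn 𝓘(ℝ, E) P.metric P.cplx (fundField K) x (o a))) (o a)
        = P.metric x (P.cplx x (A.torsionMap x (o a) (fundField K x))) (o a)
          - P.metric x (P.cplx x (A.torsionMap x (fundField K x) (o a))) (o a) := fun a => by
      rw [hh, moveMap_apply, h.J_sub, h.J_sub, h.sub_left, h.sub_left]
      ring
    rw [Finset.sum_congr rfl fun a _ => this a, Finset.sum_sub_distrib, h0, h1, sub_zero]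
  rw [trHolo, ← Finset.sum_div, ← Finset.sum_div, Finset.sum_sub_distrib, Finset.sum_sub_distrib,
    ← Finset.mul_sum, ← Finset.mul_sum]
  have t1 := congrArg (fun r : ℝ => (r : ℂ)) s1
  have t2 := congrArg (fun r : ℝ => (r : ℂ)) s2
  push_cast at t1 t2
  rw [t1, t2]

end PrequantumData

end Invariance

/-! ### The lifted action in a local frame, and Kostant's formula on a line bundle -/

section LiftedAction

variable {EG : Type*} [NormedAddCommGroup EG] [NormedSpace ℝ EG] [FiniteDimensional ℝ EG]
  {G : Type*} [TopologicalSpace G] [ChartedSpace EG G] [Group G] [LieGroup 𝓘(ℝ, EG) ∞ G]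
  {E : Type*} [NormedAddCommGroup E] [NormedSpace ℝ E] [FiniteDimensional ℝ E]
  {X : Type*} [TopologicalSpace X] [T2Space X] [ChartedSpace E X] [IsManifold 𝓘(ℝ, E) ∞ X]
  [MulAction G X] [ContMDiffSMul 𝓘(ℝ, EG) 𝓘(ℝ, E) ∞ G X]
  {L : X → Type*} [∀ x, NormedAddCommGroup (L x)] [∀ x, InnerProductSpace ℂ (L x)]
  [TopologicalSpace (TotalSpace ℂ L)] [FiberBundle ℂ L]
  [VectorBundle ℂ ℂ L] [VectorBundle ℝ ℂ L] [ContMDiffVectorBundle ∞ ℂ L 𝓘(ℝ, E)]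

/-- `ℓ` is, near `(1, x)`, the coordinate of the lifted action in the local frame at `x`. -/
structure IsLiftCoord (ρ : LineLift EG G (E := E) L) (x : X) (ℓ : G × X → ℂ) : Prop where
  smooth : ContMDiffAt (𝓘(ℝ, EG).prod 𝓘(ℝ, E)) 𝓘(ℝ, ℂ) ∞ ℓ (1, x)
  one : ∀ᶠ y in 𝓝 x, ℓ (1, y) = 1
  tr : ∀ᶠ y in 𝓝 x, ∀ᶠ h in 𝓝 (1 : G),
    ρ.tr h y (localFrame L x (h⁻¹ • y)) = ℓ (h, y) • localFrame L x y

/-- Smoothness of the lift is given on global sections, so the frame at x is replaced by a global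
section with the same germ; for h near 1 the point h⁻¹y stays where the two agree. -/
lemma exists_isLiftCoord (ρ : LineLift EG G (E := E) L) (x : X) :
    ∃ ℓ : G × X → ℂ, IsLiftCoord ρ x ℓ := by
  obtain ⟨s, hs, hs'⟩ := exists_smooth_section (E := E) (mem_baseSet_self (L := L) x)
  have hb := eventually_mem_baseSet (mem_baseSet_self (L := L) x)
  refine ⟨fun p => fibreCoord L x p.2 (ρ.tr p.1 p.2 (s (p.1⁻¹ • p.2))), ?_, ?_, ?_⟩
  · have h1 := (ρ.smooth_act s hs).contMDiffAt (x := ((1 : G), x))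
    have h4 := (Trivialization.contMDiffAt_iff (IB := 𝓘(ℝ, E)) (e := trivializationAt ℂ L x)
      ((trivializationAt ℂ L x).mem_source.2 (mem_baseSet_self (L := L) x))).1 h1
    refine h4.2.congr_of_eventuallyEq ?_
    filter_upwards [(continuous_snd.tendsto ((1 : G), x)).eventually hb] with y hy
    exact fibreCoord_eq hy _
  · filter_upwards [hs', hb] with y hy hyb
    simp only [ρ.one_act s y, ← hy]
    exact fibreCoord_localFrame hyb
  · filter_upwards [hs'.eventually_nhds, hb] with y hy hyb
    filter_upwards [(continuousAt_inv_smul EG E y).eventually hy] with h hh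
    rw [hh]
    exact (fibreCoord_smul_localFrame hyb _).symm

namespace IsLiftCoord

variable {ρ : LineLift EG G (E := E) L} {x : X} {ℓ : G × X → ℂ}

lemma eventually_mdifferentiableAt (hℓ : IsLiftCoord ρ x ℓ) :
    ∀ᶠ y in 𝓝 x, MDifferentiableAt (𝓘(ℝ, EG).prod 𝓘(ℝ, E)) 𝓘(ℝ, ℂ) ℓ (1, y) := by
  have h1 : ContMDiffAt 𝓘(ℝ, E) (𝓘(ℝ, EG).prod 𝓘(ℝ, E)) ∞ (fun y : X => ((1 : G), y)) x :=
    contMDiffAt_const.prodMk contMDiffAt_id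
  filter_upwards [h1.continuousAt.eventually ((contMDiffAt_iff_contMDiffAt_nhds (n := 1)
    (by simp)).1 (hℓ.smooth.of_le (by simp)))] with y hy
  exact ContMDiffAt.mdifferentiableAt hy (by simp)

lemma mdifferentiableAt_slice {y : X}
    (hy : MDifferentiableAt (𝓘(ℝ, EG).prod 𝓘(ℝ, E)) 𝓘(ℝ, ℂ) ℓ (1, y)) :
    MDifferentiableAt 𝓘(ℝ, EG) 𝓘(ℝ, ℂ) (fun h : G => ℓ (h, y)) 1 :=
  MDifferentiableAt.comp (f := fun h : G => (h, y)) (1 : G) hy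
    (mdifferentiableAt_id.prodMk mdifferentiableAt_const)

lemma contMDiffAt_mvfderiv (hℓ : IsLiftCoord ρ x ℓ) (K : GroupLieAlgebra 𝓘(ℝ, EG) G) :
    ContMDiffAt 𝓘(ℝ, E) 𝓘(ℝ, ℂ) ∞
      (fun y => mvfderiv 𝓘(ℝ, EG) (fun h : G => ℓ (h, y)) 1 K) x := by
  have hK := smoothFieldAt_extend (I := 𝓘(ℝ, EG)) (x := (1 : G)) K
  have h0 : SmoothFieldAt 𝓘(ℝ, E) (fun y : X => (0 : TangentSpace 𝓘(ℝ, E) y)) x :=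
    (contMDiff_zeroSection ℝ (TangentSpace 𝓘(ℝ, E))).contMDiffAt
  have h1 := contMDiffAt_mvfderiv_apply hℓ.smooth (smoothFieldAt_prodField (z := ((1 : G), x)) hK h0)
  have h2 : ContMDiffAt 𝓘(ℝ, E) (𝓘(ℝ, EG).prod 𝓘(ℝ, E)) ∞ (fun y : X => ((1 : G), y)) x :=
    contMDiffAt_const.prodMk contMDiffAt_id
  refine (ContMDiffAt.comp (f := fun y : X => ((1 : G), y)) x h1 h2).congr_of_eventuallyEq ?_
  filter_upwards [hℓ.eventually_mdifferentiableAt] with y hy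
  refine (mvfderiv_slice_fst (z := ((1 : G), y)) hy K).trans ?_
  simp only [Function.comp, prodField, FiberBundle.extend_apply_self]

/-- The action on a multiple of the local frame. -/
lemma tr_smul {y : X} (hy : ∀ᶠ h in 𝓝 (1 : G),
      ρ.tr h y (localFrame L x (h⁻¹ • y)) = ℓ (h, y) • localFrame L x y)
    {t : ∀ y, L y} {f : X → ℂ} (ht : ∀ᶠ y' in 𝓝 y, t y' = f y' • localFrame L x y') :
    ∀ᶠ h in 𝓝 (1 : G),
      ρ.tr h y (t (h⁻¹ • y)) = (f (h⁻¹ • y) * ℓ (h, y)) • localFrame L x y := by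
  filter_upwards [hy, (continuousAt_inv_smul EG E y).eventually ht] with h h1 h2
  rw [h2, map_smul, h1, smul_smul]

end IsLiftCoord

lemma mvfderiv_smul_const {E' : Type*} [NormedAddCommGroup E'] [NormedSpace ℝ E']
    {H' : Type*} [TopologicalSpace H'] {I' : ModelWithCorners ℝ E' H'}
    {Y : Type*} [TopologicalSpace Y] [ChartedSpace H' Y] {F : Type*} [NormedAddCommGroup F]
    [NormedSpace ℂ F] {c : Y → ℂ} {y : Y} (hc : MDifferentiableAt I' 𝓘(ℝ, ℂ) c y) (v : F)
    (u : TangentSpace I' y) :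
    mvfderiv I' (fun y => c y • v) y u = mvfderiv I' c y u • v := by
  have h := mvfderiv_clm_comp ((ContinuousLinearMap.id ℝ ℂ).smulRight v) hc u
  simpa using h

lemma mdifferentiableAt_smul_const {E' : Type*} [NormedAddCommGroup E'] [NormedSpace ℝ E']
    {H' : Type*} [TopologicalSpace H'] {I' : ModelWithCorners ℝ E' H'}
    {Y : Type*} [TopologicalSpace Y] [ChartedSpace H' Y] {F : Type*} [NormedAddCommGroup F]
    [NormedSpace ℂ F] {c : Y → ℂ} {y : Y} (hc : MDifferentiableAt I' 𝓘(ℝ, ℂ) c y) (v : F) :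
    MDifferentiableAt I' 𝓘(ℝ, F) (fun y => c y • v) y := by
  have h := mdifferentiableAt_clm_comp ((ContinuousLinearMap.id ℝ ℂ).smulRight v) hc
  simpa using h

lemma mvfderiv_mul_complex {E' : Type*} [NormedAddCommGroup E'] [NormedSpace ℝ E']
    {H' : Type*} [TopologicalSpace H'] {I' : ModelWithCorners ℝ E' H'}
    {Y : Type*} [TopologicalSpace Y] [ChartedSpace H' Y] {c d : Y → ℂ} {y : Y}
    (hc : MDifferentiableAt I' 𝓘(ℝ, ℂ) c y) (hd : MDifferentiableAt I' 𝓘(ℝ, ℂ) d y)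
    (u : TangentSpace I' y) :
    mvfderiv I' (fun y => c y * d y) y u = mvfderiv I' c y u * d y + c y * mvfderiv I' d y u :=
  mvfderiv_bilin (ContinuousLinearMap.mul ℝ ℂ) hc hd u

/-- For t = f σ the transform by h is f(h⁻¹y) ℓ(h, y) σ(y). The product rule at h = 1 gives the two
terms. -/
lemma IsLiftCoord.lieSection_eq {ρ : LineLift EG G (E := E) L} {x y : X} {ℓ : G × X → ℂ}
    (hy : ∀ᶠ h in 𝓝 (1 : G), ρ.tr h y (localFrame L x (h⁻¹ • y)) = ℓ (h, y) • localFrame L x y)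
    (hd : MDifferentiableAt (𝓘(ℝ, EG).prod 𝓘(ℝ, E)) 𝓘(ℝ, ℂ) ℓ (1, y)) (hone : ℓ (1, y) = 1)
    {t : ∀ y, L y} {f : X → ℂ} (ht : ∀ᶠ y' in 𝓝 y, t y' = f y' • localFrame L x y')
    (hf : MDifferentiableAt 𝓘(ℝ, E) 𝓘(ℝ, ℂ) f y) (K : GroupLieAlgebra 𝓘(ℝ, EG) G) :
    lieSection ρ K t y = (mvfderiv 𝓘(ℝ, E) f y (fundField K y)
      + f y * mvfderiv 𝓘(ℝ, EG) (fun h : G => ℓ (h, y)) 1 K) • localFrame L x y := by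
  have h1 := mdifferentiableAt_comp_inv_smul (EG := EG) (G := G) hf
  have h2 := IsLiftCoord.mdifferentiableAt_slice hd
  have h3 := mvfderiv_mul_complex h1 h2 K
  rw [mvfderiv_comp_inv_smul hf] at h3
  have h12 : MDifferentiableAt 𝓘(ℝ, EG) 𝓘(ℝ, ℂ) (fun h : G => f (h⁻¹ • y) * ℓ (h, y)) 1 :=
    h1.mul h2
  rw [lieSection, mvfderiv_congr (IsLiftCoord.tr_smul hy ht), mvfderiv_smul_const h12]
  congr 1
  refine h3.trans ?_
  rw [hone, mul_one, inv_one, one_smul]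

namespace PrequantumData

variable (P : PrequantumData EG G E X L) {x : X} {ℓ : G × X → ℂ}

/-- The coefficient `(∇_K σ - L_K σ)/σ` of the local frame `σ` at `x`. -/
noncomputable def momentCoeff (x : X) (ℓ : G × X → ℂ) (K : GroupLieAlgebra 𝓘(ℝ, EG) G) (y : X) : ℂ :=
  fibreCoord L x y (P.conn (localFrame L x) y (fundField K y))
    - mvfderiv 𝓘(ℝ, EG) (fun h : G => ℓ (h, y)) 1 K

lemma mdifferentiableAt_momentCoeff (hℓ : IsLiftCoord P.lift x ℓ)
    (K : GroupLieAlgebra 𝓘(ℝ, EG) G) :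
    MDifferentiableAt 𝓘(ℝ, E) 𝓘(ℝ, ℂ) (P.momentCoeff x ℓ K) x :=
  ((P.smoothSectionAt_conn_localFrame (mem_baseSet_self x) rfl contMDiffAt_id
    (smoothFieldAt_fundField K x)).mdifferentiableAt (by simp)).sub
    ((hℓ.contMDiffAt_mvfderiv K).mdifferentiableAt (by simp))

/-- The moment map at y is defined with the frame preferred at y, which changes with y. The
derivative of the transition function occurs both in ∇_K and in L_K and cancels, so the coefficient
can be computed in the one frame at x. -/
lemma eventually_moment_eq (hℓ : IsLiftCoord P.lift x ℓ) (K : GroupLieAlgebra 𝓘(ℝ, EG) G) :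
    ∀ᶠ y in 𝓝 x, P.moment K y = (P.momentCoeff x ℓ K y / (2 * Real.pi * Complex.I)).re := by
  have hb := eventually_mem_baseSet (mem_baseSet_self (L := L) x)
  filter_upwards [hb.eventually_nhds, hℓ.one, hℓ.tr, hℓ.eventually_mdifferentiableAt]
    with y hyb h1 h2 h3
  have b0 := hyb.self_of_nhds
  have by' := mem_baseSet_self (L := L) y
  have hσ := (smoothSectionAt_localFrame (E := E) b0).diffSectionAt
  have hτ := (smoothSectionAt_localFrame (E := E) by').diffSectionAt
  have hf : MDifferentiableAt 𝓘(ℝ, E) 𝓘(ℝ, ℂ)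
      (fun y' => fibreCoord L x y' (localFrame L y y')) y := (diffSectionAt_iff b0 _).1 hτ
  have ht : ∀ᶠ y' in 𝓝 y, localFrame L y y'
      = fibreCoord L x y' (localFrame L y y') • localFrame L x y' := by
    filter_upwards [hyb] with y' hy'
    exact (fibreCoord_smul_localFrame hy' _).symm
  have c1 : P.conn (localFrame L y) y (fundField K y) = _ :=
    (DFunLike.congr_fun (P.conn_congr hτ ht) _).trans (P.conn_smul hf hσ (fundField K y))
  have c2 := IsLiftCoord.lieSection_eq h2 h3 h1 ht hf K
  have c3 := fibreCoord_smul_localFrame b0 (P.conn (localFrame L x) y (fundField K y))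
  have c4 : P.conn (localFrame L y) y (fundField K y) - lieSection P.lift K (localFrame L y) y
      = P.momentCoeff x ℓ K y • localFrame L y y := by
    rw [momentCoeff]
    set κ := fibreCoord L x y (P.conn (localFrame L x) y (fundField K y))
    rw [c1, c2, ← c3]
    have c5 := ht.self_of_nhds
    set r := fibreCoord L x y (localFrame L y y)
    rw [c5]
    module
  rw [moment, c4]
  change ((fibreCoord L y y _) / _).re = _
  rw [map_smul, fibreCoord_localFrame by', smul_eq_mul, mul_one]

/-- Near x the moment map is the real part of a constant multiple of the coefficient in a fixed
frame, which is differentiable. -/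
lemma mdifferentiableAt_moment (K : GroupLieAlgebra 𝓘(ℝ, EG) G) (x : X) :
    MDifferentiableAt 𝓘(ℝ, E) 𝓘(ℝ, ℝ) (P.moment K) x := by
  obtain ⟨ℓ, hℓ⟩ := exists_isLiftCoord P.lift x
  have h1 := mdifferentiableAt_clm_comp Complex.reCLM
    ((P.mdifferentiableAt_momentCoeff hℓ K).mul
      (mdifferentiableAt_const (c := (2 * (Real.pi : ℂ) * Complex.I)⁻¹)))
  refine h1.congr_of_eventuallyEq ?_
  filter_upwards [P.eventually_moment_eq hℓ K] with y hy
  rw [hy, div_eq_mul_inv]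
  rfl

/-- Kostant's formula: the coefficient is purely imaginary. -/
lemma momentCoeff_eq (hℓ : IsLiftCoord P.lift x ℓ) (K : GroupLieAlgebra 𝓘(ℝ, EG) G) :
    P.momentCoeff x ℓ K x = 2 * Real.pi * Complex.I * P.moment K x := by
  have b := mem_baseSet_self (L := L) x
  have hσ := smoothSectionAt_localFrame (E := E) b
  set σ := localFrame L x with hσdef
  set κ := fibreCoord L x x (P.conn σ x (fundField K x)) with hκ
  set l := mvfderiv 𝓘(ℝ, EG) (fun h : G => ℓ (h, x)) 1 K with hl
  have hκσ : P.conn σ x (fundField K x) = κ • σ x := (fibreCoord_smul_localFrame b _).symm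
  have hN := (P.herm_smooth x σ σ hσ hσ).mdifferentiableAt (by simp)
  have u1 := P.conn_unitary x σ σ hσ.diffSectionAt hσ.diffSectionAt (fundField K x)
  rw [hκσ, inner_smul_left, inner_smul_right] at u1
  have hs := IsLiftCoord.mdifferentiableAt_slice hℓ.eventually_mdifferentiableAt.self_of_nhds
  have hs' := mdifferentiableAt_clm_comp (Complex.conjCLE : ℂ →L[ℝ] ℂ) hs
  -- The lift is unitary, so |σ|² at h⁻¹x equals |ℓ(h, x)|² |σ(x)|². Differentiating at h = 1 and
  -- comparing with unitarity of the connection shows that the derivatives of ℓ and of σ have the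
  -- same real part.
  have e1 : (fun h : G => (inner ℂ (σ (h⁻¹ • x)) (σ (h⁻¹ • x)) : ℂ)) =ᶠ[𝓝 1] fun h =>
      ((Complex.conjCLE : ℂ →L[ℝ] ℂ) (ℓ (h, x)) * ℓ (h, x)) • (inner ℂ (σ x) (σ x) : ℂ) := by
    filter_upwards [hℓ.tr.self_of_nhds] with h hh
    rw [← (P.lift.tr h x).inner_map_map, hh, inner_smul_left, inner_smul_right, smul_eq_mul,
      mul_assoc]
    rfl
  have d1 := mvfderiv_comp_inv_smul (EG := EG) (G := G) hN K
  have h12 : MDifferentiableAt 𝓘(ℝ, EG) 𝓘(ℝ, ℂ)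
      (fun h : G => (Complex.conjCLE : ℂ →L[ℝ] ℂ) (ℓ (h, x)) * ℓ (h, x)) 1 := hs'.mul hs
  rw [mvfderiv_congr e1, mvfderiv_smul_const h12, u1] at d1
  have d2 := mvfderiv_mul_complex hs' hs K
  rw [mvfderiv_clm_comp _ hs] at d2
  have d1' := (congrArg (· • (inner ℂ (σ x) (σ x) : ℂ)) d2).symm.trans d1
  rw [hℓ.one.self_of_nhds] at d1'
  have hne : (inner ℂ (σ x) (σ x) : ℂ) ≠ 0 := by
    rw [inner_self_ne_zero]
    exact localFrame_ne_zero b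
  have d3 : (starRingEnd ℂ) l + l = (starRingEnd ℂ) κ + κ := by
    refine mul_right_cancel₀ hne ?_
    have : (((starRingEnd ℂ) l) * 1 + (starRingEnd ℂ) 1 * l) * (inner ℂ (σ x) (σ x) : ℂ)
        = (starRingEnd ℂ) κ * (inner ℂ (σ x) (σ x) : ℂ) + κ * (inner ℂ (σ x) (σ x) : ℂ) := d1'
    rw [map_one] at this
    linear_combination this
  have hre : (P.momentCoeff x ℓ K x).re = 0 := by
    have h1 : P.momentCoeff x ℓ K x = κ - l := rfl
    have h2 := congrArg Complex.re d3
    simp only [Complex.add_re, Complex.conj_re] at h2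
    rw [h1, Complex.sub_re]
    linarith
  -- As the coefficient is purely imaginary, its quotient by 2π√-1 is real and the real part taken
  -- in the definition loses nothing.
  rw [(P.eventually_moment_eq hℓ K).self_of_nhds]
  have hpi : (Real.pi : ℂ) ≠ 0 := by exact_mod_cast Real.pi_ne_zero
  set c := P.momentCoeff x ℓ K x
  have hc : c = c.im * Complex.I := by
    conv_lhs => rw [← Complex.re_add_im c, hre]
    simp
  have h5 : c / (2 * Real.pi * Complex.I) = ((c.im / (2 * Real.pi) : ℝ) : ℂ) := by
    conv_lhs => rw [hc]
    push_cast
    field_simp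
  rw [h5, Complex.ofReal_re]
  conv_lhs => rw [hc]
  push_cast
  field_simp

end PrequantumData

end LiftedAction

/-! ### The infinitesimal action on sections of L ⊗ F -/

section ProductAction

variable {EG : Type*} [NormedAddCommGroup EG] [NormedSpace ℝ EG] [FiniteDimensional ℝ EG]
  {G : Type*} [TopologicalSpace G] [ChartedSpace EG G] [Group G] [LieGroup 𝓘(ℝ, EG) ∞ G]
  {EM : Type*} [NormedAddCommGroup EM] [NormedSpace ℝ EM] [FiniteDimensional ℝ EM]
  {M : Type*} [TopologicalSpace M] [T2Space M] [ChartedSpace EM M] [IsManifold 𝓘(ℝ, EM) ∞ M]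
  [MulAction G M] [ContMDiffSMul 𝓘(ℝ, EG) 𝓘(ℝ, EM) ∞ G M]
  {L : M → Type*} [∀ x, NormedAddCommGroup (L x)] [∀ x, InnerProductSpace ℂ (L x)]
  [TopologicalSpace (TotalSpace ℂ L)] [FiberBundle ℂ L] [VectorBundle ℂ ℂ L] [VectorBundle ℝ ℂ L]
  [ContMDiffVectorBundle ∞ ℂ L 𝓘(ℝ, EM)]
  {EN : Type*} [NormedAddCommGroup EN] [NormedSpace ℝ EN] [FiniteDimensional ℝ EN]
  {N : Type*} [TopologicalSpace N] [T2Space N] [ChartedSpace EN N] [IsManifold 𝓘(ℝ, EN) ∞ N]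
  [MulAction G N] [ContMDiffSMul 𝓘(ℝ, EG) 𝓘(ℝ, EN) ∞ G N]
  {F : N → Type*} [∀ y, NormedAddCommGroup (F y)] [∀ y, InnerProductSpace ℂ (F y)]
  [TopologicalSpace (TotalSpace ℂ F)] [FiberBundle ℂ F] [VectorBundle ℂ ℂ F] [VectorBundle ℝ ℂ F]
  [ContMDiffVectorBundle ∞ ℂ F 𝓘(ℝ, EN)]

variable (EM EN) in
/-- The vector field on `M × N` generated by `K`. -/
noncomputable def prodFund (K : GroupLieAlgebra 𝓘(ℝ, EG) G) : ∀ z : M × N, TProd EM EN z :=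
  prodField (fundField K) (fundField K)

lemma mdifferentiableAt_prod_inv_smul (z : M × N) (h : G) :
    MDifferentiableAt 𝓘(ℝ, EG) (𝓘(ℝ, EM).prod 𝓘(ℝ, EN)) (fun h : G => h⁻¹ • z) h :=
  ((contMDiff_inv_smul_left z.1).mdifferentiable (by simp) h).prodMk
    ((contMDiff_inv_smul_left z.2).mdifferentiable (by simp) h)

variable (EG EM EN) in
include EG EM EN in
lemma tendsto_prod_inv_smul (z : M × N) : Filter.Tendsto (fun h : G => h⁻¹ • z) (𝓝 1) (𝓝 z) := by
  have h := (mdifferentiableAt_prod_inv_smul (EG := EG) (EM := EM) (EN := EN) z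
    (1 : G)).continuousAt.tendsto
  simpa using h

lemma mdifferentiableAt_comp_prod_inv_smul {A : Type*} [NormedAddCommGroup A] [NormedSpace ℝ A]
    {f : M × N → A} {z : M × N}
    (hf : MDifferentiableAt (𝓘(ℝ, EM).prod 𝓘(ℝ, EN)) 𝓘(ℝ, A) f z) :
    MDifferentiableAt 𝓘(ℝ, EG) 𝓘(ℝ, A) (fun h : G => f (h⁻¹ • z)) 1 :=
  MDifferentiableAt.comp (I' := 𝓘(ℝ, EM).prod 𝓘(ℝ, EN)) (g := f) (f := fun h : G => h⁻¹ • z) (1 : G)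
    (by simpa using hf) (mdifferentiableAt_prod_inv_smul z 1)

lemma mvfderiv_comp_prod_inv_smul {A : Type*} [NormedAddCommGroup A] [NormedSpace ℝ A]
    {f : M × N → A} {z : M × N}
    (hf : MDifferentiableAt (𝓘(ℝ, EM).prod 𝓘(ℝ, EN)) 𝓘(ℝ, A) f z)
    (K : GroupLieAlgebra 𝓘(ℝ, EG) G) :
    mvfderiv 𝓘(ℝ, EG) (fun h : G => f (h⁻¹ • z)) 1 K
      = mvfderiv (𝓘(ℝ, EM).prod 𝓘(ℝ, EN)) f z (prodFund EM EN K z) := by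
  have h2 : (fun h : G => h⁻¹ • z) 1 = z := by simp
  have h1 : ∀ (a b : M × N) (u v : EM × EN), a = b → u = v →
      mvfderiv (𝓘(ℝ, EM).prod 𝓘(ℝ, EN)) f a u = mvfderiv (𝓘(ℝ, EM).prod 𝓘(ℝ, EN)) f b v := by
    rintro a b u v rfl rfl; rfl
  rw [mvfderiv_comp_vec (I := 𝓘(ℝ, EM).prod 𝓘(ℝ, EN)) (φ := fun h : G => h⁻¹ • z) _
    (by simpa using hf) (mdifferentiableAt_prod_inv_smul z 1)]
  have h3 := mfderiv_prodMk ((contMDiff_inv_smul_left (EG := EG) (E := EM) (G := G) z.1).mdifferentiable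
    (by simp) 1) ((contMDiff_inv_smul_left (EG := EG) (E := EN) (G := G) z.2).mdifferentiable
    (by simp) 1)
  exact h1 _ _ _ _ h2 (DFunLike.congr_fun h3 K)

variable (EG) in
include EG in
lemma mfderiv_prod_smul (h : G) (z : M × N) (v : TProd EM EN z) :
    mfderiv (𝓘(ℝ, EM).prod 𝓘(ℝ, EN)) (𝓘(ℝ, EM).prod 𝓘(ℝ, EN)) (fun z' : M × N => h⁻¹ • z') z v
      = pairVec (h⁻¹ • z) (pullVec h z.1 (fstVec z v)) (pullVec h z.2 (sndVec z v)) := by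
  have h3 := mfderiv_prodMap (p := z)
    ((contMDiff_inv_smul_right EG EM h).mdifferentiable (by simp) z.1)
    ((contMDiff_inv_smul_right EG EN h).mdifferentiable (by simp) z.2)
  exact DFunLike.congr_fun h3 v

variable (P : PrequantumData EG G EM M L) (Q : PrequantumData EG G EN N F)

/-- The lifted action on the fibres of `L ⊗ F`. -/
noncomputable def actLine (h : G) (z : M × N) : LineProd L F (h⁻¹ • z) →ₗ[ℂ] LineProd L F z :=
  TensorProduct.map (P.lift.tr h z.1).toLinearEquiv.toLinearMap
    (Q.lift.tr h z.2).toLinearEquiv.toLinearMap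

variable {t : ∀ z : M × N, LineProd L F z} {z : M × N}

lemma actLine_one (t : ∀ z : M × N, LineProd L F z) (z : M × N) :
    actLine P Q 1 z (t ((1 : G)⁻¹ • z)) = t z := by
  have t0 := (eventually_eq_lineCoord_smul t z).self_of_nhds
  have t1 : ∀ y, y = z → t y
      = lineCoord L F z z (t z) • (localFrame L z.1 y.1 ⊗ₜ[ℂ] localFrame F z.2 y.2) := by
    rintro y rfl
    exact t0
  rw [t1 ((1 : G)⁻¹ • z) (by simp), map_smul]
  have h4 : actLine P Q 1 z
      (localFrame L z.1 ((1 : G)⁻¹ • z).1 ⊗ₜ[ℂ] localFrame F z.2 ((1 : G)⁻¹ • z).2)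
      = (P.lift.tr 1 z.1 (localFrame L z.1 ((1 : G)⁻¹ • z.1)))
        ⊗ₜ[ℂ] (Q.lift.tr 1 z.2 (localFrame F z.2 ((1 : G)⁻¹ • z.2))) := rfl
  rw [h4, P.lift.one_act, Q.lift.one_act]
  exact t0.symm

/-- The infinitesimal action on sections of `L ⊗ F`, by Kostant's formula. -/
lemma mvfderiv_actLine (ht : DiffLineAt EM EN t z) :
    MDifferentiableAt 𝓘(ℝ, EG) 𝓘(ℝ, LineProd L F z)
      (fun h : G => actLine P Q h z (t (h⁻¹ • z))) 1 ∧
    ∀ K : GroupLieAlgebra 𝓘(ℝ, EG) G,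
      mvfderiv 𝓘(ℝ, EG) (fun h : G => actLine P Q h z (t (h⁻¹ • z))) 1 K
        = prodConn P Q t z (prodFund EM EN K z)
          - (2 * Real.pi * Complex.I * ((P.moment K z.1 + Q.moment K z.2 : ℝ) : ℂ)) • t z := by
  obtain ⟨ℓ, hℓ⟩ := exists_isLiftCoord P.lift z.1
  obtain ⟨ℓ', hℓ'⟩ := exists_isLiftCoord Q.lift z.2
  set a : M × N → ℂ := fun y => lineCoord L F z y (t y) with ha
  have had : MDifferentiableAt (𝓘(ℝ, EM).prod 𝓘(ℝ, EN)) 𝓘(ℝ, ℂ) a z := ht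
  -- In the frames at z the transform is a scalar function of h times a fixed vector of the fibre.
  have e1 : (fun h : G => actLine P Q h z (t (h⁻¹ • z))) =ᶠ[𝓝 1] fun h =>
      (a (h⁻¹ • z) * (ℓ (h, z.1) * ℓ' (h, z.2))) •
        (localFrame L z.1 z.1 ⊗ₜ[ℂ] localFrame F z.2 z.2) := by
    filter_upwards [(tendsto_prod_inv_smul EG EM EN z).eventually
      (eventually_eq_lineCoord_smul t z), hℓ.tr.self_of_nhds, hℓ'.tr.self_of_nhds] with h h1 h2 h3
    rw [h1, map_smul]
    have h4 : actLine P Q h z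
        (localFrame L z.1 (h⁻¹ • z).1 ⊗ₜ[ℂ] localFrame F z.2 (h⁻¹ • z).2)
        = (P.lift.tr h z.1 (localFrame L z.1 (h⁻¹ • z.1)))
          ⊗ₜ[ℂ] (Q.lift.tr h z.2 (localFrame F z.2 (h⁻¹ • z.2))) := rfl
    rw [h4, h2, h3, ← TensorProduct.smul_tmul', TensorProduct.tmul_smul, smul_smul, smul_smul,
      mul_assoc]
  have d1 := mdifferentiableAt_comp_prod_inv_smul (EG := EG) (G := G) had
  have d2 := IsLiftCoord.mdifferentiableAt_slice hℓ.eventually_mdifferentiableAt.self_of_nhds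
  have d3 := IsLiftCoord.mdifferentiableAt_slice hℓ'.eventually_mdifferentiableAt.self_of_nhds
  have d23 : MDifferentiableAt 𝓘(ℝ, EG) 𝓘(ℝ, ℂ) (fun h : G => ℓ (h, z.1) * ℓ' (h, z.2)) 1 :=
    d2.mul d3
  have d123 : MDifferentiableAt 𝓘(ℝ, EG) 𝓘(ℝ, ℂ)
      (fun h : G => a (h⁻¹ • z) * (ℓ (h, z.1) * ℓ' (h, z.2))) 1 := d1.mul d23
  refine ⟨(mdifferentiableAt_smul_const d123 _).congr_of_eventuallyEq e1, fun K => ?_⟩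
  rw [mvfderiv_congr e1, mvfderiv_smul_const d123]
  have f1 := mvfderiv_mul_complex d1 d23 K
  have f2 := mvfderiv_mul_complex d2 d3 K
  rw [mvfderiv_comp_prod_inv_smul had] at f1
  have o1 := hℓ.one.self_of_nhds
  have o2 := hℓ'.one.self_of_nhds
  have m1 := P.momentCoeff_eq hℓ K
  have m2 := Q.momentCoeff_eq hℓ' K
  have k1 := fibreCoord_smul_localFrame (mem_baseSet_self (L := L) z.1)
    (P.conn (localFrame L z.1) z.1 (fundField K z.1))
  have k2 := fibreCoord_smul_localFrame (mem_baseSet_self (L := F) z.2)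
    (Q.conn (localFrame F z.2) z.2 (fundField K z.2))
  have t0 := (eventually_eq_lineCoord_smul t z).self_of_nhds
  have c0 : prodConn P Q t z (prodFund EM EN K z)
      = (mvfderiv (𝓘(ℝ, EM).prod 𝓘(ℝ, EN)) a z (prodFund EM EN K z)) •
      (localFrame L z.1 z.1 ⊗ₜ[ℂ] localFrame F z.2 z.2)
    + a z •
      (P.conn (localFrame L z.1) z.1 (fundField K z.1) ⊗ₜ[ℂ] localFrame F z.2 z.2
        + localFrame L z.1 z.1 ⊗ₜ[ℂ] Q.conn (localFrame F z.2) z.2 (fundField K z.2)) := rfl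
  rw [PrequantumData.momentCoeff] at m1 m2
  set κ := fibreCoord L z.1 z.1 (P.conn (localFrame L z.1) z.1 (fundField K z.1))
  set κ' := fibreCoord F z.2 z.2 (Q.conn (localFrame F z.2) z.2 (fundField K z.2))
  have t1 : t z = a z • (localFrame L z.1 z.1 ⊗ₜ[ℂ] localFrame F z.2 z.2) := t0
  rw [c0, t1, ← k1, ← k2, ← TensorProduct.smul_tmul', TensorProduct.tmul_smul]
  -- Product rule at h = 1, where both coordinates of the lift equal 1. Their derivatives are then
  -- the connection coefficients minus 2π√-1 times the moments.
  have h3 : mvfderiv 𝓘(ℝ, EG) (fun h : G => a (h⁻¹ • z) * (ℓ (h, z.1) * ℓ' (h, z.2))) 1 K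
      = mvfderiv (𝓘(ℝ, EM).prod 𝓘(ℝ, EN)) a z (prodFund EM EN K z)
        + a z * (mvfderiv 𝓘(ℝ, EG) (fun h : G => ℓ (h, z.1)) 1 K
          + mvfderiv 𝓘(ℝ, EG) (fun h : G => ℓ' (h, z.2)) 1 K) := by
    rw [f1, f2, o1, o2, inv_one, one_smul]
    ring
  rw [h3]
  rw [Complex.ofReal_add, mul_add (2 * (Real.pi : ℂ) * Complex.I), ← m1, ← m2]
  module

end ProductAction

/-! ### Transport of tangent vectors in a frame -/

section Transport

variable {EG : Type*} [NormedAddCommGroup EG] [NormedSpace ℝ EG] [FiniteDimensional ℝ EG]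
  {G : Type*} [TopologicalSpace G] [ChartedSpace EG G] [Group G] [LieGroup 𝓘(ℝ, EG) ∞ G]
  {EM : Type*} [NormedAddCommGroup EM] [NormedSpace ℝ EM] [FiniteDimensional ℝ EM]
  {M : Type*} [TopologicalSpace M] [T2Space M] [ChartedSpace EM M] [IsManifold 𝓘(ℝ, EM) ∞ M]
  [MulAction G M] [ContMDiffSMul 𝓘(ℝ, EG) 𝓘(ℝ, EM) ∞ G M]
  {L : M → Type*} [∀ x, NormedAddCommGroup (L x)] [∀ x, InnerProductSpace ℂ (L x)]
  [TopologicalSpace (TotalSpace ℂ L)] [FiberBundle ℂ L] [VectorBundle ℂ ℂ L] [VectorBundle ℝ ℂ L]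
  [ContMDiffVectorBundle ∞ ℂ L 𝓘(ℝ, EM)]
  {EN : Type*} [NormedAddCommGroup EN] [NormedSpace ℝ EN] [FiniteDimensional ℝ EN]
  {N : Type*} [TopologicalSpace N] [T2Space N] [ChartedSpace EN N] [IsManifold 𝓘(ℝ, EN) ∞ N]
  [MulAction G N] [ContMDiffSMul 𝓘(ℝ, EG) 𝓘(ℝ, EN) ∞ G N]
  {F : N → Type*} [∀ y, NormedAddCommGroup (F y)] [∀ y, InnerProductSpace ℂ (F y)]
  [TopologicalSpace (TotalSpace ℂ F)] [FiberBundle ℂ F] [VectorBundle ℂ ℂ F] [VectorBundle ℝ ℂ F]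
  [ContMDiffVectorBundle ∞ ℂ F 𝓘(ℝ, EN)]

section Factor

variable (P : PrequantumData EG G EM M L)

lemma IsAlmostHermitian.holoConn_zero {E : Type*} [NormedAddCommGroup E] [NormedSpace ℝ E]
    [FiniteDimensional ℝ E] {H : Type*} [TopologicalSpace H] {I : ModelWithCorners ℝ E H}
    {X : Type*} [TopologicalSpace X] [ChartedSpace H X] [IsManifold I ∞ X]
    {g : ∀ x : X, TangentSpace I x → TangentSpace I x → ℝ}
    {J : ∀ x : X, TangentSpace I x → TangentSpace I x} (A : IsAlmostHermitian I g J) {x : X}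
    (u : TangentSpace I x) : holoConn I g J (fun y : X => (0 : TangentSpace I y)) x u = 0 := by
  have h0 : DiffFieldAt I (fun y : X => (0 : TangentSpace I y)) x :=
    ((contMDiff_zeroSection ℝ (TangentSpace I)).mdifferentiable (n := 1) (by simp)) x
  have h1 := A.holoConn_add h0 h0 u
  simp only [add_zero] at h1
  exact left_eq_add.1 h1

lemma IsAlmostHermitian.holoConn_sum_smul {E : Type*} [NormedAddCommGroup E] [NormedSpace ℝ E]
    [FiniteDimensional ℝ E] {H : Type*} [TopologicalSpace H] {I : ModelWithCorners ℝ E H}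
    {X : Type*} [TopologicalSpace X] [ChartedSpace H X] [IsManifold I ∞ X]
    {g : ∀ x : X, TangentSpace I x → TangentSpace I x → ℝ}
    {J : ∀ x : X, TangentSpace I x → TangentSpace I x} (A : IsAlmostHermitian I g J) {x : X}
    {κ : Type*} (σ : Finset κ) {c : κ → X → ℝ} {B : κ → ∀ x : X, TangentSpace I x}
    (hc : ∀ i, MDifferentiableAt I 𝓘(ℝ, ℝ) (c i) x) (hB : ∀ i, DiffFieldAt I (B i) x)
    (u : TangentSpace I x) :
    holoConn I g J (fun y => ∑ i ∈ σ, c i y • B i y) x u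
      = ∑ i ∈ σ, (mvfderiv I (c i) x u • B i x + c i x • holoConn I g J (B i) x u) := by
  classical
  induction σ using Finset.induction_on with
  | empty =>
    simp only [Finset.sum_empty]
    exact A.holoConn_zero u
  | insert i σ hi ih =>
    simp only [Finset.sum_insert hi]
    rw [A.holoConn_add ((hB i).smul (hc i)) (DiffFieldAt.sum fun i _ => (hB i).smul (hc i)), ih,
      A.holoConn_smul (hc i) (hB i)]

/-- Transported vectors live in varying tangent spaces. Written in coordinate fields, their motion
in h is that of real coefficients; the derivative of these, corrected by the projected derivative of
the fields, is an intrinsic endomorphism. -/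
lemma exists_transport_frame (x : M) (K : GroupLieAlgebra 𝓘(ℝ, EG) G)
    (v : TangentSpace 𝓘(ℝ, EM) x) :
    ∃ (c : Fin (finrank ℝ EM) → G → ℝ)
      (B : Fin (finrank ℝ EM) → ∀ y : M, TangentSpace 𝓘(ℝ, EM) y),
      (∀ i, MDifferentiableAt 𝓘(ℝ, EG) 𝓘(ℝ, ℝ) (c i) 1) ∧
      (∀ i, SmoothFieldAt 𝓘(ℝ, EM) (B i) x) ∧
      (∀ᶠ h in 𝓝 (1 : G), pullVec h x v = ∑ i, c i h • B i (h⁻¹ • x)) ∧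
      v = ∑ i, c i 1 • B i x ∧
      moveMap P.isAlmostHermitian (fundField K) (PrequantumData.diffFieldAt_fundField x K) v
        = ∑ i, (mvfderiv 𝓘(ℝ, EG) (c i) 1 K • B i x
          + c i 1 • holoConn 𝓘(ℝ, EM) P.metric P.cplx (B i) x (fundField K x)) := by
  obtain ⟨f, B, hf, hB, hfB⟩ := exists_coordinate_frame (E := EM) x
  obtain ⟨V, hV, rfl⟩ : ∃ b : ∀ y : M, TangentSpace 𝓘(ℝ, EM) y,
      SmoothFieldAt 𝓘(ℝ, EM) b x ∧ b x = v :=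
    ⟨_, smoothFieldAt_extend v, FiberBundle.extend_apply_self _ _⟩
  have hK := smoothFieldAt_fundField (E := EM) K x
  have hp : ∀ i, mvfderiv 𝓘(ℝ, EM) (f i) ((1 : G)⁻¹ • x) (pullVec (1 : G) x (V x))
      = mvfderiv 𝓘(ℝ, EM) (f i) x (V x) := fun i => mvfderiv_pullVec_one (f i) (V x)
  refine ⟨fun i h => mvfderiv 𝓘(ℝ, EM) (f i) (h⁻¹ • x) (pullVec h x (V x)), B,
    fun i => mdifferentiableAt_mvfderiv_pullVec (hf i) hV, hB, ?_, ?_, ?_⟩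
  · filter_upwards [(continuousAt_inv_smul EG EM x).eventually hfB] with h hh
    exact hh _
  · simp only [hp]
    exact hfB.self_of_nhds (V x)
  -- In the projected derivative of V along K the coefficients contribute K(V f_i). Subtracting the
  -- bracket leaves V(K f_i), the derivative of c_i at 1.
  · have c3 := fun i => (contMDiffAt_mvfderiv_apply (hf i) hV).mdifferentiableAt (by simp)
    have e1 : ∀ᶠ y in 𝓝 x, V y = ∑ i, mvfderiv 𝓘(ℝ, EM) (f i) y (V y) • B i y := by
      filter_upwards [hfB] with y hy
      exact hy (V y)
    have e2 := moveMap_field P.isAlmostHermitian (PrequantumData.diffFieldAt_fundField x K) hV.diffFieldAt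
    have e3 := congrFun (P.isAlmostHermitian.holoConn_congr e1) (fundField K x)
    rw [P.isAlmostHermitian.holoConn_sum_smul _ c3 fun i => (hB i).diffFieldAt] at e3
    have e4 := hfB.self_of_nhds (mlieBracket 𝓘(ℝ, EM) (fundField K) V x)
    refine e2.trans ?_
    rw [e3]
    refine (congrArg _ e4).trans ?_
    rw [← Finset.sum_sub_distrib]
    refine Finset.sum_congr rfl fun i _ => ?_
    rw [mvfderiv_mlieBracket ((hf i).of_le two_le_infty) hK.diffFieldAt hV.diffFieldAt,
      mvfderiv_mvfderiv_pullVec (hf i) hV]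
    dsimp only
    rw [hp]
    module

end Factor

section Product

variable (P : PrequantumData EG G EM M L) (Q : PrequantumData EG G EN N F)

lemma diffFieldAt_prodFund (z : M × N) (K : GroupLieAlgebra 𝓘(ℝ, EG) G) :
    DiffFieldAt (𝓘(ℝ, EM).prod 𝓘(ℝ, EN)) (prodFund EM EN K) z :=
  (smoothFieldAt_prodField (smoothFieldAt_fundField K z.1)
    (smoothFieldAt_fundField K z.2)).diffFieldAt

/-- The endomorphism `moveMap` of the field of `K` on the product. -/
noncomputable def prodMove (z : M × N) (K : GroupLieAlgebra 𝓘(ℝ, EG) G) :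
    TProd EM EN z →ₗ[ℝ] TProd EM EN z :=
  moveMap (isAlmostHermitian_prod P Q) (prodFund EM EN K) (diffFieldAt_prodFund z K)

/-- On a product field the projected derivative and the bracket both split. -/
lemma prodMove_eq (z : M × N) (K : GroupLieAlgebra 𝓘(ℝ, EG) G) (v : TProd EM EN z) :
    prodMove P Q z K v = pairVec z
      (moveMap P.isAlmostHermitian (fundField K) (PrequantumData.diffFieldAt_fundField z.1 K) (fstVec z v))
      (moveMap Q.isAlmostHermitian (fundField K) (PrequantumData.diffFieldAt_fundField z.2 K)
        (sndVec z v)) := by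
  obtain ⟨U, hU, hUv⟩ : ∃ b : ∀ y : M, TangentSpace 𝓘(ℝ, EM) y,
      SmoothFieldAt 𝓘(ℝ, EM) b z.1 ∧ b z.1 = fstVec z v :=
    ⟨_, smoothFieldAt_extend _, FiberBundle.extend_apply_self _ _⟩
  obtain ⟨U', hU', hUv'⟩ : ∃ b : ∀ y : N, TangentSpace 𝓘(ℝ, EN) y,
      SmoothFieldAt 𝓘(ℝ, EN) b z.2 ∧ b z.2 = sndVec z v :=
    ⟨_, smoothFieldAt_extend _, FiberBundle.extend_apply_self _ _⟩
  have hv : v = prodField U U' z := by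
    rw [prodField, hUv, hUv', pairVec_fstVec_sndVec]
  have e1 := moveMap_field P.isAlmostHermitian (PrequantumData.diffFieldAt_fundField z.1 K) hU.diffFieldAt
  have e2 := moveMap_field Q.isAlmostHermitian (PrequantumData.diffFieldAt_fundField z.2 K) hU'.diffFieldAt
  have e3 := moveMap_field (isAlmostHermitian_prod P Q) (diffFieldAt_prodFund z K)
    (smoothFieldAt_prodField hU hU').diffFieldAt
  have e4 := mlieBracket_prodField (smoothFieldAt_fundField K z.1) hU
    (smoothFieldAt_fundField K z.2) hU'
  rw [← hUv, ← hUv']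
  have e5 : prodMove P Q z K v = prodMove P Q z K (prodField U U' z) := by rw [← hv]
  refine (e5.trans e3).trans ?_
  rw [holoConn_prodField P Q hU hU']
  refine (congrArg _ e4).trans ?_
  refine Eq.trans ?_ (congrArg₂ (pairVec z) e1.symm e2.symm)
  rfl

lemma pairVec_sum {κ κ' : Type*} [Fintype κ] [Fintype κ'] {z : M × N}
    (a : κ → TangentSpace 𝓘(ℝ, EM) z.1) (b : κ' → TangentSpace 𝓘(ℝ, EN) z.2) :
    pairVec z (∑ i, a i) (∑ i, b i)
      = ∑ i, pairVec z (a i) (0 : TangentSpace 𝓘(ℝ, EN) z.2)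
        + ∑ i, pairVec z (0 : TangentSpace 𝓘(ℝ, EM) z.1) (b i) := by
  have h1 := map_sum (LinearMap.inl ℝ EM EN) a Finset.univ
  have h2 := map_sum (LinearMap.inr ℝ EM EN) b Finset.univ
  exact (pairVec_eq_add z _ _).trans (congrArg₂ _ h1 h2)

lemma pairVec_sum_smul {κ κ' : Type*} [Fintype κ] [Fintype κ'] {z : M × N} (d : κ → ℝ)
    (d' : κ' → ℝ) (b : κ → TangentSpace 𝓘(ℝ, EM) z.1) (b' : κ' → TangentSpace 𝓘(ℝ, EN) z.2) :
    pairVec z (∑ i, d i • b i) (∑ i, d' i • b' i)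
      = ∑ i, d i • pairVec z (b i) (0 : TangentSpace 𝓘(ℝ, EN) z.2)
        + ∑ i, d' i • pairVec z (0 : TangentSpace 𝓘(ℝ, EM) z.1) (b' i) := by
  rw [pairVec_sum]
  refine congrArg₂ _ (Finset.sum_congr rfl fun i _ => ?_) (Finset.sum_congr rfl fun i _ => ?_)
  · rw [← pairVec_smul, smul_zero]
  · rw [← pairVec_smul, smul_zero]

/-- The union of the frames of the factors, extended by zero; a zero component has zero projected
derivative, so no mixed terms arise. -/
lemma exists_transport_frame_prod (z : M × N) (K : GroupLieAlgebra 𝓘(ℝ, EG) G)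
    (v : TProd EM EN z) :
    ∃ (c : Fin (finrank ℝ EM) ⊕ Fin (finrank ℝ EN) → G → ℝ)
      (B : Fin (finrank ℝ EM) ⊕ Fin (finrank ℝ EN) → ∀ y : M × N, TProd EM EN y),
      (∀ i, MDifferentiableAt 𝓘(ℝ, EG) 𝓘(ℝ, ℝ) (c i) 1) ∧
      (∀ i, DiffFieldAt (𝓘(ℝ, EM).prod 𝓘(ℝ, EN)) (B i) z) ∧
      (∀ᶠ h in 𝓝 (1 : G), mfderiv (𝓘(ℝ, EM).prod 𝓘(ℝ, EN)) (𝓘(ℝ, EM).prod 𝓘(ℝ, EN))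
        (fun z' : M × N => h⁻¹ • z') z v = ∑ i, c i h • B i (h⁻¹ • z)) ∧
      v = ∑ i, c i 1 • B i z ∧
      prodMove P Q z K v = ∑ i, (mvfderiv 𝓘(ℝ, EG) (c i) 1 K • B i z
          + c i 1 • holoConn (𝓘(ℝ, EM).prod 𝓘(ℝ, EN)) (prodMetric P Q) (prodCplx P Q) (B i) z
            (prodFund EM EN K z)) := by
  obtain ⟨c, B, h1, h2, h3, h4, h5⟩ := exists_transport_frame P z.1 K (fstVec z v)
  obtain ⟨c', B', h1', h2', h3', h4', h5'⟩ := exists_transport_frame Q z.2 K (sndVec z v)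
  have hz : ∀ x : M, SmoothFieldAt 𝓘(ℝ, EM) (fun y : M => (0 : TangentSpace 𝓘(ℝ, EM) y)) x :=
    fun x => (contMDiff_zeroSection ℝ (TangentSpace 𝓘(ℝ, EM))).contMDiffAt
  have hz' : ∀ x : N, SmoothFieldAt 𝓘(ℝ, EN) (fun y : N => (0 : TangentSpace 𝓘(ℝ, EN) y)) x :=
    fun x => (contMDiff_zeroSection ℝ (TangentSpace 𝓘(ℝ, EN))).contMDiffAt
  refine ⟨Sum.elim c c', Sum.elim (fun i => prodField (B i) fun _ => 0)
    (fun i => prodField (fun _ => 0) (B' i)), ?_, ?_, ?_, ?_, ?_⟩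
  · rintro (i | i)
    exacts [h1 i, h1' i]
  · rintro (i | i)
    exacts [(smoothFieldAt_prodField (h2 i) (hz' _)).diffFieldAt,
      (smoothFieldAt_prodField (hz _) (h2' i)).diffFieldAt]
  · filter_upwards [h3, h3'] with h hh hh'
    rw [mfderiv_prod_smul EG, hh, hh', Fintype.sum_sum_type]
    exact pairVec_sum_smul _ _ _ _
  · rw [Fintype.sum_sum_type]
    conv_lhs => rw [← pairVec_fstVec_sndVec (z := z) v, h4, h4']
    exact pairVec_sum_smul _ _ _ _
  · have h6 := pairVec_sum (z := z)
      (fun i => mvfderiv 𝓘(ℝ, EG) (c i) 1 K • B i z.1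
        + c i 1 • holoConn 𝓘(ℝ, EM) P.metric P.cplx (B i) z.1 (fundField K z.1))
      (fun i => mvfderiv 𝓘(ℝ, EG) (c' i) 1 K • B' i z.2
        + c' i 1 • holoConn 𝓘(ℝ, EN) Q.metric Q.cplx (B' i) z.2 (fundField K z.2))
    rw [prodMove_eq, h5, h5', h6, Fintype.sum_sum_type]
    refine congrArg₂ _ (Finset.sum_congr rfl fun i _ => ?_) (Finset.sum_congr rfl fun i _ => ?_)
    · simp only [Sum.elim_inl]
      rw [holoConn_prodField P Q (h2 i) (hz' _), Q.isAlmostHermitian.holoConn_zero]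
      refine TProd.ext z rfl ?_
      change (0 : EN) = mvfderiv 𝓘(ℝ, EG) (c i) 1 K • (0 : EN) + c i 1 • (0 : EN)
      simp
    · simp only [Sum.elim_inr]
      rw [holoConn_prodField P Q (hz _) (h2' i), P.isAlmostHermitian.holoConn_zero]
      refine TProd.ext z ?_ rfl
      change (0 : EM) = mvfderiv 𝓘(ℝ, EG) (c' i) 1 K • (0 : EM) + c' i 1 • (0 : EM)
      simp

end Product

end Transport

/-! ### The infinitesimal action on forms -/

section LieForm

variable {EG : Type*} [NormedAddCommGroup EG] [NormedSpace ℝ EG] [FiniteDimensional ℝ EG]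
  {G : Type*} [TopologicalSpace G] [ChartedSpace EG G] [Group G] [LieGroup 𝓘(ℝ, EG) ∞ G]
  {EM : Type*} [NormedAddCommGroup EM] [NormedSpace ℝ EM] [FiniteDimensional ℝ EM]
  {M : Type*} [TopologicalSpace M] [T2Space M] [ChartedSpace EM M] [IsManifold 𝓘(ℝ, EM) ∞ M]
  [MulAction G M] [ContMDiffSMul 𝓘(ℝ, EG) 𝓘(ℝ, EM) ∞ G M]
  {L : M → Type*} [∀ x, NormedAddCommGroup (L x)] [∀ x, InnerProductSpace ℂ (L x)]
  [TopologicalSpace (TotalSpace ℂ L)] [FiberBundle ℂ L] [VectorBundle ℂ ℂ L] [VectorBundle ℝ ℂ L]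
  [ContMDiffVectorBundle ∞ ℂ L 𝓘(ℝ, EM)]
  {EN : Type*} [NormedAddCommGroup EN] [NormedSpace ℝ EN] [FiniteDimensional ℝ EN]
  {N : Type*} [TopologicalSpace N] [T2Space N] [ChartedSpace EN N] [IsManifold 𝓘(ℝ, EN) ∞ N]
  [MulAction G N] [ContMDiffSMul 𝓘(ℝ, EG) 𝓘(ℝ, EN) ∞ G N]
  {F : N → Type*} [∀ y, NormedAddCommGroup (F y)] [∀ y, InnerProductSpace ℂ (F y)]
  [TopologicalSpace (TotalSpace ℂ F)] [FiberBundle ℂ F] [VectorBundle ℂ ℂ F] [VectorBundle ℝ ℂ F]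
  [ContMDiffVectorBundle ∞ ℂ F 𝓘(ℝ, EN)]


lemma mdifferentiableAt_sum_ofReal_smul {E' : Type*} [NormedAddCommGroup E'] [NormedSpace ℝ E']
    {H' : Type*} [TopologicalSpace H'] {I' : ModelWithCorners ℝ E' H'}
    {Y : Type*} [TopologicalSpace Y] [ChartedSpace H' Y] {A : Type*} [NormedAddCommGroup A]
    [NormedSpace ℂ A] {κ : Type*} {σ : Finset κ} {c : κ → Y → ℝ} {a : κ → Y → A} {y : Y}
    (hc : ∀ i, MDifferentiableAt I' 𝓘(ℝ, ℝ) (c i) y)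
    (ha : ∀ i, MDifferentiableAt I' 𝓘(ℝ, A) (a i) y) :
    MDifferentiableAt I' 𝓘(ℝ, A) (fun y => ∑ i ∈ σ, (c i y : ℂ) • a i y) y := by
  simp only [Complex.coe_smul]
  exact mdifferentiableAt_sum_smul σ hc ha

lemma mvfderiv_sum_ofReal_smul {E' : Type*} [NormedAddCommGroup E'] [NormedSpace ℝ E']
    {H' : Type*} [TopologicalSpace H'] {I' : ModelWithCorners ℝ E' H'}
    {Y : Type*} [TopologicalSpace Y] [ChartedSpace H' Y] {A : Type*} [NormedAddCommGroup A]
    [NormedSpace ℂ A] {κ : Type*} {σ : Finset κ} {c : κ → Y → ℝ} {a : κ → Y → A} {y : Y}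
    (hc : ∀ i, MDifferentiableAt I' 𝓘(ℝ, ℝ) (c i) y)
    (ha : ∀ i, MDifferentiableAt I' 𝓘(ℝ, A) (a i) y) (u : TangentSpace I' y) :
    mvfderiv I' (fun y => ∑ i ∈ σ, (c i y : ℂ) • a i y) y u
      = ∑ i ∈ σ, (((mvfderiv I' (c i) y u : ℝ) : ℂ) • a i y
        + (c i y : ℂ) • mvfderiv I' (a i) y u) := by
  simp only [Complex.coe_smul]
  exact mvfderiv_sum_smul σ hc ha u

lemma derivForm_sum_smul {T W : Type*} [AddCommGroup W] [Module ℂ W] {κ : Type*} (σ : Finset κ)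
    (C : T → T) (c : κ → ℂ) (η : κ → Cochain T W) :
    derivForm C (∑ a ∈ σ, c a • η a) = ∑ a ∈ σ, c a • derivForm C (η a) := by
  funext q v
  simp only [derivForm, Finset.sum_apply, Pi.smul_apply, Finset.smul_sum]
  exact Finset.sum_comm

variable (P : PrequantumData EG G EM M L) (Q : PrequantumData EG G EN N F)
  {s : ∀ z : M × N, Cochain (TProd EM EN z) (LineProd L F z)} {z : M × N}

lemma actForm_one (s : ∀ z : M × N, Cochain (TProd EM EN z) (LineProd L F z)) (z : M × N) :
    actForm P Q 1 s z = s z := by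
  funext q v
  have h1 : ∀ f : M × N → M × N, f = id → ∀ w : EM × EN,
      (mfderiv (𝓘(ℝ, EM).prod 𝓘(ℝ, EN)) (𝓘(ℝ, EM).prod 𝓘(ℝ, EN)) f z w : EM × EN) = w := by
    rintro f rfl w
    rw [mfderiv_id]
    rfl
  have h2 := actLine_one P Q (fun y => s y q v) z
  refine Eq.trans ?_ h2
  refine congrArg (fun w : Fin q → EM × EN => actLine P Q 1 z (s ((1 : G)⁻¹ • z) q w)) ?_
  funext i
  exact h1 _ (funext fun y => by simp) (v i)

/-- The infinitesimal action on forms in terms of the connection. -/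
lemma mvfderiv_actForm (K : GroupLieAlgebra 𝓘(ℝ, EG) G) (q : ℕ) :
    ∀ s : ∀ z : M × N, Cochain (TProd EM EN z) (LineProd L F z),
      IsDiffForm (𝓘(ℝ, EM).prod 𝓘(ℝ, EN)) (prodCplx P Q) (DiffLineAt EM EN) s z →
      ∀ v : Fin q → TProd EM EN z,
      MDifferentiableAt 𝓘(ℝ, EG) 𝓘(ℝ, LineProd L F z)
        (fun h : G => actForm P Q h s z q v) 1 ∧
      lieForm P Q K s z q v
        = (formConn (𝓘(ℝ, EM).prod 𝓘(ℝ, EN)) (prodMetric P Q) (prodCplx P Q) (prodConn P Q) s z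
            (prodFund EM EN K z)
          - (2 * Real.pi * Complex.I * ((P.moment K z.1 + Q.moment K z.2 : ℝ) : ℂ)) • s z
          + derivForm (prodMove P Q z K) (s z)) q v := by
  have A := isAlmostHermitian_prod P Q
  have hD := isSectionConnection_prodConn P Q
  -- Differentiability in h is proved together with the formula, since the product rule in the next
  -- degree requires it.
  induction q with
  | zero =>
    intro s hs v
    have hd := hs.diff 0 (fun i _ => i.elim0) (fun i => i.elim0)
    have h1 := mvfderiv_actLine P Q hd
    have e1 : (fun h : G => actForm P Q h s z 0 v)
        = fun h => actLine P Q h z (s (h⁻¹ • z) 0 fun i => i.elim0) := by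
      funext h
      simp only [actForm, actLine]
      congr 2
      exact Subsingleton.elim _ _
    simp only [lieForm, e1]
    refine ⟨h1.1, (h1.2 K).trans ?_⟩
    have e2 : v = fun i => i.elim0 := Subsingleton.elim _ _
    have e3 : (fun y => s y 0 fun i => FiberBundle.extend (EM × EN) (v i) y)
        = fun y => s y 0 fun i => i.elim0 := by
      funext y
      congr 1
      exact Subsingleton.elim _ _
    simp only [Pi.add_apply, Pi.sub_apply, Pi.smul_apply, formConn, derivForm,
      Finset.univ_eq_empty, Finset.sum_empty, sub_zero, add_zero, e3, ← e2]
  | succ q ih =>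
    intro s hs v
    obtain ⟨c, B, h1, h2, h3, h4, h5⟩ := exists_transport_frame_prod P Q z K (v 0)
    have hB := fun a => ih _ (hs.contract (h2 a)) (Fin.tail v)
    -- Expanding the transported first vector writes the action on s as a combination of the actions
    -- on the forms i_{B_a} s, one degree lower, with coefficients c_a(h).
    have e1 : (fun h : G => actForm P Q h s z (q + 1) v) =ᶠ[𝓝 1] fun h =>
        ∑ a, (c a h : ℂ) • actForm P Q h (fun y => contract (B a y) (s y)) z q (Fin.tail v) := by
      filter_upwards [h3, (tendsto_prod_inv_smul EG EM EN z).eventually hs.antihol] with h hh ha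
      have f1 := cochain_succ (s (h⁻¹ • z)) q (fun i =>
        mfderiv (𝓘(ℝ, EM).prod 𝓘(ℝ, EN)) (𝓘(ℝ, EM).prod 𝓘(ℝ, EN))
          (fun z' : M × N => h⁻¹ • z') z (v i))
      rw [hh, ha.contract_sum] at f1
      simp only [ha.contract_smul, Finset.sum_apply, Pi.smul_apply] at f1
      change actLine P Q h z _ = _
      rw [f1, map_sum]
      exact Finset.sum_congr rfl fun a _ => map_smul _ _ _
    refine ⟨(mdifferentiableAt_sum_ofReal_smul h1 fun a => (hB a).1).congr_of_eventuallyEq e1, ?_⟩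
    rw [lieForm, mvfderiv_congr e1, mvfderiv_sum_ofReal_smul h1 fun a => (hB a).1]
    have hz := hs.antihol_self
    set u := prodFund EM EN K z
    set k : ℂ := 2 * Real.pi * Complex.I * ((P.moment K z.1 + Q.moment K z.2 : ℝ) : ℂ)
    have hF := hs.isAntiholomorphicForm_formConn A hD u
    have g1 : contract (v 0) (s z) = ∑ a, (c a 1 : ℂ) • contract (B a z) (s z) := by
      conv_lhs => rw [h4, hz.contract_sum]
      exact Finset.sum_congr rfl fun a _ => hz.contract_smul _ _
    have g2 : contract (v 0) (formConn (𝓘(ℝ, EM).prod 𝓘(ℝ, EN)) (prodMetric P Q) (prodCplx P Q)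
        (prodConn P Q) s z u) = ∑ a, (c a 1 : ℂ) • (formConn (𝓘(ℝ, EM).prod 𝓘(ℝ, EN))
          (prodMetric P Q) (prodCplx P Q) (prodConn P Q)
          (fun y => contract (B a y) (s y)) z u
          - contract (holoConn (𝓘(ℝ, EM).prod 𝓘(ℝ, EN)) (prodMetric P Q) (prodCplx P Q)
            (B a) z u) (s z)) := by
      conv_lhs => rw [h4, hF.contract_sum]
      exact Finset.sum_congr rfl fun a _ => by
        rw [hF.contract_smul, hs.contract_formConn A hD (h2 a)]
    have g3 : contract (prodMove P Q z K (v 0)) (s z)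
        = ∑ a, (((mvfderiv 𝓘(ℝ, EG) (c a) 1 K : ℝ) : ℂ) • contract (B a z) (s z)
          + (c a 1 : ℂ) • contract (holoConn (𝓘(ℝ, EM).prod 𝓘(ℝ, EN)) (prodMetric P Q)
            (prodCplx P Q) (B a) z u) (s z)) := by
      rw [h5, hz.contract_sum]
      exact Finset.sum_congr rfl fun a _ => by
        rw [hz.contract_add, hz.contract_smul, hz.contract_smul]
    -- The same expansion of the right-hand side. The projected derivatives of B_a coming from the
    -- connection cancel those in `prodMove`, and only the derivatives of c_a remain.
    have g5 : contract (v 0) (formConn (𝓘(ℝ, EM).prod 𝓘(ℝ, EN)) (prodMetric P Q) (prodCplx P Q)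
        (prodConn P Q) s z u - k • s z + derivForm (prodMove P Q z K) (s z))
        = ∑ a, (((mvfderiv 𝓘(ℝ, EG) (c a) 1 K : ℝ) : ℂ) • contract (B a z) (s z)
          + (c a 1 : ℂ) • (formConn (𝓘(ℝ, EM).prod 𝓘(ℝ, EN))
          (prodMetric P Q) (prodCplx P Q) (prodConn P Q)
          (fun y => contract (B a y) (s y)) z u - k • contract (B a z) (s z)
            + derivForm (prodMove P Q z K) (contract (B a z) (s z)))) := by
      rw [contract_add_right, contract_sub_right, contract_smul_right, contract_derivForm, g2, g3,
        g1, derivForm_sum_smul, Finset.smul_sum, ← Finset.sum_sub_distrib,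
        ← Finset.sum_add_distrib, ← Finset.sum_add_distrib]
      exact Finset.sum_congr rfl fun a _ => by module
    refine Eq.trans ?_ ((congrFun (congrFun g5.symm q) (Fin.tail v)).trans
      (cochain_succ _ q v).symm)
    rw [Finset.sum_apply, Finset.sum_apply]
    refine Finset.sum_congr rfl fun a _ => ?_
    have g6 := (hB a).2
    rw [lieForm] at g6
    rw [g6, actForm_one]
    rfl

end LieForm

/-! ### Kostant's formula for the Clifford connection -/

section Kostant

variable {EG : Type*} [NormedAddCommGroup EG] [NormedSpace ℝ EG] [FiniteDimensional ℝ EG]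
  {G : Type*} [TopologicalSpace G] [ChartedSpace EG G] [Group G] [LieGroup 𝓘(ℝ, EG) ∞ G]
  {EM : Type*} [NormedAddCommGroup EM] [NormedSpace ℝ EM] [FiniteDimensional ℝ EM]
  {M : Type*} [TopologicalSpace M] [T2Space M] [ChartedSpace EM M] [IsManifold 𝓘(ℝ, EM) ∞ M]
  [MulAction G M] [ContMDiffSMul 𝓘(ℝ, EG) 𝓘(ℝ, EM) ∞ G M]
  {L : M → Type*} [∀ x, NormedAddCommGroup (L x)] [∀ x, InnerProductSpace ℂ (L x)]
  [TopologicalSpace (TotalSpace ℂ L)] [FiberBundle ℂ L] [VectorBundle ℂ ℂ L] [VectorBundle ℝ ℂ L]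
  [ContMDiffVectorBundle ∞ ℂ L 𝓘(ℝ, EM)]
  {EN : Type*} [NormedAddCommGroup EN] [NormedSpace ℝ EN] [FiniteDimensional ℝ EN]
  {N : Type*} [TopologicalSpace N] [T2Space N] [ChartedSpace EN N] [IsManifold 𝓘(ℝ, EN) ∞ N]
  [MulAction G N] [ContMDiffSMul 𝓘(ℝ, EG) 𝓘(ℝ, EN) ∞ G N]
  {F : N → Type*} [∀ y, NormedAddCommGroup (F y)] [∀ y, InnerProductSpace ℂ (F y)]
  [TopologicalSpace (TotalSpace ℂ F)] [FiberBundle ℂ F] [VectorBundle ℂ ℂ F] [VectorBundle ℝ ℂ F]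
  [ContMDiffVectorBundle ∞ ℂ F 𝓘(ℝ, EN)]


lemma IsHermitianPair.isBilinearMap_holoTrace {T : Type*} [AddCommGroup T] [Module ℝ T]
    {g : T → T → ℝ} {J : T → T} (h : IsHermitianPair g J) (C : T →ₗ[ℝ] T) :
    IsBilinearMap ℝ (fun u v => ((g (C u) v : ℂ) - Complex.I * (g (J (C u)) v : ℂ)) / 2) where
  add_left u v w := by
    simp only [map_add, h.J_add, h.add_left, Complex.ofReal_add]
    ring
  add_right u v w := by
    simp only [h.add_right, Complex.ofReal_add]
    ring
  smul_left r u v := by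
    simp only [map_smul, h.J_smul, h.smul_left, Complex.ofReal_mul, Complex.real_smul]
    ring
  smul_right r u v := by
    simp only [h.smul_right, Complex.ofReal_mul, Complex.real_smul]
    ring

variable (P : PrequantumData EG G EM M L) (Q : PrequantumData EG G EN N F)
  {s : ∀ z : M × N, Cochain (TProd EM EN z) (LineProd L F z)} {z : M × N}
  {κ κ' : Type*} [Fintype κ] [Fintype κ']
  {e : κ → TangentSpace 𝓘(ℝ, EM) z.1} {ε : κ' → TangentSpace 𝓘(ℝ, EN) z.2}

lemma PrequantumData.sum_moveMap_frame {x : M} {e : κ → TangentSpace 𝓘(ℝ, EM) x}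
    (he : IsOrthoFrame (P.metric x) e) (K : GroupLieAlgebra 𝓘(ℝ, EG) G) :
    ∑ a, ((P.metric x (moveMap P.isAlmostHermitian (fundField K)
        (PrequantumData.diffFieldAt_fundField x K) (e a)) (e a) : ℂ)
      - Complex.I * (P.metric x (P.cplx x (moveMap P.isAlmostHermitian (fundField K)
        (PrequantumData.diffFieldAt_fundField x K) (e a))) (e a) : ℂ)) / 2
      = trHolo 𝓘(ℝ, EM) P.metric P.cplx (fundField K) x :=
  ((P.isHermitianPair x).sum_frame_eq he (P.isAlmostHermitian.isOrthoFrame_orthFrame x)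
    ((P.isHermitianPair x).isBilinearMap_holoTrace _)).trans (P.sum_moveMap K x)

/-- The orthonormal frame of the product made of frames of the factors. -/
noncomputable def prodFrame (z : M × N) (e : κ → TangentSpace 𝓘(ℝ, EM) z.1)
    (ε : κ' → TangentSpace 𝓘(ℝ, EN) z.2) : κ ⊕ κ' → TProd EM EN z :=
  Sum.elim (fun k => pairVec z (e k) 0) (fun i => pairVec z 0 (ε i))

/-- L_K contains the derivation attached to C = ∇K - B_K, which `neg_derivForm_eq` turns into a
Clifford sum and half a trace. The Clifford sum for C and the spinor term for B_K of the connection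
add up to the one for ∇K. -/
lemma cliffordConn_prodFund
    (hs : IsDiffForm (𝓘(ℝ, EM).prod 𝓘(ℝ, EN)) (prodCplx P Q) (DiffLineAt EM EN) s z)
    (he : IsOrthoFrame (P.metric z.1) e) (hε : IsOrthoFrame (Q.metric z.2) ε)
    (K : GroupLieAlgebra 𝓘(ℝ, EG) G) :
    cliffordConn (𝓘(ℝ, EM).prod 𝓘(ℝ, EN)) (prodMetric P Q) (prodCplx P Q) (prodConn P Q) s z
        (prodFund EM EN K z)
      = lieForm P Q K s z
        + (2 * Real.pi * Complex.I * ((P.moment K z.1 + Q.moment K z.2 : ℝ) : ℂ)) • s z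
        + (1 / 4 : ℂ) • ∑ a, cliff (prodMetric P Q z) (prodCplx P Q z) (prodFrame z e ε a)
          (cliff (prodMetric P Q z) (prodCplx P Q z)
            (leviCivita (𝓘(ℝ, EM).prod 𝓘(ℝ, EN)) (prodMetric P Q) (prodFund EM EN K) z
              (prodFrame z e ε a)) (s z))
        + (1 / 2 * (trHolo 𝓘(ℝ, EM) P.metric P.cplx (fundField K) z.1
          + trHolo 𝓘(ℝ, EN) Q.metric Q.cplx (fundField K) z.2)) • s z := by
  have A := isAlmostHermitian_prod P Q
  have h := isHermitianPair_prod P Q z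
  have hE : IsOrthoFrame (prodMetric P Q z) (prodFrame z e ε) := isOrthoFrame_prod P Q he hε
  have hl : lieForm P Q K s z
      = formConn (𝓘(ℝ, EM).prod 𝓘(ℝ, EN)) (prodMetric P Q) (prodCplx P Q) (prodConn P Q) s z
            (prodFund EM EN K z)
          - (2 * Real.pi * Complex.I * ((P.moment K z.1 + Q.moment K z.2 : ℝ) : ℂ)) • s z
          + derivForm (prodMove P Q z K) (s z) := by
    funext q v
    exact (mvfderiv_actForm P Q K q s hs v).2
  have hsk : ∀ u v, prodMetric P Q z (prodMove P Q z K u) v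
      = -prodMetric P Q z u (prodMove P Q z K v) := fun u v => by
    simp only [prodMetric, prodMove_eq, fstVec_pairVec, sndVec_pairVec]
    rw [P.moveMap_skew, Q.moveMap_skew]
    ring
  have hJ : ∀ u, prodMove P Q z K (prodCplx P Q z u) = prodCplx P Q z (prodMove P Q z K u) :=
    fun u => by
    simp only [prodCplx, prodMove_eq, fstVec_pairVec, sndVec_pairVec]
    rw [P.moveMap_cplx, Q.moveMap_cplx]
  have hn := h.neg_derivForm_eq hE hsk hJ hs.antihol_self
  -- The trace is taken in the product frame, where it splits into the traces over the factors; by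
  -- `sum_moveMap_frame` each is that of the projected derivative of the field.
  have htr : ∑ a, ((prodMetric P Q z (prodMove P Q z K (prodFrame z e ε a))
        (prodFrame z e ε a) : ℂ)
      - Complex.I * (prodMetric P Q z (prodCplx P Q z (prodMove P Q z K (prodFrame z e ε a)))
        (prodFrame z e ε a) : ℂ)) / 2
      = trHolo 𝓘(ℝ, EM) P.metric P.cplx (fundField K) z.1
          + trHolo 𝓘(ℝ, EN) Q.metric Q.cplx (fundField K) z.2 := by
    rw [Fintype.sum_sum_type, ← P.sum_moveMap_frame he K, ← Q.sum_moveMap_frame hε K]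
    have hP := P.isHermitianPair z.1
    have hQ := Q.isHermitianPair z.2
    refine congrArg₂ _ (Finset.sum_congr rfl fun i _ => ?_) (Finset.sum_congr rfl fun i _ => ?_)
    · simp only [prodFrame, Sum.elim_inl, prodMetric, prodCplx, prodMove_eq, fstVec_pairVec,
        sndVec_pairVec, hQ.zero_right, add_zero]
    · simp only [prodFrame, Sum.elim_inr, prodMetric, prodCplx, prodMove_eq, fstVec_pairVec,
        sndVec_pairVec, hP.zero_right, zero_add]
  rw [htr] at hn
  have hc : ∀ a, leviCivita (𝓘(ℝ, EM).prod 𝓘(ℝ, EN)) (prodMetric P Q) (prodFund EM EN K) z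
      (prodFrame z e ε a) = prodMove P Q z K (prodFrame z e ε a)
        + A.torsionMap z (prodFund EM EN K z) (prodFrame z e ε a) := fun a => by
    rw [prodMove, moveMap_apply]
    abel
  rw [IsDiffForm.cliffordConn_eq A hs hE, hl]
  have hsum : ∑ a, cliff (prodMetric P Q z) (prodCplx P Q z) (prodFrame z e ε a)
          (cliff (prodMetric P Q z) (prodCplx P Q z)
            (leviCivita (𝓘(ℝ, EM).prod 𝓘(ℝ, EN)) (prodMetric P Q) (prodFund EM EN K) z
              (prodFrame z e ε a)) (s z))
      = ∑ a, cliff (prodMetric P Q z) (prodCplx P Q z) (prodFrame z e ε a)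
          (cliff (prodMetric P Q z) (prodCplx P Q z) (prodMove P Q z K (prodFrame z e ε a)) (s z))
        + ∑ a, cliff (prodMetric P Q z) (prodCplx P Q z) (prodFrame z e ε a)
          (cliff (prodMetric P Q z) (prodCplx P Q z)
            (A.torsionMap z (prodFund EM EN K z) (prodFrame z e ε a)) (s z)) := by
    rw [← Finset.sum_add_distrib]
    exact Finset.sum_congr rfl fun a _ => by
      rw [hc, h.cliff_add_left hs.antihol_self, cliff_add_right]
  rw [hsum, smul_add]
  generalize derivForm (prodMove P Q z K) (s z) = d at hn ⊢
  rw [← neg_neg d, hn]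
  module

end Kostant

/-! ### Differentiability of the coefficients, and Leibniz rules for gradients and traces -/

section Deformation

variable {EG : Type*} [NormedAddCommGroup EG] [NormedSpace ℝ EG] [FiniteDimensional ℝ EG]
  {G : Type*} [TopologicalSpace G] [ChartedSpace EG G] [Group G] [LieGroup 𝓘(ℝ, EG) ∞ G]
  {EM : Type*} [NormedAddCommGroup EM] [NormedSpace ℝ EM] [FiniteDimensional ℝ EM]
  {M : Type*} [TopologicalSpace M] [T2Space M] [ChartedSpace EM M] [IsManifold 𝓘(ℝ, EM) ∞ M]
  [MulAction G M] [ContMDiffSMul 𝓘(ℝ, EG) 𝓘(ℝ, EM) ∞ G M]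
  {L : M → Type*} [∀ x, NormedAddCommGroup (L x)] [∀ x, InnerProductSpace ℂ (L x)]
  [TopologicalSpace (TotalSpace ℂ L)] [FiberBundle ℂ L] [VectorBundle ℂ ℂ L] [VectorBundle ℝ ℂ L]
  [ContMDiffVectorBundle ∞ ℂ L 𝓘(ℝ, EM)]
  {EN : Type*} [NormedAddCommGroup EN] [NormedSpace ℝ EN] [FiniteDimensional ℝ EN]
  {N : Type*} [TopologicalSpace N] [T2Space N] [ChartedSpace EN N] [IsManifold 𝓘(ℝ, EN) ∞ N]
  [MulAction G N] [ContMDiffSMul 𝓘(ℝ, EG) 𝓘(ℝ, EN) ∞ G N]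
  {F : N → Type*} [∀ y, NormedAddCommGroup (F y)] [∀ y, InnerProductSpace ℂ (F y)]
  [TopologicalSpace (TotalSpace ℂ F)] [FiberBundle ℂ F] [VectorBundle ℂ ℂ F] [VectorBundle ℝ ℂ F]
  [ContMDiffVectorBundle ∞ ℂ F 𝓘(ℝ, EN)]


section Calculus

variable {E' : Type*} [NormedAddCommGroup E'] [NormedSpace ℝ E']
  {H' : Type*} [TopologicalSpace H'] {I' : ModelWithCorners ℝ E' H'}
  {Y : Type*} [TopologicalSpace Y] [ChartedSpace H' Y] {ι : Type*} [Fintype ι]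

lemma mdifferentiableAt_pi {m : ι → Y → ℝ} {y : Y}
    (hm : ∀ i, MDifferentiableAt I' 𝓘(ℝ, ℝ) (m i) y) :
    MDifferentiableAt I' 𝓘(ℝ, ι → ℝ) (fun y i => m i y) y := by
  rw [mdifferentiableAt_iff]
  exact ⟨continuousAt_pi.2 fun i => (hm i).continuousAt,
    differentiableWithinAt_pi.2 fun i => ((mdifferentiableAt_iff _ _).1 (hm i)).2⟩

lemma contDiff_rescale {a : ℝ → ℝ} (ha : ContDiff ℝ ∞ a) (A : ℝ) :
    ContDiff ℝ ∞ (rescale a A) :=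
  ha.comp ((contDiff_id.div_const A).sub contDiff_const)

lemma contDiff_psi {a f : ℝ → ℝ} (ha : ContDiff ℝ ∞ a) (hf : ContDiff ℝ ∞ f) (A : ℝ) (j : ι) :
    ContDiff ℝ ∞ (fun p : (ι → ℝ) × (ι → ℝ) => psi a f A p.1 p.2 j) := by
  have h1 := contDiff_rescale ha A
  have h2 := contDiff_rescale hf A
  have h1' := (contDiff_infty_iff_deriv.1 h1).2
  have h2' := (contDiff_infty_iff_deriv.1 h2).2
  have p1 : ∀ i, ContDiff ℝ ∞ (fun p : (ι → ℝ) × (ι → ℝ) => p.1 i) := fun i => by fun_prop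
  have p2 : ∀ i, ContDiff ℝ ∞ (fun p : (ι → ℝ) × (ι → ℝ) => p.2 i) := fun i => by fun_prop
  have n1 : ContDiff ℝ ∞ (fun p : (ι → ℝ) × (ι → ℝ) => normSq p.1) :=
    ContDiff.sum fun i _ => (p1 i).pow 2
  have n2 : ContDiff ℝ ∞ (fun p : (ι → ℝ) × (ι → ℝ) => normSq (p.1 + p.2)) :=
    ContDiff.sum fun i _ => ((p1 i).add (p2 i)).pow 2
  have b : ContDiff ℝ ∞ (fun p : (ι → ℝ) × (ι → ℝ) => beta a A p.1 p.2) :=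
    n1.add ((h1.comp n1).mul (n2.sub n1))
  have r : ∀ i, ContDiff ℝ ∞ (fun p : (ι → ℝ) × (ι → ℝ) => rho a f A p.1 p.2 i) := fun i =>
    ((p1 i).add (p2 i)).sub ((h2.comp b).mul (p2 i))
  have g : ContDiff ℝ ∞ (fun p : (ι → ℝ) × (ι → ℝ) => gammaCoeff a A p.1 p.2 j) :=
    ((contDiff_const.mul (contDiff_const.add ((h1'.comp n1).mul (n2.sub n1)))).mul (p1 j)).add
      ((contDiff_const.mul (h1.comp n1)).mul (p2 j))
  exact (contDiff_const.mul (r j)).sub (((contDiff_const.mul (h2'.comp b)).mul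
    (ContDiff.sum fun i _ => (r i).mul (p2 i))).mul g)

end Calculus

section Psi

variable (P : PrequantumData EG G EM M L) (Q : PrequantumData EG G EN N F) {ι : Type*} [Fintype ι]

lemma mdifferentiableAt_psiFun (V : ι → GroupLieAlgebra 𝓘(ℝ, EG) G) {a f : ℝ → ℝ}
    (ha : ContDiff ℝ ∞ a) (hf : ContDiff ℝ ∞ f) (A : ℝ) (j : ι) (z : M × N) :
    MDifferentiableAt (𝓘(ℝ, EM).prod 𝓘(ℝ, EN)) 𝓘(ℝ, ℝ) (psiFun P Q V a f A j) z := by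
  have h1 : MDifferentiableAt (𝓘(ℝ, EM).prod 𝓘(ℝ, EN)) 𝓘(ℝ, ι → ℝ)
      (fun (z : M × N) i => P.moment (V i) z.1) z :=
    mdifferentiableAt_pi fun i => MDifferentiableAt.comp (f := Prod.fst) z
      (P.mdifferentiableAt_moment (V i) z.1) mdifferentiableAt_fst
  have h2 : MDifferentiableAt (𝓘(ℝ, EM).prod 𝓘(ℝ, EN)) 𝓘(ℝ, ι → ℝ)
      (fun (z : M × N) i => Q.moment (V i) z.2) z :=
    mdifferentiableAt_pi fun i => MDifferentiableAt.comp (f := Prod.snd) z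
      (Q.mdifferentiableAt_moment (V i) z.2) mdifferentiableAt_snd
  have h3 := ((contDiff_psi (ι := ι) ha hf A j).differentiable (by simp)).mdifferentiable
    ((fun i => P.moment (V i) z.1), (fun i => Q.moment (V i) z.2))
  exact MDifferentiableAt.comp (f := fun z : M × N =>
    ((fun i => P.moment (V i) z.1), (fun i => Q.moment (V i) z.2))) z h3 (h1.prodMk_space h2)

end Psi

section Gradient

variable {E : Type*} [NormedAddCommGroup E] [NormedSpace ℝ E] [FiniteDimensional ℝ E]
  {H : Type*} [TopologicalSpace H] {I : ModelWithCorners ℝ E H}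
  {X : Type*} [TopologicalSpace X] [ChartedSpace H X] [IsManifold I ∞ X]
  {g : ∀ x : X, TangentSpace I x → TangentSpace I x → ℝ}
  {J : ∀ x : X, TangentSpace I x → TangentSpace I x} {x : X}
  {ι κ : Type*} [Fintype κ] {c : ι → X → ℝ} {B : ι → ∀ x : X, TangentSpace I x}

lemma IsAlmostHermitian.leviCivita_sum_smul (A : IsAlmostHermitian I g J) (σ : Finset ι)
    (hc : ∀ i, MDifferentiableAt I 𝓘(ℝ, ℝ) (c i) x) (hB : ∀ i, DiffFieldAt I (B i) x)
    (u : TangentSpace I x) :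
    leviCivita I g (fun y => ∑ i ∈ σ, c i y • B i y) x u
      = ∑ i ∈ σ, (mvfderiv I (c i) x u • B i x + c i x • leviCivita I g (B i) x u) := by
  rw [A.leviCivita_sum (Y := fun i y => c i y • B i y) σ fun i => (hB i).smul (hc i)]
  exact Finset.sum_congr rfl fun i _ => A.leviCivita_smul (hc i) (hB i) u

lemma IsAlmostHermitian.sum_mvfderiv_smul {e : κ → TangentSpace I x} (A : IsAlmostHermitian I g J)
    (he : IsOrthoFrame (g x) e) (f : X → ℝ) :
    ∑ k, mvfderiv I f x (e k) • e k = grad I g f x :=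
  (A.pointwise x).sum_frame_eq he (A.isOrthoFrame_orthFrame x)
    (Q := fun u v => mvfderiv I f x u • v)
    { add_left := fun u v w => by rw [map_add, add_smul]
      add_right := fun u v w => smul_add _ _ _
      smul_left := fun r u v => by rw [map_smul, smul_eq_mul, mul_smul]
      smul_right := fun r u v => smul_comm _ _ _ }

lemma IsAlmostHermitian.metric_grad (A : IsAlmostHermitian I g J) (f : X → ℝ)
    (v : TangentSpace I x) :
    g x v (grad I g f x)
      = ∑ a, mvfderiv I f x (orthFrame I g x a) * g x v (orthFrame I g x a) := by
  rw [grad, (A.pointwise x).sum_right]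
  exact Finset.sum_congr rfl fun a _ => (A.pointwise x).smul_right _ _ _

/-- The derivatives of the coefficients are summed against the frame into gradients. For the fields
V_j^M this gradient term is twice I_2. -/
lemma IsAlmostHermitian.trHolo_sum_smul [Fintype ι] (A : IsAlmostHermitian I g J)
    (hc : ∀ i, MDifferentiableAt I 𝓘(ℝ, ℝ) (c i) x) (hB : ∀ i, DiffFieldAt I (B i) x) :
    trHolo I g J (fun y => ∑ i, c i y • B i y) x
      = ∑ i, ((c i x : ℂ) * trHolo I g J (B i) x
        + ((g x (B i x) (grad I g (c i) x) : ℂ)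
          - Complex.I * (g x (J x (B i x)) (grad I g (c i) x) : ℂ)) / 2) := by
  have h := A.pointwise x
  have h1 : ∀ i, ((c i x : ℂ) * trHolo I g J (B i) x
        + ((g x (B i x) (grad I g (c i) x) : ℂ)
          - Complex.I * (g x (J x (B i x)) (grad I g (c i) x) : ℂ)) / 2)
      = ∑ a, ((c i x : ℂ) *
        (((g x (holoConn I g J (B i) x (orthFrame I g x a)) (orthFrame I g x a) : ℂ)
          - Complex.I * (g x (J x (holoConn I g J (B i) x (orthFrame I g x a)))
            (orthFrame I g x a) : ℂ)) / 2)
        + (mvfderiv I (c i) x (orthFrame I g x a) : ℂ) *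
          ((g x (B i x) (orthFrame I g x a) : ℂ)
            - Complex.I * (g x (J x (B i x)) (orthFrame I g x a) : ℂ)) / 2) := fun i => by
    rw [trHolo, A.metric_grad, A.metric_grad, Finset.sum_add_distrib, Finset.mul_sum]
    congr 1
    rw [← Finset.sum_div]
    push_cast
    rw [Finset.mul_sum, ← Finset.sum_sub_distrib]
    congr 1
    exact Finset.sum_congr rfl fun a _ => by ring
  rw [Finset.sum_congr rfl fun i _ => h1 i, Finset.sum_comm, trHolo]
  refine Finset.sum_congr rfl fun a _ => ?_
  have hJ : ∀ w : ι → TangentSpace I x, J x (∑ i, w i) = ∑ i, J x (w i) := fun w =>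
    map_sum h.cplxLinear w Finset.univ
  rw [A.holoConn_sum_smul _ hc hB, hJ, h.sum_left, h.sum_left]
  push_cast
  rw [Finset.mul_sum, ← Finset.sum_sub_distrib, Finset.sum_div]
  refine Finset.sum_congr rfl fun i _ => ?_
  rw [h.J_add, h.J_smul, h.J_smul, h.add_left, h.add_left, h.smul_left, h.smul_left, h.smul_left,
    h.smul_left]
  push_cast
  ring

end Gradient

end Deformation

/-! ### Collecting the Clifford terms on the product -/

section Assembly

variable {EG : Type*} [NormedAddCommGroup EG] [NormedSpace ℝ EG] [FiniteDimensional ℝ EG]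
  {G : Type*} [TopologicalSpace G] [ChartedSpace EG G] [Group G] [LieGroup 𝓘(ℝ, EG) ∞ G]
  {EM : Type*} [NormedAddCommGroup EM] [NormedSpace ℝ EM] [FiniteDimensional ℝ EM]
  {M : Type*} [TopologicalSpace M] [T2Space M] [ChartedSpace EM M] [IsManifold 𝓘(ℝ, EM) ∞ M]
  [MulAction G M] [ContMDiffSMul 𝓘(ℝ, EG) 𝓘(ℝ, EM) ∞ G M]
  {L : M → Type*} [∀ x, NormedAddCommGroup (L x)] [∀ x, InnerProductSpace ℂ (L x)]
  [TopologicalSpace (TotalSpace ℂ L)] [FiberBundle ℂ L] [VectorBundle ℂ ℂ L] [VectorBundle ℝ ℂ L]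
  [ContMDiffVectorBundle ∞ ℂ L 𝓘(ℝ, EM)]
  {EN : Type*} [NormedAddCommGroup EN] [NormedSpace ℝ EN] [FiniteDimensional ℝ EN]
  {N : Type*} [TopologicalSpace N] [T2Space N] [ChartedSpace EN N] [IsManifold 𝓘(ℝ, EN) ∞ N]
  [MulAction G N] [ContMDiffSMul 𝓘(ℝ, EG) 𝓘(ℝ, EN) ∞ G N]
  {F : N → Type*} [∀ y, NormedAddCommGroup (F y)] [∀ y, InnerProductSpace ℂ (F y)]
  [TopologicalSpace (TotalSpace ℂ F)] [FiberBundle ℂ F] [VectorBundle ℂ ℂ F] [VectorBundle ℝ ℂ F]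
  [ContMDiffVectorBundle ∞ ℂ F 𝓘(ℝ, EN)]


namespace IsHermitianPair

variable {T W : Type*} [AddCommGroup T] [Module ℝ T] [AddCommGroup W] [Module ℂ W]
  {g : T → T → ℝ} {J : T → T} {η : Cochain T W} (h : IsHermitianPair g J)
include h

lemma cliff_sum_left (hη : IsAntiholomorphicForm J η) {ι : Type*} (σ : Finset ι) (u : ι → T) :
    cliff g J (∑ i ∈ σ, u i) η = ∑ i ∈ σ, cliff g J (u i) η := by
  classical
  induction σ using Finset.induction_on with
  | empty => simpa using h.cliff_smul_left hη 0 0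
  | insert i σ hi ih => rw [Finset.sum_insert hi, Finset.sum_insert hi, h.cliff_add_left hη, ih]

/-- The Leibniz rule under a Clifford trace: d holds the derivatives of the coefficients, whose sum
against the frame becomes a gradient, and r the derivatives of the fields. -/
lemma sum_cliff_cliff (hη : IsAntiholomorphicForm J η) {ι κ : Type*} [Fintype ι] [Fintype κ]
    (e : κ → T) {x : κ → T} {d : ι → κ → ℝ} {c : ι → ℝ} {b : ι → T} {r : ι → κ → T}
    (hx : ∀ a, x a = ∑ i, (d i a • b i + c i • r i a)) :
    ∑ a, cliff g J (e a) (cliff g J (x a) η)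
      = ∑ i, (cliff g J (∑ a, d i a • e a) (cliff g J (b i) η)
        + (c i : ℂ) • ∑ a, cliff g J (e a) (cliff g J (r i a) η)) := by
  have h1 : ∀ a, cliff g J (e a) (cliff g J (x a) η)
      = ∑ i, ((d i a : ℂ) • cliff g J (e a) (cliff g J (b i) η)
        + (c i : ℂ) • cliff g J (e a) (cliff g J (r i a) η)) := fun a => by
    rw [hx, h.cliff_sum_left hη, cliff_sum_right]
    exact Finset.sum_congr rfl fun i _ => by
      rw [h.cliff_add_left hη, h.cliff_smul_left hη, h.cliff_smul_left hη, cliff_add_right,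
        cliff_smul_right, cliff_smul_right]
  rw [Finset.sum_congr rfl fun a _ => h1 a, Finset.sum_comm]
  refine Finset.sum_congr rfl fun i _ => ?_
  have hb := h.isAntiholomorphicForm_cliff hη (b i)
  rw [Finset.sum_add_distrib, h.cliff_sum_left hb, Finset.smul_sum]
  simp only [h.cliff_smul_left hb]

end IsHermitianPair

variable (P : PrequantumData EG G EM M L) (Q : PrequantumData EG G EN N F)
  {z : M × N} {ι κ κ' : Type*} [Fintype ι] [Fintype κ] [Fintype κ']
  {e : κ → TangentSpace 𝓘(ℝ, EM) z.1} {ε : κ' → TangentSpace 𝓘(ℝ, EN) z.2}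

lemma deformField_eq (V : ι → GroupLieAlgebra 𝓘(ℝ, EG) G) (ψ : ι → M × N → ℝ) :
    deformField EM EN V ψ = fun y => ∑ j, ψ j y • prodFund EM EN (V j) y := by
  funext y
  have h1 := map_sum (LinearMap.fst ℝ EM EN) (fun j => ψ j y • prodFund EM EN (V j) y) Finset.univ
  have h2 := map_sum (LinearMap.snd ℝ EM EN) (fun j => ψ j y • prodFund EM EN (V j) y) Finset.univ
  exact TProd.ext y h1.symm h2.symm

lemma sum_mvfderiv_fst (he : IsOrthoFrame (P.metric z.1) e) {f : M × N → ℝ}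
    (hf : MDifferentiableAt (𝓘(ℝ, EM).prod 𝓘(ℝ, EN)) 𝓘(ℝ, ℝ) f z) :
    ∑ k, mvfderiv (𝓘(ℝ, EM).prod 𝓘(ℝ, EN)) f z (pairVec z (e k) 0) • e k = gradM P f z := by
  rw [gradM, ← P.isAlmostHermitian.sum_mvfderiv_smul he]
  exact Finset.sum_congr rfl fun k _ => by rw [mvfderiv_slice_fst hf]

lemma sum_mvfderiv_snd (hε : IsOrthoFrame (Q.metric z.2) ε) {f : M × N → ℝ}
    (hf : MDifferentiableAt (𝓘(ℝ, EM).prod 𝓘(ℝ, EN)) 𝓘(ℝ, ℝ) f z) :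
    ∑ k, mvfderiv (𝓘(ℝ, EM).prod 𝓘(ℝ, EN)) f z (pairVec z 0 (ε k)) • ε k = gradN Q f z := by
  rw [gradN, ← Q.isAlmostHermitian.sum_mvfderiv_smul hε]
  exact Finset.sum_congr rfl fun k _ => by rw [mvfderiv_slice_snd hf]

lemma sum_mvfderiv_prodFrame (he : IsOrthoFrame (P.metric z.1) e)
    (hε : IsOrthoFrame (Q.metric z.2) ε) {f : M × N → ℝ}
    (hf : MDifferentiableAt (𝓘(ℝ, EM).prod 𝓘(ℝ, EN)) 𝓘(ℝ, ℝ) f z) :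
    ∑ a, mvfderiv (𝓘(ℝ, EM).prod 𝓘(ℝ, EN)) f z (prodFrame z e ε a) • prodFrame z e ε a
      = pairVec z (gradM P f z) (gradN Q f z) := by
  rw [← sum_mvfderiv_fst P he hf, ← sum_mvfderiv_snd Q hε hf, pairVec_sum_smul,
    Fintype.sum_sum_type]
  rfl

variable {η : Cochain (TProd EM EN z) (LineProd L F z)}

lemma cliffLF_eq_add (hη : IsAntiholomorphicForm (prodCplx P Q z) η)
    (u : TangentSpace 𝓘(ℝ, EM) z.1) (v : TangentSpace 𝓘(ℝ, EN) z.2) :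
    cliffLF P Q z u v η = cliffLF P Q z u 0 η + cliffLF P Q z 0 v η := by
  rw [cliffLF, pairVec_eq_add, (isHermitianPair_prod P Q z).cliff_add_left hη]
  rfl

/-- The Clifford trace of the covariant derivative of the field of `K`. -/
noncomputable def cliffFundM (e : κ → TangentSpace 𝓘(ℝ, EM) z.1)
    (K : GroupLieAlgebra 𝓘(ℝ, EG) G) (η : Cochain (TProd EM EN z) (LineProd L F z)) :
    Cochain (TProd EM EN z) (LineProd L F z) :=
  ∑ k, cliffLF P Q z (e k) 0
    (cliffLF P Q z (leviCivita 𝓘(ℝ, EM) P.metric (fundField K) z.1 (e k)) 0 η)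

/-- The Clifford trace of the covariant derivative of the field of `K` along the second factor. -/
noncomputable def cliffFundN (ε : κ' → TangentSpace 𝓘(ℝ, EN) z.2)
    (K : GroupLieAlgebra 𝓘(ℝ, EG) G) (η : Cochain (TProd EM EN z) (LineProd L F z)) :
    Cochain (TProd EM EN z) (LineProd L F z) :=
  ∑ i, cliffLF P Q z 0 (ε i)
    (cliffLF P Q z 0 (leviCivita 𝓘(ℝ, EN) Q.metric (fundField K) z.2 (ε i)) η)

/-- The derivative of a product field along a vector of one factor stays in that factor, so there
are no mixed terms. -/
lemma sum_cliff_leviCivita_prodFund (K : GroupLieAlgebra 𝓘(ℝ, EG) G) :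
    ∑ a, cliff (prodMetric P Q z) (prodCplx P Q z) (prodFrame z e ε a)
      (cliff (prodMetric P Q z) (prodCplx P Q z)
        (leviCivita (𝓘(ℝ, EM).prod 𝓘(ℝ, EN)) (prodMetric P Q) (prodFund EM EN K) z
          (prodFrame z e ε a)) η)
      = cliffFundM P Q e K η + cliffFundN P Q ε K η := by
  have hl := leviCivita_prodField P Q (smoothFieldAt_fundField K z.1)
    (smoothFieldAt_fundField K z.2)
  -- A frame vector of one factor has zero component in the other, and the derivative along the zero
  -- vector vanishes.
  have h1 := fun x => P.isAlmostHermitian.leviCivita_smul_left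
    (PrequantumData.diffFieldAt_fundField x K) 0 0
  have h2 := fun x => Q.isAlmostHermitian.leviCivita_smul_left
    (PrequantumData.diffFieldAt_fundField x K) 0 0
  simp only [zero_smul] at h1 h2
  rw [Fintype.sum_sum_type, cliffFundM, cliffFundN]
  refine congrArg₂ _ (Finset.sum_congr rfl fun k _ => ?_) (Finset.sum_congr rfl fun i _ => ?_)
  · simp only [prodFrame, Sum.elim_inl, prodFund]
    rw [hl, fstVec_pairVec, sndVec_pairVec, h2]
    rfl
  · simp only [prodFrame, Sum.elim_inr, prodFund]
    rw [hl, fstVec_pairVec, sndVec_pairVec, h1]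
    rfl

/-- The collection of the terms of the Bochner type formula. -/
lemma collect_bochner_terms {W : Type*} [AddCommGroup W] [Module ℂ W] (T q : ℂ)
    (ψ θ tM tN x : ι → ℂ) (a b c d RM RN l : ι → W) (D η : W) :
    D + (Complex.I * T / 2) • ((∑ j, ((a j + b j + (c j + d j)) + ψ j • (RM j + RN j)))
        - (2 : ℂ) • ∑ j, ψ j • (l j + (2 * Real.pi * Complex.I * θ j) • η
          + (1 / 4 : ℂ) • (RM j + RN j) + (1 / 2 * (tM j + tN j)) • η)) + q • η
      = D + (Complex.I * T / 4) • (∑ j, (a j + ψ j • RM j))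
        + (Complex.I * T / 4) • (∑ j, ψ j • RN j)
        - (Complex.I * T / 2 * ∑ j, (ψ j * tM j + x j / 2)) • η
        - (Complex.I * T / 2 * ∑ j, ψ j * tN j) • η
        + (2 * Real.pi * T * ∑ j, ψ j * θ j) • η
        - (Complex.I * T) • (∑ j, ψ j • l j) + q • η
        + (Complex.I * T) • ((∑ j, ((1 / 4 : ℂ) • (a j + (2 : ℂ) • b j) + (1 / 2 : ℂ) • c j))
          + ((1 / 4 : ℂ) * ∑ j, x j) • η + ∑ j, (1 / 2 : ℂ) • d j) := by
  have key : (Complex.I * T / 2) • ((∑ j, ((a j + b j + (c j + d j)) + ψ j • (RM j + RN j)))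
        - (2 : ℂ) • ∑ j, ψ j • (l j + (2 * Real.pi * Complex.I * θ j) • η
          + (1 / 4 : ℂ) • (RM j + RN j) + (1 / 2 * (tM j + tN j)) • η))
      = (Complex.I * T / 4) • (∑ j, (a j + ψ j • RM j))
        + (Complex.I * T / 4) • (∑ j, ψ j • RN j)
        - (Complex.I * T / 2 * ∑ j, (ψ j * tM j + x j / 2)) • η
        - (Complex.I * T / 2 * ∑ j, ψ j * tN j) • η
        + (2 * Real.pi * T * ∑ j, ψ j * θ j) • η
        - (Complex.I * T) • (∑ j, ψ j • l j)
        + (Complex.I * T) • ((∑ j, ((1 / 4 : ℂ) • (a j + (2 : ℂ) • b j) + (1 / 2 : ℂ) • c j))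
          + ((1 / 4 : ℂ) * ∑ j, x j) • η + ∑ j, (1 / 2 : ℂ) • d j) := by
    simp only [Finset.smul_sum, Finset.mul_sum, Finset.sum_smul, ← Finset.sum_add_distrib,
      ← Finset.sum_sub_distrib]
    refine Finset.sum_congr rfl fun j _ => ?_
    -- Index by index the identity is one of coefficients: 1/2 - 1/4 for the Clifford traces, 1/4 +
    -- 1/4 for a_j, and cancellation of x_j. Only the moment term uses (√-1)² = -1.
    match_scalars <;> first
      | ring1
      | linear_combination (-2 * Real.pi * T * ψ j * θ j) * Complex.I_mul_I
  rw [key]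
  abel

end Assembly

/-! ### The Bochner type formula -/

section Bochner

variable {EG : Type*} [NormedAddCommGroup EG] [NormedSpace ℝ EG] [FiniteDimensional ℝ EG]
  {G : Type*} [TopologicalSpace G] [ChartedSpace EG G] [Group G] [LieGroup 𝓘(ℝ, EG) ∞ G]
  {EM : Type*} [NormedAddCommGroup EM] [NormedSpace ℝ EM] [FiniteDimensional ℝ EM]
  {M : Type*} [TopologicalSpace M] [T2Space M] [ChartedSpace EM M] [IsManifold 𝓘(ℝ, EM) ∞ M]
  [MulAction G M] [ContMDiffSMul 𝓘(ℝ, EG) 𝓘(ℝ, EM) ∞ G M]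
  {L : M → Type*} [∀ x, NormedAddCommGroup (L x)] [∀ x, InnerProductSpace ℂ (L x)]
  [TopologicalSpace (TotalSpace ℂ L)] [FiberBundle ℂ L] [VectorBundle ℂ ℂ L] [VectorBundle ℝ ℂ L]
  [ContMDiffVectorBundle ∞ ℂ L 𝓘(ℝ, EM)]
  {EN : Type*} [NormedAddCommGroup EN] [NormedSpace ℝ EN] [FiniteDimensional ℝ EN]
  {N : Type*} [TopologicalSpace N] [T2Space N] [ChartedSpace EN N] [IsManifold 𝓘(ℝ, EN) ∞ N]
  [MulAction G N] [ContMDiffSMul 𝓘(ℝ, EG) 𝓘(ℝ, EN) ∞ G N]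
  {F : N → Type*} [∀ y, NormedAddCommGroup (F y)] [∀ y, InnerProductSpace ℂ (F y)]
  [TopologicalSpace (TotalSpace ℂ F)] [FiberBundle ℂ F] [VectorBundle ℂ ℂ F] [VectorBundle ℝ ℂ F]
  [ContMDiffVectorBundle ∞ ℂ F 𝓘(ℝ, EN)]


variable (P : PrequantumData EG G EM M L) (Q : PrequantumData EG G EN N F)
  {s : ∀ z : M × N, Cochain (TProd EM EN z) (LineProd L F z)} {z : M × N}
  {ι κ κ' : Type*} [Fintype ι] [Fintype κ] [Fintype κ']
  {e : κ → TangentSpace 𝓘(ℝ, EM) z.1} {ε : κ' → TangentSpace 𝓘(ℝ, EN) z.2}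

/-- The Bochner type formula for arbitrary differentiable coefficients. -/
lemma bochner_formula (V : ι → GroupLieAlgebra 𝓘(ℝ, EG) G) {ψ : ι → M × N → ℝ}
    (hψ : ∀ j, MDifferentiableAt (𝓘(ℝ, EM).prod 𝓘(ℝ, EN)) 𝓘(ℝ, ℝ) (ψ j) z)
    (hs : IsDiffForm (𝓘(ℝ, EM).prod 𝓘(ℝ, EN)) (prodCplx P Q) (DiffLineAt EM EN) s z)
    (hDs : IsDiffForm (𝓘(ℝ, EM).prod 𝓘(ℝ, EN)) (prodCplx P Q) (DiffLineAt EM EN)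
      (fun y => dirac (𝓘(ℝ, EM).prod 𝓘(ℝ, EN)) (prodMetric P Q) (prodCplx P Q) (prodConn P Q) s y) z)
    (he : IsOrthoFrame (P.metric z.1) e) (hε : IsOrthoFrame (Q.metric z.2) ε) (T : ℝ) :
    deformedDiracLF P Q V ψ T (deformedDiracLF P Q V ψ T s) z
      = diracLF P Q (diracLF P Q s) z
        + (Complex.I * (T : ℂ) / 4) • ∑ k,
            cliffLF P Q z (e k) 0
              (cliffLF P Q z
                (leviCivita 𝓘(ℝ, EM) P.metric
                  (fun x => ∑ j, ψ j (x, z.2) • fundField (V j) x) z.1 (e k)) 0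
                (s z))
        + (Complex.I * (T : ℂ) / 4) • ∑ i, ∑ j, (ψ j z : ℂ) •
            cliffLF P Q z 0 (ε i)
              (cliffLF P Q z 0
                (leviCivita 𝓘(ℝ, EN) Q.metric
                  (fundField (V j)) z.2 (ε i))
                (s z))
        - (Complex.I * (T : ℂ) / 2 *
            trHolo 𝓘(ℝ, EM) P.metric P.cplx
              (fun x => ∑ j, ψ j (x, z.2) • fundField (V j) x) z.1) • s z
        - (Complex.I * (T : ℂ) / 2 * ∑ j, (ψ j z : ℂ) *
            trHolo 𝓘(ℝ, EN) Q.metric Q.cplx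
              (fundField (V j)) z.2) • s z
        + (2 * (Real.pi : ℂ) * (T : ℂ) *
            ∑ j, (ψ j z : ℂ) * ((P.moment (V j) z.1 + Q.moment (V j) z.2 : ℝ) : ℂ)) • s z
        - (Complex.I * (T : ℂ)) • ∑ j, (ψ j z : ℂ) • lieForm P Q (V j) s z
        + ((T : ℂ) ^ 2 / 4 *
            (prodMetric P Q z (deformField EM EN V ψ z)
              (deformField EM EN V ψ z) : ℂ)) • s z
        + (Complex.I * (T : ℂ)) •
            (I1 P Q V ψ z (s z) + I2 P V ψ z • s z
              + I3 P Q V ψ z (s z)) := by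
  have A := isAlmostHermitian_prod P Q
  have h := isHermitianPair_prod P Q z
  have hD := isSectionConnection_prodConn P Q
  have hE : IsOrthoFrame (prodMetric P Q z) (prodFrame z e ε) := isOrthoFrame_prod P Q he hε
  have hη := hs.antihol_self
  have hK := fun j => diffFieldAt_prodFund (EM := EM) (EN := EN) z (V j)
  have hZ := deformField_eq (EM := EM) (EN := EN) V ψ
  have hZd : DiffFieldAt (𝓘(ℝ, EM).prod 𝓘(ℝ, EN)) (deformField EM EN V ψ) z := by
    rw [hZ]
    exact DiffFieldAt.sum fun j _ => (hK j).smul (hψ j)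
  have key := IsDiffForm.deformedDirac_deformedDirac A hD hs hDs hZd hE T
  have hsl : ∀ j, MDifferentiableAt 𝓘(ℝ, EM) 𝓘(ℝ, ℝ) (fun x => ψ j (x, z.2)) z.1 := fun j =>
    MDifferentiableAt.comp (f := fun x : M => (x, z.2)) z.1 (hψ j)
      (mdifferentiableAt_id.prodMk mdifferentiableAt_const)
  -- Clifford trace of the derivative of X: the four products c(grad ψ_j)c(K_j) by factors, plus ψ_j
  -- times the traces of the generated fields.
  have t1 : ∑ a, cliff (prodMetric P Q z) (prodCplx P Q z) (prodFrame z e ε a)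
      (cliff (prodMetric P Q z) (prodCplx P Q z)
        (leviCivita (𝓘(ℝ, EM).prod 𝓘(ℝ, EN)) (prodMetric P Q) (deformField EM EN V ψ) z
          (prodFrame z e ε a)) (s z))
      = ∑ j, ((cliffLF P Q z (gradM P (ψ j) z) 0 (cliffLF P Q z (fundField (V j) z.1) 0 (s z))
        + cliffLF P Q z (gradM P (ψ j) z) 0 (cliffLF P Q z 0 (fundField (V j) z.2) (s z))
        + (cliffLF P Q z 0 (gradN Q (ψ j) z) (cliffLF P Q z (fundField (V j) z.1) 0 (s z))
        + cliffLF P Q z 0 (gradN Q (ψ j) z) (cliffLF P Q z 0 (fundField (V j) z.2) (s z))))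
        + (ψ j z : ℂ) • (cliffFundM P Q e (V j) (s z) + cliffFundN P Q ε (V j) (s z))) := by
    have h1 := h.sum_cliff_cliff hη (prodFrame z e ε)
      (x := fun a => leviCivita (𝓘(ℝ, EM).prod 𝓘(ℝ, EN)) (prodMetric P Q) (deformField EM EN V ψ) z
        (prodFrame z e ε a))
      (d := fun j a => mvfderiv (𝓘(ℝ, EM).prod 𝓘(ℝ, EN)) (ψ j) z (prodFrame z e ε a))
      (c := fun j => ψ j z) (b := fun j => prodFund EM EN (V j) z)
      (r := fun j a => leviCivita (𝓘(ℝ, EM).prod 𝓘(ℝ, EN)) (prodMetric P Q) (prodFund EM EN (V j)) z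
        (prodFrame z e ε a))
      (fun a => by rw [hZ]; exact A.leviCivita_sum_smul _ hψ hK _)
    refine h1.trans (Finset.sum_congr rfl fun j _ => ?_)
    rw [sum_cliff_leviCivita_prodFund, sum_mvfderiv_prodFrame P Q he hε (hψ j)]
    congr 1
    have hb : IsAntiholomorphicForm (prodCplx P Q z)
        (cliff (prodMetric P Q z) (prodCplx P Q z) (prodFund EM EN (V j) z) (s z)) :=
      h.isAntiholomorphicForm_cliff hη _
    refine (cliffLF_eq_add P Q hb _ _).trans ?_
    have hc : cliff (prodMetric P Q z) (prodCplx P Q z) (prodFund EM EN (V j) z) (s z)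
        = cliffLF P Q z (fundField (V j) z.1) 0 (s z)
          + cliffLF P Q z 0 (fundField (V j) z.2) (s z) := cliffLF_eq_add P Q hη _ _
    rw [hc]
    exact congrArg₂ _ (cliff_add_right _ _ _) (cliff_add_right _ _ _)
  -- Derivative along X, by linearity in the direction and Kostant's formula for each generated
  -- field.
  have t2 : cliffordConn (𝓘(ℝ, EM).prod 𝓘(ℝ, EN)) (prodMetric P Q) (prodCplx P Q) (prodConn P Q)
      s z (deformField EM EN V ψ z)
      = ∑ j, (ψ j z : ℂ) • (lieForm P Q (V j) s z
        + (2 * Real.pi * Complex.I * ((P.moment (V j) z.1 + Q.moment (V j) z.2 : ℝ) : ℂ)) • s z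
        + (1 / 4 : ℂ) • (cliffFundM P Q e (V j) (s z) + cliffFundN P Q ε (V j) (s z))
        + (1 / 2 * (trHolo 𝓘(ℝ, EM) P.metric P.cplx (fundField (V j)) z.1
          + trHolo 𝓘(ℝ, EN) Q.metric Q.cplx (fundField (V j)) z.2)) • s z) := by
    have h0 := IsDiffForm.cliffordConn_smul_left A hD hs 0 0
    simp only [zero_smul, Complex.ofReal_zero] at h0
    have h1 : ∀ σ : Finset ι, cliffordConn (𝓘(ℝ, EM).prod 𝓘(ℝ, EN)) (prodMetric P Q)
        (prodCplx P Q) (prodConn P Q) s z (∑ j ∈ σ, ψ j z • prodFund EM EN (V j) z)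
        = ∑ j ∈ σ, (ψ j z : ℂ) • cliffordConn (𝓘(ℝ, EM).prod 𝓘(ℝ, EN)) (prodMetric P Q)
          (prodCplx P Q) (prodConn P Q) s z (prodFund EM EN (V j) z) := fun σ => by
      classical
      induction σ using Finset.induction_on with
      | empty => exact h0
      | insert j σ hj ih =>
        rw [Finset.sum_insert hj, Finset.sum_insert hj,
          IsDiffForm.cliffordConn_add_left A hD hs, IsDiffForm.cliffordConn_smul_left A hD hs, ih]
    rw [hZ]
    refine (h1 Finset.univ).trans (Finset.sum_congr rfl fun j _ => ?_)
    rw [← sum_cliff_leviCivita_prodFund]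
    exact congrArg _ (cliffordConn_prodFund P Q hs he hε (V j))
  have t3 : ∑ k, cliffLF P Q z (e k) 0 (cliffLF P Q z (leviCivita 𝓘(ℝ, EM) P.metric
        (fun x => ∑ j, ψ j (x, z.2) • fundField (V j) x) z.1 (e k)) 0 (s z))
      = ∑ j, (cliffLF P Q z (gradM P (ψ j) z) 0 (cliffLF P Q z (fundField (V j) z.1) 0 (s z))
        + (ψ j z : ℂ) • cliffFundM P Q e (V j) (s z)) := by
    have h1 := h.sum_cliff_cliff hη (fun k => pairVec z (e k) 0)
      (x := fun k => pairVec z (leviCivita 𝓘(ℝ, EM) P.metric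
        (fun x => ∑ j, ψ j (x, z.2) • fundField (V j) x) z.1 (e k)) 0)
      (d := fun j k => mvfderiv 𝓘(ℝ, EM) (fun x => ψ j (x, z.2)) z.1 (e k))
      (c := fun j => ψ j z) (b := fun j => pairVec z (fundField (V j) z.1) 0)
      (r := fun j k => pairVec z (leviCivita 𝓘(ℝ, EM) P.metric (fundField (V j)) z.1 (e k)) 0)
      (fun k => by
        rw [P.isAlmostHermitian.leviCivita_sum_smul _ hsl
          fun j => PrequantumData.diffFieldAt_fundField z.1 (V j)]
        -- The empty index set on the side of N keeps the second component zero.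
        have h2 := pairVec_sum (EN := EN) (κ' := Fin 0) (z := z) (fun j => mvfderiv 𝓘(ℝ, EM)
          (fun x => ψ j (x, z.2)) z.1 (e k) • fundField (V j) z.1
          + ψ j z • leviCivita 𝓘(ℝ, EM) P.metric (fundField (V j)) z.1 (e k)) (fun _ => 0)
        simp only [Finset.univ_eq_empty, Finset.sum_empty, add_zero] at h2
        refine h2.trans (Finset.sum_congr rfl fun j _ => ?_)
        rw [← pairVec_smul, ← pairVec_smul, ← pairVec_add, smul_zero, smul_zero, add_zero])
    refine h1.trans (Finset.sum_congr rfl fun j _ => ?_)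
    have h3 : ∑ k, mvfderiv 𝓘(ℝ, EM) (fun x => ψ j (x, z.2)) z.1 (e k) •
        pairVec z (e k) (0 : TangentSpace 𝓘(ℝ, EN) z.2) = pairVec z (gradM P (ψ j) z) 0 := by
      rw [gradM, ← P.isAlmostHermitian.sum_mvfderiv_smul he]
      have h4 := pairVec_sum_smul (EN := EN) (κ' := Fin 0) (z := z)
        (fun k => mvfderiv 𝓘(ℝ, EM) (fun x => ψ j (x, z.2)) z.1 (e k)) (fun _ => 0) e (fun _ => 0)
      simp only [Finset.univ_eq_empty, Finset.sum_empty, add_zero] at h4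
      exact h4.symm
    rw [h3]
    rfl
  have t4 : ∑ i, ∑ j, (ψ j z : ℂ) • cliffLF P Q z 0 (ε i) (cliffLF P Q z 0
        (leviCivita 𝓘(ℝ, EN) Q.metric (fundField (V j)) z.2 (ε i)) (s z))
      = ∑ j, (ψ j z : ℂ) • cliffFundN P Q ε (V j) (s z) := by
    rw [Finset.sum_comm]
    exact Finset.sum_congr rfl fun j _ => by rw [cliffFundN, Finset.smul_sum]
  have t5 : trHolo 𝓘(ℝ, EM) P.metric P.cplx
        (fun x => ∑ j, ψ j (x, z.2) • fundField (V j) x) z.1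
      = ∑ j, ((ψ j z : ℂ) * trHolo 𝓘(ℝ, EM) P.metric P.cplx (fundField (V j)) z.1
        + ((P.metric z.1 (fundField (V j) z.1) (gradM P (ψ j) z) : ℂ)
      + (P.metric z.1 (P.cplx z.1 (fundField (V j) z.1)) (gradM P (ψ j) z) : ℂ) / Complex.I)
          / 2) := by
    refine (P.isAlmostHermitian.trHolo_sum_smul hsl
      fun j => PrequantumData.diffFieldAt_fundField z.1 (V j)).trans
      (Finset.sum_congr rfl fun j _ => ?_)
    -- Since 1/√-1 = -√-1, the gradient part of the trace is written in the shape of I_2.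
    rw [Complex.div_I, sub_eq_add_neg, mul_comm Complex.I]
    rfl
  have t6 : I1 P Q V ψ z (s z) = ∑ j, ((1 / 4 : ℂ) • (cliffLF P Q z (gradM P (ψ j) z) 0
        (cliffLF P Q z (fundField (V j) z.1) 0 (s z)) + (2 : ℂ) • cliffLF P Q z (gradM P (ψ j) z) 0
        (cliffLF P Q z 0 (fundField (V j) z.2) (s z)))
      + (1 / 2 : ℂ) • cliffLF P Q z 0 (gradN Q (ψ j) z)
        (cliffLF P Q z (fundField (V j) z.1) 0 (s z))) := by
    rw [I1]
    refine Finset.sum_congr rfl fun j _ => ?_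
    have h1 : cliffLF P Q z (fundField (V j) z.1) ((2 : ℝ) • fundField (V j) z.2) (s z)
        = cliffLF P Q z (fundField (V j) z.1) 0 (s z)
          + (2 : ℂ) • cliffLF P Q z 0 (fundField (V j) z.2) (s z) := by
      rw [cliffLF_eq_add P Q hη]
      congr 1
      have h2 := h.cliff_smul_left hη 2 (pairVec z 0 (fundField (V j) z.2))
      rw [← pairVec_smul, smul_zero] at h2
      rw [Complex.ofReal_ofNat] at h2
      exact h2
    rw [h1]
    congr 2
    exact (cliff_add_right _ _ _).trans (congrArg _ (cliff_smul_right _ _ _))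
  rw [t1, t2] at key
  rw [t3, t4, t5, t6, I2, I3]
  exact key.trans (collect_bochner_terms (T : ℂ) _ _ _ _ _ _ _ _ _ _ _ _ _ _ _)

end Bochner

end BochnerFormula

theorem mainTheorem10
    {EG : Type*} [NormedAddCommGroup EG] [NormedSpace ℝ EG] [FiniteDimensional ℝ EG]
    {G : Type*} [TopologicalSpace G] [ChartedSpace EG G] [Group G] [LieGroup 𝓘(ℝ, EG) ∞ G]
    {EM : Type*} [NormedAddCommGroup EM] [NormedSpace ℝ EM] [FiniteDimensional ℝ EM]
    {M : Type*} [TopologicalSpace M] [T2Space M] [SecondCountableTopology M]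
    [ChartedSpace EM M] [IsManifold 𝓘(ℝ, EM) ∞ M]
    [MulAction G M] [ContMDiffSMul 𝓘(ℝ, EG) 𝓘(ℝ, EM) ∞ G M]
    {L : M → Type*} [∀ x, NormedAddCommGroup (L x)] [∀ x, InnerProductSpace ℂ (L x)]
    [TopologicalSpace (TotalSpace ℂ L)] [FiberBundle ℂ L]
    [VectorBundle ℂ ℂ L] [VectorBundle ℝ ℂ L] [ContMDiffVectorBundle ∞ ℂ L 𝓘(ℝ, EM)]
    {EN : Type*} [NormedAddCommGroup EN] [NormedSpace ℝ EN] [FiniteDimensional ℝ EN]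
    {N : Type*} [TopologicalSpace N] [T2Space N] [SecondCountableTopology N]
    [ChartedSpace EN N] [IsManifold 𝓘(ℝ, EN) ∞ N]
    [MulAction G N] [ContMDiffSMul 𝓘(ℝ, EG) 𝓘(ℝ, EN) ∞ G N]
    {F : N → Type*} [∀ y, NormedAddCommGroup (F y)] [∀ y, InnerProductSpace ℂ (F y)]
    [TopologicalSpace (TotalSpace ℂ F)] [FiberBundle ℂ F]
    [VectorBundle ℂ ℂ F] [VectorBundle ℝ ℂ F] [ContMDiffVectorBundle ∞ ℂ F 𝓘(ℝ, EN)]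
    (P : BochnerFormula.PrequantumData EG G EM M L)
    (Q : BochnerFormula.PrequantumData EG G EN N F)
    {ι : Type*} [Fintype ι] (V : Basis ι ℝ (GroupLieAlgebra 𝓘(ℝ, EG) G))
    (a f : ℝ → ℝ) (haf : BochnerFormula.IsCutoffPair a f) (A : ℝ) (hA : 0 < A)
    (ψ : ι → M × N → ℝ) (hψ : ψ = BochnerFormula.psiFun P Q V a f A) (T : ℝ)
    (s : ∀ z : M × N,
      BochnerFormula.Cochain (BochnerFormula.TProd EM EN z) (BochnerFormula.LineProd L F z))
    (z : M × N) (hs : BochnerFormula.IsSmoothFormNear P Q s z)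
    (e : Fin (finrank ℝ EM) → TangentSpace 𝓘(ℝ, EM) z.1)
    (he : BochnerFormula.IsOrthonormal (P.metric z.1) e)
    (ε : Fin (finrank ℝ EN) → TangentSpace 𝓘(ℝ, EN) z.2)
    (hε : BochnerFormula.IsOrthonormal (Q.metric z.2) ε) :
    BochnerFormula.deformedDiracLF P Q V ψ T (BochnerFormula.deformedDiracLF P Q V ψ T s) z
      = BochnerFormula.diracLF P Q (BochnerFormula.diracLF P Q s) z
        + (Complex.I * (T : ℂ) / 4) • ∑ k,
            BochnerFormula.cliffLF P Q z (e k) 0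
              (BochnerFormula.cliffLF P Q z
                (BochnerFormula.leviCivita 𝓘(ℝ, EM) P.metric
                  (fun x => ∑ j, ψ j (x, z.2) • BochnerFormula.fundField (V j) x) z.1 (e k)) 0
                (s z))
        + (Complex.I * (T : ℂ) / 4) • ∑ i, ∑ j, (ψ j z : ℂ) •
            BochnerFormula.cliffLF P Q z 0 (ε i)
              (BochnerFormula.cliffLF P Q z 0
                (BochnerFormula.leviCivita 𝓘(ℝ, EN) Q.metric
                  (BochnerFormula.fundField (V j)) z.2 (ε i))
                (s z))
        - (Complex.I * (T : ℂ) / 2 *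
            BochnerFormula.trHolo 𝓘(ℝ, EM) P.metric P.cplx
              (fun x => ∑ j, ψ j (x, z.2) • BochnerFormula.fundField (V j) x) z.1) • s z
        - (Complex.I * (T : ℂ) / 2 * ∑ j, (ψ j z : ℂ) *
            BochnerFormula.trHolo 𝓘(ℝ, EN) Q.metric Q.cplx
              (BochnerFormula.fundField (V j)) z.2) • s z
        + (2 * (Real.pi : ℂ) * (T : ℂ) *
            ∑ j, (ψ j z : ℂ) * ((P.moment (V j) z.1 + Q.moment (V j) z.2 : ℝ) : ℂ)) • s z
        - (Complex.I * (T : ℂ)) • ∑ j, (ψ j z : ℂ) • BochnerFormula.lieForm P Q (V j) s z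
        + ((T : ℂ) ^ 2 / 4 *
            (BochnerFormula.prodMetric P Q z (BochnerFormula.deformField EM EN V ψ z)
              (BochnerFormula.deformField EM EN V ψ z) : ℂ)) • s z
        + (Complex.I * (T : ℂ)) •
            (BochnerFormula.I1 P Q V ψ z (s z) + BochnerFormula.I2 P V ψ z • s z
              + BochnerFormula.I3 P Q V ψ z (s z)) := by
  have A' := BochnerFormula.isAlmostHermitian_prod P Q
  have hD := BochnerFormula.isSectionConnection_prodConn P Q
  have hS := BochnerFormula.isSmoothClass_prodConn P Q
  have hs' := (BochnerFormula.isSmoothFormNear_iff P Q).1 hs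
  have hds := hs'.isDiffForm A' hD hS
  -- Smoothness of s near z, and not only at z, is what allows D s to be differentiated at z.
  have hDs := hs'.isDiffForm_dirac A' hD hS
  have he' := P.isAlmostHermitian.isOrthoFrame he (by simp)
  have hε' := Q.isAlmostHermitian.isOrthoFrame hε (by simp)
  have hd : ∀ j, MDifferentiableAt (𝓘(ℝ, EM).prod 𝓘(ℝ, EN)) 𝓘(ℝ, ℝ) (ψ j) z := fun j => by
    rw [hψ]
    exact BochnerFormula.mdifferentiableAt_psiFun P Q V haf.a_smooth haf.f_smooth A j z
  exact BochnerFormula.bochner_formula P Q V hd hds hDs he' hε' T
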